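/- **Setting.** For $h>0$ let $H_h=(-i\partial_{x_1}+hx_2)^2-\partial_{x_2}^2$ be the Landau Hamiltonian in $\mathbb{R}^2$. For $\alpha\in\mathbb{R}\setminus\{0\}$ let $H_{h,\alpha}$ be the operator in $L^2(\mathbb{R}^2)$ whose domain consists of all $f\in L^2(\mathbb{R}^2)$ such that the distribution $H_hf$ on $\mathbb{R}^2\setminus\mathbb{Z}^2$ belongs to $L^2$ and such that, for each $m\in\mathbb{Z}^2$, $$f(x)=\frac{a_m}{2\pi}\log\frac1{|x-m|}+b_m+o(1)\quad (x\to m),\qquad a_m+\alpha b_m=0,$$ for some $a_m,b_m\in\mathbb{C}$; for such $f$, $H_{h,\alpha}f$ is the function $H_hf$ on $\mathbb{R}^2\setminus\mathbb{Z}^2$. For $\Re z<0$ let $$G_h(x,y;z)=\frac1{4\pi}\,e^{-\frac{ih(x_1-y_1)(x_2+y_2)}2-\frac{h|x-y|^2}4}\;\Gamma\Big(\frac12-\frac z{2h}\Big)\,U\Big(\frac12-\frac z{2h},1;\frac{h|x-y|^2}2\Big)$$ be the Green function of $H_h$, where $U$ is the Kummer confluent hypergeometric function of the second kind, and put $$q(z,h)=\lim_{x\to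 y}\Big(G_h(x,y;z)-\frac1{2\pi}\log\frac1{|x-y|}\Big),\qquad \lambda(m,n;z,h)=e^{-ihmn/2}\,G_h\big((0,0),(m,n);z\big)\quad (m,n\in\mathbb Z),$$ $$a(z,h)=2\lambda(1,0;z,h),\qquad m_\alpha(z,h)=\frac{q(z,h)+\alpha^{-1}}{a(z,h)},$$ $$M_\alpha(x,p;z,h)=m_\alpha(z,h)+\cos x+\cos p+\sum_{m,n\in\mathbb{Z},\,|m|+|n|\ge2}\frac{\lambda(m,n;z,h)}{a(z,h)}\,e^{i(mx+np)}.$$ The Weyl $h$-quantization of a symbol $L(x,p)$ is the operator in $L^2(\mathbb{R})$ given on Schwartz functions by $\hat L_hf(x)=\frac1{2\pi h}\iint e^{ip(x-y)/h}L\big(\frac{x+y}2,p\big)f(y)\,dy\,dp$. For a family $A(\mu)$ of bounded operators with parameter $\mu\in[-4,4]$, its $\mu$-spectrum $\mu\text{-spec}\,A(\mu)$ is $\{\mu\in[-4,4]: 0\in\operatorname{spec}A(\mu)\}$. Given $h_0>0$, a symbol $L(x,p;\mu,h)$ is of *strong type I* if there is $\varepsilon>0$ such that for all $h\in(0,h_0)$: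 (a) for real $x,p$, $L$ is analytic in $\mu\in[-4,4]$ and takes real values there; (b) $L$ is holomorphic on $D_\varepsilon=\{(\mu,x,p)\in\mathbb{C}^3:|\mu|\le4,\ |\Im x|+|\Im p|<1/\varepsilon\}$ (that is, in a neighbourhood of each of its points), and $|L(x,p;\mu,h)-(\cos x+\cos p+\mu)|\le\varepsilon$ on $D_\varepsilon$; (c) $L(x,p)=L(-p,x)=L(x,-p)=L(x+2\pi,p)=L(x,p+2\pi)$ on $D_\varepsilon$. The infimum of such $\varepsilon$ is denoted by $\varepsilon(L)$. **Theorem.** For every $E_0>0$ there exist $\alpha_0>0$ and $h_0>0$ such that the following holds. 1. For all $\alpha\in(0,\alpha_0)$, $h\in(0,h_0)$ and $\mu\in\mathbb{C}$ with $|\mu|<5$, there is exactly one $z$ with $\Re z<-E_0$, $a(z,h)\neq0$ and $m_\alpha(z,h)=\mu$. Denote it by $\zeta_\alpha(\mu,h)$ and put $P_\alpha(x,p;\mu,h)=M_\alpha(x,p;\zeta_\alpha(\mu,h),h)$. 2. For all $\alpha\in(0,\alpha_0)$, $h\in(0,h_0)$ and $\mu\in[-4,4]$, the Weyl $h$-quantization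 $\hat P_{h,\alpha}(\mu)$ of $P_\alpha(\cdot,\cdot;\mu,h)$ exists as a bounded operator in $L^2(\mathbb{R})$, and $$\operatorname{spec}H_{h,\alpha}\cap(-\infty,-E_0)=\big\{z<-E_0:\ m_\alpha(z,h)\in\mu\text{-spec}\,\hat P_{h,\alpha}(\mu)\big\}.$$ 3. For every $\alpha\in(0,\alpha_0)$ the symbol $P_\alpha$ is of strong type I (for $h\in(0,h_0)$), and $\lim_{\alpha\to0+}\varepsilon(P_\alpha)=0$. -/

import Mathlib

open Set Filter Topology MeasureTheory
open scoped ContDiff ComplexConjugate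

noncomputable section

namespace PointLandau

/-! ### The plane, the lattice, and the Landau Hamiltonian on test functions -/

/-- The Euclidean plane. -/
abbrev Plane : Type := EuclideanSpace ℝ (Fin 2)

/-- `L²(ℝ²)`. -/
abbrev L2Plane : Type := Lp ℂ 2 (volume : Measure Plane)

/-- `L²(ℝ)`. -/
abbrev L2Line : Type := Lp ℂ 2 (volume : Measure ℝ)

/-- The lattice point `(m₁, m₂)` as a point of the plane. -/
def latticePt (m : ℤ × ℤ) : Plane := !₂[(m.1 : ℝ), (m.2 : ℝ)]

/-- The complement `ℝ² ∖ ℤ²` of the lattice. -/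
def punctured : Set Plane := (Set.range latticePt)ᶜ

/-- The partial derivative `∂φ/∂xᵢ`. -/
def partialD (i : Fin 2) (φ : Plane → ℂ) (x : Plane) : ℂ :=
  fderiv ℝ φ x (EuclideanSpace.single i 1)

/-- The magnetic momentum `(-i ∂/∂x₁ + h x₂) φ`. -/
def magMomentum (h : ℝ) (φ : Plane → ℂ) (x : Plane) : ℂ :=
  -Complex.I * partialD 0 φ x + (h : ℂ) * (x 1 : ℂ) * φ x

/-- The Landau expression `H_h φ = (-i ∂/∂x₁ + h x₂)² φ - ∂²φ/∂x₂²`. -/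
def landau (h : ℝ) (φ : Plane → ℂ) (x : Plane) : ℂ :=
  magMomentum h (magMomentum h φ) x - partialD 1 (partialD 1 φ) x

/-- Smooth complex functions with compact support in `ℝ² ∖ ℤ²`. -/
def IsTest (φ : Plane → ℂ) : Prop :=
  ContDiff ℝ ∞ φ ∧ HasCompactSupport φ ∧ tsupport φ ⊆ punctured

/-- `H_h f = g` on `ℝ² ∖ ℤ²` in the sense of distributions. -/
def WeakLandau (h : ℝ) (f g : L2Plane) : Prop :=
  ∀ φ : Plane → ℂ, IsTest φ →
    ∫ x, conj (landau h φ x) * f x = ∫ x, conj (φ x) * g x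

/-- The boundary conditions: near each lattice point `m`,
`f(x) = (a_m / 2π) log (1/|x-m|) + b_m + o(1)` with `a_m + α b_m = 0`. As `f` is a class of
functions, this is asked of a suitable representative. -/
def PointBC (α : ℝ) (f : L2Plane) : Prop :=
  ∃ (u : Plane → ℂ) (a b : ℤ × ℤ → ℂ), u =ᵐ[volume] f ∧ ∀ m : ℤ × ℤ,
    Tendsto (fun x : Plane =>
        u x - a m / (2 * (Real.pi : ℂ)) * ((Real.log (1 / ‖x - latticePt m‖) : ℝ) : ℂ))
      (𝓝[≠] (latticePt m)) (𝓝 (b m)) ∧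
    a m + (α : ℂ) * b m = 0

/-! ### Facts needed to define the operator -/

theorem isOpen_punctured : IsOpen punctured := by
  have : Set.range latticePt =
      ⋂ i : Fin 2, (fun x : Plane => x i) ⁻¹' (Set.range ((↑) : ℤ → ℝ)) := by
    ext x
    simp only [Set.mem_range, Set.mem_iInter, Set.mem_preimage, Prod.exists]
    constructor
    · rintro ⟨m, n, rfl⟩ i
      fin_cases i
      · exact ⟨m, by simp [latticePt]⟩
      · exact ⟨n, by simp [latticePt]⟩
    · intro hx
      obtain ⟨m, hm⟩ := hx 0
      obtain ⟨n, hn⟩ := hx 1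
      refine ⟨m, n, ?_⟩
      ext i
      fin_cases i
      · simpa [latticePt] using hm
      · simpa [latticePt] using hn
  rw [punctured, isOpen_compl_iff, this]
  refine isClosed_iInter fun i => ?_
  exact Int.isClosedEmbedding_coe_real.isClosed_range.preimage (by fun_prop)

theorem contDiff_partialD {φ : Plane → ℂ} (hφ : ContDiff ℝ ∞ φ) (i : Fin 2) :
    ContDiff ℝ ∞ (partialD i φ) := by
  have h1 : ContDiff ℝ ∞ (fderiv ℝ φ) := hφ.fderiv_right (by simp)
  exact h1.clm_apply contDiff_const

theorem contDiff_magMomentum {φ : Plane → ℂ} (hφ : ContDiff ℝ ∞ φ) (h : ℝ) :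
    ContDiff ℝ ∞ (magMomentum h φ) := by
  have h1 := contDiff_partialD hφ 0
  have h2 : ContDiff ℝ ∞ (fun x : Plane => (x 1 : ℂ)) :=
    Complex.ofRealCLM.contDiff.comp (contDiff_piLp_apply (p := 2) (i := (1 : Fin 2)))
  exact (contDiff_const.mul h1).add ((contDiff_const.mul h2).mul hφ)

theorem continuous_landau {φ : Plane → ℂ} (hφ : ContDiff ℝ ∞ φ) (h : ℝ) :
    Continuous (landau h φ) :=
  ((contDiff_magMomentum (contDiff_magMomentum hφ h) h).sub
    (contDiff_partialD (contDiff_partialD hφ 1) 1)).continuous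

theorem hasCompactSupport_partialD {φ : Plane → ℂ} (hφ : HasCompactSupport φ) (i : Fin 2) :
    HasCompactSupport (partialD i φ) :=
  (hφ.fderiv (𝕜 := ℝ)).comp_left (g := fun L : Plane →L[ℝ] ℂ => L (EuclideanSpace.single i 1))
    (by simp)

theorem hasCompactSupport_magMomentum {φ : Plane → ℂ} (hφ : HasCompactSupport φ) (h : ℝ) :
    HasCompactSupport (magMomentum h φ) :=
  ((hasCompactSupport_partialD hφ 0).mul_left).add hφ.mul_left

theorem hasCompactSupport_landau {φ : Plane → ℂ} (hφ : HasCompactSupport φ) (h : ℝ) :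
    HasCompactSupport (landau h φ) :=
  (hasCompactSupport_magMomentum (hasCompactSupport_magMomentum hφ h) h).sub
    (hasCompactSupport_partialD (hasCompactSupport_partialD hφ 1) 1)

theorem locallyIntegrable_L2 (f : L2Plane) : LocallyIntegrable (fun x => f x) volume :=
  (Lp.memLp f).locallyIntegrable (by norm_num)

theorem integrable_pairing {ψ : Plane → ℂ} (hc : Continuous ψ) (hs : HasCompactSupport ψ)
    (f : L2Plane) : Integrable (fun x => conj (ψ x) * f x) volume := by
  have h1 : Continuous (fun x => conj (ψ x)) := Complex.continuous_conj.comp hc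
  have h2 : HasCompactSupport (fun x => conj (ψ x)) :=
    hs.comp_left (g := fun w : ℂ => conj w) (by simp)
  simpa [smul_eq_mul] using
    (locallyIntegrable_L2 f).integrable_smul_left_of_hasCompactSupport h1 h2

theorem pairing_add {ψ : Plane → ℂ} (hc : Continuous ψ) (hs : HasCompactSupport ψ)
    (f g : L2Plane) :
    ∫ x, conj (ψ x) * (f + g) x = (∫ x, conj (ψ x) * f x) + ∫ x, conj (ψ x) * g x := by
  rw [← integral_add (integrable_pairing hc hs f) (integrable_pairing hc hs g)]
  refine integral_congr_ae ?_
  filter_upwards [Lp.coeFn_add f g] with x hx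
  rw [hx, Pi.add_apply, mul_add]

theorem pairing_smul (ψ : Plane → ℂ) (c : ℂ) (f : L2Plane) :
    ∫ x, conj (ψ x) * (c • f) x = c * ∫ x, conj (ψ x) * f x := by
  rw [← integral_const_mul]
  refine integral_congr_ae ?_
  filter_upwards [Lp.coeFn_smul c f] with x hx
  rw [hx, Pi.smul_apply, smul_eq_mul]
  ring

theorem WeakLandau.add {h : ℝ} {f₁ f₂ g₁ g₂ : L2Plane} (h₁ : WeakLandau h f₁ g₁)
    (h₂ : WeakLandau h f₂ g₂) : WeakLandau h (f₁ + f₂) (g₁ + g₂) := by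
  intro φ hφ
  rw [pairing_add (continuous_landau hφ.1 h) (hasCompactSupport_landau hφ.2.1 h),
    pairing_add hφ.1.continuous hφ.2.1, h₁ φ hφ, h₂ φ hφ]

theorem WeakLandau.smul {h : ℝ} {f g : L2Plane} (c : ℂ) (hfg : WeakLandau h f g) :
    WeakLandau h (c • f) (c • g) := by
  intro φ hφ
  rw [pairing_smul, pairing_smul, hfg φ hφ]

theorem WeakLandau.unique {h : ℝ} {f g₁ g₂ : L2Plane} (h₁ : WeakLandau h f g₁)
    (h₂ : WeakLandau h f g₂) : g₁ = g₂ := by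
  have key : ∀ᵐ x ∂(volume : Measure Plane), x ∈ punctured → g₁ x - g₂ x = 0 := by
    refine isOpen_punctured.ae_eq_zero_of_integral_contDiff_smul_eq_zero
      (((locallyIntegrable_L2 g₁).sub (locallyIntegrable_L2 g₂)).locallyIntegrableOn _) ?_
    intro φ hφ hs hU
    have hs' : HasCompactSupport (fun x => (φ x : ℂ)) :=
      hs.comp_left (g := fun r : ℝ => (r : ℂ)) (by simp)
    have hc' : ContDiff ℝ ∞ (fun x => (φ x : ℂ)) := Complex.ofRealCLM.contDiff.comp hφ
    have hT : IsTest (fun x => (φ x : ℂ)) :=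
      ⟨hc', hs', (closure_mono (Function.support_comp_subset
        (g := fun r : ℝ => (r : ℂ)) (by simp) φ)).trans hU⟩
    have e := (h₁ _ hT).symm.trans (h₂ _ hT)
    have i₁ := integrable_pairing hc'.continuous hs' g₁
    have i₂ := integrable_pairing hc'.continuous hs' g₂
    have := (integral_sub i₁ i₂).trans (sub_eq_zero.2 e)
    rw [← this]
    refine integral_congr_ae (Eventually.of_forall fun x => ?_)
    simp [mul_sub]
  have hnull : ∀ᵐ x ∂(volume : Measure Plane), x ∈ punctured := by
    have : (Set.range latticePt).Countable := Set.countable_range _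
    exact this.ae_notMem volume
  refine Lp.ext ?_
  filter_upwards [key, hnull] with x hx hx'
  exact sub_eq_zero.1 (hx hx')

theorem PointBC.add {α : ℝ} {f g : L2Plane} (hf : PointBC α f) (hg : PointBC α g) :
    PointBC α (f + g) := by
  obtain ⟨u, a, b, hu, H⟩ := hf
  obtain ⟨v, a', b', hv, H'⟩ := hg
  refine ⟨u + v, a + a', b + b', (hu.add hv).trans (Lp.coeFn_add f g).symm, fun m => ⟨?_, ?_⟩⟩
  · refine ((H m).1.add (H' m).1).congr fun x => ?_
    simp only [Pi.add_apply]
    ring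
  · simp only [Pi.add_apply]
    linear_combination (H m).2 + (H' m).2

theorem PointBC.smul {α : ℝ} {f : L2Plane} (c : ℂ) (hf : PointBC α f) : PointBC α (c • f) := by
  obtain ⟨u, a, b, hu, H⟩ := hf
  refine ⟨c • u, c • a, c • b, (hu.const_smul c).trans (Lp.coeFn_smul c f).symm,
    fun m => ⟨?_, ?_⟩⟩
  · refine ((H m).1.const_mul c).congr fun x => ?_
    simp only [Pi.smul_apply, smul_eq_mul]
    ring
  · simp only [Pi.smul_apply, smul_eq_mul]
    linear_combination c * (H m).2

theorem PointBC.zero (α : ℝ) : PointBC α 0 :=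
  ⟨0, 0, 0, (Lp.coeFn_zero ℂ 2 volume).symm, fun m => ⟨by simp, by simp⟩⟩

theorem WeakLandau.zero (h : ℝ) : WeakLandau h 0 0 := by
  intro φ _
  have e : ∀ ψ : Plane → ℂ, ∫ x, conj (ψ x) * (0 : L2Plane) x = 0 := by
    intro ψ
    have := pairing_smul ψ 0 0
    rwa [zero_smul, zero_mul] at this
  rw [e, e]

/-! ### The Hamiltonian with point interactions and its spectrum -/

/-- The domain of `H_{h,α}`: those `f ∈ L²(ℝ²)` for which `H_h f`, computed on `ℝ² ∖ ℤ²` in the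
sense of distributions, is in `L²`, and which satisfy the boundary conditions at `ℤ²`. -/
def hamDomain (h α : ℝ) : Submodule ℂ L2Plane where
  carrier := {f | (∃ g, WeakLandau h f g) ∧ PointBC α f}
  add_mem' := by
    rintro f₁ f₂ ⟨⟨g₁, h₁⟩, b₁⟩ ⟨⟨g₂, h₂⟩, b₂⟩
    exact ⟨⟨g₁ + g₂, h₁.add h₂⟩, b₁.add b₂⟩
  zero_mem' := ⟨⟨0, WeakLandau.zero h⟩, PointBC.zero α⟩
  smul_mem' := by
    rintro c f ⟨⟨g, hg⟩, b⟩
    exact ⟨⟨c • g, hg.smul c⟩, b.smul c⟩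

/-- The operator `H_{h,α}`: the function `f` in the domain is mapped to the element of `L²(ℝ²)`
that is `H_h f` on `ℝ² ∖ ℤ²`. -/
def ham (h α : ℝ) : L2Plane →ₗ.[ℂ] L2Plane where
  domain := hamDomain h α
  toFun :=
    { toFun := fun f => f.2.1.choose
      map_add' := fun f₁ f₂ =>
        (f₁ + f₂).2.1.choose_spec.unique (f₁.2.1.choose_spec.add f₂.2.1.choose_spec)
      map_smul' := fun c f => (c • f).2.1.choose_spec.unique (f.2.1.choose_spec.smul c) }

/-- The resolvent set of an operator `T` in a normed space: `T - z` maps the domain bijectively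
onto the space, with bounded inverse `R`. -/
def resolventSetP {E : Type*} [NormedAddCommGroup E] [NormedSpace ℂ E] (T : E →ₗ.[ℂ] E) : Set ℂ :=
  {z | ∃ R : E →L[ℂ] E,
    (∀ g : E, ∃ f : T.domain, (f : E) = R g ∧ T f - z • (f : E) = g) ∧
    ∀ f : T.domain, R (T f - z • (f : E)) = f}

/-- The spectrum of an operator `T` that need not be everywhere defined. -/
def spectrumP {E : Type*} [NormedAddCommGroup E] [NormedSpace ℂ E] (T : E →ₗ.[ℂ] E) : Set ℂ :=
  (resolventSetP T)ᶜ

/-! ### The Green function and the effective symbol -/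

/-- The Kummer confluent hypergeometric function of the second kind `U(a,c;x)`, for `Re a > 0`
and `x > 0` (it is used only there). -/
def kummerU (a c : ℂ) (x : ℝ) : ℂ :=
  (Complex.Gamma a)⁻¹ * ∫ t in Set.Ioi (0 : ℝ),
    Complex.exp (-((x * t : ℝ) : ℂ)) * (t : ℂ) ^ (a - 1) * ((1 + t : ℝ) : ℂ) ^ (c - a - 1)

/-- The Green function `G_h(x,y;z)` of the Landau Hamiltonian, for `Re z < h`. -/
def green (h : ℝ) (x y : Plane) (z : ℂ) : ℂ :=
  1 / (4 * (Real.pi : ℂ)) *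
    Complex.exp (-(Complex.I * h * (x 0 - y 0) * (x 1 + y 1) / 2) - h * (‖x - y‖ : ℂ) ^ 2 / 4) *
    Complex.Gamma (1 / 2 - z / (2 * h)) * kummerU (1 / 2 - z / (2 * h)) 1 (h * ‖x - y‖ ^ 2 / 2)

/-- `F_h(x,y;z) = exp(i h (x₁-y₁)(x₂+y₂)/2) G_h(x,y;z)`. -/
def greenF (h : ℝ) (x y : Plane) (z : ℂ) : ℂ :=
  Complex.exp (Complex.I * h * (x 0 - y 0) * (x 1 + y 1) / 2) * green h x y z

/-- `q(z,h) = lim_{x → y} (G_h(x,y;z) - (1/2π) log (1/|x-y|))`, with `y = 0`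
(the limit does not depend on `y`). -/
def qFun (z : ℂ) (h : ℝ) : ℂ :=
  limUnder (𝓝[≠] (0 : Plane)) fun x =>
    green h x 0 z - 1 / (2 * (Real.pi : ℂ)) * ((Real.log (1 / ‖x‖) : ℝ) : ℂ)

/-- `λ(m,n;z,h) = F_h((0,0),(m,n);z)`. -/
def lam (m n : ℤ) (z : ℂ) (h : ℝ) : ℂ := greenF h 0 (latticePt (m, n)) z

/-- `a(z,h) = 2 λ(1,0;z,h)`. -/
def aFun (z : ℂ) (h : ℝ) : ℂ := 2 * lam 1 0 z h

/-- `m_α(z,h) = (q(z,h) + α⁻¹) / a(z,h)`. -/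
def mFun (α : ℝ) (z : ℂ) (h : ℝ) : ℂ := (qFun z h + (α : ℂ)⁻¹) / aFun z h

/-- `N(x,p;z,h) = ∑_{|m|+|n| ≥ 2} (λ(m,n;z,h) / a(z,h)) e^{i(mx+np)}`. -/
def symbolN (x p z : ℂ) (h : ℝ) : ℂ :=
  ∑' k : {k : ℤ × ℤ // 2 ≤ |k.1| + |k.2|},
    lam k.1.1 k.1.2 z h / aFun z h * Complex.exp (Complex.I * (k.1.1 * x + k.1.2 * p))

/-- `M_α(x,p;z,h) = m_α(z,h) + cos x + cos p + N(x,p;z,h)`. -/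
def symbolM (α : ℝ) (x p z : ℂ) (h : ℝ) : ℂ :=
  mFun α z h + Complex.cos x + Complex.cos p + symbolN x p z h

/-- `P_α(x,p;μ,h) = M_α(x,p;ζ(μ,h),h)`, where `ζ` is a given function of `h` and `μ`. -/
def symbolP (α : ℝ) (ζ : ℝ → ℂ → ℂ) (x p μ : ℂ) (h : ℝ) : ℂ := symbolM α x p (ζ h μ) h

/-! ### Weyl quantization, `μ`-spectrum, and strong type I symbols -/

/-- The operator `A` in `L²(ℝ)` is the Weyl `h`-quantization of the symbol `L`: on Schwartz
functions it is given by `(2πh)⁻¹ ∫ (∫ e^{ip(x-y)/h} L((x+y)/2, p) f(y) dy) dp`,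
where the integrals converge. -/
def IsWeylQuantization (h : ℝ) (L : ℝ → ℝ → ℂ) (A : L2Line →L[ℂ] L2Line) : Prop :=
  ∀ f : SchwartzMap ℝ ℂ,
    (∀ x p : ℝ, Integrable fun y : ℝ =>
      Complex.exp (Complex.I * p * (x - y) / h) * L ((x + y) / 2) p * f y) ∧
    (∀ x : ℝ, Integrable fun p : ℝ => ∫ y : ℝ,
      Complex.exp (Complex.I * p * (x - y) / h) * L ((x + y) / 2) p * f y) ∧
    (A (f.toLp 2 volume) : ℝ → ℂ) =ᵐ[volume] fun x =>
      1 / (2 * (Real.pi : ℂ) * h) * ∫ p : ℝ, ∫ y : ℝ,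
        Complex.exp (Complex.I * p * (x - y) / h) * L ((x + y) / 2) p * f y

/-- The `μ`-spectrum of a family of operators `A(μ)` with real parameter `μ ∈ I`. -/
def muSpec (I : Set ℝ) (A : ℝ → L2Line →L[ℂ] L2Line) : Set ℝ :=
  {μ | μ ∈ I ∧ (0 : ℂ) ∈ spectrum ℂ (A μ)}

/-- The domain `D_ε` of triples `(μ,x,p)`. -/
def tube (ε : ℝ) : Set (ℂ × ℂ × ℂ) :=
  {v | ‖v.1‖ ≤ 4 ∧ |v.2.1.im| + |v.2.2.im| < 1 / ε}

/-- The conditions of strong type I for the symbol `L(x,p;μ,h)`, for all `h ∈ (0,h₀)`,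
with the constant `ε`. -/
structure StrongTypeIWith (h₀ ε : ℝ) (L : ℂ → ℂ → ℂ → ℝ → ℂ) : Prop where
  analytic_mu : ∀ h ∈ Ioo 0 h₀, ∀ x p : ℝ,
    AnalyticOnNhd ℝ (fun μ : ℝ => L x p μ h) (Icc (-4) 4)
  real_valued : ∀ h ∈ Ioo 0 h₀, ∀ x p : ℝ, ∀ μ ∈ Icc (-4 : ℝ) 4, (L x p μ h).im = 0
  holomorphic : ∀ h ∈ Ioo 0 h₀,
    AnalyticOnNhd ℂ (fun v : ℂ × ℂ × ℂ => L v.2.1 v.2.2 v.1 h) (tube ε)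
  close : ∀ h ∈ Ioo 0 h₀, ∀ μ x p : ℂ, (μ, x, p) ∈ tube ε →
    ‖L x p μ h - (Complex.cos x + Complex.cos p + μ)‖ ≤ ε
  symm : ∀ h ∈ Ioo 0 h₀, ∀ μ x p : ℂ, (μ, x, p) ∈ tube ε →
    L x p μ h = L (-p) x μ h ∧ L x p μ h = L x (-p) μ h
  periodic : ∀ h ∈ Ioo 0 h₀, ∀ μ x p : ℂ, (μ, x, p) ∈ tube ε →
    L x p μ h = L (x + 2 * Real.pi) p μ h ∧ L x p μ h = L x (p + 2 * Real.pi) μ h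

/-- `L(x,p;μ,h)`, `h ∈ (0,h₀)`, is a symbol of strong type I. -/
def StrongTypeI (h₀ : ℝ) (L : ℂ → ℂ → ℂ → ℝ → ℂ) : Prop :=
  ∃ ε > 0, StrongTypeIWith h₀ ε L

/-- `ε(L)`: the infimum of the constants `ε` for which the conditions hold. -/
def epsOf (h₀ : ℝ) (L : ℂ → ℂ → ℂ → ℝ → ℂ) : ℝ :=
  sInf {ε | 0 < ε ∧ StrongTypeIWith h₀ ε L}

end PointLandau

end

noncomputable section

namespace PointLandau

/-! ### The heat kernel profile -/

/-! For `Re z < 0` the Green function is the Laplace transform of the heat kernel of the Landau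
Hamiltonian: the substitution `t = 1/(e^{2hs} - 1)` in Kummer's integral (`kummer_integral_eq`,
`green_eq`) writes it as a gauge phase times `(1/4π) ∫₀^∞ e^{zs} (h / sinh hs) e^{-h r² coth(hs)/4}
ds`. All facts about it are read off this formula. The heat equation gives the fundamental solution
and uniqueness for `H_h + E` on the plane. Comparison with the free heat kernel gives decay that is
uniform in `h`. Frullani's integral gives the logarithmic singularity and the value `4πq = C -
log(-z) + ρ(z)` with a small remainder `ρ`.

Krein's formula (`mem_resolventSetP_ham_iff`) reduces the spectrum of the point interaction
Hamiltonian to a lattice problem. A sum `∑ cₘ G(·,m)` solves the equation off the lattice, with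
logarithmic coefficients `cₙ` and regular values given by the matrix with entries `G(n,m)` off the
diagonal and `q` on it. With the condition `a + αb = 0`, the point `-E < 0` is in the resolvent set
exactly when the matrix with `q + α⁻¹` on the diagonal is bounded from below on `ℓ²(ℤ²)`; being
self-adjoint, it is then invertible.

That matrix is an absolutely convergent real combination of magnetic translations, and the effective
Weyl operator is the same combination of the operators `e^{i(k₁x + k₂hD)}` on the line. The two
families satisfy the same multiplication rules up to a change of gauge, so lower bounds can be
transported in both directions (`latOp_bounded_below_iff`). From the lattice to the line, a vector
`v` is replaced by its orbit under the Weyl operators, damped by `e^{-δ|m|}` to be square summable,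
with `δ → 0`. From the line to the lattice, the orbit of a long chirp is asymptotically orthonormal
and so imitates the standard basis. No arithmetic condition on `h` is needed. That the Weyl series
really is the quantization of the symbol is Fourier inversion, term by term
(`isWeylQuantization_weylSum`).

The equation `m_α(z,h) = μ` becomes `log(-z) = 4π/α + C + ρ(z) - 4πμ a(z,h)`. For small `α` the
right-hand side is a contraction in the variable `w = log(-z)` on a thin half strip far to the
right, and an a priori estimate forces every solution with `Re z < -E₀` into that strip. This gives
existence, uniqueness, reality and holomorphy of `ζ` (`eq_zetaVal_iff`, `differentiableOn_zetaVal`),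
and `Re ζ → -∞` as `α → 0`.

Far out, `G` at distance `r` is of size about `e^{-r√E}`, so each coefficient with `|m| + |n| ≥ 2`,
divided by `a`, is exponentially small in `√E`, even after multiplication by exponentials growing in
a wide complex strip. Hence the symbol is as close to `cos x + cos p + μ` as desired
(`exists_strongTypeIWith`). Finally, when `|m_α| > 4` the diagonal dominates the rest of the matrix
and there is no spectrum (`exists_isUnit_weylSum`), so restricting `μ` to `[-4,4]` loses nothing. -/

/-- `h / sinh (h s)`. -/
def hS (h s : ℝ) : ℝ := h / Real.sinh (h * s)

/-- `h coth (h s)`. -/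
def hC (h s : ℝ) : ℝ := h * Real.cosh (h * s) / Real.sinh (h * s)

theorem sinh_le_mul_cosh {w : ℝ} (hw : 0 ≤ w) : Real.sinh w ≤ w * Real.cosh w := by
  have hd : ∀ x : ℝ, HasDerivAt (fun x => x * Real.cosh x - Real.sinh x) (x * Real.sinh x) x := by
    intro x
    have := ((hasDerivAt_id x).mul (Real.hasDerivAt_cosh x)).sub (Real.hasDerivAt_sinh x)
    convert! this using 1
    simp
  have hm : MonotoneOn (fun x => x * Real.cosh x - Real.sinh x) (Ici 0) := by
    refine monotoneOn_of_deriv_nonneg (convex_Ici 0)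
      (fun x _ => (hd x).continuousAt.continuousWithinAt)
      (fun x _ => (hd x).differentiableAt.differentiableWithinAt) fun x hx => ?_
    rw [(hd x).deriv]
    have : 0 < x := by simpa using hx
    exact mul_nonneg this.le (Real.sinh_nonneg_iff.2 this.le)
  have := hm (self_mem_Ici) hw hw
  simp at this
  linarith

theorem sinh_pos {h s : ℝ} (hh : 0 < h) (hs : 0 < s) : 0 < Real.sinh (h * s) := Real.sinh_pos_iff.2 (mul_pos hh hs)

theorem hS_pos {h s : ℝ} (hh : 0 < h) (hs : 0 < s) : 0 < hS h s := div_pos hh (sinh_pos hh hs)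

theorem hC_pos {h s : ℝ} (hh : 0 < h) (hs : 0 < s) : 0 < hC h s := div_pos (mul_pos hh (Real.cosh_pos _)) (sinh_pos hh hs)

theorem hS_le {h s : ℝ} (hh : 0 < h) (hs : 0 < s) : hS h s ≤ 1 / s := by
  rw [hS, div_le_div_iff₀ (sinh_pos hh hs) hs]
  have := Real.self_le_sinh_iff.2 (mul_pos hh hs).le
  linarith

theorem le_hC {h s : ℝ} (hh : 0 < h) (hs : 0 < s) : 1 / s ≤ hC h s := by
  rw [hC, div_le_div_iff₀ hs (sinh_pos hh hs)]
  have := sinh_le_mul_cosh (mul_pos hh hs).le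
  linarith

theorem hC_le {h s : ℝ} (hh : 0 < h) (hs : 0 < s) : hC h s ≤ 1 / s + h := by
  have h1 := sinh_pos hh hs
  rw [hC, div_le_iff₀ h1]
  have h2 : Real.cosh (h * s) ≤ 1 + Real.sinh (h * s) := by
    have := Real.cosh_sub_sinh (h * s)
    have := Real.exp_le_one_iff.2 (neg_nonpos.2 (mul_pos hh hs).le)
    linarith
  have h3 : h ≤ 1 / s * Real.sinh (h * s) := by
    have := Real.self_le_sinh_iff.2 (mul_pos hh hs).le
    rw [one_div, inv_mul_eq_div, le_div_iff₀ hs]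
    exact this
  nlinarith

/-- With `w = hs`: `w / sinh w ≥ 1 / cosh w ≥ e^{-w²/2} ≥ 1 - w²/2`. The error is linear in `s`, so
removing the pole `1/s` leaves a remainder whose Laplace transform `rhoFun` is `O(h²/|Re z|²)`. -/
theorem le_hS {h s : ℝ} (hh : 0 < h) (hs : 0 < s) : 1 / s - hS h s ≤ h ^ 2 * s / 2 := by
  have h1 := sinh_pos hh hs
  have hw := mul_pos hh hs
  have h2 : 1 - (h * s) ^ 2 / 2 ≤ h * s / Real.sinh (h * s) := by
    rw [le_div_iff₀ h1]
    have e1 : Real.sinh (h * s) ≤ h * s * Real.cosh (h * s) := sinh_le_mul_cosh hw.le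
    have e2 := Real.cosh_le_exp_half_sq (h * s)
    rcases le_or_gt (1 - (h * s) ^ 2 / 2) 0 with h0 | h0
    · nlinarith
    have e3 : 1 - (h * s) ^ 2 / 2 ≤ Real.exp (-((h * s) ^ 2 / 2)) := by
      have := Real.add_one_le_exp (-((h * s) ^ 2 / 2)); linarith
    calc (1 - (h * s) ^ 2 / 2) * Real.sinh (h * s)
        ≤ (1 - (h * s) ^ 2 / 2) * (h * s * Real.cosh (h * s)) := by gcongr
      _ = h * s * ((1 - (h * s) ^ 2 / 2) * Real.cosh (h * s)) := by ring
      _ ≤ h * s * (Real.exp (-((h * s) ^ 2 / 2)) * Real.exp ((h * s) ^ 2 / 2)) := by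
          have := Real.cosh_pos (h * s)
          gcongr
      _ = h * s := by rw [← Real.exp_add]; simp
  have : hS h s = 1 / s * (h * s / Real.sinh (h * s)) := by
    rw [hS]; field_simp
  rw [this]
  have e4 : 1 / s * (1 - (h * s) ^ 2 / 2) ≤ 1 / s * (h * s / Real.sinh (h * s)) := by gcongr
  have e5 : 1 / s * (1 - (h * s) ^ 2 / 2) = 1 / s - h ^ 2 * s / 2 := by field_simp
  linarith

/-- This is `coth² = 1 + csch²`. It turns the coefficient `c² - h²` in `landau_magGauss` into `hS²`,
which is what the heat equation requires. -/
theorem hC_sq {h s : ℝ} (hh : 0 < h) (hs : 0 < s) : hC h s ^ 2 = hS h s ^ 2 + h ^ 2 := by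
  have h1 := (sinh_pos hh hs).ne'
  rw [hC, hS]
  field_simp
  linarith [Real.cosh_sq (h * s)]

theorem hasDerivAt_hS {h s : ℝ} (hh : 0 < h) (hs : 0 < s) : HasDerivAt (hS h) (-(hS h s * hC h s)) s := by
  have h1 := (sinh_pos hh hs).ne'
  have e : HasDerivAt (fun s : ℝ => Real.sinh (h * s)) (Real.cosh (h * s) * h) s :=
    ((Real.hasDerivAt_sinh _).comp s ((hasDerivAt_id s).const_mul h)).congr_deriv (by simp)
  convert! (hasDerivAt_const s h).div e h1 using 1
  rw [hS, hC]
  field_simp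
  ring

theorem hasDerivAt_hC {h s : ℝ} (hh : 0 < h) (hs : 0 < s) : HasDerivAt (hC h) (-(hS h s ^ 2)) s := by
  have h1 := (sinh_pos hh hs).ne'
  have e : HasDerivAt (fun s : ℝ => Real.sinh (h * s)) (Real.cosh (h * s) * h) s :=
    ((Real.hasDerivAt_sinh _).comp s ((hasDerivAt_id s).const_mul h)).congr_deriv (by simp)
  have e' : HasDerivAt (fun s : ℝ => h * Real.cosh (h * s)) (h * (Real.sinh (h * s) * h)) s :=
    (((Real.hasDerivAt_cosh _).comp s ((hasDerivAt_id s).const_mul h)).congr_deriv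
      (by simp)).const_mul h
  convert! e'.div e h1 using 1
  rw [hS]
  field_simp
  rw [Real.cosh_sq]
  ring

theorem measurable_hS (h : ℝ) : Measurable (hS h) := by unfold hS; fun_prop

theorem measurable_hC (h : ℝ) : Measurable (hC h) := by unfold hC; fun_prop

/-- The modulus of the heat kernel of the Landau Hamiltonian at distance `r`. -/
def heatProfile (h r s : ℝ) : ℝ := hS h s / (4 * Real.pi) * Real.exp (-(hC h s * r ^ 2 / 4))

theorem measurable_heatProfile (h r : ℝ) : Measurable (heatProfile h r) := by
  have := measurable_hS h
  have := measurable_hC h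
  unfold heatProfile
  fun_prop

theorem heatProfile_pos {h s : ℝ} (hh : 0 < h) (hs : 0 < s) (r : ℝ) : 0 < heatProfile h r s :=
  mul_pos (div_pos (hS_pos hh hs) (by positivity)) (Real.exp_pos _)

/-- Diamagnetic comparison: `sinh w ≥ w` and `w coth w ≥ 1` bound the modulus of the magnetic heat
kernel by the free one. All later decay estimates inherit their uniformity in `h` from here. -/
theorem heatProfile_le {h s : ℝ} (hh : 0 < h) (hs : 0 < s) (r : ℝ) :
    heatProfile h r s ≤ 1 / (4 * Real.pi) * (1 / s * Real.exp (-(r ^ 2 / (4 * s)))) := by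
  have h1 := hS_le hh hs
  have h2 := le_hC hh hs
  have h3 : Real.exp (-(hC h s * r ^ 2 / 4)) ≤ Real.exp (-(r ^ 2 / (4 * s))) := by
    apply Real.exp_le_exp.2
    have : r ^ 2 / (4 * s) = 1 / s * r ^ 2 / 4 := by field_simp
    rw [this]
    have := mul_le_mul_of_nonneg_right h2 (sq_nonneg r)
    linarith
  have h4 := (hS_pos hh hs).le
  calc heatProfile h r s = 1 / (4 * Real.pi) * (hS h s * Real.exp (-(hC h s * r ^ 2 / 4))) := by
        rw [heatProfile]; ring
    _ ≤ _ := by gcongr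

/-- The radial profile `(1/4π) ∫₀^∞ e^{zs} (h / sinh hs) e^{-h r² coth(hs) / 4} ds` of the Green
function. -/
def greenProfile (h r : ℝ) (z : ℂ) : ℂ :=
  ∫ s in Ioi (0 : ℝ), Complex.exp (z * s) * (heatProfile h r s : ℂ)

/-- The gauge phase of the Green function and of the heat kernel. -/
def gaugePhase (h : ℝ) (x y : Plane) : ℂ :=
  Complex.exp (-(Complex.I * h * (x 0 - y 0) * (x 1 + y 1) / 2))

theorem image_one_div_exp_sub_one {h : ℝ} (hh : 0 < h) :
    (fun s : ℝ => 1 / (Real.exp (2 * h * s) - 1)) '' Ioi 0 = Ioi 0 := by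
  ext t
  constructor
  · rintro ⟨s, hs, rfl⟩
    have : 1 < Real.exp (2 * h * s) := Real.one_lt_exp_iff.2 (by have := mem_Ioi.1 hs; positivity)
    exact one_div_pos.2 (sub_pos.2 this)
  · intro ht
    have ht : 0 < t := ht
    have h1 : 1 < 1 + 1 / t := by have := one_div_pos.2 ht; linarith
    refine ⟨Real.log (1 + 1 / t) / (2 * h), div_pos (Real.log_pos h1) (by positivity), ?_⟩
    simp only
    rw [mul_div_cancel₀ _ (by positivity), Real.exp_log (by linarith)]
    simp

/-- Under `t = 1/(e^{2hs} - 1)` one has `1 + t = e^{2hs} t`, so with `a = 1/2 - z/(2h)` the powers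
collapse to `t⁻¹ e^{-2hsa} = t⁻¹ e^{zs} e^{-hs}`. Also `t + 1/2 = coth(hs)/2`, which merges the two
exponentials in `r²`, and the Jacobian supplies the factor `h / sinh(hs)`. -/
theorem kummer_integral_eq {h : ℝ} (hh : 0 < h) (r : ℝ) (z : ℂ) :
    Complex.exp (-(h * (r : ℂ) ^ 2 / 4)) * ∫ t in Ioi (0 : ℝ),
      Complex.exp (-((h * r ^ 2 / 2 * t : ℝ) : ℂ)) * (t : ℂ) ^ (1 / 2 - z / (2 * h) - 1) *
        ((1 + t : ℝ) : ℂ) ^ (1 - (1 / 2 - z / (2 * h)) - 1) =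
    4 * Real.pi * greenProfile h r z := by
  have hd : ∀ s ∈ Ioi (0 : ℝ), HasDerivWithinAt (fun s : ℝ => 1 / (Real.exp (2 * h * s) - 1))
      (-(2 * h * Real.exp (2 * h * s)) / (Real.exp (2 * h * s) - 1) ^ 2) (Ioi 0) s := by
    intro s hs
    have hs : 0 < s := hs
    have h1 : 1 < Real.exp (2 * h * s) := Real.one_lt_exp_iff.2 (by positivity)
    have e : HasDerivAt (fun s : ℝ => Real.exp (2 * h * s) - 1)
        (2 * h * Real.exp (2 * h * s)) s :=
      (((hasDerivAt_id s).const_mul (2 * h)).exp.sub_const 1).congr_deriv (by simp; ring)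
    have := (hasDerivAt_const s (1 : ℝ)).div e (by linarith)
    refine (this.congr_deriv ?_).hasDerivWithinAt
    simp
  have hinj : InjOn (fun s : ℝ => 1 / (Real.exp (2 * h * s) - 1)) (Ioi 0) := by
    intro s hs s' hs' e
    simp only [one_div, inv_inj] at e
    have : Real.exp (2 * h * s) = Real.exp (2 * h * s') := by linarith
    have := Real.exp_injective this
    exact mul_left_cancel₀ (by positivity) this
  conv_lhs => rw [← image_one_div_exp_sub_one hh]
  rw [integral_image_eq_integral_abs_deriv_smul measurableSet_Ioi hd hinj, greenProfile,
    ← integral_const_mul, ← integral_const_mul]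
  refine setIntegral_congr_fun measurableSet_Ioi fun s hs => ?_
  have hs : 0 < s := hs
  have h1 : 1 < Real.exp (2 * h * s) := Real.one_lt_exp_iff.2 (by positivity)
  set w := Real.exp (h * s) with hw
  have hw2 : Real.exp (2 * h * s) = w ^ 2 := by
    rw [hw, ← Real.exp_nat_mul]; congr 1; push_cast; ring
  have hwpos : 0 < w := Real.exp_pos _
  rw [hw2] at h1
  have hsinh : Real.sinh (h * s) = (w ^ 2 - 1) / (2 * w) := by
    rw [Real.sinh_eq, Real.exp_neg, ← hw]; field_simp
  have hcosh : Real.cosh (h * s) = (w ^ 2 + 1) / (2 * w) := by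
    rw [Real.cosh_eq, Real.exp_neg, ← hw]; field_simp
  have hpos : 0 < w ^ 2 - 1 := by linarith
  have htpos : 0 < 1 / (w ^ 2 - 1) := by positivity
  have hS' : hS h s = 2 * h * w / (w ^ 2 - 1) := by rw [hS, hsinh]; field_simp
  have hC' : hC h s = h * (w ^ 2 + 1) / (w ^ 2 - 1) := by rw [hC, hsinh, hcosh]; field_simp
  simp only [hw2]
  have e1 : (1 : ℝ) + 1 / (w ^ 2 - 1) = w ^ 2 * (1 / (w ^ 2 - 1)) := by field_simp; ring
  rw [e1]
  have e2 : |-(2 * h * w ^ 2) / (w ^ 2 - 1) ^ 2| = 2 * h * w ^ 2 / (w ^ 2 - 1) ^ 2 := by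
    rw [neg_div, abs_neg, abs_of_pos (by positivity)]
  rw [e2, heatProfile, hS', hC']
  set t := 1 / (w ^ 2 - 1) with ht
  set a : ℂ := 1 / 2 - z / (2 * h) with ha
  have htc : (t : ℂ) ≠ 0 := by exact_mod_cast htpos.ne'
  have hlogw : ((Real.log (w ^ 2) : ℝ) : ℂ) = 2 * h * s := by
    rw [← hw2, Real.log_exp]; push_cast; ring
  have e3 : (t : ℂ) ^ (a - 1) * ((w ^ 2 * t : ℝ) : ℂ) ^ (1 - a - 1) =
      (t : ℂ)⁻¹ * Complex.exp (-(2 * h * s) * a) := by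
    rw [show ((w ^ 2 * t : ℝ) : ℂ) = ((w ^ 2 : ℝ) : ℂ) * (t : ℂ) by push_cast; ring,
      Complex.mul_cpow_ofReal_nonneg (by positivity) htpos.le,
      Complex.cpow_def_of_ne_zero (x := ((w ^ 2 : ℝ) : ℂ)) (by exact_mod_cast (by positivity)),
      ← Complex.ofReal_log (by positivity), hlogw,
      show (1 - a - 1 : ℂ) = -a by ring, Complex.cpow_sub _ _ htc, Complex.cpow_neg,
      Complex.cpow_one]
    have : (t : ℂ) ^ a ≠ 0 := by simp [Complex.cpow_eq_zero_iff, htc]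
    field_simp
  have e4 : Complex.exp (-(2 * h * s) * a) = Complex.exp (z * s) * (w : ℂ)⁻¹ := by
    rw [hw, Complex.ofReal_exp, ← Complex.exp_neg, ← Complex.exp_add]
    congr 1
    rw [ha]
    have : (h : ℂ) ≠ 0 := by exact_mod_cast hh.ne'
    push_cast
    field_simp
    ring
  rw [mul_assoc (Complex.exp _) ((t : ℂ) ^ (a - 1)), e3, e4]
  have e5 : Complex.exp (-(h * (r : ℂ) ^ 2 / 4)) * Complex.exp (-((h * r ^ 2 / 2 * t : ℝ) : ℂ)) =
      ((Real.exp (-(h * (w ^ 2 + 1) / (w ^ 2 - 1) * r ^ 2 / 4)) : ℝ) : ℂ) := by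
    rw [← Complex.exp_add, Complex.ofReal_exp]
    congr 1
    rw [ht]
    have : ((w : ℂ) ^ 2 - 1) ≠ 0 := by exact_mod_cast hpos.ne'
    push_cast
    field_simp
    ring
  have hwc : (w : ℂ) ≠ 0 := by exact_mod_cast hwpos.ne'
  have hw1 : ((w : ℂ) ^ 2 - 1) ≠ 0 := by exact_mod_cast hpos.ne'
  have hpi : (Real.pi : ℂ) ≠ 0 := by exact_mod_cast Real.pi_ne_zero
  rw [Complex.real_smul]
  have e6 : ∀ X Y Z : ℂ, Complex.exp (-(h * (r : ℂ) ^ 2 / 4)) *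
      (X * (Complex.exp (-((h * r ^ 2 / 2 * t : ℝ) : ℂ)) * Y)) =
      X * Y * (Complex.exp (-(h * (r : ℂ) ^ 2 / 4)) *
        Complex.exp (-((h * r ^ 2 / 2 * t : ℝ) : ℂ))) := by intros; ring
  rw [e6 _ _ 0, e5, ht]
  push_cast
  field_simp

/-- The factor `Γ(a)` cancels the normalization `Γ(a)⁻¹` of `kummerU`; the condition `Re z < h` says
that `Re a > 0`, whence `Γ(a) ≠ 0`. -/
theorem green_eq {h : ℝ} (hh : 0 < h) {z : ℂ} (hz : z.re < h) (x y : Plane) :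
    green h x y z = gaugePhase h x y * greenProfile h ‖x - y‖ z := by
  have hre : 0 < (1 / 2 - z / (2 * h) : ℂ).re := by
    have : (z / (2 * h) : ℂ).re = z.re / (2 * h) := by
      rw [show (2 * h : ℂ) = ((2 * h : ℝ) : ℂ) by push_cast; ring, Complex.div_ofReal_re]
    rw [Complex.sub_re, this]
    have : z.re / (2 * h) < 1 / 2 := by rw [div_lt_iff₀ (by positivity)]; linarith
    norm_num at this ⊢
    exact this
  have hG := Complex.Gamma_ne_zero_of_re_pos hre
  have key := kummer_integral_eq hh ‖x - y‖ z
  have hpi : (Real.pi : ℂ) ≠ 0 := by exact_mod_cast Real.pi_ne_zero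
  rw [green, kummerU, gaugePhase, sub_eq_add_neg (-(Complex.I * h * _ * _ / 2)), Complex.exp_add]
  have e : ∀ A B C G J : ℂ, G ≠ 0 → C * J = 4 * Real.pi * B →
      1 / (4 * (Real.pi : ℂ)) * (A * C) * G * (G⁻¹ * J) = A * B := by
    intro A B C G J hG hJ
    have : 1 / (4 * (Real.pi : ℂ)) * (A * C) * G * (G⁻¹ * J) =
        1 / (4 * (Real.pi : ℂ)) * A * (G * G⁻¹) * (C * J) := by ring
    rw [this, hJ, mul_inv_cancel₀ hG]
    field_simp
  exact e _ _ _ _ _ hG key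

theorem greenF_eq {h : ℝ} (hh : 0 < h) {z : ℂ} (hz : z.re < h) (x y : Plane) :
    greenF h x y z = greenProfile h ‖x - y‖ z := by
  rw [greenF, green_eq hh hz, gaugePhase, ← mul_assoc, ← Complex.exp_add]
  simp

/-! ### Calculus of the Landau expression -/

theorem partialD_add {φ ψ : Plane → ℂ} {x : Plane} (hφ : DifferentiableAt ℝ φ x)
    (hψ : DifferentiableAt ℝ ψ x) (i : Fin 2) :
    partialD i (fun x => φ x + ψ x) x = partialD i φ x + partialD i ψ x := by
  simp only [partialD]
  rw [fderiv_fun_add hφ hψ]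
  rfl

theorem partialD_mul {φ ψ : Plane → ℂ} {x : Plane} (hφ : DifferentiableAt ℝ φ x)
    (hψ : DifferentiableAt ℝ ψ x) (i : Fin 2) :
    partialD i (fun x => φ x * ψ x) x = partialD i φ x * ψ x + φ x * partialD i ψ x := by
  simp only [partialD]
  rw [fderiv_fun_mul hφ hψ]
  simp
  ring

theorem partialD_const (c : ℂ) (i : Fin 2) (x : Plane) : partialD i (fun _ => c) x = 0 := by
  simp [partialD]

theorem partialD_const_mul {φ : Plane → ℂ} {x : Plane} (hφ : DifferentiableAt ℝ φ x) (c : ℂ)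
    (i : Fin 2) : partialD i (fun x => c * φ x) x = c * partialD i φ x := by
  rw [partialD_mul (differentiableAt_const c) hφ, partialD_const]
  ring

theorem hasFDerivAt_coord (i : Fin 2) (x : Plane) :
    HasFDerivAt (fun x : Plane => (x i : ℂ))
      (Complex.ofRealCLM.comp (EuclideanSpace.proj i : Plane →L[ℝ] ℝ)) x :=
  (Complex.ofRealCLM.comp (EuclideanSpace.proj i : Plane →L[ℝ] ℝ)).hasFDerivAt

theorem contDiff_coord (i : Fin 2) : ContDiff ℝ ∞ (fun x : Plane => (x i : ℂ)) :=
  (Complex.ofRealCLM.comp (EuclideanSpace.proj i : Plane →L[ℝ] ℝ)).contDiff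

theorem partialD_coord (i j : Fin 2) (x : Plane) :
    partialD i (fun x : Plane => (x j : ℂ)) x = if i = j then 1 else 0 := by
  rw [partialD, (hasFDerivAt_coord j x).fderiv]
  simp [eq_comm, apply_ite (fun r : ℝ => (r : ℂ))]

theorem partialD_exp {φ : Plane → ℂ} {x : Plane} (hφ : DifferentiableAt ℝ φ x) (i : Fin 2) :
    partialD i (fun x => Complex.exp (φ x)) x = partialD i φ x * Complex.exp (φ x) := by
  rw [partialD, hφ.hasFDerivAt.cexp.fderiv, partialD]
  simp [mul_comm]

theorem partialD_conj {φ : Plane → ℂ} (hφ : Differentiable ℝ φ) (i : Fin 2) (x : Plane) :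
    partialD i (fun x => conj (φ x)) x = conj (partialD i φ x) := by
  have := ((Complex.conjCLE : ℂ →L[ℝ] ℂ).hasFDerivAt).comp x (hφ x).hasFDerivAt
  rw [partialD, partialD]
  erw [this.fderiv]
  simp

theorem partialD_comp_affine {χ : Plane → ℂ} (hχ : Differentiable ℝ χ) (c : ℝ) (a : Plane)
    (i : Fin 2) (x : Plane) :
    partialD i (fun x => χ (c • (x - a))) x = c * partialD i χ (c • (x - a)) := by
  have h1 : HasFDerivAt (fun x : Plane => c • (x - a)) (c • ContinuousLinearMap.id ℝ Plane) x :=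
    ((hasFDerivAt_id x).sub_const a).const_smul c
  have := (hχ (c • (x - a))).hasFDerivAt.comp x h1
  rw [partialD, partialD]
  erw [this.fderiv]
  simp

theorem contDiff_landau {φ : Plane → ℂ} (hφ : ContDiff ℝ ∞ φ) (h : ℝ) :
    ContDiff ℝ ∞ (landau h φ) :=
  (contDiff_magMomentum (contDiff_magMomentum hφ h) h).sub
    (contDiff_partialD (contDiff_partialD hφ 1) 1)

theorem diff_of_contDiff {φ : Plane → ℂ} (hφ : ContDiff ℝ ∞ φ) : Differentiable ℝ φ :=
  hφ.differentiable (by simp)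

theorem magMomentum_mul {χ φ : Plane → ℂ} (hχ : ContDiff ℝ ∞ χ) (hφ : ContDiff ℝ ∞ φ) (h : ℝ)
    (x : Plane) : magMomentum h (fun x => χ x * φ x) x =
      χ x * magMomentum h φ x + -Complex.I * partialD 0 χ x * φ x := by
  rw [magMomentum, partialD_mul (diff_of_contDiff hχ x) (diff_of_contDiff hφ x), magMomentum]
  ring

theorem magMomentum_add {χ φ : Plane → ℂ} (hχ : ContDiff ℝ ∞ χ) (hφ : ContDiff ℝ ∞ φ) (h : ℝ)
    (x : Plane) : magMomentum h (fun x => χ x + φ x) x =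
      magMomentum h χ x + magMomentum h φ x := by
  rw [magMomentum, partialD_add (diff_of_contDiff hχ x) (diff_of_contDiff hφ x), magMomentum,
    magMomentum]
  ring

theorem landau_add {χ φ : Plane → ℂ} (hχ : ContDiff ℝ ∞ χ) (hφ : ContDiff ℝ ∞ φ) (h : ℝ)
    (x : Plane) : landau h (fun x => χ x + φ x) x = landau h χ x + landau h φ x := by
  have e1 : magMomentum h (fun x => χ x + φ x) = fun x => magMomentum h χ x + magMomentum h φ x :=
    funext fun x => magMomentum_add hχ hφ h x
  have e2 : partialD 1 (fun x => χ x + φ x) = fun x => partialD 1 χ x + partialD 1 φ x :=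
    funext fun x => partialD_add (diff_of_contDiff hχ x) (diff_of_contDiff hφ x) 1
  rw [landau, e1, e2, magMomentum_add (contDiff_magMomentum hχ h) (contDiff_magMomentum hφ h),
    partialD_add (diff_of_contDiff (contDiff_partialD hχ 1) x)
      (diff_of_contDiff (contDiff_partialD hφ 1) x), landau, landau]
  ring

theorem landau_mul {χ φ : Plane → ℂ} (hχ : ContDiff ℝ ∞ χ) (hφ : ContDiff ℝ ∞ φ) (h : ℝ)
    (x : Plane) : landau h (fun x => χ x * φ x) x =
      χ x * landau h φ x - 2 * Complex.I * partialD 0 χ x * magMomentum h φ x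
        - partialD 0 (partialD 0 χ) x * φ x
        - 2 * partialD 1 χ x * partialD 1 φ x - partialD 1 (partialD 1 χ) x * φ x := by
  have e1 : magMomentum h (fun x => χ x * φ x) =
      fun x => χ x * magMomentum h φ x + (-Complex.I * partialD 0 χ x) * φ x :=
    funext fun x => magMomentum_mul hχ hφ h x
  have e2 : partialD 1 (fun x => χ x * φ x) = fun x => partialD 1 χ x * φ x + χ x * partialD 1 φ x :=
    funext fun x => partialD_mul (diff_of_contDiff hχ x) (diff_of_contDiff hφ x) 1
  have c0 := contDiff_partialD hχ 0
  have c1 := contDiff_partialD hχ 1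
  have d1 := contDiff_partialD hφ 1
  have m1 := contDiff_magMomentum hφ h
  have c0' : ContDiff ℝ ∞ (fun x => -Complex.I * partialD 0 χ x) := contDiff_const.mul c0
  rw [landau, e1, e2, magMomentum_add (hχ.mul m1) (c0'.mul hφ), magMomentum_mul hχ m1,
    magMomentum_mul c0' hφ, partialD_const_mul (diff_of_contDiff c0 x),
    partialD_add (diff_of_contDiff (c1.mul hφ) x) (diff_of_contDiff (hχ.mul d1) x),
    partialD_mul (diff_of_contDiff c1 x) (diff_of_contDiff hφ x),
    partialD_mul (diff_of_contDiff hχ x) (diff_of_contDiff d1 x), landau]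
  linear_combination (partialD 0 (partialD 0 χ) x * φ x) * Complex.I_mul_I

theorem integrable_conj_mul {ψ v : Plane → ℂ} (h1 : Continuous ψ) (h2 : HasCompactSupport ψ)
    (h3 : Continuous v) : Integrable (fun x => conj (ψ x) * v x) volume := by
  have h2' : HasCompactSupport (fun x => conj (ψ x)) :=
    h2.comp_left (g := fun w : ℂ => conj w) (by simp)
  exact ((Complex.continuous_conj.comp h1).mul h3).integrable_of_hasCompactSupport h2'.mul_right

/-- Integration by parts for a partial derivative, against a compactly supported function. -/
theorem integral_conj_partialD {φ u : Plane → ℂ} (hφ : ContDiff ℝ ∞ φ) (hs : HasCompactSupport φ)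
    (hu : ContDiff ℝ ∞ u) (i : Fin 2) :
    ∫ x, conj (partialD i φ x) * u x = -∫ x, conj (φ x) * partialD i u x := by
  have hd := diff_of_contDiff hφ
  have e : ∀ x, fderiv ℝ (fun x => conj (φ x)) x (EuclideanSpace.single i 1) =
      conj (partialD i φ x) := fun x => partialD_conj hd i x
  have h1 := integrable_conj_mul (contDiff_partialD hφ i).continuous (hasCompactSupport_partialD hs i)
    hu.continuous
  have := integral_mul_fderiv_eq_neg_fderiv_mul_of_integrable (μ := (volume : Measure Plane))
    (f := fun x => conj (φ x)) (g := u) (v := EuclideanSpace.single i 1)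
    (by simpa only [e] using h1) (integrable_conj_mul hφ.continuous hs (contDiff_partialD hu i).continuous)
    (integrable_conj_mul hφ.continuous hs hu.continuous)
    (fun x _ => ((Complex.conjCLE : ℂ →L[ℝ] ℂ).differentiableAt).comp x (hd x))
    (fun x _ => diff_of_contDiff hu x)
  simp only [e] at this
  have h2 : ∫ x, conj (φ x) * partialD i u x = -∫ x, conj (partialD i φ x) * u x := this
  rw [h2, neg_neg]

theorem integral_conj_magMomentum {φ u : Plane → ℂ} (hφ : ContDiff ℝ ∞ φ)
    (hs : HasCompactSupport φ) (hu : ContDiff ℝ ∞ u) (h : ℝ) :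
    ∫ x, conj (magMomentum h φ x) * u x = ∫ x, conj (φ x) * magMomentum h u x := by
  have key := integral_conj_partialD hφ hs hu 0
  have i1 := integrable_conj_mul (contDiff_partialD hφ 0).continuous (hasCompactSupport_partialD hs 0)
    hu.continuous
  have i2 := integrable_conj_mul hφ.continuous hs (contDiff_partialD hu 0).continuous
  have i3 : Integrable (fun x : Plane => conj (φ x) * (h * (x 1 : ℂ) * u x)) :=
    integrable_conj_mul hφ.continuous hs
      ((continuous_const (y := (h : ℂ))).mul (contDiff_coord 1).continuous |>.mul hu.continuous)
  have e1 : ∀ x, conj (magMomentum h φ x) * u x =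
      Complex.I * (conj (partialD 0 φ x) * u x) + conj (φ x) * (h * (x 1 : ℂ) * u x) := by
    intro x
    simp only [magMomentum, map_add, map_mul, map_neg, Complex.conj_I, Complex.conj_ofReal]
    ring
  have e2 : ∀ x, conj (φ x) * magMomentum h u x =
      -Complex.I * (conj (φ x) * partialD 0 u x) + conj (φ x) * (h * (x 1 : ℂ) * u x) := by
    intro x
    simp only [magMomentum]
    ring
  simp only [e1, e2]
  rw [integral_add (i1.const_mul _) i3, integral_add (i2.const_mul _) i3, integral_const_mul,
    integral_const_mul, key]
  ring

/-- The Landau expression is formally self-adjoint. -/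
theorem integral_conj_landau {φ u : Plane → ℂ} (hφ : ContDiff ℝ ∞ φ)
    (hs : HasCompactSupport φ) (hu : ContDiff ℝ ∞ u) (h : ℝ) :
    ∫ x, conj (landau h φ x) * u x = ∫ x, conj (φ x) * landau h u x := by
  have m1 := contDiff_magMomentum hφ h
  have m2 := hasCompactSupport_magMomentum hs h
  have n1 := contDiff_magMomentum hu h
  have p1 := contDiff_partialD hφ 1
  have p2 := hasCompactSupport_partialD hs 1
  have q1 := contDiff_partialD hu 1
  have e1 : ∀ x, conj (landau h φ x) * u x = conj (magMomentum h (magMomentum h φ) x) * u x -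
      conj (partialD 1 (partialD 1 φ) x) * u x := by
    intro x; rw [landau, map_sub, sub_mul]
  have e2 : ∀ x, conj (φ x) * landau h u x = conj (φ x) * magMomentum h (magMomentum h u) x -
      conj (φ x) * partialD 1 (partialD 1 u) x := by
    intro x; rw [landau, mul_sub]
  simp only [e1, e2]
  rw [integral_sub (integrable_conj_mul (contDiff_magMomentum m1 h).continuous
      (hasCompactSupport_magMomentum m2 h) hu.continuous)
      (integrable_conj_mul (contDiff_partialD p1 1).continuous (hasCompactSupport_partialD p2 1)
        hu.continuous),
    integral_sub (integrable_conj_mul hφ.continuous hs (contDiff_magMomentum n1 h).continuous)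
      (integrable_conj_mul hφ.continuous hs (contDiff_partialD q1 1).continuous),
    integral_conj_magMomentum m1 m2 hu, integral_conj_magMomentum hφ hs n1,
    integral_conj_partialD p1 p2 hu, integral_conj_partialD hφ hs q1, neg_neg]

/-- The Landau expression is nonnegative on test functions. -/
theorem integral_conj_landau_self_nonneg {φ : Plane → ℂ} (hφ : ContDiff ℝ ∞ φ)
    (hs : HasCompactSupport φ) (h : ℝ) : 0 ≤ (∫ x, conj (φ x) * landau h φ x).re := by
  have m1 := contDiff_magMomentum hφ h
  have m2 := hasCompactSupport_magMomentum hs h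
  have p1 := contDiff_partialD hφ 1
  have p2 := hasCompactSupport_partialD hs 1
  have e2 : ∀ x, conj (φ x) * landau h φ x = conj (φ x) * magMomentum h (magMomentum h φ) x -
      conj (φ x) * partialD 1 (partialD 1 φ) x := by
    intro x; rw [landau, mul_sub]
  simp only [e2]
  rw [integral_sub (integrable_conj_mul hφ.continuous hs (contDiff_magMomentum m1 h).continuous)
      (integrable_conj_mul hφ.continuous hs (contDiff_partialD p1 1).continuous),
    ← integral_conj_magMomentum hφ hs m1, ← neg_eq_iff_eq_neg.2 (integral_conj_partialD hφ hs p1 1),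
    sub_neg_eq_add]
  have e : ∀ w : ℂ, conj w * w = ((‖w‖ ^ 2 : ℝ) : ℂ) := by
    intro w; rw [mul_comm, Complex.mul_conj, Complex.normSq_eq_norm_sq]
  simp only [e]
  rw [integral_complex_ofReal, integral_complex_ofReal]
  simp only [Complex.add_re, Complex.ofReal_re]
  exact add_nonneg (integral_nonneg fun x => by positivity) (integral_nonneg fun x => by positivity)

/-! ### Magnetic translations -/

/-- The magnetic translate of `φ` by `a`. -/
def magTranslate (h : ℝ) (a : Plane) (φ : Plane → ℂ) (x : Plane) : ℂ :=
  Complex.exp (-(Complex.I * h * a 1 * x 0)) * φ (x - a)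

theorem contDiff_magTranslate {φ : Plane → ℂ} (hφ : ContDiff ℝ ∞ φ) (h : ℝ) (a : Plane) :
    ContDiff ℝ ∞ (magTranslate h a φ) := by
  have h1 : ContDiff ℝ ∞ (fun x : Plane => Complex.exp (-(Complex.I * h * a 1 * x 0))) :=
    Complex.contDiff_exp.comp (contDiff_const.mul (contDiff_coord 0)).neg
  exact h1.mul (hφ.comp (contDiff_id.sub contDiff_const))

theorem hasCompactSupport_magTranslate {φ : Plane → ℂ} (hφ : HasCompactSupport φ) (h : ℝ)
    (a : Plane) : HasCompactSupport (magTranslate h a φ) :=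
  (hφ.comp_homeomorph (Homeomorph.subRight a)).mul_left

theorem norm_magTranslate (h : ℝ) (a : Plane) (φ : Plane → ℂ) (x : Plane) :
    ‖magTranslate h a φ x‖ = ‖φ (x - a)‖ := by
  rw [magTranslate, norm_mul, Complex.norm_exp]
  simp

theorem partialD_magTranslate {φ : Plane → ℂ} (hφ : ContDiff ℝ ∞ φ) (h : ℝ) (a : Plane)
    (i : Fin 2) (x : Plane) : partialD i (magTranslate h a φ) x =
      magTranslate h a (partialD i φ) x -
        (if i = 0 then Complex.I * h * a 1 else 0) * magTranslate h a φ x := by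
  have h1 : Differentiable ℝ (fun x : Plane => -(Complex.I * h * a 1 * x 0)) := by
    have := diff_of_contDiff (contDiff_coord 0)
    fun_prop
  have h2 : partialD i (fun x => φ (x - a)) x = partialD i φ (x - a) := by
    simpa using partialD_comp_affine (diff_of_contDiff hφ) 1 a i x
  have h3 : partialD i (fun x : Plane => -(Complex.I * h * a 1 * x 0)) x =
      -(if i = 0 then Complex.I * h * a 1 else 0) := by
    have e : (fun x : Plane => -(Complex.I * h * a 1 * x 0)) =
      fun x : Plane => (-(Complex.I * h * a 1)) * (x 0 : ℂ) := by ext; ring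
    rw [e, partialD_const_mul (diff_of_contDiff (contDiff_coord 0) x), partialD_coord]
    split_ifs <;> simp
  have h4 : Differentiable ℝ (fun x => φ (x - a)) := by
    have := diff_of_contDiff hφ
    fun_prop
  unfold magTranslate
  rw [partialD_mul (h1.cexp x) (h4 x), partialD_exp (h1 x), h2, h3]
  ring

/-- Differentiating the phase `e^{-i h a₂ x₁}` produces `-h a₂`, which turns the potential `h x₂`
into its translate `h (x₂ - a₂)`. This is why the translation must carry a phase in order to commute
with the Hamiltonian. -/
theorem magMomentum_magTranslate {φ : Plane → ℂ} (hφ : ContDiff ℝ ∞ φ) (h : ℝ) (a : Plane) :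
    magMomentum h (magTranslate h a φ) = magTranslate h a (magMomentum h φ) := by
  ext x
  rw [magMomentum, partialD_magTranslate hφ]
  simp only [magTranslate, magMomentum, if_true, PiLp.sub_apply]
  push_cast
  linear_combination (-(h : ℂ) * a 1 * (Complex.exp (-(Complex.I * h * a 1 * x 0)) * φ (x - a))) *
    (Complex.I_mul_I) * (-1)

theorem landau_magTranslate {φ : Plane → ℂ} (hφ : ContDiff ℝ ∞ φ) (h : ℝ) (a : Plane) :
    landau h (magTranslate h a φ) = magTranslate h a (landau h φ) := by
  have e : partialD 1 (magTranslate h a φ) = magTranslate h a (partialD 1 φ) := by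
    ext x; rw [partialD_magTranslate hφ]; simp
  ext x
  rw [landau, magMomentum_magTranslate hφ, magMomentum_magTranslate (contDiff_magMomentum hφ h), e,
    partialD_magTranslate (contDiff_partialD hφ 1)]
  simp only [magTranslate, landau]
  simp
  ring

/-! ### The heat kernel -/

/-- The Gaussian `e^{-ih(x₁-y₁)(x₂+y₂)/2 - c|x-y|²/4}`. -/
def magGauss (h c : ℝ) (y x : Plane) : ℂ :=
  gaugePhase h x y * ((Real.exp (-(c * ‖x - y‖ ^ 2 / 4)) : ℝ) : ℂ)

/-- The heat kernel of the Landau Hamiltonian. -/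
def heat (h s : ℝ) (y x : Plane) : ℂ := gaugePhase h x y * (heatProfile h ‖x - y‖ s : ℂ)

theorem heat_eq (h s : ℝ) (y x : Plane) :
    heat h s y x = ((hS h s / (4 * Real.pi) : ℝ) : ℂ) * magGauss h (hC h s) y x := by
  rw [heat, heatProfile, magGauss]
  push_cast
  ring

theorem norm_gaugePhase (h : ℝ) (x y : Plane) : ‖gaugePhase h x y‖ = 1 := by
  rw [gaugePhase, show (-(Complex.I * h * (x 0 - y 0) * (x 1 + y 1) / 2) : ℂ) =
    ((-(h * (x 0 - y 0) * (x 1 + y 1) / 2) : ℝ) : ℂ) * Complex.I by push_cast; ring,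
    Complex.norm_exp_ofReal_mul_I]

theorem conj_gaugePhase (h : ℝ) (x y : Plane) : conj (gaugePhase h x y) = gaugePhase h y x := by
  rw [gaugePhase, gaugePhase, ← Complex.exp_conj]
  congr 1
  simp only [map_neg, map_div₀, map_mul, map_sub, map_add, Complex.conj_I, Complex.conj_ofReal]
  rw [show (starRingEnd ℂ) 2 = 2 from Complex.conj_ofReal 2]
  ring

theorem norm_sq_plane (x : Plane) : ‖x‖ ^ 2 = x 0 ^ 2 + x 1 ^ 2 := by
  rw [EuclideanSpace.norm_sq_eq]
  simp

theorem magGauss_eq (h c : ℝ) (y : Plane) : magGauss h c y = fun x : Plane =>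
    Complex.exp (-(Complex.I * h / 2) * ((x 0 - y 0) * (x 1 + y 1)) +
      -(c / 4 : ℂ) * ((x 0 - y 0) * (x 0 - y 0) + (x 1 - y 1) * (x 1 - y 1))) := by
  ext x
  rw [magGauss, gaugePhase, Complex.ofReal_exp, ← Complex.exp_add, norm_sq_plane]
  congr 1
  simp only [PiLp.sub_apply]
  push_cast
  ring

theorem partialD_magGauss (h c : ℝ) (y : Plane) :
    partialD 0 (magGauss h c y) = (fun x : Plane =>
      (-(Complex.I * h / 2) * (x 1 + y 1) + -(c / 2 : ℂ) * (x 0 - y 0)) * magGauss h c y x) ∧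
    partialD 1 (magGauss h c y) = (fun x : Plane =>
      (-(Complex.I * h / 2) * (x 0 - y 0) + -(c / 2 : ℂ) * (x 1 - y 1)) * magGauss h c y x) := by
  have d0 := diff_of_contDiff (contDiff_coord 0)
  have d1 := diff_of_contDiff (contDiff_coord 1)
  have D : ∀ (j : Fin 2) (w : ℂ) (x : Plane),
      DifferentiableAt ℝ (fun x : Plane => (x j : ℂ) + w) x := by
    intro j w x
    exact (diff_of_contDiff (contDiff_coord j) x).add_const w
  have P : ∀ (i j : Fin 2) (w : ℂ) (x : Plane), partialD i (fun x : Plane => (x j : ℂ) + w) x =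
      if i = j then 1 else 0 := by
    intro i j w x
    rw [partialD_add (diff_of_contDiff (contDiff_coord j) x) (differentiableAt_const _),
      partialD_const, partialD_coord, add_zero]
  have key : ∀ (i : Fin 2) (x : Plane), partialD i (magGauss h c y) x =
      (-(Complex.I * h / 2) * ((if i = 0 then 1 else 0) * (x 1 + y 1) +
        (x 0 - y 0) * (if i = 1 then 1 else 0)) +
      -(c / 2 : ℂ) * ((x 0 - y 0) * (if i = 0 then 1 else 0) +
        (x 1 - y 1) * (if i = 1 then 1 else 0))) * magGauss h c y x := by
    intro i x
    rw [magGauss_eq]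
    simp only [sub_eq_add_neg]
    have a1 := (D 0 (-(y 0 : ℂ)) x).fun_mul (D 1 (y 1 : ℂ) x)
    have a2 := (D 0 (-(y 0 : ℂ)) x).fun_mul (D 0 (-(y 0 : ℂ)) x)
    have a3 := (D 1 (-(y 1 : ℂ)) x).fun_mul (D 1 (-(y 1 : ℂ)) x)
    rw [partialD_exp ((a1.const_mul _).fun_add ((a2.fun_add a3).const_mul _)),
      partialD_add (a1.const_mul _) ((a2.fun_add a3).const_mul _), partialD_const_mul a1,
      partialD_const_mul (a2.fun_add a3), partialD_add a2 a3, partialD_mul (D 0 _ x) (D 1 _ x),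
      partialD_mul (D 0 _ x) (D 0 _ x), partialD_mul (D 1 _ x) (D 1 _ x), P, P, P]
    ring
  constructor
  · ext x; rw [key]; simp
  · ext x; rw [key]; simp

theorem contDiff_magGauss (h c : ℝ) (y : Plane) : ContDiff ℝ ∞ (magGauss h c y) := by
  have h0 := contDiff_coord 0
  have h1 := contDiff_coord 1
  rw [magGauss_eq]
  refine Complex.contDiff_exp.comp ?_
  fun_prop

theorem magMomentum_magGauss (h c : ℝ) (y : Plane) :
    magMomentum h (magGauss h c y) = fun x : Plane =>
      (h / 2 * (x 1 - y 1) + Complex.I * c / 2 * (x 0 - y 0)) * magGauss h c y x := by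
  ext x
  rw [magMomentum, (partialD_magGauss h c y).1]
  linear_combination (h / 2 * (x 1 + y 1) * magGauss h c y x) * Complex.I_mul_I

/-- The gauge phase absorbs the part of the potential that depends on the base point; the remaining
rotation field annihilates radial functions. The operator therefore acts on the Gaussian as the
two-dimensional oscillator `-Δ + h² r²/4`. -/
theorem landau_magGauss (h c : ℝ) (y x : Plane) :
    landau h (magGauss h c y) x =
      (c - (c ^ 2 - h ^ 2) * ‖x - y‖ ^ 2 / 4 : ℝ) * magGauss h c y x := by
  have hg := diff_of_contDiff (contDiff_magGauss h c y) x
  have P : ∀ (i j : Fin 2) (a w : ℂ) (x : Plane),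
      partialD i (fun x : Plane => a * ((x j : ℂ) - w)) x = a * if i = j then 1 else 0 := by
    intro i j a w x
    simp only [sub_eq_add_neg]
    rw [partialD_const_mul ((diff_of_contDiff (contDiff_coord j) x).add_const _),
      partialD_add (diff_of_contDiff (contDiff_coord j) x) (differentiableAt_const _),
      partialD_const, partialD_coord, add_zero]
  have D : ∀ (j : Fin 2) (a w : ℂ), DifferentiableAt ℝ (fun x : Plane => a * ((x j : ℂ) - w)) x := by
    intro j a w
    exact ((diff_of_contDiff (contDiff_coord j) x).sub_const w).const_mul a
  rw [landau, magMomentum_magGauss, (partialD_magGauss h c y).2, magMomentum,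
    partialD_mul ((D 1 _ _).fun_add (D 0 _ _)) hg, partialD_add (D 1 _ _) (D 0 _ _), P, P,
    partialD_mul ((D 0 _ _).fun_add (D 1 _ _)) hg, partialD_add (D 0 _ _) (D 1 _ _), P, P,
    (partialD_magGauss h c y).1, (partialD_magGauss h c y).2, norm_sq_plane]
  simp only [PiLp.sub_apply]
  push_cast
  simp
  ring_nf
  simp only [Complex.I_sq, Complex.I_pow_three]
  ring

theorem contDiff_heat (h s : ℝ) (y : Plane) : ContDiff ℝ ∞ (heat h s y) := by
  have : heat h s y = fun x => ((hS h s / (4 * Real.pi) : ℝ) : ℂ) * magGauss h (hC h s) y x :=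
    funext fun x => heat_eq h s y x
  rw [this]
  exact contDiff_const.mul (contDiff_magGauss h _ y)

/-- The time derivative of the heat kernel. -/
def heatDeriv (h s : ℝ) (y x : Plane) : ℂ :=
  (hS h s ^ 2 * ‖x - y‖ ^ 2 / 4 - hC h s : ℝ) * heat h s y x

theorem landau_const_mul {φ : Plane → ℂ} (hφ : ContDiff ℝ ∞ φ) (h : ℝ) (c : ℂ) (x : Plane) :
    landau h (fun x => c * φ x) x = c * landau h φ x := by
  have : partialD (0 : Fin 2) (fun _ => c) = fun _ => 0 := funext fun x => partialD_const c 0 x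
  have e1 : partialD (1 : Fin 2) (fun _ => c) = fun _ => 0 := funext fun x => partialD_const c 1 x
  rw [landau_mul contDiff_const hφ, this, e1, partialD_const, partialD_const]
  ring

/-- The heat equation. -/
theorem landau_heat {h s : ℝ} (hh : 0 < h) (hs : 0 < s) (y x : Plane) :
    landau h (heat h s y) x = -heatDeriv h s y x := by
  have : heat h s y = fun x => ((hS h s / (4 * Real.pi) : ℝ) : ℂ) * magGauss h (hC h s) y x :=
    funext fun x => heat_eq h s y x
  rw [heatDeriv, this, landau_const_mul (contDiff_magGauss _ _ _), landau_magGauss, hC_sq hh hs]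
  push_cast
  ring

theorem hasDerivAt_heat {h s : ℝ} (hh : 0 < h) (hs : 0 < s) (y x : Plane) :
    HasDerivAt (fun s => heat h s y x) (heatDeriv h s y x) s := by
  have h1 := hasDerivAt_hS hh hs
  have h2 := ((hasDerivAt_hC hh hs).mul_const (‖x - y‖ ^ 2)).div_const 4 |>.neg.exp
  have h3 : HasDerivAt (fun s => heatProfile h ‖x - y‖ s)
      ((hS h s ^ 2 * ‖x - y‖ ^ 2 / 4 - hC h s) * heatProfile h ‖x - y‖ s) s := by
    refine ((h1.div_const (4 * Real.pi)).mul h2).congr_deriv ?_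
    simp only [heatProfile, Pi.neg_apply]
    ring
  refine (h3.ofReal_comp.const_mul (gaugePhase h x y)).congr_deriv ?_
  rw [heatDeriv, heat]
  push_cast
  ring

/-! ### Integrals of the heat kernel -/

theorem integral_gauss_plane {b : ℝ} (hb : 0 < b) (y : Plane) :
    ∫ x : Plane, Real.exp (-(b * ‖x - y‖ ^ 2)) = Real.pi / b := by
  have h1 := GaussianFourier.integral_rexp_neg_mul_sq_norm (V := Plane) hb
  rw [integral_sub_right_eq_self (fun x : Plane => Real.exp (-(b * ‖x‖ ^ 2))) y]
  simp only [neg_mul] at h1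
  rw [h1]
  simp

theorem integrable_gauss_plane {b : ℝ} (hb : 0 < b) (y : Plane) :
    Integrable (fun x : Plane => Real.exp (-(b * ‖x - y‖ ^ 2))) := by
  -- A function that is not integrable has integral `0` by convention, whereas this integral equals
  -- `π/b > 0`.
  by_contra hcon
  have h1 := integral_gauss_plane hb y
  rw [integral_undef hcon] at h1
  have : 0 < Real.pi / b := by positivity
  linarith

theorem integrable_heatProfile_sq {h s : ℝ} (hh : 0 < h) (hs : 0 < s) (y : Plane) :
    Integrable (fun x : Plane => heatProfile h ‖x - y‖ s ^ 2) := by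
  have hCp := hC_pos hh hs
  have := (integrable_gauss_plane (b := hC h s / 2) (by positivity) y).const_mul
    ((hS h s / (4 * Real.pi)) ^ 2)
  refine this.congr (Eventually.of_forall fun x => ?_)
  simp only [heatProfile]
  rw [mul_pow, ← Real.exp_nat_mul]
  congr 2
  push_cast
  ring

theorem integral_heatProfile_sq_le {h s : ℝ} (hh : 0 < h) (hs : 0 < s) (y : Plane) :
    ∫ x : Plane, heatProfile h ‖x - y‖ s ^ 2 ≤ 1 / s := by
  have hCp := hC_pos hh hs
  have hSp := hS_pos hh hs
  have e : ∀ x : Plane, heatProfile h ‖x - y‖ s ^ 2 =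
      (hS h s / (4 * Real.pi)) ^ 2 * Real.exp (-(hC h s / 2 * ‖x - y‖ ^ 2)) := by
    intro x
    simp only [heatProfile]
    rw [mul_pow, ← Real.exp_nat_mul]
    congr 2
    push_cast
    ring
  simp only [e]
  rw [integral_const_mul, integral_gauss_plane (by positivity)]
  have h1 := hS_le hh hs
  have h2 := le_hC hh hs
  have h3 : hS h s ≤ hC h s := h1.trans h2
  have hpi := Real.pi_gt_three
  have e1 : (hS h s / (4 * Real.pi)) ^ 2 * (Real.pi / (hC h s / 2)) =
      hS h s * (hS h s / hC h s) * (1 / (8 * Real.pi)) := by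
    field_simp
    ring
  rw [e1]
  have h4 : hS h s / hC h s ≤ 1 := (div_le_one hCp).2 h3
  have h5 : 1 / (8 * Real.pi) ≤ 1 := (div_le_one (by positivity)).2 (by linarith)
  calc hS h s * (hS h s / hC h s) * (1 / (8 * Real.pi)) ≤ 1 / s * 1 * 1 := by gcongr
    _ = 1 / s := by ring

theorem continuous_gaugePhase_left (h : ℝ) (y : Plane) :
    Continuous (fun x : Plane => gaugePhase h x y) := by
  unfold gaugePhase
  fun_prop

theorem measurable_heatProfile_prod (h : ℝ) :
    Measurable (fun p : ℝ × ℝ => heatProfile h p.2 p.1) := by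
  unfold heatProfile
  have h1 : Measurable (fun p : ℝ × ℝ => hS h p.1) := (measurable_hS h).comp measurable_fst
  have h2 : Measurable (fun p : ℝ × ℝ => hC h p.1) := (measurable_hC h).comp measurable_fst
  fun_prop

theorem measurable_heat (h : ℝ) (y : Plane) :
    Measurable (fun p : ℝ × Plane => heat h p.1 y p.2) := by
  unfold heat
  have h1 : Measurable (fun p : ℝ × Plane => gaugePhase h p.2 y) :=
    (continuous_gaugePhase_left h y).measurable.comp measurable_snd
  have h2 : Measurable (fun p : ℝ × Plane => heatProfile h ‖p.2 - y‖ p.1) :=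
    (measurable_heatProfile_prod h).comp (f := fun p : ℝ × Plane => (p.1, ‖p.2 - y‖))
      (measurable_fst.prodMk (measurable_snd.sub_const y).norm)
  exact h1.mul (Complex.measurable_ofReal.comp h2)

theorem norm_heat {h s : ℝ} (hh : 0 < h) (hs : 0 < s) (y x : Plane) :
    ‖heat h s y x‖ = heatProfile h ‖x - y‖ s := by
  rw [heat, norm_mul, norm_gaugePhase, one_mul, Complex.norm_real, Real.norm_of_nonneg
    (heatProfile_pos hh hs _).le]

theorem integrable_norm_sq {f : Plane → ℂ} (hf : MemLp f 2 volume) :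
    Integrable (fun x => ‖f x‖ ^ 2) :=
  (memLp_two_iff_integrable_sq_norm hf.1).1 hf

theorem memLp_heat {h s : ℝ} (hh : 0 < h) (hs : 0 < s) (y : Plane) :
    MemLp (heat h s y) 2 volume := by
  refine (memLp_two_iff_integrable_sq_norm (contDiff_heat h s y).continuous.aestronglyMeasurable).2 ?_
  simp only [norm_heat hh hs]
  exact integrable_heatProfile_sq hh hs y

theorem integrable_conj_mul_memLp {f g : Plane → ℂ} (hf : MemLp f 2 volume)
    (hg : MemLp g 2 volume) : Integrable (fun x => conj (f x) * g x) :=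
  (hf.star).integrable_mul hg

/-- `∫ |f| p_s ≤ C s^{-1/2}`. -/
theorem integral_norm_heat_le {f : Plane → ℂ} (hf : MemLp f 2 volume) {h s : ℝ} (hh : 0 < h)
    (hs : 0 < s) (y : Plane) : ∫ x, ‖conj (f x) * heat h s y x‖ ≤
      ((∫ x, ‖f x‖ ^ 2) + 1) * s ^ (-(1 / 2) : ℝ) := by
  -- The bound is `|f| p ≤ t |f|² + t⁻¹ p²`. Since `∫ p² ≤ 1/s = t²`, this weight balances the two
  -- terms.
  set t := s ^ (-(1 / 2) : ℝ) with ht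
  have htpos : 0 < t := Real.rpow_pos_of_pos hs _
  have htt : t * t = 1 / s := by
    rw [ht, ← Real.rpow_add hs]; norm_num; rw [Real.rpow_neg_one]
  have i1 := integrable_norm_sq hf
  have i2 := integrable_heatProfile_sq hh hs y
  have hle : ∀ x, ‖conj (f x) * heat h s y x‖ ≤
      t * ‖f x‖ ^ 2 + t⁻¹ * heatProfile h ‖x - y‖ s ^ 2 := by
    intro x
    rw [norm_mul, norm_heat hh hs, RCLike.norm_conj]
    have h1 := sq_nonneg (t * ‖f x‖ - heatProfile h ‖x - y‖ s)
    have h3 : 0 ≤ ‖f x‖ * heatProfile h ‖x - y‖ s :=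
      mul_nonneg (norm_nonneg _) (heatProfile_pos hh hs _).le
    have h2 : t * (‖f x‖ * heatProfile h ‖x - y‖ s) ≤
        t * (t * ‖f x‖ ^ 2 + t⁻¹ * heatProfile h ‖x - y‖ s ^ 2) := by
      rw [mul_add, ← mul_assoc t t⁻¹, mul_inv_cancel₀ htpos.ne']
      nlinarith [mul_nonneg htpos.le h3]
    exact le_of_mul_le_mul_left h2 htpos
  calc ∫ x, ‖conj (f x) * heat h s y x‖
      ≤ ∫ x, (t * ‖f x‖ ^ 2 + t⁻¹ * heatProfile h ‖x - y‖ s ^ 2) :=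
        integral_mono (integrable_conj_mul_memLp hf (memLp_heat hh hs y)).norm
          ((i1.const_mul t).add (i2.const_mul t⁻¹)) hle
    _ = t * (∫ x, ‖f x‖ ^ 2) + t⁻¹ * ∫ x, heatProfile h ‖x - y‖ s ^ 2 := by
        rw [integral_add (i1.const_mul t) (i2.const_mul t⁻¹), integral_const_mul,
          integral_const_mul]
    _ ≤ t * (∫ x, ‖f x‖ ^ 2) + t⁻¹ * (1 / s) := by
        gcongr
        exact integral_heatProfile_sq_le hh hs y
    _ = ((∫ x, ‖f x‖ ^ 2) + 1) * t := by
        rw [← htt, ← mul_assoc, inv_mul_cancel₀ htpos.ne']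
        ring

/-- Integrating in space leaves at most `C s^{-1/2} e^{-Es}`, which is integrable in time. This
justifies exchanging the time integral with pairings against `L²` functions. -/
theorem integrable_heat_prod {f : Plane → ℂ} (hf : MemLp f 2 volume) {h E : ℝ} (hh : 0 < h)
    (hE : 0 < E) (y : Plane) :
    Integrable (fun p : ℝ × Plane => conj (f p.2) * heat h p.1 y p.2 * (Real.exp (-(E * p.1)) : ℂ))
      ((volume.restrict (Ioi (0 : ℝ))).prod (volume : Measure Plane)) := by
  have hmeas : AEStronglyMeasurable
      (fun p : ℝ × Plane => conj (f p.2) * heat h p.1 y p.2 * (Real.exp (-(E * p.1)) : ℂ))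
      ((volume.restrict (Ioi (0 : ℝ))).prod (volume : Measure Plane)) := by
    refine ((hf.star.1.comp_snd (μ := volume.restrict (Ioi (0 : ℝ)))).mul
      (measurable_heat h y).aestronglyMeasurable).mul ?_
    exact Continuous.aestronglyMeasurable (by fun_prop)
  rw [integrable_prod_iff hmeas]
  constructor
  · refine (ae_restrict_mem measurableSet_Ioi).mono fun s hs => ?_
    exact (integrable_conj_mul_memLp hf (memLp_heat hh hs y)).mul_const
      ((Real.exp (-(E * s)) : ℝ) : ℂ)
  · have i1 : IntegrableOn (fun s : ℝ => ((∫ x, ‖f x‖ ^ 2) + 1) *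
        (s ^ (-(1 / 2) : ℝ) * Real.exp (-E * s ^ (1 : ℝ)))) (Ioi 0) :=
      (integrableOn_rpow_mul_exp_neg_mul_rpow (by norm_num) one_pos hE).const_mul _
    refine Integrable.mono' i1 hmeas.norm.integral_prod_right' ?_
    refine (ae_restrict_mem measurableSet_Ioi).mono fun s hs => ?_
    rw [Real.norm_of_nonneg (integral_nonneg fun _ => norm_nonneg _)]
    have e : ∀ x, ‖conj (f x) * heat h s y x * (Real.exp (-(E * s)) : ℂ)‖ =
        ‖conj (f x) * heat h s y x‖ * Real.exp (-(E * s)) := by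
      intro x
      rw [norm_mul (conj (f x) * heat h s y x), Complex.norm_real,
        Real.norm_of_nonneg (Real.exp_pos _).le]
    simp only [e]
    rw [integral_mul_const, Real.rpow_one, ← mul_assoc, neg_mul]
    exact mul_le_mul_of_nonneg_right (integral_norm_heat_le hf hh hs y) (Real.exp_pos _).le

/-- The profile of the Green function at the real energy `-E`. -/
def gF (h E r : ℝ) : ℝ := ∫ s in Ioi (0 : ℝ), heatProfile h r s * Real.exp (-(E * s))

theorem greenProfile_ofReal (h E r : ℝ) : greenProfile h r ((-E : ℝ) : ℂ) = (gF h E r : ℂ) := by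
  rw [greenProfile, gF, ← integral_complex_ofReal]
  congr 1
  ext s
  rw [← Complex.ofReal_mul, ← Complex.ofReal_exp, ← Complex.ofReal_mul]
  congr 1
  rw [neg_mul]
  ring

/-- The Green function at the real energy `-E`, as a function of its first argument. -/
def greenK (h E : ℝ) (y x : Plane) : ℂ := gaugePhase h x y * (gF h E ‖x - y‖ : ℂ)

theorem conj_greenK (h E : ℝ) (y x : Plane) : conj (greenK h E y x) = greenK h E x y := by
  rw [greenK, greenK, map_mul, conj_gaugePhase, Complex.conj_ofReal, norm_sub_rev]

theorem greenK_eq_integral (h E : ℝ) (y x : Plane) :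
    greenK h E y x = ∫ s in Ioi (0 : ℝ), heat h s y x * (Real.exp (-(E * s)) : ℂ) := by
  rw [greenK, gF, ← integral_complex_ofReal, ← integral_const_mul]
  congr 1
  ext s
  rw [heat]
  push_cast
  ring

/-- Pairing with the Green function as a time integral. -/
theorem integral_conj_mul_greenK {f : Plane → ℂ} (hf : MemLp f 2 volume) {h E : ℝ} (hh : 0 < h)
    (hE : 0 < E) (y : Plane) :
    ∫ x, conj (f x) * greenK h E y x =
      ∫ s in Ioi (0 : ℝ), (∫ x, conj (f x) * heat h s y x) * (Real.exp (-(E * s)) : ℂ) := by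
  have := integral_integral_swap (f := fun s x =>
    conj (f x) * heat h s y x * (Real.exp (-(E * s)) : ℂ)) (integrable_heat_prod hf hh hE y)
  have e : ∀ s, (∫ x, conj (f x) * heat h s y x) * (Real.exp (-(E * s)) : ℂ) =
      ∫ x, conj (f x) * heat h s y x * (Real.exp (-(E * s)) : ℂ) := by
    intro s; rw [integral_mul_const]
  simp only [e]
  refine Eq.trans ?_ this.symm
  congr 1
  ext x
  rw [greenK_eq_integral, ← integral_const_mul]
  congr 1
  ext s
  ring

/-! ### Time derivative of pairings with the heat kernel -/

theorem sq_mul_exp_neg_le {κ r : ℝ} (hκ : 0 < κ) :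
    r ^ 2 * Real.exp (-(κ * r ^ 2)) ≤ κ⁻¹ := by
  have h1 := Real.add_one_le_exp (κ * r ^ 2)
  rw [Real.exp_neg, ← div_eq_mul_inv, div_le_iff₀ (Real.exp_pos _), inv_mul_eq_div,
    le_div_iff₀ hκ]
  linarith

/-- The Gaussian exponent is at least `r²/(8s)` on the time window, that is, twice `r²/(16s)`. One
copy absorbs the factor `r²` of the time derivative and the other remains. A bound uniform on a
window permits differentiation under the integral. -/
theorem exists_norm_heatDeriv_le {h s : ℝ} (hh : 0 < h) (hs : 0 < s) :
    ∃ K κ : ℝ, 0 < κ ∧ 0 ≤ K ∧ ∀ s' ∈ Ioo (s / 2) (2 * s), ∀ y x : Plane,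
      ‖heatDeriv h s' y x‖ ≤ K * Real.exp (-(κ * ‖x - y‖ ^ 2)) := by
  refine ⟨((2 / s) ^ 2 * (16 * s) + (2 / s + h)) * (2 / s), 1 / (16 * s), by positivity,
    by positivity, ?_⟩
  intro s' hs' y x
  have hs'0 : 0 < s' := lt_trans (by positivity) hs'.1
  have b1 : 1 / s' ≤ 2 / s := by
    rw [div_le_div_iff₀ hs'0 hs]; linarith [hs'.1]
  have b2 : 1 / (2 * s) ≤ 1 / s' := by
    rw [div_le_div_iff₀ (by positivity) hs'0]; linarith [hs'.2]
  have c1 := (hS_le hh hs'0).trans b1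
  have c2 := (hC_le hh hs'0).trans (add_le_add_left b1 h)
  have c3 := b2.trans (le_hC hh hs'0)
  have p1 := hS_pos hh hs'0
  have p2 := hC_pos hh hs'0
  set r := ‖x - y‖ with hr
  have hpi := Real.pi_gt_three
  have hp : heatProfile h r s' ≤ 2 / s * (Real.exp (-(1 / (16 * s) * r ^ 2)) *
      Real.exp (-(1 / (16 * s) * r ^ 2))) := by
    rw [heatProfile]
    have e1 : hS h s' / (4 * Real.pi) ≤ 2 / s := by
      refine (div_le_self p1.le (by linarith)).trans c1
    have e2 : Real.exp (-(hC h s' * r ^ 2 / 4)) ≤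
        Real.exp (-(1 / (16 * s) * r ^ 2)) * Real.exp (-(1 / (16 * s) * r ^ 2)) := by
      rw [← Real.exp_add]
      apply Real.exp_le_exp.2
      have := mul_le_mul_of_nonneg_right c3 (sq_nonneg r)
      have e3 : 1 / (2 * s) * r ^ 2 = 4 * (1 / (16 * s) * r ^ 2 + 1 / (16 * s) * r ^ 2) := by
        field_simp; ring
      linarith
    gcongr
  rw [heatDeriv, norm_mul, norm_heat hh hs'0, Complex.norm_real, Real.norm_eq_abs]
  have ha : |hS h s' ^ 2 * r ^ 2 / 4 - hC h s'| ≤ (2 / s) ^ 2 * r ^ 2 + (2 / s + h) := by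
    rw [abs_le]
    have : hS h s' ^ 2 * r ^ 2 ≤ (2 / s) ^ 2 * r ^ 2 := by gcongr
    have : 0 ≤ hS h s' ^ 2 * r ^ 2 := by positivity
    constructor <;> linarith
  set e := Real.exp (-(1 / (16 * s) * r ^ 2)) with he
  have hepos : 0 < e := Real.exp_pos _
  have he1 : e ≤ 1 := Real.exp_le_one_iff.2 (by have : 0 ≤ 1 / (16 * s) * r ^ 2 := by positivity
                                                linarith)
  have hre : r ^ 2 * e ≤ 16 * s := by
    have := sq_mul_exp_neg_le (κ := 1 / (16 * s)) (r := r) (by positivity)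
    rwa [one_div, inv_inv, ← one_div] at this
  calc |hS h s' ^ 2 * r ^ 2 / 4 - hC h s'| * heatProfile h r s'
      ≤ ((2 / s) ^ 2 * r ^ 2 + (2 / s + h)) * (2 / s * (e * e)) := by
        have := (heatProfile_pos hh hs'0 r).le
        gcongr
    _ = ((2 / s) ^ 2 * (r ^ 2 * e) + (2 / s + h) * e) * (2 / s) * e := by ring
    _ ≤ ((2 / s) ^ 2 * (16 * s) + (2 / s + h) * 1) * (2 / s) * e := by gcongr
    _ = _ := by ring

theorem memLp_gauss {κ : ℝ} (hκ : 0 < κ) (K : ℝ) (y : Plane) :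
    MemLp (fun x : Plane => K * Real.exp (-(κ * ‖x - y‖ ^ 2))) 2 volume := by
  have hc : Continuous (fun x : Plane => K * Real.exp (-(κ * ‖x - y‖ ^ 2))) := by fun_prop
  refine (memLp_two_iff_integrable_sq hc.aestronglyMeasurable).2 ?_
  refine ((integrable_gauss_plane (b := 2 * κ) (by positivity) y).const_mul (K ^ 2)).congr
    (Eventually.of_forall fun x => ?_)
  simp only
  rw [mul_pow, ← Real.exp_nat_mul]
  congr 2
  push_cast
  ring

theorem continuous_heatDeriv (h s : ℝ) (y : Plane) : Continuous (heatDeriv h s y) := by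
  unfold heatDeriv
  have := (contDiff_heat h s y).continuous
  fun_prop

theorem hasDerivAt_integral_heat {f : Plane → ℂ} (hf : MemLp f 2 volume) {h s : ℝ} (hh : 0 < h)
    (hs : 0 < s) (y : Plane) :
    HasDerivAt (fun s => ∫ x, conj (f x) * heat h s y x) (∫ x, conj (f x) * heatDeriv h s y x) s := by
  obtain ⟨K, κ, hκ, hK, hb⟩ := exists_norm_heatDeriv_le hh hs
  have hmem : Ioo (s / 2) (2 * s) ∈ 𝓝 s := Ioo_mem_nhds (by linarith) (by linarith)
  refine (hasDerivAt_integral_of_dominated_loc_of_deriv_le (μ := (volume : Measure Plane))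
    (F' := fun s x => conj (f x) * heatDeriv h s y x)
    (bound := fun x => ‖f x‖ * (K * Real.exp (-(κ * ‖x - y‖ ^ 2)))) hmem
    (Eventually.of_forall fun s' => hf.star.1.mul
      (contDiff_heat h s' y).continuous.aestronglyMeasurable)
    (integrable_conj_mul_memLp hf (memLp_heat hh hs y))
    (hf.star.1.mul (continuous_heatDeriv h s y).aestronglyMeasurable) ?_ ?_ ?_).2
  · refine Eventually.of_forall fun x s' hs' => ?_
    rw [norm_mul, RCLike.norm_conj]
    exact mul_le_mul_of_nonneg_left (hb s' hs' y x) (norm_nonneg _)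
  · exact hf.norm.integrable_mul (memLp_gauss hκ K y)
  · refine Eventually.of_forall fun x s' hs' => ?_
    exact (hasDerivAt_heat hh (lt_trans (by positivity) hs'.1) y x).const_mul _

/-! ### The heat kernel at small times -/

theorem tendsto_mul_hS {h : ℝ} (hh : 0 < h) : Tendsto (fun s => s * hS h s) (𝓝[>] 0) (𝓝 1) := by
  have h1 : Tendsto (fun s : ℝ => 1 - h ^ 2 * s ^ 2 / 2) (𝓝[>] 0) (𝓝 1) := by
    have : Continuous (fun s : ℝ => 1 - h ^ 2 * s ^ 2 / 2) := by fun_prop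
    have := (this.tendsto 0).mono_left (nhdsWithin_le_nhds (s := Ioi 0))
    simpa using this
  refine tendsto_of_tendsto_of_tendsto_of_le_of_le' h1 tendsto_const_nhds ?_ ?_
  · filter_upwards [self_mem_nhdsWithin] with s hs
    have hs : 0 < s := hs
    have := mul_le_mul_of_nonneg_left (le_hS hh hs) hs.le
    rw [mul_sub, mul_one_div_cancel hs.ne'] at this
    nlinarith
  · filter_upwards [self_mem_nhdsWithin] with s hs
    have hs : 0 < s := hs
    have := mul_le_mul_of_nonneg_left (hS_le hh hs) hs.le
    rwa [mul_one_div_cancel hs.ne'] at this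

theorem tendsto_mul_hC {h : ℝ} (hh : 0 < h) : Tendsto (fun s => s * hC h s) (𝓝[>] 0) (𝓝 1) := by
  have h1 : Tendsto (fun s : ℝ => 1 + h * s) (𝓝[>] 0) (𝓝 1) := by
    have : Continuous (fun s : ℝ => 1 + h * s) := by fun_prop
    have := (this.tendsto 0).mono_left (nhdsWithin_le_nhds (s := Ioi 0))
    simpa using this
  refine tendsto_of_tendsto_of_tendsto_of_le_of_le' tendsto_const_nhds h1 ?_ ?_
  · filter_upwards [self_mem_nhdsWithin] with s hs
    have hs : 0 < s := hs
    have := mul_le_mul_of_nonneg_left (le_hC hh hs) hs.le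
    rwa [mul_one_div_cancel hs.ne'] at this
  · filter_upwards [self_mem_nhdsWithin] with s hs
    have hs : 0 < s := hs
    have := mul_le_mul_of_nonneg_left (hC_le hh hs) hs.le
    rw [mul_add, mul_one_div_cancel hs.ne'] at this
    linarith

theorem integral_mul_heat_eq_scaled {η : Plane → ℂ} {h s : ℝ} (hs : 0 < s) (y : Plane) :
    ∫ x, η x * ((heatProfile h ‖x - y‖ s : ℝ) : ℂ) =
      ∫ w : Plane, η (√s • w + y) * ((s * heatProfile h (√s * ‖w‖) s : ℝ) : ℂ) := by
  have e1 : ∫ x, η x * ((heatProfile h ‖x - y‖ s : ℝ) : ℂ) =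
      ∫ x, η (x + y) * ((heatProfile h ‖x‖ s : ℝ) : ℂ) := by
    rw [← integral_add_right_eq_self (fun x => η x * ((heatProfile h ‖x - y‖ s : ℝ) : ℂ)) y]
    simp only [add_sub_cancel_right]
  have e2 := Measure.integral_comp_smul_of_nonneg (volume : Measure Plane)
    (fun x => η (x + y) * ((heatProfile h ‖x‖ s : ℝ) : ℂ)) (√s) (hR := Real.sqrt_nonneg s)
  have e3 : (√s ^ Module.finrank ℝ Plane)⁻¹ = s⁻¹ := by
    rw [finrank_euclideanSpace, Fintype.card_fin, Real.sq_sqrt hs.le]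
  rw [e3, Complex.real_smul] at e2
  have hsc : (s : ℂ) ≠ 0 := by exact_mod_cast hs.ne'
  have e4 : ∫ x, η (x + y) * ((heatProfile h ‖x‖ s : ℝ) : ℂ) =
      (s : ℂ) * ∫ w : Plane, η (√s • w + y) * ((heatProfile h ‖√s • w‖ s : ℝ) : ℂ) := by
    rw [e2, ← mul_assoc, Complex.ofReal_inv, mul_inv_cancel₀ hsc, one_mul]
  rw [e1, e4, ← integral_const_mul]
  congr 1
  ext w
  rw [norm_smul, Real.norm_of_nonneg (Real.sqrt_nonneg s), Complex.ofReal_mul]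
  ring

theorem tendsto_scaled_heatProfile {h : ℝ} (hh : 0 < h) (r : ℝ) :
    Tendsto (fun s => s * heatProfile h (√s * r) s) (𝓝[>] 0)
      (𝓝 (1 / (4 * Real.pi) * Real.exp (-(1 / 4 * r ^ 2)))) := by
  have h1 := (tendsto_mul_hS hh).div_const (4 * Real.pi)
  have h2 := (((tendsto_mul_hC hh).mul_const (r ^ 2)).div_const 4).neg
  have h3 := h1.mul ((Real.continuous_exp.tendsto _).comp h2)
  rw [show (1 : ℝ) * r ^ 2 / 4 = 1 / 4 * r ^ 2 by ring] at h3
  refine h3.congr' ?_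
  filter_upwards [self_mem_nhdsWithin] with s hs
  have hs : 0 < s := hs
  rw [heatProfile, mul_pow, Real.sq_sqrt hs.le, Function.comp_apply,
    show hC h s * (s * r ^ 2) / 4 = s * hC h s * r ^ 2 / 4 by ring]
  ring

theorem scaled_heatProfile_le {h s : ℝ} (hh : 0 < h) (hs : 0 < s) (r : ℝ) :
    s * heatProfile h (√s * r) s ≤ Real.exp (-(1 / 4 * r ^ 2)) := by
  refine (mul_le_mul_of_nonneg_left (heatProfile_le hh hs _) hs.le).trans ?_
  rw [mul_pow, Real.sq_sqrt hs.le]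
  have e1 : s * r ^ 2 / (4 * s) = 1 / 4 * r ^ 2 := by field_simp
  rw [e1]
  have e2 : s * (1 / (4 * Real.pi) * (1 / s * Real.exp (-(1 / 4 * r ^ 2)))) =
      1 / (4 * Real.pi) * Real.exp (-(1 / 4 * r ^ 2)) := by field_simp
  rw [e2]
  have hpi := Real.pi_gt_three
  exact mul_le_of_le_one_left (Real.exp_pos _).le ((div_le_one (by positivity)).2 (by linarith))

/-- After the parabolic scaling `x = y + √s w` the kernels are dominated by `e^{-|w|²/4}` and
converge to the normalized Gaussian of total mass one, so the heat kernel is an approximate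
identity. -/
theorem tendsto_integral_mul_heatProfile {η : Plane → ℂ} (hηc : Continuous η) {B : ℝ}
    (hηB : ∀ x, ‖η x‖ ≤ B) {h : ℝ} (hh : 0 < h) (y : Plane) :
    Tendsto (fun s => ∫ x, η x * ((heatProfile h ‖x - y‖ s : ℝ) : ℂ)) (𝓝[>] 0) (𝓝 (η y)) := by
  refine Tendsto.congr' (f₁ := fun s : ℝ => ∫ w : Plane, η (√s • w + y) *
    ((s * heatProfile h (√s * ‖w‖) s : ℝ) : ℂ)) ?_ ?_
  · filter_upwards [self_mem_nhdsWithin] with s hs using (integral_mul_heat_eq_scaled hs y).symm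
  have hval : η y = ∫ w : Plane, η y *
      ((1 / (4 * Real.pi) * Real.exp (-(1 / 4 * ‖w‖ ^ 2)) : ℝ) : ℂ) := by
    have h0 := integral_gauss_plane (b := 1 / 4) (by norm_num) 0
    simp only [sub_zero] at h0
    rw [integral_const_mul, integral_complex_ofReal, integral_const_mul, h0]
    have : 1 / (4 * Real.pi) * (Real.pi / (1 / 4)) = 1 := by
      have := Real.pi_ne_zero; field_simp
    rw [this]
    simp
  have hgi := integrable_gauss_plane (b := 1 / 4) (by norm_num) 0
  simp only [sub_zero] at hgi
  have hlim : Tendsto (fun s : ℝ => ∫ w : Plane, η (√s • w + y) *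
      ((s * heatProfile h (√s * ‖w‖) s : ℝ) : ℂ)) (𝓝[>] 0) (𝓝 (∫ w : Plane, η y *
      ((1 / (4 * Real.pi) * Real.exp (-(1 / 4 * ‖w‖ ^ 2)) : ℝ) : ℂ))) := by
    refine tendsto_integral_filter_of_dominated_convergence
      (bound := fun w : Plane => B * (Real.exp (-(1 / 4 * ‖w‖ ^ 2)))) ?_ ?_
      (hgi.const_mul B) ?_
    · refine Eventually.of_forall fun s => Continuous.aestronglyMeasurable ?_
      have : Continuous (fun w : Plane => η (√s • w + y)) := hηc.comp (by fun_prop)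
      refine this.mul (Complex.continuous_ofReal.comp ?_)
      unfold heatProfile
      fun_prop
    · filter_upwards [self_mem_nhdsWithin] with s hs
      refine Eventually.of_forall fun w => ?_
      have hs' : 0 < s := hs
      have h0 := mul_nonneg hs'.le (heatProfile_pos hh hs' (√s * ‖w‖)).le
      rw [norm_mul, Complex.norm_real, Real.norm_of_nonneg h0]
      exact mul_le_mul (hηB _) (scaled_heatProfile_le hh hs' _) h0 ((norm_nonneg _).trans (hηB 0))
    · refine Eventually.of_forall fun w => ?_
      refine Tendsto.mul ?_ ((Complex.continuous_ofReal.tendsto _).comp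
        (tendsto_scaled_heatProfile hh ‖w‖))
      have hcont : Continuous (fun s : ℝ => η (√s • w + y)) := hηc.comp (by fun_prop)
      have := (hcont.tendsto 0).mono_left (nhdsWithin_le_nhds (s := Ioi 0))
      simpa using this
  rwa [← hval] at hlim

theorem tendsto_integral_heat {φ : Plane → ℂ} (hφ : Continuous φ) (hc : HasCompactSupport φ)
    {h : ℝ} (hh : 0 < h) (y : Plane) :
    Tendsto (fun s => ∫ x, conj (φ x) * heat h s y x) (𝓝[>] 0) (𝓝 (conj (φ y))) := by
  obtain ⟨B, hB⟩ := hc.exists_bound_of_continuous hφ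
  have hg := continuous_gaugePhase_left h y
  have := tendsto_integral_mul_heatProfile (η := fun x => conj (φ x) * gaugePhase h x y)
    ((Complex.continuous_conj.comp hφ).mul hg) (B := B)
    (fun x => by rw [norm_mul, RCLike.norm_conj, norm_gaugePhase, mul_one]; exact hB x) hh y
  have e : gaugePhase h y y = 1 := by simp [gaugePhase]
  rw [e, mul_one] at this
  simpa only [heat, mul_assoc] using this

theorem tendsto_integral_heat_atTop {f : Plane → ℂ} (hf : MemLp f 2 volume) {h E : ℝ} (hh : 0 < h)
    (hE : 0 < E) (y : Plane) :
    Tendsto (fun s => (∫ x, conj (f x) * heat h s y x) * (Real.exp (-(E * s)) : ℂ)) atTop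
      (𝓝 0) := by
  have h1 : Tendsto (fun s : ℝ => ((∫ x, ‖f x‖ ^ 2) + 1) * Real.exp (-(E * s))) atTop
      (𝓝 (((∫ x, ‖f x‖ ^ 2) + 1) * 0)) := by
    refine Tendsto.const_mul _ (Real.tendsto_exp_atBot.comp ?_)
    exact tendsto_neg_atTop_atBot.comp (tendsto_id.const_mul_atTop hE)
  rw [mul_zero] at h1
  refine squeeze_zero_norm' ?_ h1
  filter_upwards [eventually_ge_atTop 1] with s hs1
  have hs0 : 0 < s := by linarith
  rw [norm_mul, Complex.norm_real, Real.norm_of_nonneg (Real.exp_pos _).le]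
  refine mul_le_mul_of_nonneg_right ?_ (Real.exp_pos _).le
  refine (norm_integral_le_integral_norm _).trans ((integral_norm_heat_le hf hh hs0 y).trans ?_)
  have : s ^ (-(1 / 2) : ℝ) ≤ 1 := Real.rpow_le_one_of_one_le_of_nonpos hs1 (by norm_num)
  have h0 : 0 ≤ (∫ x, ‖f x‖ ^ 2) + 1 := by
    have : 0 ≤ ∫ x, ‖f x‖ ^ 2 := integral_nonneg fun _ => by positivity
    linarith
  exact mul_le_of_le_one_right h0 this

/-! ### The fundamental solution -/

/-- `(H_h + E) φ`. -/
def opHE (h E : ℝ) (φ : Plane → ℂ) (x : Plane) : ℂ := landau h φ x + E * φ x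

theorem contDiff_opHE {φ : Plane → ℂ} (hφ : ContDiff ℝ ∞ φ) (h E : ℝ) :
    ContDiff ℝ ∞ (opHE h E φ) :=
  (contDiff_landau hφ h).add (contDiff_const.mul hφ)

theorem hasCompactSupport_opHE {φ : Plane → ℂ} (hφ : HasCompactSupport φ) (h E : ℝ) :
    HasCompactSupport (opHE h E φ) :=
  (hasCompactSupport_landau hφ h).add hφ.mul_left

theorem memLp_of_contDiff {φ : Plane → ℂ} (hφ : ContDiff ℝ ∞ φ) (hs : HasCompactSupport φ) :
    MemLp φ 2 volume :=
  hφ.continuous.memLp_of_hasCompactSupport hs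

/-- Put `J(s) = e^{-Es} ⟨φ, p_s⟩`. By the heat equation and formal self-adjointness, `-J'(s) =
e^{-Es} ⟨(H_h + E)φ, p_s⟩`. Integrating over `(0,∞)`, the end values `J(0+) = conj φ(y)` and `J(∞) =
0` show that the Green function is a fundamental solution. -/
theorem integral_conj_opHE_mul_greenK {φ : Plane → ℂ} (hφ : ContDiff ℝ ∞ φ)
    (hs : HasCompactSupport φ) {h E : ℝ} (hh : 0 < h) (hE : 0 < E) (y : Plane) :
    ∫ x, conj (opHE h E φ x) * greenK h E y x = conj (φ y) := by
  have hLφ := memLp_of_contDiff hφ hs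
  have hLψ := memLp_of_contDiff (contDiff_opHE hφ h E) (hasCompactSupport_opHE hs h E)
  have hintg := (integrable_heat_prod hLψ hh hE y).integral_prod_left
  rw [integral_conj_mul_greenK hLψ hh hE]
  set J : ℝ → ℂ := fun s => (∫ x, conj (φ x) * heat h s y x) * (Real.exp (-(E * s)) : ℂ) with hJ
  have hJd : ∀ s ∈ Ioi (0 : ℝ), HasDerivAt J
      (-((∫ x, conj (opHE h E φ x) * heat h s y x) * (Real.exp (-(E * s)) : ℂ))) s := by
    intro s hs'
    have hs' : 0 < s := hs'
    have d1 := hasDerivAt_integral_heat hLφ hh hs' y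
    have d2 : HasDerivAt (fun s : ℝ => (Real.exp (-(E * s)) : ℂ))
        ((Real.exp (-(E * s)) * (-(E * 1)) : ℝ) : ℂ) s :=
      (((hasDerivAt_id s).const_mul E).neg.exp).ofReal_comp
    refine (d1.mul d2).congr_deriv ?_
    have e1 : ∫ x, conj (φ x) * heatDeriv h s y x = -∫ x, conj (landau h φ x) * heat h s y x := by
      rw [integral_conj_landau hφ hs (contDiff_heat h s y), ← integral_neg]
      congr 1
      ext x
      rw [landau_heat hh hs']
      ring
    have e2 : ∫ x, conj (opHE h E φ x) * heat h s y x = (∫ x, conj (landau h φ x) * heat h s y x) +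
        E * ∫ x, conj (φ x) * heat h s y x := by
      rw [← integral_const_mul, ← integral_add
        (integrable_conj_mul (continuous_landau hφ h) (hasCompactSupport_landau hs h)
          (contDiff_heat h s y).continuous)
        ((integrable_conj_mul hφ.continuous hs (contDiff_heat h s y).continuous).const_mul _)]
      congr 1
      ext x
      simp only [opHE, map_add, map_mul, Complex.conj_ofReal]
      ring
    rw [e1, e2]
    push_cast
    ring
  have hJ0 : Tendsto J (𝓝[>] 0) (𝓝 (conj (φ y))) := by
    have h1 := tendsto_integral_heat hφ.continuous hs hh y
    have h2 : Tendsto (fun s : ℝ => (Real.exp (-(E * s)) : ℂ)) (𝓝[>] 0) (𝓝 1) := by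
      have : Continuous (fun s : ℝ => (Real.exp (-(E * s)) : ℂ)) := by fun_prop
      have := (this.tendsto 0).mono_left (nhdsWithin_le_nhds (s := Ioi 0))
      simpa using this
    have h3 := h1.mul h2
    rwa [mul_one] at h3
  have hJinf : Tendsto J atTop (𝓝 0) := tendsto_integral_heat_atTop hLφ hh hE y
  -- At `s = 0` division by `sinh 0` makes the kernel zero, so `J` has the wrong value there and is
  -- replaced by its limit.
  set J' : ℝ → ℂ := Function.update J 0 (conj (φ y)) with hJ'
  have hJJ : ∀ s ≠ 0, J' s = J s := fun s hs => Function.update_of_ne hs _ _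
  have hintg' : IntegrableOn (fun s => -((∫ x, conj (opHE h E φ x) * heat h s y x) *
      (Real.exp (-(E * s)) : ℂ))) (Ioi 0) := by
    refine Integrable.neg ?_
    simpa only [integral_mul_const] using hintg
  have := integral_Ioi_of_hasDerivAt_of_tendsto (a := 0) (f := J') (m := 0) ?_
    (fun s hs' => (hJd s hs').congr_of_eventuallyEq ?_) hintg' ?_
  · rw [integral_neg, hJ', Function.update_self, zero_sub, neg_inj] at this
    exact this
  · rw [hJ', continuousWithinAt_update_same]
    simpa using hJ0
  · filter_upwards [isOpen_ne.mem_nhds (ne_of_gt hs')] with t ht using hJJ t ht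
  · refine hJinf.congr' ?_
    filter_upwards [eventually_gt_atTop 0] with s hs' using (hJJ s hs'.ne').symm

/-! ### Decay of the Green function -/

/-- The majorant `r^{-1/2} e^{-√E r / 2}` of the Green function. -/
def bG (E r : ℝ) : ℝ := r ^ (-(1 / 2) : ℝ) * Real.exp (-(√E / 2 * r))

theorem exp_neg_le_rpow {u : ℝ} (hu : 0 < u) : Real.exp (-u) ≤ u ^ (-(1 / 4) : ℝ) := by
  rw [Real.rpow_neg hu.le, Real.exp_neg]
  refine inv_anti₀ (Real.rpow_pos_of_pos hu _) ?_
  rcases le_or_gt u 1 with h | h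
  · exact (Real.rpow_le_one hu.le h (by norm_num)).trans (Real.one_le_exp hu.le)
  · have h1 : u ^ (1 / 4 : ℝ) ≤ u ^ (1 : ℝ) := Real.rpow_le_rpow_of_exponent_le h.le (by norm_num)
    rw [Real.rpow_one] at h1
    linarith [Real.add_one_le_exp u]

/-- Half of the exponent `r²/(4s)` is spent, through `e^{-u} ≤ u^{-1/4}`, on replacing the
singularity `1/s` by the integrable `r^{-1/2} s^{-3/4}`. The other half, with half of `Es`, gives
`e^{-√E r/2}` after completing a square. The power `r^{-1/2}` overestimates the true logarithm but
is still square integrable at the origin of the plane. -/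
theorem heatProfile_mul_exp_le {h E r s : ℝ} (hh : 0 < h) (hE : 0 < E) (hr : 0 < r) (hs : 0 < s) :
    heatProfile h r s * Real.exp (-(E * s)) ≤
      bG E r * (s ^ (-(3 / 4) : ℝ) * Real.exp (-(E / 2) * s ^ (1 : ℝ))) := by
  have h1 := heatProfile_le hh hs r
  have hu : 0 < r ^ 2 / (8 * s) := by positivity
  have h2 := exp_neg_le_rpow hu
  have e1 : (r ^ 2 / (8 * s)) ^ (-(1 / 4) : ℝ) =
      r ^ (-(1 / 2) : ℝ) * (8 ^ (1 / 4 : ℝ) * s ^ (1 / 4 : ℝ)) := by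
    rw [Real.div_rpow (by positivity) (by positivity), ← Real.rpow_natCast, ← Real.rpow_mul hr.le,
      Real.rpow_neg (x := 8 * s) (by positivity), Real.mul_rpow (by norm_num) hs.le, div_inv_eq_mul]
    norm_num
  have e8 : (8 : ℝ) ^ (1 / 4 : ℝ) ≤ 2 := by
    have : (8 : ℝ) ^ (1 / 4 : ℝ) ≤ 16 ^ (1 / 4 : ℝ) :=
      Real.rpow_le_rpow (by norm_num) (by norm_num) (by norm_num)
    refine this.trans (le_of_eq ?_)
    rw [show (16 : ℝ) = 2 ^ (4 : ℝ) by norm_num, ← Real.rpow_mul (by norm_num)]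
    norm_num
  have e2 : 1 / s * s ^ (1 / 4 : ℝ) = s ^ (-(3 / 4) : ℝ) := by
    rw [one_div, ← Real.rpow_neg_one, ← Real.rpow_add hs]
    norm_num
  have e3 : Real.exp (-(r ^ 2 / (4 * s))) =
      Real.exp (-(r ^ 2 / (8 * s))) * Real.exp (-(r ^ 2 / (8 * s))) := by
    rw [← Real.exp_add]; congr 1; field_simp; ring
  have e4 : Real.exp (-(r ^ 2 / (8 * s))) * Real.exp (-(E * s)) ≤
      Real.exp (-(√E / 2 * r)) * Real.exp (-(E / 2) * s ^ (1 : ℝ)) := by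
    rw [← Real.exp_add, ← Real.exp_add, Real.rpow_one]
    apply Real.exp_le_exp.2
    have hq : √E / 2 * r ≤ E / 2 * s + r ^ 2 / (8 * s) := by
      have hsq := Real.sq_sqrt hE.le
      have : E / 2 * s + r ^ 2 / (8 * s) - √E / 2 * r = (2 * √E * s - r) ^ 2 / (8 * s) := by
        field_simp
        ring_nf
        rw [hsq]
        ring
      have h0 : 0 ≤ (2 * √E * s - r) ^ 2 / (8 * s) := by positivity
      linarith
    linarith
  have hpi := Real.pi_gt_three
  have c1 : 1 / (4 * Real.pi) * 2 ≤ 1 := by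
    rw [div_mul_eq_mul_div, div_le_one (by positivity)]; linarith
  have hr2 : 0 < r ^ (-(1 / 2) : ℝ) := Real.rpow_pos_of_pos hr _
  have hs4 : 0 < s ^ (1 / 4 : ℝ) := Real.rpow_pos_of_pos hs _
  calc heatProfile h r s * Real.exp (-(E * s))
      ≤ 1 / (4 * Real.pi) * (1 / s * (Real.exp (-(r ^ 2 / (8 * s))) *
          Real.exp (-(r ^ 2 / (8 * s))))) * Real.exp (-(E * s)) := by
        rw [← e3]; gcongr
    _ = 1 / (4 * Real.pi) * (1 / s * Real.exp (-(r ^ 2 / (8 * s)))) *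
          (Real.exp (-(r ^ 2 / (8 * s))) * Real.exp (-(E * s))) := by ring
    _ ≤ 1 / (4 * Real.pi) * (1 / s * (r ^ (-(1 / 2) : ℝ) * (2 * s ^ (1 / 4 : ℝ)))) *
          (Real.exp (-(√E / 2 * r)) * Real.exp (-(E / 2) * s ^ (1 : ℝ))) := by
        gcongr
        rw [e1] at h2
        exact h2.trans (by gcongr)
    _ = (1 / (4 * Real.pi) * 2) * ((r ^ (-(1 / 2) : ℝ) * Real.exp (-(√E / 2 * r))) *
          ((1 / s * s ^ (1 / 4 : ℝ)) * Real.exp (-(E / 2) * s ^ (1 : ℝ)))) := by ring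
    _ ≤ 1 * ((r ^ (-(1 / 2) : ℝ) * Real.exp (-(√E / 2 * r))) *
          ((1 / s * s ^ (1 / 4 : ℝ)) * Real.exp (-(E / 2) * s ^ (1 : ℝ)))) := by gcongr
    _ = _ := by rw [one_mul, e2, bG]

theorem integrableOn_heatProfile_mul_exp {h E r : ℝ} (hh : 0 < h) (hE : 0 < E) (hr : 0 < r) :
    IntegrableOn (fun s => heatProfile h r s * Real.exp (-(E * s))) (Ioi 0) := by
  have i1 : IntegrableOn (fun s : ℝ => bG E r *
      (s ^ (-(3 / 4) : ℝ) * Real.exp (-(E / 2) * s ^ (1 : ℝ)))) (Ioi 0) :=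
    (integrableOn_rpow_mul_exp_neg_mul_rpow (by norm_num) one_pos (by positivity)).const_mul _
  refine Integrable.mono' i1 ((measurable_heatProfile h r).mul
    (by fun_prop)).aestronglyMeasurable ?_
  refine (ae_restrict_mem measurableSet_Ioi).mono fun s hs => ?_
  rw [Real.norm_of_nonneg (mul_nonneg (heatProfile_pos hh hs r).le (Real.exp_pos _).le)]
  exact heatProfile_mul_exp_le hh hE hr hs

theorem gF_nonneg {h : ℝ} (hh : 0 < h) (E r : ℝ) : 0 ≤ gF h E r :=
  setIntegral_nonneg measurableSet_Ioi fun _ hs =>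
    mul_nonneg (heatProfile_pos hh hs r).le (Real.exp_pos _).le

/-- `∫₀^∞ s^{-3/4} e^{-Es/2} ds`. -/
def kG (E : ℝ) : ℝ := ∫ s in Ioi (0 : ℝ), s ^ (-(3 / 4) : ℝ) * Real.exp (-(E / 2) * s ^ (1 : ℝ))

theorem kG_nonneg (E : ℝ) : 0 ≤ kG E :=
  setIntegral_nonneg measurableSet_Ioi fun _ hs =>
    mul_nonneg (Real.rpow_nonneg (le_of_lt hs) _) (Real.exp_pos _).le

theorem gF_le {h E r : ℝ} (hh : 0 < h) (hE : 0 < E) (hr : 0 < r) : gF h E r ≤ kG E * bG E r := by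
  rw [mul_comm, kG, ← integral_const_mul]
  refine setIntegral_mono_on (integrableOn_heatProfile_mul_exp hh hE hr)
    ((integrableOn_rpow_mul_exp_neg_mul_rpow (by norm_num) one_pos (by positivity)).const_mul _)
    measurableSet_Ioi fun s hs => heatProfile_mul_exp_le hh hE hr hs

theorem measurable_gF (h E : ℝ) : Measurable (gF h E) := by
  have h1 : StronglyMeasurable (Function.uncurry fun (r s : ℝ) =>
      heatProfile h r s * Real.exp (-(E * s))) := by
    have m1 : Measurable (fun p : ℝ × ℝ => heatProfile h p.1 p.2) :=
      (measurable_heatProfile_prod h).comp (f := fun p : ℝ × ℝ => (p.2, p.1))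
        (measurable_snd.prodMk measurable_fst)
    have m2 : Measurable (fun p : ℝ × ℝ => Real.exp (-(E * p.2))) := by fun_prop
    exact (m1.mul m2).stronglyMeasurable
  exact (h1.integral_prod_right (ν := volume.restrict (Ioi (0 : ℝ)))).measurable

theorem norm_greenK {h : ℝ} (hh : 0 < h) (E : ℝ) (y x : Plane) :
    ‖greenK h E y x‖ = gF h E ‖x - y‖ := by
  rw [greenK, norm_mul, norm_gaugePhase, one_mul, Complex.norm_real,
    Real.norm_of_nonneg (gF_nonneg hh _ _)]

theorem measurable_greenK (h E : ℝ) :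
    Measurable (fun p : Plane × Plane => greenK h E p.1 p.2) := by
  have h1 : Measurable (fun p : Plane × Plane => gaugePhase h p.2 p.1) := by
    refine Continuous.measurable ?_
    unfold gaugePhase
    fun_prop
  have h2 : Measurable (fun p : Plane × Plane => gF h E ‖p.2 - p.1‖) :=
    (measurable_gF h E).comp (f := fun p : Plane × Plane => ‖p.2 - p.1‖)
      (measurable_snd.sub measurable_fst).norm
  exact h1.mul (Complex.measurable_ofReal.comp h2)

theorem measurable_greenK_right (h E : ℝ) (y : Plane) : Measurable (greenK h E y) :=
  (measurable_greenK h E).comp (f := fun x : Plane => (y, x)) (measurable_const.prodMk measurable_id)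

theorem ae_ne (y : Plane) : ∀ᵐ x : Plane, x ≠ y := (Set.countable_singleton y).ae_notMem volume

theorem integrable_bG_sq {E : ℝ} (c : ℝ) (hc : -(√E) < c) (y : Plane) :
    Integrable (fun x : Plane => bG E ‖x - y‖ ^ 2 * Real.exp (-(c * ‖x - y‖))) := by
  suffices h : Integrable (fun x : Plane => bG E ‖x‖ ^ 2 * Real.exp (-(c * ‖x‖))) from
    h.comp_sub_right y
  rw [integrable_fun_norm_addHaar (volume : Measure Plane)
    (f := fun r => bG E r ^ 2 * Real.exp (-(c * r)))]
  have i1 : IntegrableOn (fun r : ℝ => Real.exp (-(√E + c) * r)) (Ioi 0) :=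
    integrableOn_exp_mul_Ioi (by linarith) 0
  refine i1.congr_fun (fun r hr => ?_) measurableSet_Ioi
  have hr : 0 < r := hr
  simp only [bG]
  have e1 : (r ^ (-(1 / 2) : ℝ)) ^ 2 = r⁻¹ := by
    rw [← Real.rpow_natCast, ← Real.rpow_mul hr.le]
    norm_num
    rw [Real.rpow_neg_one]
  have e2 : Real.exp (-(√E / 2 * r)) ^ 2 = Real.exp (-(√E * r)) := by
    rw [← Real.exp_nat_mul]; congr 1; push_cast; ring
  rw [mul_pow, e1, e2, finrank_euclideanSpace, Fintype.card_fin, smul_eq_mul,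
    show (2 - 1 : ℕ) = 1 from rfl, pow_one]
  have : r * (r⁻¹ * Real.exp (-(√E * r)) * Real.exp (-(c * r))) =
      (r * r⁻¹) * (Real.exp (-(√E * r)) * Real.exp (-(c * r))) := by ring
  rw [this, mul_inv_cancel₀ hr.ne', one_mul, ← Real.exp_add]
  congr 1
  ring

theorem memLp_greenK {h E : ℝ} (hh : 0 < h) (hE : 0 < E) (y : Plane) :
    MemLp (greenK h E y) 2 volume := by
  have hm := (measurable_greenK_right h E y).aestronglyMeasurable (μ := (volume : Measure Plane))
  refine (memLp_two_iff_integrable_sq_norm hm).2 ?_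
  have hs := Real.sqrt_pos.2 hE
  have i1 := (integrable_bG_sq 0 (by linarith) y).const_mul (kG E ^ 2)
  refine Integrable.mono' i1 (hm.norm.pow 2) ?_
  filter_upwards [ae_ne y] with x hx
  have hr : 0 < ‖x - y‖ := norm_pos_iff.2 (sub_ne_zero.2 hx)
  rw [norm_greenK hh, Real.norm_of_nonneg (sq_nonneg _), zero_mul, neg_zero, Real.exp_zero, mul_one,
    ← mul_pow]
  exact pow_le_pow_left₀ (gF_nonneg hh _ _) (gF_le hh hE hr) 2

/-- The constant in the Gram estimate for Green functions. -/
def gramK (E : ℝ) : ℝ :=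
  kG E ^ 2 * ∫ x : Plane, bG E ‖x‖ ^ 2 * Real.exp (-(-(√E / 2) * ‖x‖))

theorem gramK_nonneg (E : ℝ) : 0 ≤ gramK E :=
  mul_nonneg (sq_nonneg _) (integral_nonneg fun _ => by positivity)

/-- Almost orthogonality of Green functions. -/
theorem norm_integral_greenK_le {h E : ℝ} (hh : 0 < h) (hE : 0 < E) (y y' : Plane) :
    ‖∫ x, conj (greenK h E y x) * greenK h E y' x‖ ≤
      gramK E * Real.exp (-(√E / 4 * ‖y - y'‖)) := by
  have hs := Real.sqrt_pos.2 hE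
  -- The square of the majorant decays like `e^{-√E r}`. Half of this rate keeps the weighted
  -- integral finite; the other half, through `|y - y'| ≤ |x - y| + |x - y'|`, yields the factor
  -- `e^{-√E |y - y'|/4}`.
  set c := -(√E / 2) with hc
  have i1 := fun y => integrable_bG_sq c (by rw [hc]; linarith) y
  have hI : ∀ y : Plane, ∫ x, bG E ‖x - y‖ ^ 2 * Real.exp (-(c * ‖x - y‖)) =
      ∫ x : Plane, bG E ‖x‖ ^ 2 * Real.exp (-(c * ‖x‖)) := fun y =>
    integral_sub_right_eq_self (fun x : Plane => bG E ‖x‖ ^ 2 * Real.exp (-(c * ‖x‖))) y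
  set W : Plane → Plane → ℝ := fun y x => bG E ‖x - y‖ ^ 2 * Real.exp (-(c * ‖x - y‖)) with hW
  have hbd : ∀ᵐ x, ‖conj (greenK h E y x) * greenK h E y' x‖ ≤
      (kG E ^ 2 * Real.exp (-(√E / 4 * ‖y - y'‖)) / 2) * (W y x + W y' x) := by
    filter_upwards [ae_ne y, ae_ne y'] with x hx hx'
    have hr : 0 < ‖x - y‖ := norm_pos_iff.2 (sub_ne_zero.2 hx)
    have hr' : 0 < ‖x - y'‖ := norm_pos_iff.2 (sub_ne_zero.2 hx')
    rw [norm_mul, RCLike.norm_conj, norm_greenK hh, norm_greenK hh]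
    have b1 := gF_le (h := h) hh hE hr
    have b2 := gF_le (h := h) hh hE hr'
    have k0 := kG_nonneg E
    have htri : ‖y - y'‖ ≤ ‖x - y‖ + ‖x - y'‖ := by
      calc ‖y - y'‖ = ‖(x - y') - (x - y)‖ := by congr 1; abel
        _ ≤ ‖x - y'‖ + ‖x - y‖ := norm_sub_le _ _
        _ = _ := add_comm _ _
    set r := ‖x - y‖
    set r' := ‖x - y'‖
    set e := Real.exp (√E / 4 * r)
    set e' := Real.exp (√E / 4 * r')
    have hee : 1 ≤ Real.exp (-(√E / 4 * ‖y - y'‖)) * (e * e') := by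
      rw [← Real.exp_add, ← Real.exp_add]
      apply Real.one_le_exp
      have := mul_le_mul_of_nonneg_left htri (by positivity : 0 ≤ √E / 4)
      linarith
    have hb : 0 ≤ bG E r := by unfold bG; positivity
    have hb' : 0 ≤ bG E r' := by unfold bG; positivity
    have w1 : W y x = (bG E r * e) ^ 2 := by
      rw [hW, mul_pow, ← Real.exp_nat_mul]; simp only; congr 2; rw [hc]; push_cast; ring
    have w2 : W y' x = (bG E r' * e') ^ 2 := by
      rw [hW, mul_pow, ← Real.exp_nat_mul]; simp only; congr 2; rw [hc]; push_cast; ring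
    rw [w1, w2]
    calc gF h E r * gF h E r' ≤ (kG E * bG E r) * (kG E * bG E r') :=
          mul_le_mul b1 b2 (gF_nonneg hh _ _) (by positivity)
      _ = kG E ^ 2 * (bG E r * bG E r') * 1 := by ring
      _ ≤ kG E ^ 2 * (bG E r * bG E r') * (Real.exp (-(√E / 4 * ‖y - y'‖)) * (e * e')) := by
          gcongr
      _ = kG E ^ 2 * Real.exp (-(√E / 4 * ‖y - y'‖)) / 2 *
            (2 * ((bG E r * e) * (bG E r' * e'))) := by ring
      _ ≤ _ := by
          gcongr
          nlinarith [sq_nonneg (bG E r * e - bG E r' * e')]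
  refine (norm_integral_le_of_norm_le (((i1 y).add (i1 y')).const_mul _) hbd).trans (le_of_eq ?_)
  rw [integral_const_mul]
  simp only [Pi.add_apply]
  rw [integral_add (i1 y) (i1 y'), hI, hI, gramK]
  ring

/-! ### Cutoffs -/

theorem exists_cutoff : ∃ χ : Plane → ℂ, ContDiff ℝ ∞ χ ∧ HasCompactSupport χ ∧
    (∀ x, ‖x‖ ≤ 1 → χ x = 1) ∧ (∀ x, 2 ≤ ‖x‖ → χ x = 0) := by
  let f : ContDiffBump (0 : Plane) := ⟨1, 2, one_pos, one_lt_two⟩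
  refine ⟨fun x => (f x : ℂ), Complex.ofRealCLM.contDiff.comp f.contDiff,
    f.hasCompactSupport.comp_left (g := fun r : ℝ => (r : ℂ)) (by simp), fun x hx => ?_,
    fun x hx => ?_⟩
  · simp only
    rw [f.one_of_mem_closedBall (by simpa using hx)]
    simp
  · simp only
    rw [f.zero_of_le_dist (by simpa using hx)]
    simp

/-- A bound for a smooth compactly supported function and its derivatives of order at most two. -/
theorem exists_deriv_bound {χ : Plane → ℂ} (hχ : ContDiff ℝ ∞ χ) (hs : HasCompactSupport χ) :
    ∃ B : ℝ, 0 ≤ B ∧ (∀ x, ‖χ x‖ ≤ B) ∧ (∀ i x, ‖partialD i χ x‖ ≤ B) ∧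
      ∀ i x, ‖partialD i (partialD i χ) x‖ ≤ B := by
  obtain ⟨B₀, h₀⟩ := hs.exists_bound_of_continuous hχ.continuous
  have h1 := fun i => (hasCompactSupport_partialD hs i).exists_bound_of_continuous
    (contDiff_partialD hχ i).continuous
  have h2 := fun i => (hasCompactSupport_partialD (hasCompactSupport_partialD hs i)
    i).exists_bound_of_continuous (contDiff_partialD (contDiff_partialD hχ i) i).continuous
  choose B₁ h₁ using h1
  choose B₂ h₂ using h2
  have n0 : 0 ≤ B₀ := (norm_nonneg _).trans (h₀ 0)
  have n1 : ∀ i, 0 ≤ B₁ i := fun i => (norm_nonneg _).trans (h₁ i 0)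
  have n2 : ∀ i, 0 ≤ B₂ i := fun i => (norm_nonneg _).trans (h₂ i 0)
  refine ⟨B₀ + (∑ i, B₁ i) + ∑ i, B₂ i, ?_, fun x => ?_, fun i x => ?_, fun i x => ?_⟩
  · have := Finset.sum_nonneg fun i (_ : i ∈ Finset.univ) => n1 i
    have := Finset.sum_nonneg fun i (_ : i ∈ Finset.univ) => n2 i
    linarith
  all_goals
    have s1 := Finset.sum_nonneg fun i (_ : i ∈ Finset.univ) => n1 i
    have s2 := Finset.sum_nonneg fun i (_ : i ∈ Finset.univ) => n2 i
  · linarith [h₀ x]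
  · have := Finset.single_le_sum (fun i _ => n1 i) (Finset.mem_univ i)
    linarith [h₁ i x]
  · have := Finset.single_le_sum (fun i _ => n2 i) (Finset.mem_univ i)
    linarith [h₂ i x]

theorem contDiff_comp_affine {χ : Plane → ℂ} (hχ : ContDiff ℝ ∞ χ) (c : ℝ) (a : Plane) :
    ContDiff ℝ ∞ (fun x => χ (c • (x - a))) :=
  hχ.comp (by fun_prop)

theorem partialD_partialD_comp_affine {χ : Plane → ℂ} (hχ : ContDiff ℝ ∞ χ) (c : ℝ) (a : Plane)
    (i : Fin 2) (x : Plane) :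
    partialD i (partialD i (fun x => χ (c • (x - a)))) x =
      c ^ 2 * partialD i (partialD i χ) (c • (x - a)) := by
  have e : partialD i (fun x => χ (c • (x - a))) = fun x => c * partialD i χ (c • (x - a)) :=
    funext fun x => partialD_comp_affine (diff_of_contDiff hχ) c a i x
  have h1 := contDiff_comp_affine (contDiff_partialD hχ i) c a
  rw [e, partialD_const_mul (diff_of_contDiff h1 x),
    partialD_comp_affine (diff_of_contDiff (contDiff_partialD hχ i))]
  ring

/-- The Landau expression applied to a product with a scaled cutoff. -/
theorem landau_cutoff_mul {χ φ : Plane → ℂ} (hχ : ContDiff ℝ ∞ χ) (hφ : ContDiff ℝ ∞ φ) (h c : ℝ)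
    (a x : Plane) : landau h (fun x => χ (c • (x - a)) * φ x) x =
      χ (c • (x - a)) * landau h φ x - c * (2 * Complex.I * partialD 0 χ (c • (x - a)) *
        magMomentum h φ x + 2 * partialD 1 χ (c • (x - a)) * partialD 1 φ x) -
      c ^ 2 * ((partialD 0 (partialD 0 χ) (c • (x - a)) +
        partialD 1 (partialD 1 χ) (c • (x - a))) * φ x) := by
  rw [landau_mul (contDiff_comp_affine hχ c a) hφ, partialD_partialD_comp_affine hχ,
    partialD_partialD_comp_affine hχ, partialD_comp_affine (diff_of_contDiff hχ),
    partialD_comp_affine (diff_of_contDiff hχ)]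
  ring

theorem norm_landau_cutoff_mul_le {χ φ : Plane → ℂ} (hχ : ContDiff ℝ ∞ χ) (hφ : ContDiff ℝ ∞ φ)
    {B : ℝ} (hB0 : ∀ x, ‖χ x‖ ≤ B) (hB1 : ∀ i x, ‖partialD i χ x‖ ≤ B)
    (hB2 : ∀ i x, ‖partialD i (partialD i χ) x‖ ≤ B) (h : ℝ) {c : ℝ} (hc : 0 ≤ c) (a x : Plane) :
    ‖landau h (fun x => χ (c • (x - a)) * φ x) x‖ ≤
      B * ‖landau h φ x‖ + c * (2 * B * ‖magMomentum h φ x‖ + 2 * B * ‖partialD 1 φ x‖) +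
        c ^ 2 * (2 * B * ‖φ x‖) := by
  rw [landau_cutoff_mul hχ hφ]
  refine (norm_sub_le _ _).trans (add_le_add ((norm_sub_le _ _).trans (add_le_add ?_ ?_)) ?_)
  · rw [norm_mul]
    exact mul_le_mul_of_nonneg_right (hB0 _) (norm_nonneg _)
  · rw [norm_mul, Complex.norm_real, Real.norm_of_nonneg hc]
    refine mul_le_mul_of_nonneg_left ((norm_add_le _ _).trans (add_le_add ?_ ?_)) hc
    · rw [norm_mul, norm_mul, norm_mul, Complex.norm_I, mul_one]
      have := hB1 0 (c • (x - a))
      norm_num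
      gcongr
    · rw [norm_mul, norm_mul]
      have := hB1 1 (c • (x - a))
      norm_num
      gcongr
  · rw [norm_mul, norm_pow, Complex.norm_real, Real.norm_of_nonneg hc, norm_mul]
    refine mul_le_mul_of_nonneg_left (mul_le_mul_of_nonneg_right ?_ (norm_nonneg _)) (sq_nonneg c)
    refine (norm_add_le _ _).trans ?_
    have := hB2 0 (c • (x - a))
    have := hB2 1 (c • (x - a))
    linarith

/-! ### Uniqueness of weak solutions on the plane -/

theorem exists_gauss_bound {h s : ℝ} (hh : 0 < h) (hs : 0 < s) (y : Plane) :
    ∃ K κ : ℝ, 0 < κ ∧ 0 ≤ K ∧ ∀ x : Plane,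
      ‖heat h s y x‖ ≤ K * Real.exp (-(κ * ‖x - y‖ ^ 2)) ∧
      ‖magMomentum h (heat h s y) x‖ ≤ K * Real.exp (-(κ * ‖x - y‖ ^ 2)) ∧
      ‖partialD 1 (heat h s y) x‖ ≤ K * Real.exp (-(κ * ‖x - y‖ ^ 2)) := by
  set c := hC h s with hc
  have hcp : 0 < c := hC_pos hh hs
  set k := hS h s / (4 * Real.pi) with hk
  have hkp : 0 < k := div_pos (hS_pos hh hs) (by positivity)
  have hfun : heat h s y = fun x => (k : ℂ) * magGauss h c y x := funext fun x => heat_eq h s y x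
  refine ⟨k * ((1 + h + c) * (1 + (c / 8)⁻¹)), c / 8, by positivity, by positivity, fun x => ?_⟩
  set r := ‖x - y‖ with hr
  set e := Real.exp (-(c / 8 * r ^ 2)) with he
  have hep : 0 < e := Real.exp_pos _
  have hg : ‖magGauss h c y x‖ = e * e := by
    rw [magGauss, norm_mul, norm_gaugePhase, one_mul, Complex.norm_real,
      Real.norm_of_nonneg (Real.exp_pos _).le, he, ← Real.exp_add]
    congr 1
    ring
  have h1e : e ≤ 1 := Real.exp_le_one_iff.2 (by
    have : 0 ≤ c / 8 * r ^ 2 := by positivity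
    linarith)
  have hr2 : r ^ 2 * e ≤ (c / 8)⁻¹ := sq_mul_exp_neg_le (by positivity)
  have hmain : (1 + r) * (e * e) ≤ 2 * (1 + (c / 8)⁻¹) * e := by
    have : (1 + r) ≤ 2 * (1 + r ^ 2) := by nlinarith [sq_nonneg (r - 1)]
    calc (1 + r) * (e * e) ≤ 2 * (1 + r ^ 2) * (e * e) := by gcongr
      _ = 2 * (e + r ^ 2 * e) * e := by ring
      _ ≤ 2 * (1 + (c / 8)⁻¹) * e := by gcongr
  have hx : ∀ i : Fin 2, ‖((x i : ℂ) - (y i : ℂ))‖ ≤ r := by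
    intro i
    rw [← Complex.ofReal_sub, Complex.norm_real]
    exact PiLp.norm_apply_le (x - y) i
  have hC0 : 0 ≤ (1 + (c / 8)⁻¹) := by positivity
  have fin : ∀ w : ℂ, ‖w‖ ≤ (h / 2 + c / 2) * (1 + r) →
      ‖(k : ℂ) * (w * magGauss h c y x)‖ ≤ k * ((1 + h + c) * (1 + (c / 8)⁻¹)) * e := by
    intro w hw
    rw [norm_mul, norm_mul, Complex.norm_real, Real.norm_of_nonneg hkp.le, hg, mul_assoc k]
    refine mul_le_mul_of_nonneg_left ?_ hkp.le
    calc ‖w‖ * (e * e) ≤ (h / 2 + c / 2) * (1 + r) * (e * e) := by gcongr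
      _ = (h / 2 + c / 2) * ((1 + r) * (e * e)) := by ring
      _ ≤ (h / 2 + c / 2) * (2 * (1 + (c / 8)⁻¹) * e) := by gcongr
      _ = (h + c) * (1 + (c / 8)⁻¹) * e := by ring
      _ ≤ (1 + h + c) * (1 + (c / 8)⁻¹) * e := by gcongr; linarith
  have hr0 : 0 ≤ r := norm_nonneg _
  have hdiff := diff_of_contDiff (contDiff_magGauss h c y) x
  refine ⟨?_, ?_, ?_⟩
  · rw [hfun]
    simp only
    rw [norm_mul, hg, Complex.norm_real, Real.norm_of_nonneg hkp.le, mul_assoc k]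
    refine mul_le_mul_of_nonneg_left ?_ hkp.le
    refine mul_le_mul_of_nonneg_right ?_ hep.le
    have : 0 ≤ (c / 8)⁻¹ := by positivity
    nlinarith
  · have e1 : magMomentum h (heat h s y) x = k * magMomentum h (magGauss h c y) x := by
      rw [hfun, magMomentum, partialD_const_mul hdiff, magMomentum]; ring
    rw [e1, magMomentum_magGauss]
    refine fin _ ((norm_add_le _ _).trans ?_)
    rw [norm_mul, norm_mul, norm_div, norm_div, norm_mul, Complex.norm_I, Complex.norm_real,
      Complex.norm_real, Real.norm_of_nonneg hh.le, Real.norm_of_nonneg hcp.le]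
    have := hx 0
    have := hx 1
    norm_num
    nlinarith
  · have e1 : partialD 1 (heat h s y) x = k * partialD 1 (magGauss h c y) x := by
      rw [hfun, partialD_const_mul hdiff]
    rw [e1, (partialD_magGauss h c y).2]
    refine fin _ ((norm_add_le _ _).trans ?_)
    rw [norm_mul, norm_mul, norm_neg, norm_neg, norm_div, norm_div, norm_mul, Complex.norm_I,
      Complex.norm_real, Complex.norm_real, Real.norm_of_nonneg hh.le, Real.norm_of_nonneg hcp.le]
    have := hx 0
    have := hx 1
    norm_num
    nlinarith

/-- A weak solution of `(H_h + E) f = 0` on the plane is orthogonal to `(H_h + E) p_s`. -/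
theorem integral_conj_opHE_heat_eq_zero {f : Plane → ℂ} (hf : MemLp f 2 volume) {h E s : ℝ}
    (hh : 0 < h) (hs : 0 < s) (hE : 0 < E)
    (hw : ∀ φ : Plane → ℂ, ContDiff ℝ ∞ φ → HasCompactSupport φ →
      ∫ x, conj (opHE h E φ x) * f x = 0) (y : Plane) :
    ∫ x, conj (opHE h E (heat h s y) x) * f x = 0 := by
  obtain ⟨χ, hχ, hχs, hχ1, -⟩ := exists_cutoff
  obtain ⟨B, hB, hB0, hB1, hB2⟩ := exists_deriv_bound hχ hχs
  obtain ⟨K, κ, hκ, hK, hbd⟩ := exists_gauss_bound hh hs y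
  obtain ⟨K', κ', hκ', hK', hbd'⟩ := exists_norm_heatDeriv_le hh hs
  have hu := contDiff_heat h s y
  set c : ℕ → ℝ := fun n => 1 / ((n : ℝ) + 1) with hc
  have hc0 : ∀ n, 0 < c n := fun n => by positivity
  have hc1 : ∀ n, c n ≤ 1 := fun n => by
    rw [hc]; exact (div_le_one (by positivity)).2 (by have := n.cast_nonneg (α := ℝ); linarith)
  have hclim : Tendsto c atTop (𝓝 0) := tendsto_one_div_add_atTop_nhds_zero_nat
  -- The heat kernel is not compactly supported, so it is cut off at a radius of order `n + 1`. Each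
  -- derivative falling on the cutoff brings a factor `c n → 0`, and the Gaussian bounds dominate
  -- the rest.
  set φ : ℕ → Plane → ℂ := fun n x => χ (c n • (x - 0)) * heat h s y x with hφ
  have hφs : ∀ n, HasCompactSupport (φ n) := by
    intro n
    have e : HasCompactSupport (fun x : Plane => χ (c n • x)) :=
      hχs.comp_homeomorph (Homeomorph.smulOfNeZero (c n) (hc0 n).ne')
    simp only [hφ, sub_zero]
    exact e.mul_right
  have hz : ∀ n, ∫ x, conj (opHE h E (φ n) x) * f x = 0 := fun n =>
    hw (φ n) ((contDiff_comp_affine hχ _ _).mul hu) (hφs n)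
  have hlim : Tendsto (fun n => ∫ x, conj (opHE h E (φ n) x) * f x) atTop
      (𝓝 (∫ x, conj (opHE h E (heat h s y) x) * f x)) := by
    refine tendsto_integral_of_dominated_convergence
      (fun x => (B * K' * Real.exp (-(κ' * ‖x - y‖ ^ 2)) +
        (6 * B + E * B) * K * Real.exp (-(κ * ‖x - y‖ ^ 2))) * ‖f x‖) ?_ ?_ ?_ ?_
    · intro n
      refine AEStronglyMeasurable.mul ?_ hf.1
      exact (Complex.continuous_conj.comp (contDiff_opHE
        ((contDiff_comp_affine hχ _ _).mul hu) h E).continuous).aestronglyMeasurable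
    · exact ((memLp_gauss hκ' (B * K') y).add
        (memLp_gauss hκ ((6 * B + E * B) * K) y)).integrable_mul hf.norm
    · intro n
      refine Eventually.of_forall fun x => ?_
      rw [norm_mul, RCLike.norm_conj]
      refine mul_le_mul_of_nonneg_right ?_ (norm_nonneg _)
      obtain ⟨b0, b1, b2⟩ := hbd x
      have b3 := hbd' s ⟨by linarith, by linarith⟩ y x
      have hL := norm_landau_cutoff_mul_le hχ hu hB0 hB1 hB2 h (hc0 n).le 0 x
      rw [landau_heat hh hs, norm_neg] at hL
      have hEφ : ‖(E : ℂ) * φ n x‖ ≤ E * (B * ‖heat h s y x‖) := by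
        rw [norm_mul, Complex.norm_real, Real.norm_of_nonneg hE.le]
        refine mul_le_mul_of_nonneg_left ?_ hE.le
        simp only [hφ]
        rw [norm_mul]
        exact mul_le_mul_of_nonneg_right (hB0 _) (norm_nonneg _)
      set G := Real.exp (-(κ * ‖x - y‖ ^ 2))
      set G' := Real.exp (-(κ' * ‖x - y‖ ^ 2))
      have hcc : c n ^ 2 ≤ 1 := pow_le_one₀ (hc0 n).le (hc1 n)
      have t1 : c n * (2 * B * ‖magMomentum h (heat h s y) x‖ + 2 * B * ‖partialD 1 (heat h s y) x‖)
          ≤ 1 * (2 * B * (K * G) + 2 * B * (K * G)) := by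
        have := hc1 n
        have := (hc0 n).le
        gcongr
      have t2 : c n ^ 2 * (2 * B * ‖heat h s y x‖) ≤ 1 * (2 * B * (K * G)) := by gcongr
      have t3 : B * ‖heatDeriv h s y x‖ ≤ B * (K' * G') := by gcongr
      have t4 : E * (B * ‖heat h s y x‖) ≤ E * (B * (K * G)) := by gcongr
      refine (norm_add_le _ _).trans ?_
      calc _ ≤ _ := add_le_add hL hEφ
        _ ≤ _ := by linarith
    · refine Eventually.of_forall fun x => ?_
      refine Tendsto.mul_const _ ((Complex.continuous_conj.tendsto _).comp ?_)
      have l0 : Tendsto (fun n => χ (c n • (x - 0))) atTop (𝓝 1) := by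
        have h1 : Tendsto (fun n => c n • (x - 0)) atTop (𝓝 ((0 : ℝ) • (x - 0))) :=
          hclim.smul_const _
        have h2 := (hχ.continuous.tendsto _).comp h1
        rw [zero_smul, hχ1 0 (by simp)] at h2
        exact h2
      have lb : ∀ g : ℕ → ℂ, (∃ C, ∀ n, ‖g n‖ ≤ C) → Tendsto (fun n => (c n : ℂ) * g n) atTop
          (𝓝 0) := by
        rintro g ⟨C, hC⟩
        have h1 : Tendsto (fun n => c n * C) atTop (𝓝 (0 * C)) := hclim.mul_const C
        rw [zero_mul] at h1
        refine squeeze_zero_norm (fun n => ?_) h1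
        rw [norm_mul, Complex.norm_real, Real.norm_of_nonneg (hc0 n).le]
        exact mul_le_mul_of_nonneg_left (hC n) (hc0 n).le
      have l1 := lb (fun n => 2 * Complex.I * partialD 0 χ (c n • (x - 0)) *
        magMomentum h (heat h s y) x + 2 * partialD 1 χ (c n • (x - 0)) *
          partialD 1 (heat h s y) x)
        ⟨2 * B * ‖magMomentum h (heat h s y) x‖ + 2 * B * ‖partialD 1 (heat h s y) x‖, fun n => by
          refine (norm_add_le _ _).trans (add_le_add ?_ ?_)
          · rw [norm_mul, norm_mul, norm_mul, Complex.norm_I, mul_one]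
            have := hB1 0 (c n • (x - 0))
            norm_num
            simp only [sub_zero] at this
            gcongr
          · rw [norm_mul, norm_mul]
            have := hB1 1 (c n • (x - 0))
            norm_num
            simp only [sub_zero] at this
            gcongr⟩
      have l2 := lb (fun n => c n * ((partialD 0 (partialD 0 χ) (c n • (x - 0)) +
        partialD 1 (partialD 1 χ) (c n • (x - 0))) * heat h s y x))
        ⟨1 * ((B + B) * ‖heat h s y x‖), fun n => by
          rw [norm_mul, norm_mul, Complex.norm_real, Real.norm_of_nonneg (hc0 n).le]
          refine mul_le_mul (hc1 n) (mul_le_mul_of_nonneg_right ((norm_add_le _ _).trans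
            (add_le_add (hB2 0 _) (hB2 1 _))) (norm_nonneg _)) (by positivity) zero_le_one⟩
      have l3 := ((l0.mul_const (landau h (heat h s y) x)).sub l1).sub l2 |>.add
        ((l0.mul_const (heat h s y x)).const_mul (E : ℂ))
      rw [one_mul, one_mul, show landau h (heat h s y) x - 0 - 0 + (E : ℂ) * heat h s y x =
        opHE h E (heat h s y) x by rw [opHE]; ring] at l3
      refine l3.congr fun n => ?_
      rw [opHE, hφ]
      simp only
      rw [landau_cutoff_mul hχ hu]
      ring
  simp only [hz] at hlim
  exact (tendsto_nhds_unique hlim tendsto_const_nhds)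

/-- For a weak null solution `f` the function `e^{-Es} ⟨f, p_s⟩` has zero derivative and tends to
`0` at infinity, hence vanishes for all `s > 0`. Its time integral is the pairing with the Green
function. -/
theorem integral_conj_mul_greenK_eq_zero {f : Plane → ℂ} (hf : MemLp f 2 volume) {h E : ℝ}
    (hh : 0 < h) (hE : 0 < E)
    (hw : ∀ φ : Plane → ℂ, ContDiff ℝ ∞ φ → HasCompactSupport φ →
      ∫ x, conj (opHE h E φ x) * f x = 0) (y : Plane) :
    ∫ x, conj (f x) * greenK h E y x = 0 := by
  set J : ℝ → ℂ := fun s => (∫ x, conj (f x) * heat h s y x) * (Real.exp (-(E * s)) : ℂ) with hJ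
  have hd : ∀ s ∈ Ioi (0 : ℝ), HasDerivAt J 0 s := by
    intro s hs
    have hs : 0 < s := hs
    have d1 := hasDerivAt_integral_heat hf hh hs y
    have d2 : HasDerivAt (fun s : ℝ => (Real.exp (-(E * s)) : ℂ))
        ((Real.exp (-(E * s)) * (-(E * 1)) : ℝ) : ℂ) s :=
      (((hasDerivAt_id s).const_mul E).neg.exp).ofReal_comp
    refine (d1.mul d2).congr_deriv ?_
    have e0 := congrArg conj (integral_conj_opHE_heat_eq_zero hf hh hs hE hw y)
    rw [← integral_conj, map_zero] at e0
    obtain ⟨K', κ', hκ', hK', hbd'⟩ := exists_norm_heatDeriv_le hh hs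
    have m1 : MemLp (heatDeriv h s y) 2 volume :=
      (memLp_gauss hκ' K' y).mono' (continuous_heatDeriv h s y).aestronglyMeasurable
        (Eventually.of_forall fun x => hbd' s ⟨by linarith, by linarith⟩ y x)
    have e1 : ∫ x, conj (f x) * heatDeriv h s y x = E * ∫ x, conj (f x) * heat h s y x := by
      rw [← sub_eq_zero, ← integral_const_mul, ← integral_sub (integrable_conj_mul_memLp hf m1)
        ((integrable_conj_mul_memLp hf (memLp_heat hh hs y)).const_mul _), ← neg_eq_zero,
        ← integral_neg, ← e0]
      congr 1
      ext x
      rw [opHE, landau_heat hh hs]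
      simp only [map_mul, Complex.conj_conj]
      ring
    rw [e1]
    push_cast
    ring
  have hconst : ∀ s ∈ Ioi (0 : ℝ), J s = 0 := by
    intro s hs
    have hlim := tendsto_integral_heat_atTop hf hh hE y
    have hc : ∀ t ∈ Ioi (0 : ℝ), J t = J s := by
      intro t ht
      exact isOpen_Ioi.is_const_of_deriv_eq_zero isPreconnected_Ioi
        (fun u hu => (hd u hu).differentiableAt.differentiableWithinAt)
        (fun u hu => (hd u hu).deriv) ht hs
    have : Tendsto J atTop (𝓝 (J s)) := by
      refine tendsto_const_nhds.congr' ?_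
      filter_upwards [eventually_gt_atTop 0] with t ht using (hc t ht).symm
    exact tendsto_nhds_unique this hlim
  rw [integral_conj_mul_greenK hf hh hE]
  exact setIntegral_eq_zero_of_forall_eq_zero hconst

theorem integral_norm_greenK_le {f : Plane → ℂ} (hf : MemLp f 2 volume) {h E : ℝ} (hh : 0 < h)
    (hE : 0 < E) (y : Plane) : ∫ x, ‖f x * greenK h E x y‖ ≤
      (∫ x, ‖f x‖ ^ 2) + ∫ x : Plane, gF h E ‖x‖ ^ 2 := by
  have i1 := integrable_norm_sq hf
  have i2 := integrable_norm_sq (memLp_greenK hh hE y)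
  simp only [norm_greenK hh] at i2
  have e : ∫ x : Plane, gF h E ‖x‖ ^ 2 = ∫ x, gF h E ‖x - y‖ ^ 2 :=
    (integral_sub_right_eq_self (fun x : Plane => gF h E ‖x‖ ^ 2) y).symm
  rw [e, ← integral_add i1 i2]
  refine integral_mono_of_nonneg (Eventually.of_forall fun _ => norm_nonneg _) (i1.add i2)
    (Eventually.of_forall fun x => ?_)
  simp only
  rw [norm_mul, norm_greenK hh, norm_sub_rev]
  have := sq_nonneg (‖f x‖ - gF h E ‖x - y‖)
  have := mul_nonneg (norm_nonneg (f x)) (gF_nonneg hh E ‖x - y‖)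
  nlinarith

/-- An `L²` function that is orthogonal to `(H_h + E) C_c^∞` vanishes. -/
theorem ae_eq_zero_of_orthogonal {f : Plane → ℂ} (hf : MemLp f 2 volume) {h E : ℝ}
    (hh : 0 < h) (hE : 0 < E)
    (hw : ∀ φ : Plane → ℂ, ContDiff ℝ ∞ φ → HasCompactSupport φ →
      ∫ x, conj (opHE h E φ x) * f x = 0) : f =ᵐ[volume] 0 := by
  refine ae_eq_zero_of_integral_contDiff_smul_eq_zero (hf.locallyIntegrable (by norm_num)) ?_
  intro g hg hgs
  set φ : Plane → ℂ := fun x => (g x : ℂ) with hφ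
  have hφc : ContDiff ℝ ∞ φ := Complex.ofRealCLM.contDiff.comp hg
  have hφs : HasCompactSupport φ := hgs.comp_left (g := fun r : ℝ => (r : ℂ)) (by simp)
  set ψ := opHE h E φ with hψ
  have hψc := contDiff_opHE hφc h E
  have hψs := hasCompactSupport_opHE hφs h E
  have hψi : Integrable ψ := hψc.continuous.integrable_of_hasCompactSupport hψs
  -- The test function is represented by the Green function applied to `ψ = (H_h + E)φ`. After
  -- exchanging the integrals, the symmetry of the kernel leaves an inner pairing of `f` with a
  -- Green function, which vanishes.
  have e1 : ∫ x, g x • f x = ∫ y, ∫ x, conj (ψ x) * (f y * greenK h E y x) := by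
    congr 1
    ext y
    have := integral_conj_opHE_mul_greenK hφc hφs hh hE y
    have e2 : ∀ x, conj (ψ x) * (f y * greenK h E y x) = f y * (conj (ψ x) * greenK h E y x) := by
      intro x; ring
    simp only [e2]
    rw [integral_const_mul, this, hφ]
    simp [mul_comm]
  have hmeas : AEStronglyMeasurable (fun p : Plane × Plane =>
      conj (ψ p.2) * (f p.1 * greenK h E p.1 p.2)) (volume.prod volume) := by
    refine AEStronglyMeasurable.mul ?_ (hf.1.comp_fst.mul (measurable_greenK h E).aestronglyMeasurable)
    exact ((Complex.continuous_conj.comp hψc.continuous).comp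
      continuous_snd).aestronglyMeasurable
  have hintg : Integrable (fun p : Plane × Plane =>
      conj (ψ p.2) * (f p.1 * greenK h E p.1 p.2)) (volume.prod volume) := by
    rw [integrable_prod_iff' hmeas]
    constructor
    · refine Eventually.of_forall fun x => ?_
      suffices hi : Integrable (fun y => f y * greenK h E y x) from hi.const_mul (conj (ψ x))
      have := integrable_conj_mul_memLp (memLp_greenK hh hE x) hf
      refine this.congr (Eventually.of_forall fun y => ?_)
      simp only
      rw [conj_greenK, mul_comm]
    · refine Integrable.mono' (hψi.norm.mul_const ((∫ x, ‖f x‖ ^ 2) + ∫ x : Plane, gF h E ‖x‖ ^ 2))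
        hmeas.prod_swap.norm.integral_prod_right' ?_
      refine Eventually.of_forall fun x => ?_
      rw [Real.norm_of_nonneg (integral_nonneg fun _ => norm_nonneg _)]
      have e3 : ∀ y, ‖conj (ψ x) * (f y * greenK h E y x)‖ = ‖ψ x‖ * ‖f y * greenK h E y x‖ := by
        intro y; rw [norm_mul, RCLike.norm_conj]
      simp only [e3]
      rw [integral_const_mul]
      exact mul_le_mul_of_nonneg_left (integral_norm_greenK_le hf hh hE x) (norm_nonneg _)
  rw [e1, integral_integral_swap (f := fun y x => conj (ψ x) * (f y * greenK h E y x)) hintg]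
  have e4 : ∀ x, ∫ y, conj (ψ x) * (f y * greenK h E y x) = 0 := by
    intro x
    rw [integral_const_mul]
    have := congrArg conj (integral_conj_mul_greenK_eq_zero hf hh hE hw x)
    rw [← integral_conj, map_zero] at this
    simp only [map_mul, Complex.conj_conj, conj_greenK] at this
    rw [this, mul_zero]
  simp [e4]

/-! ### The free resolvent -/

theorem inner_toLp_left {f : Plane → ℂ} (hf : MemLp f 2 volume) (g : L2Plane) :
    inner ℂ (hf.toLp f) g = ∫ x, conj (f x) * g x := by
  rw [L2.inner_def]
  refine integral_congr_ae ?_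
  filter_upwards [hf.coeFn_toLp] with x hx
  rw [hx, RCLike.inner_apply, mul_comm]

theorem inner_toLp_toLp {f g : Plane → ℂ} (hf : MemLp f 2 volume) (hg : MemLp g 2 volume) :
    inner ℂ (hf.toLp f) (hg.toLp g) = ∫ x, conj (f x) * g x := by
  rw [inner_toLp_left hf]
  refine integral_congr_ae ?_
  filter_upwards [hg.coeFn_toLp] with x hx
  rw [hx]

theorem norm_sq_toLp {f : Plane → ℂ} (hf : MemLp f 2 volume) :
    ‖hf.toLp f‖ ^ 2 = ∫ x, ‖f x‖ ^ 2 := by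
  have h1 := inner_toLp_toLp hf hf
  rw [inner_self_eq_norm_sq_to_K] at h1
  have e : ∀ x, conj (f x) * f x = ((‖f x‖ ^ 2 : ℝ) : ℂ) := by
    intro x; rw [mul_comm, Complex.mul_conj, Complex.normSq_eq_norm_sq]
  simp only [e] at h1
  rw [integral_complex_ofReal] at h1
  have h2 : ((‖hf.toLp f‖ ^ 2 : ℝ) : ℂ) = ((∫ x, ‖f x‖ ^ 2 : ℝ) : ℂ) := by
    rw [← h1]; push_cast; rfl
  exact Complex.ofReal_injective h2

theorem integral_conj_opHE_comm {φ u : Plane → ℂ} (hφ : ContDiff ℝ ∞ φ)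
    (hs : HasCompactSupport φ) (hu : ContDiff ℝ ∞ u) (h E : ℝ) :
    ∫ x, conj (opHE h E φ x) * u x = ∫ x, conj (φ x) * opHE h E u x := by
  have e1 : ∀ x, conj (opHE h E φ x) * u x = conj (landau h φ x) * u x +
      E * (conj (φ x) * u x) := by
    intro x; simp only [opHE, map_add, map_mul, Complex.conj_ofReal]; ring
  have e2 : ∀ x, conj (φ x) * opHE h E u x = conj (φ x) * landau h u x +
      E * (conj (φ x) * u x) := by
    intro x; simp only [opHE]; ring
  have i0 := (integrable_conj_mul hφ.continuous hs hu.continuous).const_mul (E : ℂ)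
  simp only [e1, e2]
  rw [integral_add (integrable_conj_mul (continuous_landau hφ h) (hasCompactSupport_landau hs h)
    hu.continuous) i0, integral_add (integrable_conj_mul hφ.continuous hs
    (continuous_landau hu h)) i0, integral_conj_landau hφ hs hu]

/-- Since `H_h ≥ 0` on test functions, `E‖φ‖² ≤ Re ⟨φ, (H_h + E)φ⟩`, and Cauchy–Schwarz applies. -/
theorem mul_norm_le_norm_opHE {φ : Plane → ℂ} (hφ : ContDiff ℝ ∞ φ) (hs : HasCompactSupport φ)
    {h E : ℝ} :
    E * ‖(memLp_of_contDiff hφ hs).toLp φ‖ ≤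
      ‖(memLp_of_contDiff (contDiff_opHE hφ h E) (hasCompactSupport_opHE hs h E)).toLp _‖ := by
  set Φ := (memLp_of_contDiff hφ hs).toLp φ
  set F := (memLp_of_contDiff (contDiff_opHE hφ h E) (hasCompactSupport_opHE hs h E)).toLp _
  have h1 : inner ℂ Φ F = (∫ x, conj (φ x) * landau h φ x) + E * (‖Φ‖ ^ 2 : ℝ) := by
    rw [inner_toLp_toLp, norm_sq_toLp, ← integral_complex_ofReal, ← integral_const_mul,
      ← integral_add (integrable_conj_mul hφ.continuous hs (continuous_landau hφ h))]
    · congr 1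
      ext x
      have e : conj (φ x) * φ x = ((‖φ x‖ ^ 2 : ℝ) : ℂ) := by
        rw [mul_comm, Complex.mul_conj, Complex.normSq_eq_norm_sq]
      rw [opHE, ← e]
      ring
    · exact ((integrable_norm_sq (memLp_of_contDiff hφ hs)).ofReal).const_mul _
  have h2 := integral_conj_landau_self_nonneg hφ hs h
  have h3 : E * ‖Φ‖ ^ 2 ≤ ‖Φ‖ * ‖F‖ := by
    have h4 : (inner ℂ Φ F).re ≤ ‖Φ‖ * ‖F‖ := re_inner_le_norm (𝕜 := ℂ) Φ F
    rw [h1, Complex.add_re, ← Complex.ofReal_mul, Complex.ofReal_re] at h4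
    linarith
  rcases eq_or_lt_of_le (norm_nonneg Φ) with h0 | h0
  · rw [← h0, mul_zero]; exact norm_nonneg _
  · nlinarith

/-- The range of `H_h + E` on test functions. -/
def ranHE (h E : ℝ) : Submodule ℂ L2Plane where
  carrier := {F | ∃ φ : Plane → ℂ, ContDiff ℝ ∞ φ ∧ HasCompactSupport φ ∧
    F =ᵐ[volume] opHE h E φ}
  add_mem' := by
    rintro F G ⟨φ, h1, h2, h3⟩ ⟨ψ, g1, g2, g3⟩
    refine ⟨fun x => φ x + ψ x, h1.add g1, h2.add g2, ?_⟩
    filter_upwards [Lp.coeFn_add F G, h3, g3] with x e1 e2 e3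
    rw [e1, Pi.add_apply, e2, e3, opHE, opHE, opHE, landau_add h1 g1]
    ring
  zero_mem' := by
    refine ⟨fun _ => 0, contDiff_const, HasCompactSupport.zero, ?_⟩
    filter_upwards [Lp.coeFn_zero ℂ 2 (volume : Measure Plane)] with x e1
    have := landau_const_mul (φ := fun _ => 0) contDiff_const h 0 x
    simp only [zero_mul] at this
    rw [e1, opHE, this]
    simp
  smul_mem' := by
    rintro c F ⟨φ, h1, h2, h3⟩
    refine ⟨fun x => c * φ x, contDiff_const.mul h1, h2.mul_left, ?_⟩
    filter_upwards [Lp.coeFn_smul c F, h3] with x e1 e2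
    rw [e1, Pi.smul_apply, e2, opHE, opHE, landau_const_mul h1, smul_eq_mul]
    ring

/-- A vector orthogonal to the range is a weak `L²` solution of `(H_h + E)f = 0` on the whole plane,
hence zero. This is essential self-adjointness in the form in which it is used. -/
theorem dense_ranHE {h E : ℝ} (hh : 0 < h) (hE : 0 < E) : Dense (ranHE h E : Set L2Plane) := by
  rw [Submodule.dense_iff_topologicalClosure_eq_top, Submodule.topologicalClosure_eq_top_iff,
    Submodule.eq_bot_iff]
  intro f hf
  rw [Submodule.mem_orthogonal] at hf
  have := ae_eq_zero_of_orthogonal (Lp.memLp f) hh hE fun φ hφ hs => by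
    have hm := memLp_of_contDiff (contDiff_opHE hφ h E) (hasCompactSupport_opHE hs h E)
    rw [← inner_toLp_left hm]
    exact hf _ ⟨φ, hφ, hs, hm.coeFn_toLp⟩
  exact Lp.ext (this.trans (Lp.coeFn_zero ℂ 2 volume).symm)

/-- The weak solution of `(H_h + E) f = g` on the plane, and its continuous representative. -/
theorem exists_weak_solution {h E : ℝ} (hh : 0 < h) (hE : 0 < E) (g : L2Plane) :
    ∃ f : L2Plane, ∃ u : Plane → ℂ, ‖f‖ ≤ E⁻¹ * ‖g‖ ∧ Continuous u ∧ u =ᵐ[volume] f ∧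
      (∀ y, u y = ∫ x, conj (greenK h E y x) * g x) ∧
      ∀ φ : Plane → ℂ, ContDiff ℝ ∞ φ → HasCompactSupport φ →
        ∫ x, conj (opHE h E φ x) * f x = ∫ x, conj (φ x) * g x := by
  obtain ⟨F, hFmem, hFlim⟩ := mem_closure_iff_seq_limit.1 (dense_ranHE hh hE g)
  choose φ hφ hφs hFφ using hFmem
  have hL := fun n => memLp_of_contDiff (hφ n) (hφs n)
  have hLψ := fun n => memLp_of_contDiff (contDiff_opHE (hφ n) h E)
    (hasCompactSupport_opHE (hφs n) h E)
  set Φ : ℕ → L2Plane := fun n => (hL n).toLp (φ n) with hΦ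
  have hF : ∀ n, F n = (hLψ n).toLp _ := fun n => Lp.ext ((hFφ n).trans (hLψ n).coeFn_toLp.symm)
  have hdiff : ∀ m n, E * ‖Φ m - Φ n‖ ≤ ‖F m - F n‖ := by
    intro m n
    have c1 : ContDiff ℝ ∞ (fun x => φ m x + -1 * φ n x) := (hφ m).add (contDiff_const.mul (hφ n))
    have c2 : HasCompactSupport (fun x => φ m x + -1 * φ n x) := (hφs m).add (hφs n).mul_left
    have := mul_norm_le_norm_opHE (h := h) (E := E) c1 c2
    convert! this using 3
    · rw [hΦ, ← MemLp.toLp_sub]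
      refine MemLp.toLp_congr _ _ (Eventually.of_forall fun x => ?_)
      simp only [Pi.sub_apply]; ring
    · rw [hF, hF, ← MemLp.toLp_sub]
      refine MemLp.toLp_congr _ _ (Eventually.of_forall fun x => ?_)
      simp only [Pi.sub_apply, opHE]
      rw [landau_add (hφ m) (contDiff_const.mul (hφ n)), landau_const_mul (hφ n)]
      ring
  have hCau : CauchySeq Φ := by
    rw [Metric.cauchySeq_iff]
    intro ε hε
    obtain ⟨N, hN⟩ := Metric.cauchySeq_iff.1 hFlim.cauchySeq (E * ε) (by positivity)
    refine ⟨N, fun m hm n hn => ?_⟩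
    have h1 := hN m hm n hn
    have h2 := hdiff m n
    rw [dist_eq_norm] at h1 ⊢
    exact lt_of_mul_lt_mul_left (h2.trans_lt h1) hE.le
  obtain ⟨f, hf⟩ := cauchySeq_tendsto_of_complete hCau
  have hG := fun y => memLp_greenK hh hE y
  set u : Plane → ℂ := fun y => ∫ x, conj (greenK h E y x) * g x with hu
  have hu' : ∀ y, u y = inner ℂ ((hG y).toLp _) g := fun y => (inner_toLp_left (hG y) g).symm
  have hφu : ∀ n y, φ n y = inner ℂ ((hG y).toLp _) (F n) := by
    intro n y
    rw [hF, inner_toLp_toLp]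
    have := congrArg conj (integral_conj_opHE_mul_greenK (hφ n) (hφs n) hh hE y)
    rw [← integral_conj, Complex.conj_conj] at this
    rw [← this]
    congr 1
    ext x
    rw [map_mul, Complex.conj_conj, mul_comm]
  have hGn : ∀ y, ‖(hG y).toLp _‖ = ‖(hG 0).toLp _‖ := by
    intro y
    have : ∀ y, ‖(hG y).toLp _‖ ^ 2 = ∫ x : Plane, gF h E ‖x‖ ^ 2 := by
      intro y
      rw [norm_sq_toLp]
      simp only [norm_greenK hh]
      exact integral_sub_right_eq_self (fun x : Plane => gF h E ‖x‖ ^ 2) y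
    exact (pow_left_inj₀ (norm_nonneg _) (norm_nonneg _) two_ne_zero).1
      ((this y).trans (this 0).symm)
  -- The values are `φₙ(y) = ⟨G_y, Fₙ⟩`, and `‖G_y‖` does not depend on `y`. Thus convergence of
  -- `Fₙ` in `L²` gives uniform convergence, and the solution has a continuous representative with
  -- values at lattice points.
  have hunif : TendstoUniformly φ u atTop := by
    rw [Metric.tendstoUniformly_iff]
    intro ε hε
    set K := ‖(hG 0).toLp _‖
    have h1 : ∀ᶠ n in atTop, dist (F n) g < ε / (K + 1) :=
      (Metric.tendsto_nhds.1 hFlim) _ (by positivity)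
    filter_upwards [h1] with n hn y
    rw [dist_comm, dist_eq_norm, hu', hφu, ← inner_sub_right]
    refine (norm_inner_le_norm _ _).trans_lt ?_
    rw [hGn, ← dist_eq_norm]
    have hK : 0 ≤ K := norm_nonneg _
    rw [lt_div_iff₀ (by positivity)] at hn
    nlinarith [dist_nonneg (x := F n) (y := g)]
  refine ⟨f, u, ?_, hunif.continuous (Eventually.of_forall fun n => (hφ n).continuous).frequently,
    ?_, fun y => rfl, ?_⟩
  · have h1 : ∀ n, ‖Φ n‖ ≤ E⁻¹ * ‖F n‖ := by
      intro n
      have := mul_norm_le_norm_opHE (h := h) (E := E) (hφ n) (hφs n)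
      rw [hF, inv_mul_eq_div, le_div_iff₀ hE, mul_comm]
      exact this
    exact le_of_tendsto_of_tendsto' hf.norm (hFlim.norm.const_mul _) h1
  · have h1 :=
      (Lp.tendsto_Lp_iff_tendsto_eLpNorm' Φ f).1 hf
    obtain ⟨ns, hns, hae⟩ := (tendstoInMeasure_of_tendsto_eLpNorm (p := 2) (by norm_num)
      (fun n => (Lp.aestronglyMeasurable (Φ n))) (Lp.aestronglyMeasurable f) h1).exists_seq_tendsto_ae
    have h2 : ∀ᵐ x, ∀ n, Φ n x = φ n x := ae_all_iff.2 fun n => (hL n).coeFn_toLp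
    filter_upwards [hae, h2] with x hx hx2
    have h3 := (hunif.tendsto_at x).comp hns.tendsto_atTop
    refine tendsto_nhds_unique h3 (hx.congr fun n => ?_)
    rw [hx2]
    rfl
  · intro θ hθ hθs
    have m1 := memLp_of_contDiff (contDiff_opHE hθ h E) (hasCompactSupport_opHE hθs h E)
    have m2 := memLp_of_contDiff hθ hθs
    rw [← inner_toLp_left m1, ← inner_toLp_left m2]
    have l1 : Tendsto (fun n => inner ℂ (m1.toLp _) (Φ n)) atTop (𝓝 (inner ℂ (m1.toLp _) f)) :=
      tendsto_const_nhds.inner hf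
    have l2 : Tendsto (fun n => inner ℂ (m2.toLp _) (F n)) atTop (𝓝 (inner ℂ (m2.toLp _) g)) :=
      tendsto_const_nhds.inner hFlim
    refine tendsto_nhds_unique (l1.congr fun n => ?_) l2
    rw [hF, inner_toLp_toLp, inner_toLp_toLp, integral_conj_opHE_comm hθ hθs (hφ n)]

/-! ### Laplace transforms -/

theorem norm_cexp_mul (z : ℂ) (s : ℝ) : ‖Complex.exp (z * s)‖ = Real.exp (z.re * s) := by
  rw [Complex.norm_exp]; simp

theorem integrableOn_cexp_mul {φ : ℝ → ℂ} (hm : Measurable φ)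
    (hφ : ∀ κ > 0, IntegrableOn (fun s => Real.exp (-(κ * s)) * ‖φ s‖) (Ioi 0)) {z : ℂ}
    (hz : z.re < 0) : IntegrableOn (fun s : ℝ => Complex.exp (z * s) * φ s) (Ioi 0) := by
  refine Integrable.mono' (hφ (-z.re) (by linarith)) ?_ ?_
  · exact (Measurable.mul (by fun_prop) hm).aestronglyMeasurable
  · refine Eventually.of_forall fun s => ?_
    rw [norm_mul, norm_cexp_mul, neg_mul, neg_neg]

theorem hasDerivAt_laplace {φ : ℝ → ℂ} (hm : Measurable φ)
    (hφ : ∀ κ > 0, IntegrableOn (fun s => Real.exp (-(κ * s)) * ‖φ s‖) (Ioi 0)) {z : ℂ}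
    (hz : z.re < 0) :
    HasDerivAt (fun z : ℂ => ∫ s in Ioi (0 : ℝ), Complex.exp (z * s) * φ s)
      (∫ s in Ioi (0 : ℝ), Complex.exp (z * s) * (s * φ s)) z := by
  set κ := -z.re / 4 with hκ
  have hκ0 : 0 < κ := by rw [hκ]; linarith
  have hU : {w : ℂ | w.re < -(2 * κ)} ∈ 𝓝 z :=
    (isOpen_lt Complex.continuous_re continuous_const).mem_nhds (by
      show z.re < -(2 * κ); rw [hκ]; linarith)
  refine (hasDerivAt_integral_of_dominated_loc_of_deriv_le
    (μ := volume.restrict (Ioi (0 : ℝ))) (F := fun (w : ℂ) (s : ℝ) => Complex.exp (w * s) * φ s)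
    (F' := fun (w : ℂ) (s : ℝ) => Complex.exp (w * s) * (s * φ s))
    (bound := fun s => κ⁻¹ * (Real.exp (-(κ * s)) * ‖φ s‖)) hU ?_
    (integrableOn_cexp_mul hm hφ hz) ?_ ?_ ((hφ κ hκ0).const_mul _) ?_).2
  · exact Eventually.of_forall fun w => (Measurable.mul (by fun_prop) hm).aestronglyMeasurable
  · exact (Measurable.mul (by fun_prop) (Measurable.mul (by fun_prop) hm)).aestronglyMeasurable
  · refine (ae_restrict_mem measurableSet_Ioi).mono fun s hs w hw => ?_
    have hs : 0 < s := hs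
    have hw : w.re < -(2 * κ) := hw
    rw [norm_mul, norm_mul, norm_cexp_mul, Complex.norm_real, Real.norm_of_nonneg hs.le]
    have h1 : Real.exp (w.re * s) ≤ Real.exp (-(κ * s)) * Real.exp (-(κ * s)) := by
      rw [← Real.exp_add]
      apply Real.exp_le_exp.2
      nlinarith
    have h2 : s * Real.exp (-(κ * s)) ≤ κ⁻¹ := by
      have := Real.add_one_le_exp (κ * s)
      rw [Real.exp_neg, ← div_eq_mul_inv, div_le_iff₀ (Real.exp_pos _), inv_mul_eq_div,
        le_div_iff₀ hκ0]
      linarith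
    calc Real.exp (w.re * s) * (s * ‖φ s‖)
        ≤ (Real.exp (-(κ * s)) * Real.exp (-(κ * s))) * (s * ‖φ s‖) := by gcongr
      _ = (s * Real.exp (-(κ * s))) * (Real.exp (-(κ * s)) * ‖φ s‖) := by ring
      _ ≤ _ := by gcongr
  · refine Eventually.of_forall fun s w _ => ?_
    have h1 : HasDerivAt (fun w : ℂ => Complex.exp (w * s)) (Complex.exp (w * s) * s) w :=
      (((hasDerivAt_id w).mul_const (s : ℂ)).cexp).congr_deriv (by simp)
    exact (h1.mul_const (φ s)).congr_deriv (by ring)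

/-! ### Frullani's integral -/

theorem norm_cexp_sub_exp_le {z : ℂ} {κ : ℝ} (hz : z.re ≤ -κ) (hκ : κ ≤ 1) {s : ℝ} (hs : 0 < s) :
    ‖Complex.exp (z * s) - Complex.exp (-s)‖ ≤ ‖z + 1‖ * s * Real.exp (-(κ * s)) := by
  have hconv : Convex ℝ {w : ℂ | w.re ≤ -κ} := convex_halfSpace_re_le (-κ)
  have := hconv.norm_image_sub_le_of_norm_hasDerivWithin_le
    (f := fun w : ℂ => Complex.exp (w * s)) (f' := fun w => Complex.exp (w * s) * s)
    (C := s * Real.exp (-(κ * s))) (x := -1) (y := z)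
    (fun w _ => ((((hasDerivAt_id w).mul_const (s : ℂ)).cexp).congr_deriv
      (by simp)).hasDerivWithinAt) ?_ (by show (-1 : ℂ).re ≤ -κ; simpa using hκ) hz
  · simp only [neg_mul, one_mul, sub_neg_eq_add] at this
    refine this.trans (le_of_eq ?_)
    ring
  · intro w hw
    have hw : w.re ≤ -κ := hw
    rw [norm_mul, norm_cexp_mul, Complex.norm_real, Real.norm_of_nonneg hs.le, mul_comm]
    refine mul_le_mul_of_nonneg_left (Real.exp_le_exp.2 ?_) hs.le
    nlinarith

theorem integrableOn_exp_neg {κ : ℝ} (hκ : 0 < κ) :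
    IntegrableOn (fun s : ℝ => Real.exp (-(κ * s))) (Ioi 0) := by
  simpa only [neg_mul] using integrableOn_exp_mul_Ioi (a := -κ) (by linarith) 0

theorem integral_exp_neg {κ : ℝ} (hκ : 0 < κ) :
    ∫ s in Ioi (0 : ℝ), Real.exp (-(κ * s)) = 1 / κ := by
  have := integral_exp_mul_Ioi (a := -κ) (by linarith) 0
  simp only [neg_mul, mul_zero, Real.exp_zero] at this
  rw [this, neg_div_neg_eq]

theorem integrableOn_frullani {z : ℂ} (hz : z.re < 0) :
    IntegrableOn (fun s : ℝ => (Complex.exp (z * s) - Complex.exp (-s)) / s) (Ioi 0) := by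
  have hκ : 0 < min (-z.re) 1 := lt_min (by linarith) one_pos
  refine Integrable.mono' ((integrableOn_exp_neg hκ).const_mul ‖z + 1‖) ?_ ?_
  · exact Measurable.aestronglyMeasurable (by fun_prop)
  · refine (ae_restrict_mem measurableSet_Ioi).mono fun s hs => ?_
    have hs : 0 < s := hs
    have := norm_cexp_sub_exp_le (z := z) (κ := min (-z.re) 1)
      (by have := min_le_left (-z.re) 1; linarith) (min_le_right _ _) hs
    rw [norm_div, Complex.norm_real, Real.norm_of_nonneg hs.le, div_le_iff₀ hs]
    linarith

theorem integral_cexp_mul {z : ℂ} (hz : z.re < 0) :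
    ∫ s in Ioi (0 : ℝ), Complex.exp (z * s) = -1 / z := by
  have := integral_exp_mul_complex_Ioi (a := z) hz 0
  simpa using this

/-- Frullani's integral. -/
theorem integral_frullani {z : ℂ} (hz : z.re < 0) :
    ∫ s in Ioi (0 : ℝ), (Complex.exp (z * s) - Complex.exp (-s)) / s = -Complex.log (-z) := by
  set U : Set ℂ := {w : ℂ | w.re < 0} with hU
  have hUo : IsOpen U := isOpen_lt Complex.continuous_re continuous_const
  have hUc : IsPreconnected U := (convex_halfSpace_re_lt 0).isPreconnected
  have hslit : ∀ w ∈ U, -w ∈ Complex.slitPlane := by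
    intro w hw
    left
    have : w.re < 0 := hw
    simpa using this
  set L : ℂ → ℂ := fun z => ∫ s in Ioi (0 : ℝ), (Complex.exp (z * s) - Complex.exp (-s)) / s with hL
  -- The `z`-derivative of the integrand is `e^{zs}`, of integral `-1/z`. So the integral and
  -- `-log(-z)` have the same derivative on the half plane, and both vanish at `z = -1`.
  have hd : ∀ w ∈ U, HasDerivAt L (-1 / w) w := by
    intro w hw
    have hw : w.re < 0 := hw
    set κ := -w.re / 2 with hκ
    have hκ0 : 0 < κ := by rw [hκ]; linarith
    have hV : {v : ℂ | v.re < -κ} ∈ 𝓝 w :=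
      (isOpen_lt Complex.continuous_re continuous_const).mem_nhds (by
        show w.re < -κ; rw [hκ]; linarith)
    rw [← integral_cexp_mul hw]
    refine (hasDerivAt_integral_of_dominated_loc_of_deriv_le
      (μ := volume.restrict (Ioi (0 : ℝ)))
      (F := fun (w : ℂ) (s : ℝ) => (Complex.exp (w * s) - Complex.exp (-s)) / s)
      (F' := fun (w : ℂ) (s : ℝ) => Complex.exp (w * s))
      (bound := fun s => Real.exp (-(κ * s))) hV ?_
      (integrableOn_frullani hw) ?_ ?_ (integrableOn_exp_neg hκ0) ?_).2
    · exact Eventually.of_forall fun w => Measurable.aestronglyMeasurable (by fun_prop)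
    · exact Measurable.aestronglyMeasurable (by fun_prop)
    · refine (ae_restrict_mem measurableSet_Ioi).mono fun s hs v hv => ?_
      have hs : 0 < s := hs
      have hv : v.re < -κ := hv
      rw [norm_cexp_mul]
      apply Real.exp_le_exp.2
      nlinarith
    · refine (ae_restrict_mem measurableSet_Ioi).mono fun s hs v _ => ?_
      have hs : (s : ℂ) ≠ 0 := by exact_mod_cast (ne_of_gt hs)
      have h1 : HasDerivAt (fun w : ℂ => Complex.exp (w * s)) (Complex.exp (v * s) * s) v :=
        (((hasDerivAt_id v).mul_const (s : ℂ)).cexp).congr_deriv (by simp)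
      exact ((h1.sub_const _).div_const _).congr_deriv (by field_simp)
  have hd2 : ∀ w ∈ U, HasDerivAt (fun w => L w + Complex.log (-w)) 0 w := by
    intro w hw
    have hw0 : w ≠ 0 := by
      rintro rfl
      simp [hU] at hw
    have h1 := ((hasDerivAt_id w).neg).clog (hslit w hw)
    refine ((hd w hw).add h1).congr_deriv ?_
    simp only [Pi.neg_apply, id]
    field_simp
    ring
  have hc := hUo.is_const_of_deriv_eq_zero hUc
    (fun w hw => (hd2 w hw).differentiableAt.differentiableWithinAt)
    (fun w hw => (hd2 w hw).deriv) (x := z) (y := -1) hz (by simp [hU])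
  have h0 : L (-1) = 0 := by simp [hL]
  rw [h0] at hc
  simp only [neg_neg, Complex.log_one, add_zero] at hc
  exact eq_neg_of_add_eq_zero_left hc

theorem integral_frullani_real {a : ℝ} (ha : 0 < a) :
    ∫ s in Ioi (0 : ℝ), (Real.exp (-(a * s)) - Real.exp (-s)) / s = -Real.log a := by
  have h1 := integral_frullani (z := ((-a : ℝ) : ℂ)) (by simpa using ha)
  rw [← Complex.ofReal_neg, neg_neg, ← Complex.ofReal_log ha.le] at h1
  have e : ∀ s : ℝ, (Complex.exp (((-a : ℝ) : ℂ) * s) - Complex.exp (-s)) / s =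
      (((Real.exp (-(a * s)) - Real.exp (-s)) / s : ℝ) : ℂ) := by
    intro s; push_cast; ring_nf
  simp only [e] at h1
  rw [integral_complex_ofReal] at h1
  exact_mod_cast h1

theorem integrableOn_frullani_real {a : ℝ} (ha : 0 < a) :
    IntegrableOn (fun s : ℝ => (Real.exp (-(a * s)) - Real.exp (-s)) / s) (Ioi 0) := by
  have h1 := integrableOn_frullani (z := ((-a : ℝ) : ℂ)) (by simpa using ha)
  have e : ∀ s : ℝ, (Complex.exp (((-a : ℝ) : ℂ) * s) - Complex.exp (-s)) / s =
      (((Real.exp (-(a * s)) - Real.exp (-s)) / s : ℝ) : ℂ) := by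
    intro s; push_cast; ring_nf
  simp only [e] at h1
  exact h1.re

theorem image_inv_four_mul : (fun s : ℝ => 1 / (4 * s)) '' Ioi 0 = Ioi 0 := by
  ext t
  constructor
  · rintro ⟨s, hs, rfl⟩
    have : 0 < s := hs
    show 0 < 1 / (4 * s)
    positivity
  · intro ht
    have ht : 0 < t := ht
    refine ⟨1 / (4 * t), by show 0 < 1 / (4 * t); positivity, ?_⟩
    field_simp

theorem hasDerivWithinAt_inv_four_mul {s : ℝ} (hs : 0 < s) :
    HasDerivWithinAt (fun s : ℝ => 1 / (4 * s)) (-1 / (4 * s ^ 2)) (Ioi 0) s := by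
  have h1 : HasDerivAt (fun s : ℝ => 4 * s) 4 s := by
    simpa using (hasDerivAt_id s).const_mul (4 : ℝ)
  refine (((hasDerivAt_const s (1 : ℝ)).div h1 (by positivity)).congr_deriv ?_).hasDerivWithinAt
  field_simp
  ring

theorem injOn_inv_four_mul : InjOn (fun s : ℝ => 1 / (4 * s)) (Ioi 0) := by
  intro s hs t ht e
  have hs : s ≠ 0 := ne_of_gt hs
  have ht : t ≠ 0 := ne_of_gt ht
  field_simp at e
  linarith

/-- The logarithm as a difference of two heat kernel integrals. -/
theorem integral_exp_inv_sub {r : ℝ} (hr : 0 < r) :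
    IntegrableOn (fun s : ℝ => (Real.exp (-(r ^ 2 / (4 * s))) - Real.exp (-(1 / (4 * s)))) / s)
      (Ioi 0) ∧
    ∫ s in Ioi (0 : ℝ), (Real.exp (-(r ^ 2 / (4 * s))) - Real.exp (-(1 / (4 * s)))) / s =
      2 * Real.log (1 / r) := by
  have h1 := integral_frullani_real (a := r ^ 2) (by positivity)
  have h0 := integrableOn_frullani_real (a := r ^ 2) (by positivity)
  -- The involution `s ↦ 1/(4s)` preserves the measure `ds/s`, so this is Frullani's integral with
  -- parameter `r²`.
  have e : ∀ s ∈ Ioi (0 : ℝ), |-1 / (4 * s ^ 2)| • ((Real.exp (-(r ^ 2 * (1 / (4 * s)))) -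
      Real.exp (-(1 / (4 * s)))) / (1 / (4 * s))) =
      (Real.exp (-(r ^ 2 / (4 * s))) - Real.exp (-(1 / (4 * s)))) / s := by
    intro s hs
    have hs : 0 < s := hs
    rw [neg_div, abs_neg, abs_of_pos (by positivity), smul_eq_mul,
      show r ^ 2 * (1 / (4 * s)) = r ^ 2 / (4 * s) by ring]
    field_simp
  constructor
  · rw [← image_inv_four_mul, integrableOn_image_iff_integrableOn_abs_deriv_smul measurableSet_Ioi
      (fun s hs => hasDerivWithinAt_inv_four_mul hs) injOn_inv_four_mul] at h0
    exact h0.congr_fun e measurableSet_Ioi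
  · rw [← image_inv_four_mul, integral_image_eq_integral_abs_deriv_smul measurableSet_Ioi
      (fun s hs => hasDerivWithinAt_inv_four_mul hs) injOn_inv_four_mul,
      setIntegral_congr_fun measurableSet_Ioi e] at h1
    rw [h1, one_div, Real.log_inv, Real.log_pow]
    push_cast
    ring

/-! ### The renormalized diagonal value of the Green function -/

theorem mul_exp_neg_le_inv {κ : ℝ} (hκ : 0 < κ) (s : ℝ) : s * Real.exp (-(κ * s)) ≤ κ⁻¹ := by
  have := Real.add_one_le_exp (κ * s)
  rw [Real.exp_neg, ← div_eq_mul_inv, div_le_iff₀ (Real.exp_pos _), inv_mul_eq_div,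
    le_div_iff₀ hκ]
  linarith

theorem integrableOn_pow_mul_exp_neg (n : ℕ) {κ : ℝ} (hκ : 0 < κ) :
    IntegrableOn (fun s : ℝ => s ^ n * Real.exp (-(κ * s))) (Ioi 0) := by
  have h1 : (-1 : ℝ) < n := by have : (0 : ℝ) ≤ n := n.cast_nonneg; linarith
  have := integrableOn_rpow_mul_exp_neg_mul_rpow (p := 1) (s := n) h1 one_pos hκ
  refine this.congr_fun (fun s _ => ?_) measurableSet_Ioi
  simp

theorem integral_pow_mul_exp_neg (n : ℕ) {κ : ℝ} (hκ : 0 < κ) :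
    ∫ s in Ioi (0 : ℝ), s ^ n * Real.exp (-(κ * s)) = n.factorial / κ ^ (n + 1) := by
  have h1 : (-1 : ℝ) < n := by have : (0 : ℝ) ≤ n := n.cast_nonneg; linarith
  have := integral_rpow_mul_exp_neg_mul_rpow (p := 1) (q := n) (b := κ) one_pos h1 hκ
  simp only [Real.rpow_one, Real.rpow_natCast, div_one, neg_mul] at this
  rw [this, Real.Gamma_nat_eq_factorial, Real.rpow_neg hκ.le]
  have e : κ ^ ((n : ℝ) + 1) = κ ^ (n + 1) := by rw [← Real.rpow_natCast]; push_cast; rfl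
  rw [e]
  field_simp

theorem hC_sub_le {h s : ℝ} (hh : 0 < h) (hs : 0 < s) : hC h s - 1 / s ≤ h ^ 2 * s := by
  have h1 := hC_sq hh hs
  have h2 := hS_le hh hs
  have h3 := le_hC hh hs
  have h4 := hS_pos hh hs
  have h5 : hS h s ^ 2 ≤ (1 / s) ^ 2 := pow_le_pow_left₀ h4.le h2 2
  have h6 : (hC h s - 1 / s) * (1 / s) ≤ h ^ 2 := by
    have : 0 < 1 / s := by positivity
    nlinarith
  rwa [mul_one_div, div_le_iff₀ hs] at h6

/-- `∫₀^∞ e^{zs} (h / sinh hs - 1/s) ds`. -/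
def rhoFun (h : ℝ) (z : ℂ) : ℂ :=
  ∫ s in Ioi (0 : ℝ), Complex.exp (z * s) * ((hS h s - 1 / s : ℝ) : ℂ)

/-- The constant in the renormalized diagonal value. -/
def frullaniConst : ℝ :=
  ∫ s in Ioi (0 : ℝ), (Real.exp (-s) - 1 + Real.exp (-(1 / (4 * s)))) / s

/-- The renormalized diagonal value of the Green function. -/
def qVal (h : ℝ) (z : ℂ) : ℂ :=
  1 / (4 * (Real.pi : ℂ)) * (frullaniConst - Complex.log (-z) + rhoFun h z)

theorem abs_hS_sub_le {h s : ℝ} (hh : 0 < h) (hs : 0 < s) : |hS h s - 1 / s| ≤ h ^ 2 * s / 2 := by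
  rw [abs_sub_comm, abs_of_nonneg (by linarith [hS_le hh hs])]
  exact le_hS hh hs

theorem measurable_hS_sub (h : ℝ) : Measurable (fun s : ℝ => ((hS h s - 1 / s : ℝ) : ℂ)) := by
  have := measurable_hS h
  fun_prop

theorem integrableOn_exp_mul_hS_sub {h : ℝ} (hh : 0 < h) : ∀ κ > 0,
    IntegrableOn (fun s => Real.exp (-(κ * s)) * ‖((hS h s - 1 / s : ℝ) : ℂ)‖) (Ioi 0) := by
  intro κ hκ
  have := measurable_hS_sub h
  refine Integrable.mono' ((integrableOn_pow_mul_exp_neg 1 hκ).const_mul (h ^ 2 / 2))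
    (Measurable.aestronglyMeasurable (by fun_prop)) ?_
  refine (ae_restrict_mem measurableSet_Ioi).mono fun s hs => ?_
  have hs : 0 < s := hs
  rw [norm_mul, norm_norm, Complex.norm_real, Real.norm_eq_abs, Real.norm_eq_abs,
    abs_of_pos (Real.exp_pos _), pow_one]
  have := mul_le_mul_of_nonneg_left (abs_hS_sub_le hh hs) (Real.exp_pos (-(κ * s))).le
  linarith

theorem norm_rhoFun_le {h : ℝ} (hh : 0 < h) {z : ℂ} (hz : z.re < 0) :
    ‖rhoFun h z‖ ≤ h ^ 2 / (2 * z.re ^ 2) := by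
  have hE : 0 < -z.re := by linarith
  have h1 := integral_pow_mul_exp_neg 1 hE
  have h2 := norm_integral_le_of_norm_le (μ := volume.restrict (Ioi (0 : ℝ)))
    (f := fun s : ℝ => Complex.exp (z * s) * ((hS h s - 1 / s : ℝ) : ℂ))
    ((integrableOn_pow_mul_exp_neg 1 hE).const_mul (h ^ 2 / 2)) ?_
  · rw [integral_const_mul, h1] at h2
    refine h2.trans (le_of_eq ?_)
    simp
    field_simp
  · refine (ae_restrict_mem measurableSet_Ioi).mono fun s hs => ?_
    have hs : 0 < s := hs
    rw [norm_mul, norm_cexp_mul, Complex.norm_real, Real.norm_eq_abs, pow_one, neg_mul, neg_neg]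
    have := mul_le_mul_of_nonneg_left (abs_hS_sub_le hh hs) (Real.exp_pos (z.re * s)).le
    linarith

theorem hasDerivAt_rhoFun {h : ℝ} (hh : 0 < h) {z : ℂ} (hz : z.re < 0) :
    ∃ ρ' : ℂ, HasDerivAt (rhoFun h) ρ' z ∧ ‖ρ'‖ ≤ h ^ 2 / (-z.re) ^ 3 := by
  refine ⟨_, hasDerivAt_laplace (measurable_hS_sub h) (integrableOn_exp_mul_hS_sub hh) hz, ?_⟩
  have hE : 0 < -z.re := by linarith
  have h1 := integral_pow_mul_exp_neg 2 hE
  have h2 := norm_integral_le_of_norm_le (μ := volume.restrict (Ioi (0 : ℝ)))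
    (f := fun s : ℝ => Complex.exp (z * s) * (s * ((hS h s - 1 / s : ℝ) : ℂ)))
    ((integrableOn_pow_mul_exp_neg 2 hE).const_mul (h ^ 2 / 2)) ?_
  · rw [integral_const_mul, h1] at h2
    refine h2.trans (le_of_eq ?_)
    simp
    field_simp
  · refine (ae_restrict_mem measurableSet_Ioi).mono fun s hs => ?_
    have hs : 0 < s := hs
    rw [norm_mul, norm_mul, norm_cexp_mul, Complex.norm_real, Complex.norm_real,
      Real.norm_of_nonneg hs.le, Real.norm_eq_abs, neg_mul, neg_neg]
    have := mul_le_mul_of_nonneg_left (abs_hS_sub_le hh hs)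
      (mul_pos (Real.exp_pos (z.re * s)) hs).le
    linarith

/-- The integrand of the renormalized Green function. -/
def renorm (h : ℝ) (z : ℂ) (r s : ℝ) : ℂ :=
  Complex.exp (z * s) * ((hS h s * Real.exp (-(hC h s * r ^ 2 / 4)) : ℝ) : ℂ) -
    (((Real.exp (-(r ^ 2 / (4 * s))) - Real.exp (-(1 / (4 * s)))) / s : ℝ) : ℂ)

theorem measurable_renorm (h : ℝ) (z : ℂ) (r : ℝ) : Measurable (renorm h z r) := by
  have := measurable_hS h
  have := measurable_hC h
  unfold renorm
  fun_prop

theorem norm_cexp_sub_one_le' {z : ℂ} (hz : z.re < 0) {s : ℝ} (hs : 0 < s) :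
    ‖Complex.exp (z * s) - 1‖ ≤ ‖z‖ * s := by
  have hconv : Convex ℝ {w : ℂ | w.re ≤ 0} := convex_halfSpace_re_le 0
  have := hconv.norm_image_sub_le_of_norm_hasDerivWithin_le
    (f := fun w : ℂ => Complex.exp (w * s)) (f' := fun w => Complex.exp (w * s) * s)
    (C := s) (x := 0) (y := z)
    (fun w _ => ((((hasDerivAt_id w).mul_const (s : ℂ)).cexp).congr_deriv
      (by simp)).hasDerivWithinAt) ?_ (by simp) hz.le
  · simp only [zero_mul, Complex.exp_zero, sub_zero] at this
    linarith
  · intro w hw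
    have hw : w.re ≤ 0 := hw
    rw [norm_mul, norm_cexp_mul, Complex.norm_real, Real.norm_of_nonneg hs.le]
    have : Real.exp (w.re * s) ≤ 1 := Real.exp_le_one_iff.2 (by nlinarith)
    nlinarith

theorem abs_exp_neg_sub_le {a b : ℝ} (ha : 0 ≤ a) (hab : a ≤ b) :
    0 ≤ Real.exp (-a) - Real.exp (-b) ∧ Real.exp (-a) - Real.exp (-b) ≤ b - a := by
  constructor
  · have := Real.exp_le_exp.2 (neg_le_neg hab); linarith
  · have h1 : Real.exp (-b) = Real.exp (-a) * Real.exp (-(b - a)) := by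
      rw [← Real.exp_add]; congr 1; ring
    have h2 := Real.add_one_le_exp (-(b - a))
    have h3 : Real.exp (-a) ≤ 1 := Real.exp_le_one_iff.2 (by linarith)
    have h4 := Real.exp_pos (-a)
    rw [h1]
    nlinarith

theorem exp_inv_div_le {s : ℝ} (hs : 0 < s) : Real.exp (-(1 / (4 * s))) / s ≤ 4 := by
  have := mul_exp_neg_le_inv one_pos (1 / (4 * s))
  rw [one_mul, inv_one] at this
  have e : Real.exp (-(1 / (4 * s))) / s = 4 * (1 / (4 * s) * Real.exp (-(1 / (4 * s)))) := by
    field_simp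
  rw [e]
  linarith

/-- One majorant serves all `r ∈ [0,1]`. For `s ≤ 1` the poles `1/s` cancel and four bounded pieces
remain. For `s > 1` the Green part decays like `e^{s Re z}` and the logarithmic part like `s⁻²`. The
function `(1 + s²)⁻¹` covers both ranges. -/
theorem norm_renorm_le {h : ℝ} (hh : 0 < h) {z : ℂ} (hz : z.re < 0) {r : ℝ} (hr : 0 ≤ r)
    (hr1 : r ≤ 1) {s : ℝ} (hs : 0 < s) :
    ‖renorm h z r s‖ ≤ Real.exp (z.re * s) + (2 * (‖z‖ + h ^ 2 + 4) + 1) * (1 + s ^ 2)⁻¹ := by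
  have hS0 := hS_pos hh hs
  have hSl := hS_le hh hs
  have hCg := le_hC hh hs
  have hr2 : r ^ 2 ≤ 1 := by nlinarith
  set g := Real.exp (-(hC h s * r ^ 2 / 4)) with hg
  have hg0 : 0 < g := Real.exp_pos _
  have hg1 : g ≤ 1 := Real.exp_le_one_iff.2 (by have := hC_pos hh hs; have := sq_nonneg r; nlinarith [mul_nonneg (hC_pos hh hs).le (sq_nonneg r)])
  have hpos : 0 < 1 + s ^ 2 := by positivity
  rcases le_or_gt s 1 with h1 | h1
  · have hd := abs_exp_neg_sub_le (a := r ^ 2 / (4 * s)) (b := hC h s * r ^ 2 / 4)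
      (by positivity) (by
        have e : r ^ 2 / (4 * s) = 1 / s * r ^ 2 / 4 := by field_simp
        rw [e]
        have := mul_le_mul_of_nonneg_right hCg (sq_nonneg r); linarith)
    have hb : hC h s * r ^ 2 / 4 - r ^ 2 / (4 * s) ≤ h ^ 2 * s / 4 := by
      have e : r ^ 2 / (4 * s) = 1 / s * r ^ 2 / 4 := by field_simp
      have := hC_sub_le hh hs
      have h0 : 0 ≤ h ^ 2 * s := by positivity
      have := mul_le_mul_of_nonneg_right this (sq_nonneg r)
      rw [e]
      nlinarith
    have hexp : renorm h z r s = (Complex.exp (z * s) - 1) * ((hS h s * g : ℝ) : ℂ) +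
        (((hS h s - 1 / s) * g : ℝ) : ℂ) -
        (((Real.exp (-(r ^ 2 / (4 * s))) - g) / s : ℝ) : ℂ) +
        ((Real.exp (-(1 / (4 * s))) / s : ℝ) : ℂ) := by
      rw [renorm, ← hg]
      push_cast
      ring
    have b1 : ‖(Complex.exp (z * s) - 1) * ((hS h s * g : ℝ) : ℂ)‖ ≤ ‖z‖ := by
      rw [norm_mul, Complex.norm_real, Real.norm_of_nonneg (by positivity)]
      calc _ ≤ ‖z‖ * s * (1 / s * 1) := by
            gcongr
            exact norm_cexp_sub_one_le' hz hs
        _ = ‖z‖ := by field_simp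
    have b2 : ‖(((hS h s - 1 / s) * g : ℝ) : ℂ)‖ ≤ h ^ 2 / 2 := by
      rw [Complex.norm_real, norm_mul, Real.norm_eq_abs, Real.norm_of_nonneg hg0.le]
      calc _ ≤ h ^ 2 * s / 2 * 1 := by gcongr; exact abs_hS_sub_le hh hs
        _ ≤ _ := by nlinarith [sq_nonneg h]
    have b3 : ‖(((Real.exp (-(r ^ 2 / (4 * s))) - g) / s : ℝ) : ℂ)‖ ≤ h ^ 2 / 4 := by
      rw [Complex.norm_real, Real.norm_of_nonneg (div_nonneg hd.1 hs.le), div_le_iff₀ hs]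
      linarith [hd.2]
    have b4 : ‖((Real.exp (-(1 / (4 * s))) / s : ℝ) : ℂ)‖ ≤ 4 := by
      rw [Complex.norm_real, Real.norm_of_nonneg (by positivity)]
      exact exp_inv_div_le hs
    have hK : 0 ≤ ‖z‖ + h ^ 2 + 4 := by positivity
    have b5 : ‖z‖ + h ^ 2 + 4 ≤ (2 * (‖z‖ + h ^ 2 + 4) + 1) * (1 + s ^ 2)⁻¹ := by
      rw [← div_eq_mul_inv, le_div_iff₀ hpos]
      have : s ^ 2 ≤ 1 := by nlinarith
      have := mul_le_mul_of_nonneg_left this hK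
      linarith
    rw [hexp]
    have t1 := norm_add_le ((Complex.exp (z * s) - 1) * ((hS h s * g : ℝ) : ℂ) +
        (((hS h s - 1 / s) * g : ℝ) : ℂ) -
        (((Real.exp (-(r ^ 2 / (4 * s))) - g) / s : ℝ) : ℂ)) 
        ((Real.exp (-(1 / (4 * s))) / s : ℝ) : ℂ)
    have t2 := norm_sub_le ((Complex.exp (z * s) - 1) * ((hS h s * g : ℝ) : ℂ) +
        (((hS h s - 1 / s) * g : ℝ) : ℂ)) 
        (((Real.exp (-(r ^ 2 / (4 * s))) - g) / s : ℝ) : ℂ)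
    have t3 := norm_add_le ((Complex.exp (z * s) - 1) * ((hS h s * g : ℝ) : ℂ))
        (((hS h s - 1 / s) * g : ℝ) : ℂ)
    have := Real.exp_pos (z.re * s)
    nlinarith [sq_nonneg h]
  · have hd := abs_exp_neg_sub_le (a := r ^ 2 / (4 * s)) (b := 1 / (4 * s))
      (by positivity) (by gcongr)
    have b1 : ‖Complex.exp (z * s) * ((hS h s * g : ℝ) : ℂ)‖ ≤ Real.exp (z.re * s) := by
      rw [norm_mul, norm_cexp_mul, Complex.norm_real, Real.norm_of_nonneg (by positivity)]
      have : hS h s * g ≤ 1 * 1 := by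
        have : 1 / s ≤ 1 := by rw [div_le_one hs]; exact h1.le
        gcongr
        linarith
      have := Real.exp_pos (z.re * s)
      nlinarith
    have b2 : ‖(((Real.exp (-(r ^ 2 / (4 * s))) - Real.exp (-(1 / (4 * s)))) / s : ℝ) : ℂ)‖ ≤
        (1 + s ^ 2)⁻¹ := by
      rw [Complex.norm_real, Real.norm_of_nonneg (div_nonneg hd.1 hs.le), inv_eq_one_div,
        div_le_div_iff₀ hs hpos]
      have e1 : Real.exp (-(r ^ 2 / (4 * s))) - Real.exp (-(1 / (4 * s))) ≤ 1 / (4 * s) := by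
        have : 0 ≤ r ^ 2 / (4 * s) := by positivity
        linarith [hd.2]
      calc _ ≤ 1 / (4 * s) * (1 + s ^ 2) := by gcongr
        _ ≤ 1 / (4 * s) * (4 * s ^ 2) := by gcongr; nlinarith
        _ = 1 * s := by field_simp
    have hK : 0 ≤ (2 * (‖z‖ + h ^ 2 + 4)) * (1 + s ^ 2)⁻¹ := by positivity
    have t := norm_sub_le (Complex.exp (z * s) * ((hS h s * g : ℝ) : ℂ))
      (((Real.exp (-(r ^ 2 / (4 * s))) - Real.exp (-(1 / (4 * s)))) / s : ℝ) : ℂ)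
    rw [renorm, ← hg]
    linarith

theorem integrableOn_renorm_bound {z : ℂ} (hz : z.re < 0) (K : ℝ) :
    IntegrableOn (fun s : ℝ => Real.exp (z.re * s) + K * (1 + s ^ 2)⁻¹) (Ioi 0) :=
  (integrableOn_exp_mul_Ioi hz 0).add (integrable_inv_one_add_sq.const_mul K).integrableOn

theorem integrableOn_renorm {h : ℝ} (hh : 0 < h) {z : ℂ} (hz : z.re < 0) {r : ℝ} (hr : 0 ≤ r)
    (hr1 : r ≤ 1) : IntegrableOn (renorm h z r) (Ioi 0) :=
  Integrable.mono' (integrableOn_renorm_bound hz _)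
    (measurable_renorm h z r).aestronglyMeasurable
    ((ae_restrict_mem measurableSet_Ioi).mono fun _ hs => norm_renorm_le hh hz hr hr1 hs)

theorem tendsto_integral_renorm {h : ℝ} (hh : 0 < h) {z : ℂ} (hz : z.re < 0) :
    Tendsto (fun r => ∫ s in Ioi (0 : ℝ), renorm h z r s) (𝓝[>] 0)
      (𝓝 (∫ s in Ioi (0 : ℝ), renorm h z 0 s)) := by
  refine tendsto_integral_filter_of_dominated_convergence
    (fun s => Real.exp (z.re * s) + (2 * (‖z‖ + h ^ 2 + 4) + 1) * (1 + s ^ 2)⁻¹)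
    (Eventually.of_forall fun r => (measurable_renorm h z r).aestronglyMeasurable) ?_
    (integrableOn_renorm_bound hz _) ?_
  · filter_upwards [Ioc_mem_nhdsGT (zero_lt_one (α := ℝ))] with r hr
    exact (ae_restrict_mem measurableSet_Ioi).mono fun _ hs =>
      norm_renorm_le hh hz hr.1.le hr.2 hs
  · refine Eventually.of_forall fun s => ?_
    have : Continuous fun r => renorm h z r s := by unfold renorm; fun_prop
    exact (this.tendsto 0).mono_left nhdsWithin_le_nhds

/-- At `r = 0` the integrand is the sum of Frullani's integrand, the integrand of `rhoFun`, and a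
remainder independent of `z` and `h`, whose integral is `frullaniConst`. -/
theorem integral_renorm_zero {h : ℝ} (hh : 0 < h) {z : ℂ} (hz : z.re < 0) :
    ∫ s in Ioi (0 : ℝ), renorm h z 0 s = 4 * Real.pi * qVal h z := by
  have hpi : (Real.pi : ℂ) ≠ 0 := by exact_mod_cast Real.pi_ne_zero
  have i1 := integrableOn_frullani hz
  have i2 := integrableOn_cexp_mul (measurable_hS_sub h) (integrableOn_exp_mul_hS_sub hh) hz
  have i0 := integrableOn_renorm hh hz le_rfl zero_le_one
  have e : ∀ s ∈ Ioi (0 : ℝ), (((Real.exp (-s) - 1 + Real.exp (-(1 / (4 * s)))) / s : ℝ) : ℂ) =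
      renorm h z 0 s - ((Complex.exp (z * s) - Complex.exp (-s)) / s +
        Complex.exp (z * s) * ((hS h s - 1 / s : ℝ) : ℂ)) := by
    intro s hs
    rw [renorm]
    push_cast
    simp
    ring
  have hc : ((frullaniConst : ℝ) : ℂ) = ∫ s in Ioi (0 : ℝ),
      (((Real.exp (-s) - 1 + Real.exp (-(1 / (4 * s)))) / s : ℝ) : ℂ) := by
    rw [integral_complex_ofReal, frullaniConst]
  have e3 := integral_sub i0 (i1.add i2)
  simp only [Pi.add_apply] at e3
  rw [setIntegral_congr_fun measurableSet_Ioi e, e3, integral_add i1 i2,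
    integral_frullani hz, ← rhoFun] at hc
  rw [qVal, hc]
  field_simp
  ring

theorem integrableOn_cexp_heatProfile {h : ℝ} (hh : 0 < h) {z : ℂ} (hz : z.re < 0) {r : ℝ}
    (hr : 0 < r) :
    IntegrableOn (fun s : ℝ => Complex.exp (z * s) * (heatProfile h r s : ℂ)) (Ioi 0) := by
  have := measurable_heatProfile h r
  refine integrableOn_cexp_mul (φ := fun s => (heatProfile h r s : ℂ)) (by fun_prop) ?_ hz
  intro κ hκ
  refine (integrableOn_heatProfile_mul_exp hh hκ hr).congr_fun (fun s hs => ?_) measurableSet_Ioi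
  simp only
  rw [Complex.norm_real, Real.norm_of_nonneg (heatProfile_pos hh hs r).le, mul_comm]

/-- The logarithm is itself written as a heat integral (`integral_exp_inv_sub`), so it can be
subtracted under the integral sign, where dominated convergence gives the limit `r → 0`. -/
theorem tendsto_greenProfile_sub_log {h : ℝ} (hh : 0 < h) {z : ℂ} (hz : z.re < 0) :
    Tendsto (fun r : ℝ => greenProfile h r z -
      1 / (2 * (Real.pi : ℂ)) * ((Real.log (1 / r) : ℝ) : ℂ)) (𝓝[>] 0) (𝓝 (qVal h z)) := by
  have hpi : (Real.pi : ℂ) ≠ 0 := by exact_mod_cast Real.pi_ne_zero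
  have h1 := (tendsto_integral_renorm hh hz).const_mul (1 / (4 * (Real.pi : ℂ)))
  rw [integral_renorm_zero hh hz, ← mul_assoc, one_div_mul_cancel (by simp),
    one_mul] at h1
  refine h1.congr' ?_
  filter_upwards [self_mem_nhdsWithin] with r hr
  have hr : 0 < r := hr
  obtain ⟨i2, e2⟩ := integral_exp_inv_sub hr
  have i1 := integrableOn_cexp_heatProfile hh hz hr
  have e : ∀ s : ℝ, renorm h z r s = 4 * Real.pi * (Complex.exp (z * s) * (heatProfile h r s : ℂ)) -
      (((Real.exp (-(r ^ 2 / (4 * s))) - Real.exp (-(1 / (4 * s)))) / s : ℝ) : ℂ) := by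
    intro s
    rw [renorm, heatProfile]
    push_cast
    field_simp
  simp only [e]
  have e3 := integral_sub (i1.const_mul (4 * (Real.pi : ℂ))) (i2.ofReal (𝕜 := ℂ))
  simp only [Complex.coe_algebraMap] at e3
  rw [e3, integral_const_mul, integral_complex_ofReal, e2,
    greenProfile]
  push_cast
  field_simp
  ring

theorem tendsto_norm_sub_nhdsWithin (y : Plane) :
    Tendsto (fun x : Plane => ‖x - y‖) (𝓝[≠] y) (𝓝[>] 0) := by
  refine tendsto_nhdsWithin_iff.2 ⟨?_, ?_⟩
  · have : Continuous fun x : Plane => ‖x - y‖ := by fun_prop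
    have := this.tendsto y
    simp only [sub_self, norm_zero] at this
    exact this.mono_left nhdsWithin_le_nhds
  · filter_upwards [self_mem_nhdsWithin] with x hx
    exact norm_pos_iff.2 (sub_ne_zero.2 hx)

theorem norm_gaugePhase_sub_one_le (h : ℝ) (x y : Plane) :
    ‖gaugePhase h x y - 1‖ ≤ ‖x - y‖ * (|h| * ‖x + y‖) := by
  have e : gaugePhase h x y =
      Complex.exp (Complex.I * ((-(h * (x 0 - y 0) * (x 1 + y 1) / 2) : ℝ) : ℂ)) := by
    rw [gaugePhase]; congr 1; push_cast; ring
  rw [e]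
  refine (Real.norm_exp_I_mul_ofReal_sub_one_le).trans ?_
  have h0 : |x 0 - y 0| ≤ ‖x - y‖ := by
    have := PiLp.norm_apply_le (p := 2) (x - y) 0
    simpa using this
  have h1 : |x 1 + y 1| ≤ ‖x + y‖ := by
    have := PiLp.norm_apply_le (p := 2) (x + y) 1
    simpa using this
  rw [norm_neg, Real.norm_eq_abs, abs_div, abs_mul, abs_mul, abs_two]
  have : |h| * |x 0 - y 0| * |x 1 + y 1| ≤ ‖x - y‖ * (|h| * ‖x + y‖) := by
    calc |h| * |x 0 - y 0| * |x 1 + y 1| ≤ |h| * ‖x - y‖ * ‖x + y‖ := by gcongr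
      _ = _ := by ring
  have h2 : 0 ≤ |h| * |x 0 - y 0| * |x 1 + y 1| := by positivity
  linarith

/-- The logarithmic singularity of the Green function, at every point. -/
theorem tendsto_gauge_greenProfile_sub_log {h : ℝ} (hh : 0 < h) {z : ℂ} (hz : z.re < 0)
    (y : Plane) :
    Tendsto (fun x : Plane => gaugePhase h x y * greenProfile h ‖x - y‖ z -
      1 / (2 * (Real.pi : ℂ)) * ((Real.log (1 / ‖x - y‖) : ℝ) : ℂ)) (𝓝[≠] y)
      (𝓝 (qVal h z)) := by
  have h1 := (tendsto_greenProfile_sub_log hh hz).comp (tendsto_norm_sub_nhdsWithin y)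
  have hlog : Tendsto (fun r : ℝ => (r : ℂ) * (1 / (2 * (Real.pi : ℂ)) *
      ((Real.log (1 / r) : ℝ) : ℂ))) (𝓝[>] 0) (𝓝 0) := by
    have h0 := tendsto_log_mul_rpow_nhdsGT_zero one_pos
    have := ((Complex.continuous_ofReal.tendsto 0).comp h0).const_mul (-(1 / (2 * (Real.pi : ℂ))))
    simp only [Complex.ofReal_zero, mul_zero] at this
    refine this.congr fun r => ?_
    simp only [Function.comp, Real.rpow_one, one_div, Real.log_inv]
    push_cast
    ring
  have hr : Tendsto (fun r : ℝ => (r : ℂ)) (𝓝[>] 0) (𝓝 0) := by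
    have := (Complex.continuous_ofReal.tendsto 0).mono_left
      (nhdsWithin_le_nhds (s := Ioi (0 : ℝ)))
    simpa using this
  have hrp : Tendsto (fun r : ℝ => (r : ℂ) * greenProfile h r z) (𝓝[>] 0) (𝓝 0) := by
    have := (hr.mul (tendsto_greenProfile_sub_log hh hz)).add hlog
    simp only [zero_mul, add_zero] at this
    refine this.congr fun r => ?_
    ring
  have hb : Tendsto (fun x : Plane => |h| * ‖x + y‖) (𝓝[≠] y) (𝓝 (|h| * ‖y + y‖)) := by
    have : Continuous fun x : Plane => |h| * ‖x + y‖ := by fun_prop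
    exact (this.tendsto y).mono_left nhdsWithin_le_nhds
  -- The phase differs from `1` by `O(|x - y|)`, which beats the logarithmic singularity; the gauge
  -- thus does not affect the renormalized value.
  have h2 : Tendsto (fun x : Plane => (gaugePhase h x y - 1) * greenProfile h ‖x - y‖ z)
      (𝓝[≠] y) (𝓝 0) := by
    have h3 := ((hrp.comp (tendsto_norm_sub_nhdsWithin y)).norm.mul hb)
    simp only [norm_zero, zero_mul] at h3
    refine squeeze_zero_norm (fun x => ?_) h3
    simp only [Function.comp]
    rw [norm_mul, norm_mul, Complex.norm_real, norm_norm]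
    have := mul_le_mul_of_nonneg_right (norm_gaugePhase_sub_one_le h x y)
      (norm_nonneg (greenProfile h ‖x - y‖ z))
    linarith
  have h3 := h1.add h2
  rw [add_zero] at h3
  refine h3.congr fun x => ?_
  simp only [Function.comp]
  ring

theorem qFun_eq_qVal {h : ℝ} (hh : 0 < h) {z : ℂ} (hz : z.re < 0) : qFun z h = qVal h z := by
  refine Tendsto.limUnder_eq ?_
  refine (tendsto_gauge_greenProfile_sub_log hh hz 0).congr fun x => ?_
  rw [green_eq hh (by linarith), sub_zero]

theorem tendsto_greenK_sub_log {h E : ℝ} (hh : 0 < h) (hE : 0 < E) (y : Plane) :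
    Tendsto (fun x : Plane => greenK h E y x -
      1 / (2 * (Real.pi : ℂ)) * ((Real.log (1 / ‖x - y‖) : ℝ) : ℂ)) (𝓝[≠] y)
      (𝓝 (qVal h ((-E : ℝ) : ℂ))) := by
  refine (tendsto_gauge_greenProfile_sub_log hh (z := ((-E : ℝ) : ℂ)) (by simpa using hE) y).congr
    fun x => ?_
  rw [greenProfile_ofReal, greenK]

/-! ### Hilbert space preliminaries -/

section Hilbert

variable {X : Type*} [NormedAddCommGroup X] [InnerProductSpace ℂ X]

/-- `ℓ²(ℤ²)`. -/
abbrev L2Lat : Type := lp (fun _ : ℤ × ℤ => ℂ) 2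

theorem summable_norm_sq (c : L2Lat) : Summable fun m => ‖c m‖ ^ 2 := by
  have := (lp.memℓp c).summable (by norm_num)
  simpa using this

theorem norm_sq_eq_tsum (c : L2Lat) : ‖c‖ ^ 2 = ∑' m, ‖c m‖ ^ 2 := by
  have := lp.norm_rpow_eq_tsum (p := 2) (by norm_num) c
  simpa using this

theorem memℓp_of_summable {c : ℤ × ℤ → ℂ} (h : Summable fun m => ‖c m‖ ^ 2) : Memℓp c 2 :=
  memℓp_gen (by simpa using h)

/-- Schur's test for the Gram matrix: its entries are dominated by a convolution kernel, so all row
and column sums are at most `∑ K`. -/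
theorem norm_sum_sq_le {e : ℤ × ℤ → X} {K : ℤ × ℤ → ℝ} (hK : Summable K) (hK0 : ∀ k, 0 ≤ K k)
    (he : ∀ m n, ‖inner ℂ (e m) (e n)‖ ≤ K (m - n)) (c : ℤ × ℤ → ℂ) (s : Finset (ℤ × ℤ)) :
    ‖∑ m ∈ s, c m • e m‖ ^ 2 ≤ (∑' k, K k) * ∑ m ∈ s, ‖c m‖ ^ 2 := by
  have h1 : ‖∑ m ∈ s, c m • e m‖ ^ 2 =
      (∑ m ∈ s, ∑ n ∈ s, inner ℂ (c m • e m) (c n • e n)).re := by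
    rw [← inner_self_eq_norm_sq (𝕜 := ℂ), sum_inner]
    simp_rw [inner_sum]
    rfl
  have hrow : ∀ m, ∑ n ∈ s, K (m - n) ≤ ∑' k, K k := by
    intro m
    have := (((Equiv.subLeft m).summable_iff (f := K)).2 hK).sum_le_tsum s fun _ _ => hK0 _
    rwa [(Equiv.subLeft m).tsum_eq] at this
  have hcol : ∀ n, ∑ m ∈ s, K (m - n) ≤ ∑' k, K k := by
    intro n
    have := (((Equiv.subRight n).summable_iff (f := K)).2 hK).sum_le_tsum s fun _ _ => hK0 _
    rwa [(Equiv.subRight n).tsum_eq] at this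
  calc ‖∑ m ∈ s, c m • e m‖ ^ 2
      ≤ ∑ m ∈ s, ∑ n ∈ s, (‖c m‖ ^ 2 * K (m - n) / 2 + ‖c n‖ ^ 2 * K (m - n) / 2) := by
        rw [h1, Complex.re_sum]
        refine Finset.sum_le_sum fun m _ => ?_
        rw [Complex.re_sum]
        refine Finset.sum_le_sum fun n _ => ?_
        refine (Complex.re_le_norm _).trans ?_
        rw [inner_smul_left, inner_smul_right, norm_mul, norm_mul, RCLike.norm_conj]
        have e1 := he m n
        have e2 := hK0 (m - n)
        calc ‖c m‖ * (‖c n‖ * ‖inner ℂ (e m) (e n)‖) ≤ ‖c m‖ * (‖c n‖ * K (m - n)) := by gcongr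
          _ ≤ _ := by
            have := mul_nonneg (sq_nonneg (‖c m‖ - ‖c n‖)) e2
            nlinarith
    _ = (∑ m ∈ s, ‖c m‖ ^ 2 * (∑ n ∈ s, K (m - n))) / 2 +
        (∑ n ∈ s, ‖c n‖ ^ 2 * (∑ m ∈ s, K (m - n))) / 2 := by
        simp_rw [Finset.sum_add_distrib, Finset.mul_sum, Finset.sum_div]
        congr 1
        rw [Finset.sum_comm]
    _ ≤ (∑ m ∈ s, ‖c m‖ ^ 2 * (∑' k, K k)) / 2 + (∑ n ∈ s, ‖c n‖ ^ 2 * (∑' k, K k)) / 2 := by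
        gcongr with m _ n _
        · exact hrow m
        · exact hcol n
    _ = _ := by rw [← Finset.sum_mul]; ring

/-- The synthesis operator of a family of vectors with summable correlations. -/
theorem exists_synthesis [CompleteSpace X] {e : ℤ × ℤ → X} {K : ℤ × ℤ → ℝ} (hK : Summable K)
    (hK0 : ∀ k, 0 ≤ K k) (he : ∀ m n, ‖inner ℂ (e m) (e n)‖ ≤ K (m - n)) :
    ∃ T : L2Lat →L[ℂ] X, (∀ c, HasSum (fun m => c m • e m) (T c)) ∧
      ∀ (f : X) m, (ContinuousLinearMap.adjoint T f) m = inner ℂ (e m) f := by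
  have hsum : ∀ c : L2Lat, Summable fun m => c m • e m := by
    intro c
    rw [summable_iff_vanishing_norm]
    intro ε hε
    have hC : 0 ≤ ∑' k, K k := tsum_nonneg hK0
    obtain ⟨s, hs⟩ := summable_iff_vanishing_norm.1 (summable_norm_sq c)
      (ε ^ 2 / (∑' k, K k + 1)) (by positivity)
    refine ⟨s, fun t ht => ?_⟩
    have h1 := hs t ht
    rw [Real.norm_of_nonneg (Finset.sum_nonneg fun _ _ => sq_nonneg _),
      lt_div_iff₀ (by positivity)] at h1
    have h2 := norm_sum_sq_le hK hK0 he c t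
    have h3 : 0 ≤ ∑ m ∈ t, ‖c m‖ ^ 2 := Finset.sum_nonneg fun _ _ => sq_nonneg _
    refine lt_of_pow_lt_pow_left₀ 2 hε.le ?_
    nlinarith
  have hb : ∀ c : L2Lat, ‖∑' m, c m • e m‖ ≤ √(∑' k, K k) * ‖c‖ := by
    intro c
    have h1 : ‖∑' m, c m • e m‖ ^ 2 ≤ (∑' k, K k) * ‖c‖ ^ 2 := by
      refine le_of_tendsto ((hsum c).hasSum.norm.pow 2) (Eventually.of_forall fun s => ?_)
      refine (norm_sum_sq_le hK hK0 he c s).trans ?_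
      rw [norm_sq_eq_tsum]
      exact mul_le_mul_of_nonneg_left
        ((summable_norm_sq c).sum_le_tsum s fun _ _ => sq_nonneg _) (tsum_nonneg hK0)
    refine le_of_sq_le_sq ?_ (by positivity)
    rwa [mul_pow, Real.sq_sqrt (tsum_nonneg hK0)]
  let T₀ : L2Lat →ₗ[ℂ] X :=
    { toFun := fun c => ∑' m, c m • e m
      map_add' := fun c d => by
        simp only [lp.coeFn_add, Pi.add_apply, add_smul]
        exact (hsum c).tsum_add (hsum d)
      map_smul' := fun a c => by
        simp only [lp.coeFn_smul, Pi.smul_apply, smul_assoc, RingHom.id_apply]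
        exact (hsum c).tsum_const_smul a }
  let T : L2Lat →L[ℂ] X := T₀.mkContinuous _ hb
  refine ⟨T, fun c => (hsum c).hasSum, fun f m => ?_⟩
  have h1 : T (lp.single 2 m 1) = e m := by
    show ∑' n, (lp.single 2 m 1 : L2Lat) n • e n = e m
    rw [tsum_eq_single m]
    · simp
    · intro n hn
      rw [lp.single_apply_ne _ _ _ hn, zero_smul]
  have h2 := lp.inner_single_left (𝕜 := ℂ) m (1 : ℂ) (ContinuousLinearMap.adjoint T f)
  rw [ContinuousLinearMap.adjoint_inner_right, h1] at h2
  rw [h2]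
  simp

/-- A lower bound gives injectivity and a closed range. By self-adjointness the orthogonal
complement of the range is the kernel, hence zero. -/
theorem isUnit_of_isSelfAdjoint_of_bounded_below [CompleteSpace X] {T : X →L[ℂ] X}
    (hT : IsSelfAdjoint T) {κ : ℝ} (hκ : 0 < κ) (hb : ∀ x, κ * ‖x‖ ≤ ‖T x‖) : IsUnit T := by
  have hlip : AntilipschitzWith (Real.toNNReal κ⁻¹) T := by
    refine ContinuousLinearMap.antilipschitz_of_bound T fun x => ?_
    rw [Real.coe_toNNReal _ (inv_nonneg.2 hκ.le), inv_mul_eq_div, le_div_iff₀ hκ]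
    linarith [hb x]
  have hker : T.ker = ⊥ := LinearMap.ker_eq_bot.2 hlip.injective
  have hcl : IsClosed (T.range : Set X) := by
    rw [LinearMap.coe_range]
    exact hlip.isClosed_range T.uniformContinuous
  have hran : T.range = ⊤ := by
    have : CompleteSpace T.range := hcl.completeSpace_coe
    rw [← Submodule.orthogonal_eq_bot_iff, ContinuousLinearMap.orthogonal_range,
      show ContinuousLinearMap.adjoint T = T from hT, hker]
  rw [ContinuousLinearMap.isUnit_iff_bijective]
  exact ⟨hlip.injective, LinearMap.range_eq_top.1 hran⟩

theorem exists_bounded_below_of_isUnit {T : X →L[ℂ] X} (hT : IsUnit T) :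
    ∃ κ > 0, ∀ x, κ * ‖x‖ ≤ ‖T x‖ := by
  obtain ⟨u, rfl⟩ := hT
  set S : X →L[ℂ] X := ↑u⁻¹ with hS
  refine ⟨(‖S‖ + 1)⁻¹, by positivity, fun x => ?_⟩
  have h1 : S ((u : X →L[ℂ] X) x) = x := by
    rw [← mul_apply_eq_comp, hS, Units.inv_mul]; rfl
  have h2 := S.le_opNorm ((u : X →L[ℂ] X) x)
  rw [h1] at h2
  rw [inv_mul_eq_div, div_le_iff₀ (by positivity)]
  have := norm_nonneg ((u : X →L[ℂ] X) x)
  nlinarith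

theorem isSelfAdjoint_tsum [CompleteSpace X] {V : ℤ × ℤ → X →L[ℂ] X} {f : ℤ × ℤ → ℝ}
    (hV : ∀ k, star (V k) = V (-k)) (hf : ∀ k, f (-k) = f k) :
    IsSelfAdjoint (∑' k, (f k : ℂ) • V k) := by
  rw [IsSelfAdjoint, tsum_star, ← (Equiv.neg (ℤ × ℤ)).tsum_eq]
  refine tsum_congr fun k => ?_
  simp [star_smul, hV, hf]

theorem mem_resolventSetP_of_bijective {T : X →ₗ.[ℂ] X} {z : ℂ} {C : ℝ}
    (hsurj : ∀ g : X, ∃ f : T.domain, T f - z • (f : X) = g ∧ ‖(f : X)‖ ≤ C * ‖g‖)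
    (hinj : ∀ f : T.domain, T f - z • (f : X) = 0 → f = 0) : z ∈ resolventSetP T := by
  choose R hR hRb using hsurj
  have huniq : ∀ f f' : T.domain, T f - z • (f : X) = T f' - z • (f' : X) → f = f' := by
    intro f f' e
    refine sub_eq_zero.1 (hinj (f - f') ?_)
    rw [T.map_sub, Submodule.coe_sub, smul_sub]
    rw [← sub_eq_zero] at e
    rw [← e]
    abel
  let R₀ : X →ₗ[ℂ] X :=
    { toFun := fun g => (R g : X)
      map_add' := fun g g' => by
        rw [← Submodule.coe_add]
        congr 1
        refine huniq _ _ ?_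
        rw [hR, T.map_add, Submodule.coe_add, smul_add]
        conv_lhs => rw [← hR g, ← hR g']
        abel
      map_smul' := fun a g => by
        rw [RingHom.id_apply, ← Submodule.coe_smul]
        congr 1
        refine huniq _ _ ?_
        rw [hR, T.map_smul, Submodule.coe_smul]
        conv_lhs => rw [← hR g]
        rw [smul_sub, smul_comm] }
  refine ⟨R₀.mkContinuous C hRb, fun g => ⟨R g, rfl, hR g⟩, fun f => ?_⟩
  show ((R _ : T.domain) : X) = f
  congr 1
  exact huniq _ _ (hR _)

end Hilbert

/-- A sum that converges in `L²` and almost everywhere has the same limit in both senses. -/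
theorem ae_eq_of_hasSum {Y : Type*} [MeasurableSpace Y] {μ : Measure Y} {e : ℤ × ℤ → Lp ℂ 2 μ}
    {u : ℤ × ℤ → Y → ℂ} {F : Lp ℂ 2 μ} {v : Y → ℂ} (heu : ∀ m, e m =ᵐ[μ] u m) (he : HasSum e F)
    (hu : ∀ᵐ x ∂μ, HasSum (fun m => u m x) (v x)) : v =ᵐ[μ] F := by
  have h1 := tendstoInMeasure_of_tendsto_Lp he
  obtain ⟨ns, hns, h2⟩ := h1.exists_seq_tendsto_ae'
  have h3 : ∀ s : Finset (ℤ × ℤ), (↑(∑ m ∈ s, e m) : Y → ℂ) =ᵐ[μ]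
      fun x => ∑ m ∈ s, e m x := by
    intro s
    induction s using Finset.induction_on with
    | empty =>
      simp only [Finset.sum_empty]
      exact Lp.coeFn_zero ℂ 2 μ
    | insert a s ha ih =>
      rw [Finset.sum_insert ha]
      filter_upwards [Lp.coeFn_add (e a) (∑ m ∈ s, e m), ih] with x hx1 hx2
      rw [hx1, Pi.add_apply, hx2, Finset.sum_insert ha]
  filter_upwards [h2, hu, ae_all_iff.2 heu, ae_all_iff.2 fun n => h3 (ns n)] with x a1 a2 a3 a4
  refine tendsto_nhds_unique (a2.comp hns) ?_
  refine a1.congr fun n => ?_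
  rw [a4 n]
  exact Finset.sum_congr rfl fun m _ => a3 m

/-! ### Lattice points -/

theorem latticePt_sub (m n : ℤ × ℤ) : latticePt m - latticePt n = latticePt (m - n) := by
  ext i
  fin_cases i <;> simp [latticePt]

theorem norm_latticePt_sq (m : ℤ × ℤ) : ‖latticePt m‖ ^ 2 = (m.1 : ℝ) ^ 2 + (m.2 : ℝ) ^ 2 := by
  rw [norm_sq_plane]; simp [latticePt]

theorem abs_add_abs_le (m : ℤ × ℤ) : (|(m.1 : ℝ)| + |(m.2 : ℝ)|) / 2 ≤ ‖latticePt m‖ := by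
  refine le_of_sq_le_sq ?_ (norm_nonneg _)
  rw [norm_latticePt_sq, ← sq_abs (m.1 : ℝ), ← sq_abs (m.2 : ℝ)]
  nlinarith [sq_nonneg (|(m.1 : ℝ)| - |(m.2 : ℝ)|), sq_nonneg |(m.1 : ℝ)|, sq_nonneg |(m.2 : ℝ)|]

theorem one_le_norm_latticePt {m : ℤ × ℤ} (hm : m ≠ 0) : 1 ≤ ‖latticePt m‖ := by
  have h1 : 1 ≤ m.1 ^ 2 + m.2 ^ 2 := by
    rcases eq_or_ne m.1 0 with h | h
    · have h2 : m.2 ≠ 0 := fun h' => hm (Prod.ext h h')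
      have := sq_pos_of_ne_zero h2
      nlinarith [sq_nonneg m.1]
    · have := sq_pos_of_ne_zero h
      nlinarith [sq_nonneg m.2]
  have h2 : (1 : ℝ) ≤ (m.1 : ℝ) ^ 2 + (m.2 : ℝ) ^ 2 := by exact_mod_cast h1
  rw [← norm_latticePt_sq] at h2
  nlinarith [norm_nonneg (latticePt m)]

theorem one_le_norm_latticePt_sub {m n : ℤ × ℤ} (hmn : m ≠ n) :
    1 ≤ ‖latticePt m - latticePt n‖ := by
  rw [latticePt_sub]; exact one_le_norm_latticePt (sub_ne_zero.2 hmn)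

theorem summable_exp_neg_abs {c : ℝ} (hc : 0 < c) :
    Summable fun k : ℤ => Real.exp (-(c * |(k : ℝ)|)) := by
  have h1 : Summable fun n : ℕ => Real.exp (-(c * (n : ℝ))) := by
    have := Real.summable_exp_nat_mul_iff.2 (neg_lt_zero.2 hc)
    refine this.congr fun n => ?_
    congr 1; ring
  refine Summable.of_nat_of_neg ?_ ?_
  · refine h1.congr fun n => ?_
    simp
  · refine h1.congr fun n => ?_
    simp

theorem summable_exp_neg_abs_add {c : ℝ} (hc : 0 < c) :
    Summable fun k : ℤ × ℤ => Real.exp (-(c * (|(k.1 : ℝ)| + |(k.2 : ℝ)|))) := by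
  have := (summable_exp_neg_abs hc).mul_of_nonneg (summable_exp_neg_abs hc)
    (fun _ => (Real.exp_pos _).le) (fun _ => (Real.exp_pos _).le)
  refine this.congr fun k => ?_
  rw [← Real.exp_add]
  congr 1; ring

theorem summable_exp_neg_norm {c : ℝ} (hc : 0 < c) :
    Summable fun k : ℤ × ℤ => Real.exp (-(c * ‖latticePt k‖)) := by
  refine Summable.of_nonneg_of_le (fun _ => (Real.exp_pos _).le) (fun k => ?_)
    (summable_exp_neg_abs_add (half_pos hc))
  apply Real.exp_le_exp.2
  have := mul_le_mul_of_nonneg_left (abs_add_abs_le k) hc.le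
  linarith

/-! ### Locality -/

theorem partialD_eventuallyEq {φ ψ : Plane → ℂ} {x : Plane} (hx : φ =ᶠ[𝓝 x] ψ) (i : Fin 2) :
    partialD i φ =ᶠ[𝓝 x] partialD i ψ := by
  filter_upwards [hx.fderiv (𝕜 := ℝ)] with y hy
  rw [partialD, partialD, hy]

theorem magMomentum_eventuallyEq {φ ψ : Plane → ℂ} {x : Plane} (hx : φ =ᶠ[𝓝 x] ψ) (h : ℝ) :
    magMomentum h φ =ᶠ[𝓝 x] magMomentum h ψ := by
  filter_upwards [partialD_eventuallyEq hx 0, hx] with y h1 h2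
  rw [magMomentum, magMomentum, h1, h2]

theorem opHE_eventuallyEq {φ ψ : Plane → ℂ} {x : Plane} (hx : φ =ᶠ[𝓝 x] ψ) (h E : ℝ) :
    opHE h E φ x = opHE h E ψ x := by
  rw [opHE, opHE, landau, landau,
    (magMomentum_eventuallyEq (magMomentum_eventuallyEq hx h) h).eq_of_nhds,
    (partialD_eventuallyEq (partialD_eventuallyEq hx 1) 1).eq_of_nhds, hx.eq_of_nhds]

theorem opHE_zero_fun (h E : ℝ) (x : Plane) : opHE h E (fun _ => 0) x = 0 := by
  have := landau_const_mul (φ := fun _ => 0) contDiff_const h 0 x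
  simp only [mul_zero, zero_mul] at this
  rw [opHE, this]
  simp

theorem opHE_eq_zero {φ : Plane → ℂ} {x : Plane} (hx : φ =ᶠ[𝓝 x] 0) (h E : ℝ) :
    opHE h E φ x = 0 := by
  rw [opHE_eventuallyEq hx]
  exact opHE_zero_fun h E x

theorem opHE_add {χ φ : Plane → ℂ} (hχ : ContDiff ℝ ∞ χ) (hφ : ContDiff ℝ ∞ φ) (h E : ℝ)
    (x : Plane) : opHE h E (fun x => χ x + φ x) x = opHE h E χ x + opHE h E φ x := by
  simp only [opHE, landau_add hχ hφ]; ring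

theorem opHE_const_mul {φ : Plane → ℂ} (hφ : ContDiff ℝ ∞ φ) (h E : ℝ) (c : ℂ)
    (x : Plane) : opHE h E (fun x => c * φ x) x = c * opHE h E φ x := by
  simp only [opHE, landau_const_mul hφ]; ring

theorem continuous_opHE {φ : Plane → ℂ} (hφ : ContDiff ℝ ∞ φ) (h E : ℝ) :
    Continuous (opHE h E φ) := (contDiff_opHE hφ h E).continuous

theorem integral_conj_opHE_add {χ φ : Plane → ℂ} (hχ : ContDiff ℝ ∞ χ) (hχs : HasCompactSupport χ)
    (hφ : ContDiff ℝ ∞ φ) (hφs : HasCompactSupport φ) (h E : ℝ) (F : L2Plane) :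
    ∫ x, conj (opHE h E (fun x => χ x + φ x) x) * F x =
      (∫ x, conj (opHE h E χ x) * F x) + ∫ x, conj (opHE h E φ x) * F x := by
  rw [← integral_add (integrable_pairing (continuous_opHE hχ h E)
    (hasCompactSupport_opHE hχs h E) F) (integrable_pairing (continuous_opHE hφ h E)
    (hasCompactSupport_opHE hφs h E) F)]
  refine integral_congr_ae (Eventually.of_forall fun x => ?_)
  simp only [opHE_add hχ hφ, map_add, add_mul]

/-! ### Removability of a point, and Green's formula at the lattice points -/

theorem volume_closedBall_plane (y : Plane) {r : ℝ} (hr : 0 ≤ r) :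
    volume.real (Metric.closedBall y r) = r ^ 2 * volume.real (Metric.ball (0 : Plane) 1) := by
  rw [Measure.real, Measure.addHaar_closedBall volume y hr, ENNReal.toReal_mul, Measure.real,
    ENNReal.toReal_ofReal (by positivity)]
  simp

theorem cutoff_eventuallyEq_zero {χ φ : Plane → ℂ} (hχ2 : ∀ x, 2 ≤ ‖x‖ → χ x = 0) {c : ℝ}
    (hc : 0 < c) (y : Plane) {x : Plane} (hx : x ∉ Metric.closedBall y (2 / c)) :
    (fun x => χ (c • (x - y)) * φ x) =ᶠ[𝓝 x] 0 := by
  filter_upwards [Metric.isClosed_closedBall.isOpen_compl.mem_nhds hx] with w hw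
  have : 2 / c < ‖w - y‖ := by simpa [dist_eq_norm] using hw
  rw [div_lt_iff₀ hc] at this
  have h2 : 2 ≤ ‖c • (w - y)‖ := by
    rw [norm_smul, Real.norm_of_nonneg hc.le]; linarith
  simp [hχ2 _ h2]

theorem one_sub_cutoff_eventuallyEq_zero {χ φ : Plane → ℂ} (hχ1 : ∀ x, ‖x‖ ≤ 1 → χ x = 1) {c : ℝ}
    (hc : 0 < c) (y : Plane) :
    (fun x => (1 - χ (c • (x - y))) * φ x) =ᶠ[𝓝 y] 0 := by
  filter_upwards [Metric.ball_mem_nhds y (one_div_pos.2 hc)] with w hw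
  have : ‖w - y‖ < 1 / c := by simpa [dist_eq_norm] using hw
  rw [lt_div_iff₀ hc] at this
  have h2 : ‖c • (w - y)‖ ≤ 1 := by
    rw [norm_smul, Real.norm_of_nonneg hc.le]; linarith
  simp [hχ1 _ h2]

/-- Two derivatives of a cutoff at scale `1/c` cost `c²`. This is exactly compensated by the area,
of order `c⁻²`, of the disc on which the product lives, as used in `removable_point`. -/
theorem exists_opHE_cutoff_bound {χ φ : Plane → ℂ} (hχ : ContDiff ℝ ∞ χ)
    (hχs : HasCompactSupport χ) (hφ : ContDiff ℝ ∞ φ) (hφs : HasCompactSupport φ) (h E : ℝ)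
    (y : Plane) :
    ∃ K : ℝ, 0 ≤ K ∧ ∀ c : ℝ, 1 ≤ c → ∀ x,
      ‖opHE h E (fun x => χ (c • (x - y)) * φ x) x‖ ≤ K * c ^ 2 := by
  obtain ⟨B, hB0, hB1, hB2, hB3⟩ := exists_deriv_bound hχ hχs
  obtain ⟨b0, h0⟩ := hφs.exists_bound_of_continuous hφ.continuous
  obtain ⟨b1, h1⟩ := (hasCompactSupport_landau hφs h).exists_bound_of_continuous
    (continuous_landau hφ h)
  obtain ⟨b2, h2⟩ := (hasCompactSupport_magMomentum hφs h).exists_bound_of_continuous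
    (contDiff_magMomentum hφ h).continuous
  obtain ⟨b3, h3⟩ := (hasCompactSupport_partialD hφs 1).exists_bound_of_continuous
    (contDiff_partialD hφ 1).continuous
  have n0 : 0 ≤ b0 := (norm_nonneg _).trans (h0 0)
  have n1 : 0 ≤ b1 := (norm_nonneg _).trans (h1 0)
  have n2 : 0 ≤ b2 := (norm_nonneg _).trans (h2 0)
  have n3 : 0 ≤ b3 := (norm_nonneg _).trans (h3 0)
  refine ⟨B * b1 + (2 * B * b2 + 2 * B * b3) + 2 * B * b0 + |E| * (B * b0), by positivity,
    fun c hc x => ?_⟩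
  have hc0 : 0 ≤ c := by linarith
  have hc2 : c ≤ c ^ 2 := by nlinarith
  have hc1 : 1 ≤ c ^ 2 := by nlinarith
  have e1 := norm_landau_cutoff_mul_le hχ hφ hB1 hB2 hB3 h hc0 y x
  rw [opHE]
  have e2 : ‖(E : ℂ) * (χ (c • (x - y)) * φ x)‖ ≤ |E| * (B * b0) := by
    rw [norm_mul, norm_mul, Complex.norm_real, Real.norm_eq_abs]
    have := hB1 (c • (x - y))
    have := h0 x
    gcongr
  have e3 := norm_add_le (landau h (fun x => χ (c • (x - y)) * φ x) x)
    ((E : ℂ) * (χ (c • (x - y)) * φ x))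
  have e4 : B * ‖landau h φ x‖ + c * (2 * B * ‖magMomentum h φ x‖ + 2 * B * ‖partialD 1 φ x‖) +
      c ^ 2 * (2 * B * ‖φ x‖) ≤ B * b1 * c ^ 2 + c ^ 2 * (2 * B * b2 + 2 * B * b3) +
      c ^ 2 * (2 * B * b0) := by
    have a0 := h0 x
    have a1 := h1 x
    have a2 := h2 x
    have a3 := h3 x
    have : B * ‖landau h φ x‖ ≤ B * b1 * c ^ 2 := by
      calc B * ‖landau h φ x‖ ≤ B * b1 * 1 := by rw [mul_one]; gcongr
        _ ≤ _ := by gcongr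
    gcongr
  have e5 : |E| * (B * b0) ≤ |E| * (B * b0) * c ^ 2 := le_mul_of_one_le_right (by positivity) hc1
  linarith

/-- A point at which an `L²` function has a finite limit is removable for the weak equation. -/
theorem removable_point {h E : ℝ} {f G : L2Plane} {u : Plane → ℂ} (huf : u =ᵐ[volume] f)
    {y : Plane} {b : ℂ} (hu : Tendsto u (𝓝[≠] y) (𝓝 b)) {φ : Plane → ℂ} (hφ : ContDiff ℝ ∞ φ)
    (hφs : HasCompactSupport φ)
    (hw : ∀ ψ : Plane → ℂ, ContDiff ℝ ∞ ψ → HasCompactSupport ψ → y ∉ tsupport ψ →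
      tsupport ψ ⊆ tsupport φ → ∫ x, conj (opHE h E ψ x) * f x = ∫ x, conj (ψ x) * G x) :
    ∫ x, conj (opHE h E φ x) * f x = ∫ x, conj (φ x) * G x := by
  obtain ⟨χ, hχ, hχs, hχ1, hχ2⟩ := exists_cutoff
  obtain ⟨B, hB⟩ := hχs.exists_bound_of_continuous hχ.continuous
  obtain ⟨K, hK0, hK⟩ := exists_opHE_cutoff_bound hχ hχs hφ hφs h E y
  set P : ℝ → Plane → ℂ := fun c x => χ (c • (x - y)) * φ x with hP
  have hPc : ∀ c, ContDiff ℝ ∞ (P c) := fun c => (contDiff_comp_affine hχ c y).mul hφ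
  have hPs : ∀ c, HasCompactSupport (P c) := fun c => hφs.mul_left
  -- The limit value `b` is subtracted as a multiple of the constant function, which the operator
  -- maps to the continuous function `V`. Only `u - b`, which tends to zero at `y`, is then paired
  -- with the badly behaved second derivatives.
  set V : Plane → ℂ := opHE h E (fun _ => 1) with hV
  have hVc : Continuous V := continuous_opHE contDiff_const h E
  have hone : ContDiff ℝ ∞ (fun _ : Plane => (1 : ℂ)) := contDiff_const
  have key : ∀ c > 0, (∫ x, conj (opHE h E φ x) * f x) - ∫ x, conj (φ x) * G x =
      (∫ x, conj (opHE h E (P c) x) * (u x - b)) + ∫ x, conj (P c x) * (b * V x - G x) := by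
    intro c hc
    set Q : Plane → ℂ := fun x => (1 - χ (c • (x - y))) * φ x with hQ
    have hQc : ContDiff ℝ ∞ Q := (contDiff_const.sub (contDiff_comp_affine hχ c y)).mul hφ
    have hQs : HasCompactSupport Q := hφs.mul_left
    have hQw := hw Q hQc hQs
      (notMem_tsupport_iff_eventuallyEq.2 (one_sub_cutoff_eventuallyEq_zero hχ1 hc y))
      (tsupport_mul_subset_right)
    have e1 : φ = fun x => P c x + Q x := by
      ext x; simp only [hP, hQ]; ring
    have e2 := integral_conj_opHE_add (hPc c) (hPs c) hQc hQs h E f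
    rw [← e1] at e2
    have e3 : ∫ x, conj (φ x) * G x = (∫ x, conj (P c x) * G x) + ∫ x, conj (Q x) * G x := by
      rw [← integral_add (integrable_pairing (hPc c).continuous (hPs c) G)
        (integrable_pairing hQc.continuous hQs G)]
      refine integral_congr_ae (Eventually.of_forall fun x => ?_)
      simp only
      conv_lhs => rw [e1]
      rw [map_add, add_mul]
    have e4 := integral_conj_opHE_comm (hPc c) (hPs c) hone h E
    have i1 := integrable_pairing (continuous_opHE (hPc c) h E) (hasCompactSupport_opHE (hPs c) h E) f
    have i2 := integrable_conj_mul (continuous_opHE (hPc c) h E) (hasCompactSupport_opHE (hPs c) h E)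
      hone.continuous
    have i3 := integrable_conj_mul (hPc c).continuous (hPs c) hVc
    have i4 := integrable_pairing (hPc c).continuous (hPs c) G
    have e5 : ∫ x, conj (opHE h E (P c) x) * (u x - b) =
        (∫ x, conj (opHE h E (P c) x) * f x) - b * ∫ x, conj (opHE h E (P c) x) * 1 := by
      rw [← integral_const_mul, ← integral_sub i1 (i2.const_mul b)]
      refine integral_congr_ae ?_
      filter_upwards [huf] with x hx
      rw [hx]; ring
    have e6 : ∫ x, conj (P c x) * (b * V x - G x) =
        b * (∫ x, conj (P c x) * V x) - ∫ x, conj (P c x) * G x := by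
      rw [← integral_const_mul, ← integral_sub (i3.const_mul b) i4]
      refine integral_congr_ae (Eventually.of_forall fun x => ?_)
      simp only
      ring
    rw [e5, e6, e4, e2, e3, hQw]
    ring
  have lim2 : Tendsto (fun c : ℝ => ∫ x, conj (P c x) * (b * V x - G x)) atTop (𝓝 0) := by
    have i3 := integrable_conj_mul hφ.continuous hφs hVc
    have i4 := integrable_pairing hφ.continuous hφs G
    have hI : Integrable (fun x => B * ‖conj (φ x) * (b * V x - G x)‖) := by
      refine (((i3.const_mul b).sub i4).norm.const_mul B).congr
        (Eventually.of_forall fun x => ?_)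
      simp only [Pi.sub_apply]
      congr 2
      ring
    have : Tendsto (fun c : ℝ => ∫ x, conj (P c x) * (b * V x - G x)) atTop
        (𝓝 (∫ _ : Plane, (0 : ℂ))) := by
      refine tendsto_integral_filter_of_dominated_convergence _
        (Eventually.of_forall fun c => ?_) (Eventually.of_forall fun c => ?_) hI ?_
      · have := (hPc c).continuous
        have := Complex.continuous_conj.comp this
        exact this.aestronglyMeasurable.mul
          ((hVc.aestronglyMeasurable.const_mul b).sub (Lp.aestronglyMeasurable G))
      · refine Eventually.of_forall fun x => ?_
        simp only [hP, map_mul, norm_mul, RCLike.norm_conj]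
        rw [mul_assoc]
        gcongr
        exact hB _
      · filter_upwards [ae_ne y] with x hx
        refine tendsto_const_nhds.congr' ?_
        have hxy : 0 < ‖x - y‖ := norm_pos_iff.2 (sub_ne_zero.2 hx)
        filter_upwards [eventually_ge_atTop (2 / ‖x - y‖), eventually_gt_atTop 0] with c hc hc0
        rw [div_le_iff₀ hxy] at hc
        have : χ (c • (x - y)) = 0 := hχ2 _ (by
          rw [norm_smul, Real.norm_of_nonneg hc0.le]; exact hc)
        simp [hP, this]
    simpa using this
  -- The integrand is at most `K c² δ` on a disc of radius `2/c`, where `|u - b| < δ`. The integral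
  -- is therefore at most `4Kδ` times the area of the unit disc.
  have lim1 : Tendsto (fun c : ℝ => ∫ x, conj (opHE h E (P c) x) * (u x - b)) atTop (𝓝 0) := by
    rw [Metric.tendsto_atTop]
    intro ε hε
    set vol := volume.real (Metric.ball (0 : Plane) 1) with hvol
    have hvol0 : 0 ≤ vol := measureReal_nonneg
    set δ := ε / (4 * K * vol + 1) with hδ
    have hδ0 : 0 < δ := by positivity
    have hev : ∀ᶠ x in 𝓝[≠] y, ‖u x - b‖ < δ := by
      have := (Metric.tendsto_nhds.1 hu) δ hδ0
      simpa [dist_eq_norm] using this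
    rw [eventually_nhdsWithin_iff, Metric.eventually_nhds_iff] at hev
    obtain ⟨r, hr, hev⟩ := hev
    refine ⟨max 1 (4 / r), fun c hc => ?_⟩
    have hc1 : 1 ≤ c := (le_max_left _ _).trans hc
    have hc0 : 0 < c := by linarith
    have hcr : 2 / c < r := by
      have := (le_max_right _ _).trans hc
      rw [div_le_iff₀ hr] at this
      rw [div_lt_iff₀ hc0]
      linarith
    rw [dist_zero_right]
    have hbound : ∀ᵐ x, ‖conj (opHE h E (P c) x) * (u x - b)‖ ≤
        (Metric.closedBall y (2 / c)).indicator (fun _ => K * c ^ 2 * δ) x := by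
      filter_upwards [ae_ne y] with x hx
      by_cases hxb : x ∈ Metric.closedBall y (2 / c)
      · rw [indicator_of_mem hxb, norm_mul, RCLike.norm_conj]
        have := hev (lt_of_le_of_lt hxb hcr) hx
        have := hK c hc1 x
        gcongr
      · rw [indicator_of_notMem hxb, opHE_eq_zero (cutoff_eventuallyEq_zero hχ2 hc0 y hxb)]
        simp
    have hfin : volume (Metric.closedBall y (2 / c)) ≠ ⊤ := measure_closedBall_lt_top.ne
    refine lt_of_le_of_lt (norm_integral_le_of_norm_le
      ((integrable_indicator_iff measurableSet_closedBall).2 (integrableOn_const hfin)) hbound) ?_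
    rw [integral_indicator measurableSet_closedBall, setIntegral_const, smul_eq_mul,
      volume_closedBall_plane y (by positivity), ← hvol]
    have e : (2 / c) ^ 2 * vol * (K * c ^ 2 * δ) = 4 * K * vol * δ := by field_simp; ring
    rw [e, hδ, mul_div_assoc', div_lt_iff₀ (by positivity)]
    nlinarith
  have lim := lim1.add lim2
  rw [add_zero] at lim
  have lim' : Tendsto (fun _ : ℝ => (∫ x, conj (opHE h E φ x) * f x) - ∫ x, conj (φ x) * G x)
      atTop (𝓝 0) := by
    refine lim.congr' ?_
    filter_upwards [eventually_gt_atTop 0] with c hc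
    exact (key c hc).symm
  exact sub_eq_zero.1 (tendsto_nhds_unique tendsto_const_nhds lim')

/-- `(H_h + E) f = G` on the punctured plane in the sense of distributions. -/
def WeakHE (h E : ℝ) (f G : L2Plane) : Prop :=
  ∀ φ : Plane → ℂ, IsTest φ → ∫ x, conj (opHE h E φ x) * f x = ∫ x, conj (φ x) * G x

theorem integral_conj_opHE {φ : Plane → ℂ} (hφ : ContDiff ℝ ∞ φ) (hs : HasCompactSupport φ)
    (h E : ℝ) (f : L2Plane) : ∫ x, conj (opHE h E φ x) * f x =
      (∫ x, conj (landau h φ x) * f x) + E * ∫ x, conj (φ x) * f x := by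
  rw [← integral_const_mul, ← integral_add (integrable_pairing (continuous_landau hφ h)
    (hasCompactSupport_landau hs h) f) ((integrable_pairing hφ.continuous hs f).const_mul _)]
  refine integral_congr_ae (Eventually.of_forall fun x => ?_)
  simp only [opHE, map_add, map_mul, Complex.conj_ofReal]
  ring

theorem weakHE_iff {h E : ℝ} {f g : L2Plane} :
    WeakHE h E f (g + (E : ℂ) • f) ↔ WeakLandau h f g := by
  refine forall_congr' fun φ => forall_congr' fun hφ => ?_
  rw [integral_conj_opHE hφ.1 hφ.2.1, pairing_add hφ.1.continuous hφ.2.1, pairing_smul]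
  exact add_left_inj _

open Classical in
/-- The class of the Green function with pole at `m`. -/
def greenL (h E : ℝ) (m : ℤ × ℤ) : L2Plane :=
  if H : MemLp (greenK h E (latticePt m)) 2 volume then H.toLp _ else 0

theorem greenL_eq {h E : ℝ} (hh : 0 < h) (hE : 0 < E) (m : ℤ × ℤ) :
    greenL h E m = (memLp_greenK hh hE (latticePt m)).toLp _ := by
  rw [greenL, dif_pos (memLp_greenK hh hE (latticePt m))]

theorem greenL_ae {h E : ℝ} (hh : 0 < h) (hE : 0 < E) (m : ℤ × ℤ) :
    greenL h E m =ᵐ[volume] greenK h E (latticePt m) := by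
  rw [greenL_eq hh hE]; exact MemLp.coeFn_toLp _

theorem integral_conj_opHE_greenL {φ : Plane → ℂ} (hφ : ContDiff ℝ ∞ φ)
    (hs : HasCompactSupport φ) {h E : ℝ} (hh : 0 < h) (hE : 0 < E) (m : ℤ × ℤ) :
    ∫ x, conj (opHE h E φ x) * greenL h E m x = conj (φ (latticePt m)) := by
  rw [← integral_conj_opHE_mul_greenK hφ hs hh hE]
  refine integral_congr_ae ?_
  filter_upwards [greenL_ae hh hE m] with x hx
  rw [hx]

theorem isTest_of_subset_closedBall {ψ : Plane → ℂ} (hψ : ContDiff ℝ ∞ ψ)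
    (hs : HasCompactSupport ψ) {m : ℤ × ℤ} (hm : latticePt m ∉ tsupport ψ)
    (hsub : tsupport ψ ⊆ Metric.closedBall (latticePt m) (1 / 4)) : IsTest ψ := by
  refine ⟨hψ, hs, fun x hx => ?_⟩
  rintro ⟨n, rfl⟩
  rcases eq_or_ne n m with rfl | hnm
  · exact hm hx
  · have h1 := one_le_norm_latticePt_sub hnm
    have h2 := hsub hx
    rw [Metric.mem_closedBall, dist_eq_norm] at h2
    linarith

/-- Green's formula near a lattice point. -/
theorem integral_conj_opHE_local {h E : ℝ} (hh : 0 < h) (hE : 0 < E) {f G : L2Plane}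
    (hfG : WeakHE h E f G) {u : Plane → ℂ} (huf : u =ᵐ[volume] f) {m : ℤ × ℤ} {a b : ℂ}
    (hu : Tendsto (fun x : Plane =>
        u x - a / (2 * (Real.pi : ℂ)) * ((Real.log (1 / ‖x - latticePt m‖) : ℝ) : ℂ))
      (𝓝[≠] (latticePt m)) (𝓝 b)) {φ : Plane → ℂ} (hφ : ContDiff ℝ ∞ φ)
    (hs : HasCompactSupport φ) (hsub : tsupport φ ⊆ Metric.closedBall (latticePt m) (1 / 4)) :
    ∫ x, conj (opHE h E φ x) * f x = (∫ x, conj (φ x) * G x) + a * conj (φ (latticePt m)) := by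
  have hpair : ∀ ψ : Plane → ℂ, ContDiff ℝ ∞ ψ → HasCompactSupport ψ →
      ∫ x, conj (opHE h E ψ x) * (f + (-a) • greenL h E m) x =
        (∫ x, conj (opHE h E ψ x) * f x) - a * conj (ψ (latticePt m)) := by
    intro ψ hψ hψs
    rw [pairing_add (continuous_opHE hψ h E) (hasCompactSupport_opHE hψs h E), pairing_smul,
      integral_conj_opHE_greenL hψ hψs hh hE]
    ring
  -- Subtracting `a G(·,m)` cancels the logarithm and leaves a finite limit at `m`, so the point is
  -- removable for the difference. The subtracted term contributes the point mass.
  have h1 := removable_point (h := h) (E := E) (f := f + (-a) • greenL h E m) (G := G)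
    (u := fun x => u x + -a * greenK h E (latticePt m) x) (y := latticePt m)
    (b := b - a * qVal h ((-E : ℝ) : ℂ)) ?_ ?_ hφ hs ?_
  · rw [hpair φ hφ hs] at h1
    rw [← h1]
    ring
  · filter_upwards [huf, greenL_ae hh hE m, Lp.coeFn_add f ((-a) • greenL h E m),
      Lp.coeFn_smul (-a) (greenL h E m)] with x h1 h2 h3 h4
    rw [h3, Pi.add_apply, h4, Pi.smul_apply, h1, h2, smul_eq_mul]
  · refine (hu.sub ((tendsto_greenK_sub_log hh hE (latticePt m)).const_mul a)).congr fun x => ?_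
    ring
  · intro ψ hψ hψs hm hψφ
    rw [hpair ψ hψ hψs, image_eq_zero_of_notMem_tsupport hm, map_zero, mul_zero, sub_zero]
    exact hfG ψ (isTest_of_subset_closedBall hψ hψs hm (hψφ.trans hsub))

theorem finite_latticePt_mem {K : Set Plane} (hK : IsCompact K) :
    {m : ℤ × ℤ | latticePt m ∈ K}.Finite := by
  obtain ⟨R, hR⟩ := hK.isBounded.exists_norm_le
  obtain ⟨N, hN⟩ := exists_nat_ge (2 * R)
  refine (Set.finite_Icc ((-N, -N) : ℤ × ℤ) (N, N)).subset fun m hm => ?_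
  have h1 := hR _ hm
  have h2 := abs_add_abs_le m
  have h3 : |(m.1 : ℝ)| ≤ N := by have := abs_nonneg (m.2 : ℝ); linarith
  have h4 : |(m.2 : ℝ)| ≤ N := by have := abs_nonneg (m.1 : ℝ); linarith
  have h3' : |m.1| ≤ (N : ℤ) := by exact_mod_cast h3
  have h4' : |m.2| ≤ (N : ℤ) := by exact_mod_cast h4
  rw [abs_le] at h3' h4'
  exact ⟨⟨h3'.1, h4'.1⟩, ⟨h3'.2, h4'.2⟩⟩

/-- The weak equation on the plane follows from its local versions. -/
theorem integral_conj_opHE_eq_zero_of_local {h E : ℝ} {F : L2Plane}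
    (hT : ∀ φ, IsTest φ → ∫ x, conj (opHE h E φ x) * F x = 0)
    (hL : ∀ (m : ℤ × ℤ) (φ : Plane → ℂ), ContDiff ℝ ∞ φ → HasCompactSupport φ →
      tsupport φ ⊆ Metric.closedBall (latticePt m) (1 / 4) →
      ∫ x, conj (opHE h E φ x) * F x = 0)
    {φ : Plane → ℂ} (hφ : ContDiff ℝ ∞ φ) (hs : HasCompactSupport φ) :
    ∫ x, conj (opHE h E φ x) * F x = 0 := by
  obtain ⟨χ, hχ, hχs, hχ1, hχ2⟩ := exists_cutoff
  suffices H : ∀ (S : Finset (ℤ × ℤ)) (φ : Plane → ℂ), ContDiff ℝ ∞ φ → HasCompactSupport φ →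
      (∀ m, latticePt m ∈ tsupport φ → m ∈ S) → ∫ x, conj (opHE h E φ x) * F x = 0 from
    H (finite_latticePt_mem hs).toFinset φ hφ hs fun m hm => by simpa using hm
  intro S
  induction S using Finset.induction_on with
  | empty =>
    intro φ hφ hs hS
    refine hT φ ⟨hφ, hs, fun x hx => ?_⟩
    rintro ⟨m, rfl⟩
    simpa using hS m hx
  | insert a S ha ih =>
    intro φ hφ hs hS
    -- Induction on the lattice points in the support: `P` isolates the point `a`. The factor `8`
    -- shrinks the cutoff of radius `2` to radius `1/4`, and `a` no longer belongs to the support of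
    -- the rest `Q`.
    set P : Plane → ℂ := fun x => χ ((8 : ℝ) • (x - latticePt a)) * φ x with hP
    set Q : Plane → ℂ := fun x => (1 - χ ((8 : ℝ) • (x - latticePt a))) * φ x with hQ
    have hPc : ContDiff ℝ ∞ P := (contDiff_comp_affine hχ 8 _).mul hφ
    have hPs : HasCompactSupport P := hs.mul_left
    have hQc : ContDiff ℝ ∞ Q := (contDiff_const.sub (contDiff_comp_affine hχ 8 _)).mul hφ
    have hQs : HasCompactSupport Q := hs.mul_left
    have e1 : φ = fun x => P x + Q x := by
      ext x; simp only [hP, hQ]; ring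
    rw [e1, integral_conj_opHE_add hPc hPs hQc hQs, hL a P hPc hPs, ih Q hQc hQs, add_zero]
    · intro m hm
      have hmφ : latticePt m ∈ tsupport φ := tsupport_mul_subset_right hm
      rcases Finset.mem_insert.1 (hS m hmφ) with rfl | h'
      · exact absurd hm (notMem_tsupport_iff_eventuallyEq.2
          (one_sub_cutoff_eventuallyEq_zero hχ1 (by norm_num) _))
      · exact h'
    · intro x hx
      by_contra hxb
      refine absurd hx (notMem_tsupport_iff_eventuallyEq.2
        (cutoff_eventuallyEq_zero hχ2 (by norm_num) _ ?_))
      norm_num at hxb ⊢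
      exact hxb

/-! ### The lattice operator -/

theorem norm_twist_sq (h : ℝ) (k : ℤ × ℤ) (c : L2Lat) (n : ℤ × ℤ) :
    ‖gaugePhase h (latticePt n) (latticePt (n - k)) * c (n - k)‖ ^ 2 =
      (fun m => ‖c m‖ ^ 2) (Equiv.subRight k n) := by
  rw [norm_mul, norm_gaugePhase, one_mul]
  rfl

/-- The magnetic translation by `k` in `ℓ²(ℤ²)`. -/
def latShift (h : ℝ) (k : ℤ × ℤ) : L2Lat →L[ℂ] L2Lat :=
  LinearMap.mkContinuous
    { toFun := fun c => ⟨fun n => gaugePhase h (latticePt n) (latticePt (n - k)) * c (n - k), by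
        refine memℓp_of_summable ?_
        simp only [norm_twist_sq]
        exact (Equiv.subRight k).summable_iff.2 (summable_norm_sq c)⟩
      map_add' := fun c d => by
        ext n
        simp only [lp.coeFn_add, Pi.add_apply, mul_add]
      map_smul' := fun a c => by
        ext n
        simp only [lp.coeFn_smul, Pi.smul_apply, smul_eq_mul, RingHom.id_apply]
        ring } 1 (fun c => by
      rw [one_mul]
      refine le_of_sq_le_sq (le_of_eq ?_) (norm_nonneg _)
      rw [norm_sq_eq_tsum, norm_sq_eq_tsum]
      simp only [LinearMap.coe_mk, AddHom.coe_mk, norm_twist_sq]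
      exact (Equiv.subRight k).tsum_eq (fun m => ‖c m‖ ^ 2))

theorem latShift_apply (h : ℝ) (k : ℤ × ℤ) (c : L2Lat) (n : ℤ × ℤ) :
    latShift h k c n = gaugePhase h (latticePt n) (latticePt (n - k)) * c (n - k) := rfl

theorem norm_latShift_le (h : ℝ) (k : ℤ × ℤ) : ‖latShift h k‖ ≤ 1 :=
  LinearMap.mkContinuous_norm_le _ zero_le_one _

theorem star_latShift (h : ℝ) (k : ℤ × ℤ) : star (latShift h k) = latShift h (-k) := by
  rw [ContinuousLinearMap.star_eq_adjoint]
  symm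
  rw [ContinuousLinearMap.eq_adjoint_iff]
  intro c d
  rw [lp.inner_eq_tsum, lp.inner_eq_tsum, ← (Equiv.subRight k).tsum_eq]
  refine tsum_congr fun n => ?_
  simp only [Equiv.subRight_apply, latShift_apply, sub_neg_eq_add, sub_add_cancel,
    RCLike.inner_apply, map_mul, conj_gaugePhase]
  ring

/-- The coefficients of the lattice operator: the Green function off the diagonal, and `d` on the
diagonal. -/
def latCoef (h E d : ℝ) (k : ℤ × ℤ) : ℝ := if k = 0 then d else gF h E ‖latticePt k‖

theorem latticePt_neg (k : ℤ × ℤ) : latticePt (-k) = -latticePt k := by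
  ext i
  fin_cases i <;> simp [latticePt]

theorem latCoef_neg (h E d : ℝ) (k : ℤ × ℤ) : latCoef h E d (-k) = latCoef h E d k := by
  rw [latCoef, latCoef, latticePt_neg, norm_neg]
  simp

theorem bG_le {E r : ℝ} (hr : 1 / 4 ≤ r) : bG E r ≤ 2 * Real.exp (-(√E / 2 * r)) := by
  rw [bG]
  refine mul_le_mul_of_nonneg_right ?_ (Real.exp_pos _).le
  have h1 : r ^ (-(1 / 2) : ℝ) ≤ (1 / 4 : ℝ) ^ (-(1 / 2) : ℝ) :=
    Real.rpow_le_rpow_of_nonpos (by norm_num) hr (by norm_num)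
  have h2 : (1 / 4 : ℝ) ^ (-(1 / 2) : ℝ) = 2 := by
    rw [show (1 / 4 : ℝ) = (2 : ℝ) ^ (-2 : ℝ) by norm_num [Real.rpow_neg], ← Real.rpow_mul
      (by norm_num)]
    norm_num
  linarith

theorem gF_le_exp {h E r : ℝ} (hh : 0 < h) (hE : 0 < E) (hr : 1 / 4 ≤ r) :
    gF h E r ≤ 2 * kG E * Real.exp (-(√E / 2 * r)) := by
  have h1 := gF_le hh hE (lt_of_lt_of_le (by norm_num) hr)
  have := mul_le_mul_of_nonneg_left (bG_le (E := E) hr) (kG_nonneg E)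
  linarith

theorem summable_latCoef {h E : ℝ} (hh : 0 < h) (hE : 0 < E) (d : ℝ) :
    Summable fun k => |latCoef h E d k| := by
  have h1 := (summable_exp_neg_norm (c := √E / 2) (by positivity)).mul_left (2 * kG E)
  have h2 : Summable fun k : ℤ × ℤ => if k = 0 then |d| else 0 :=
    summable_of_hasFiniteSupport ((Set.finite_singleton 0).subset fun k hk => by
      by_contra h0
      simp at hk h0
      exact h0 hk.1)
  refine Summable.of_nonneg_of_le (fun _ => abs_nonneg _) (fun k => ?_) (h1.add h2)
  by_cases hk : k = 0
  · simp only [latCoef, hk, if_true]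
    have := kG_nonneg E
    have : 0 ≤ 2 * kG E * Real.exp (-(√E / 2 * ‖latticePt 0‖)) := by positivity
    linarith
  · simp only [latCoef, hk, if_false, add_zero, abs_of_nonneg (gF_nonneg hh E _)]
    exact gF_le_exp hh hE (by linarith [one_le_norm_latticePt hk])

/-- The operator in `ℓ²(ℤ²)` with matrix `G_h(n,m;-E)` off the diagonal and `d` on the diagonal. -/
def latOp (h E d : ℝ) : L2Lat →L[ℂ] L2Lat := ∑' k, (latCoef h E d k : ℂ) • latShift h k

theorem hasSum_smul_of_norm_le_one {X : Type*} [NormedAddCommGroup X] [NormedSpace ℂ X]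
    [CompleteSpace X] {V : ℤ × ℤ → X →L[ℂ] X} (hV : ∀ k, ‖V k‖ ≤ 1) {f : ℤ × ℤ → ℝ}
    (hf : Summable fun k => |f k|) : HasSum (fun k => (f k : ℂ) • V k) (∑' k, (f k : ℂ) • V k) := by
  refine Summable.hasSum (Summable.of_norm_bounded hf fun k => ?_)
  rw [norm_smul, Complex.norm_real, Real.norm_eq_abs]
  exact mul_le_of_le_one_right (abs_nonneg _) (hV k)

theorem hasSum_latOp {h E : ℝ} (hh : 0 < h) (hE : 0 < E) (d : ℝ) :
    HasSum (fun k => (latCoef h E d k : ℂ) • latShift h k) (latOp h E d) :=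
  hasSum_smul_of_norm_le_one (norm_latShift_le h) (summable_latCoef hh hE d)

theorem isSelfAdjoint_latOp (h E d : ℝ) : IsSelfAdjoint (latOp h E d) :=
  isSelfAdjoint_tsum (star_latShift h) (latCoef_neg h E d)

theorem hasSum_latOp_apply {h E : ℝ} (hh : 0 < h) (hE : 0 < E) (d : ℝ) (c : L2Lat) (n : ℤ × ℤ) :
    HasSum (fun k => (latCoef h E d k : ℂ) *
      (gaugePhase h (latticePt n) (latticePt (n - k)) * c (n - k))) (latOp h E d c n) := by
  have h1 := (hasSum_latOp hh hE d).mapL (ContinuousLinearMap.apply ℂ L2Lat c)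
  exact h1.mapL (lp.evalCLM ℂ (fun _ : ℤ × ℤ => ℂ) 2 n)

theorem gaugePhase_self (h : ℝ) (x : Plane) : gaugePhase h x x = 1 := by
  simp [gaugePhase]

/-- Reindexing by `m = n - k` exhibits the sum of weighted magnetic translations as a matrix acting
on `c`, with the Green function at the lattice points as its off-diagonal entries. -/
theorem hasSum_latOp_apply' {h E : ℝ} (hh : 0 < h) (hE : 0 < E) (d : ℝ) (c : L2Lat) (n : ℤ × ℤ) :
    HasSum (fun m => if m = n then (0 : ℂ) else c m * greenK h E (latticePt m) (latticePt n))
      (latOp h E d c n - d * c n) := by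
  have h1 := (Equiv.subLeft n).hasSum_iff.2 (hasSum_latOp_apply hh hE d c n)
  have h2 : HasSum (fun m => if m = n then (d : ℂ) * c n else 0) (d * c n) := by
    simpa using hasSum_ite_eq n ((d : ℂ) * c n)
  refine (h1.sub h2).congr_fun fun m => ?_
  simp only [Function.comp, Equiv.subLeft_apply, sub_sub_cancel, latCoef, sub_eq_zero]
  by_cases hm : m = n
  · subst hm
    simp [gaugePhase_self]
  · rw [if_neg hm, if_neg hm, if_neg (Ne.symm hm), greenK, latticePt_sub]
    ring

theorem latOp_add {h E : ℝ} (hh : 0 < h) (hE : 0 < E) (d e : ℝ) (c : L2Lat) (n : ℤ × ℤ) :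
    latOp h E (d + e) c n = latOp h E d c n + e * c n := by
  have := (hasSum_latOp_apply' hh hE (d + e) c n).unique (hasSum_latOp_apply' hh hE d c n)
  push_cast at this
  linear_combination this

/-! ### Sums of Green functions -/

theorem continuousAt_gF {h E r : ℝ} (hh : 0 < h) (hE : 0 < E) (hr : 0 < r) :
    ContinuousAt (gF h E) r := by
  unfold gF
  refine continuousAt_of_dominated (bound := fun s => heatProfile h (r / 2) s * Real.exp (-(E * s)))
    (Eventually.of_forall fun r => ?_) ?_
    (integrableOn_heatProfile_mul_exp hh hE (half_pos hr)) ?_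
  · have := measurable_heatProfile h r
    exact Measurable.aestronglyMeasurable (by fun_prop)
  · filter_upwards [lt_mem_nhds (half_lt_self hr)] with r' hr'
    refine (ae_restrict_mem measurableSet_Ioi).mono fun s hs => ?_
    have h1 := heatProfile_pos hh hs r'
    rw [Real.norm_of_nonneg (by positivity)]
    refine mul_le_mul_of_nonneg_right ?_ (Real.exp_pos _).le
    rw [heatProfile, heatProfile]
    have h2 := hS_pos hh hs
    have h3 := hC_pos hh hs
    have h4 : (r / 2) ^ 2 ≤ r' ^ 2 := by gcongr
    refine mul_le_mul_of_nonneg_left (Real.exp_le_exp.2 ?_) (by positivity)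
    have := mul_le_mul_of_nonneg_left h4 h3.le
    linarith
  · refine Eventually.of_forall fun s => ?_
    unfold heatProfile
    fun_prop

theorem continuousAt_greenK {h E : ℝ} (hh : 0 < h) (hE : 0 < E) {x y : Plane} (hxy : x ≠ y) :
    ContinuousAt (greenK h E y) x := by
  have h1 : ContinuousAt (fun x => gF h E ‖x - y‖) x :=
    ContinuousAt.comp (f := fun x => ‖x - y‖) (g := gF h E)
      (continuousAt_gF hh hE (norm_pos_iff.2 (sub_ne_zero.2 hxy))) (by fun_prop)
  unfold greenK
  exact (continuous_gaugePhase_left h y).continuousAt.mul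
    (Complex.continuous_ofReal.continuousAt.comp h1)

/-- Half the diagonal of the unit cell is `√2/2 < 3/4`, while lattice points are at least `1` apart.
Hence at every point of the plane at most one pole is closer than `1/4`, and all other terms of a
sum of Green functions are uniformly controlled. -/
theorem exists_norm_sub_latticePt_lt (x : Plane) : ∃ n, ‖x - latticePt n‖ < 3 / 4 := by
  refine ⟨(round (x 0), round (x 1)), ?_⟩
  have h0 := abs_sub_round (x 0)
  have h1 := abs_sub_round (x 1)
  refine lt_of_pow_lt_pow_left₀ 2 (by norm_num) ?_
  rw [norm_sq_plane]
  simp only [latticePt, PiLp.sub_apply, Matrix.cons_val_zero, Matrix.cons_val_one]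
  have e0 := sq_le_sq' (by linarith [(abs_le.1 h0).1]) (abs_le.1 h0).2
  have e1 := sq_le_sq' (by linarith [(abs_le.1 h1).1]) (abs_le.1 h1).2
  nlinarith

theorem quarter_lt_norm_sub {x : Plane} {n m : ℤ × ℤ} (hx : ‖x - latticePt n‖ < 3 / 4)
    (hm : m ≠ n) : ‖latticePt m - latticePt n‖ - 3 / 4 ≤ ‖x - latticePt m‖ ∧
      1 / 4 < ‖x - latticePt m‖ := by
  have h1 := one_le_norm_latticePt_sub hm
  have h2 : ‖latticePt m - latticePt n‖ ≤ ‖x - latticePt m‖ + ‖x - latticePt n‖ := by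
    have := norm_sub_le (x - latticePt n) (x - latticePt m)
    rw [sub_sub_sub_cancel_left] at this
    linarith
  constructor <;> linarith

theorem norm_greenK_le_exp {h E : ℝ} (hh : 0 < h) (hE : 0 < E) {x : Plane} {n m : ℤ × ℤ}
    (hx : ‖x - latticePt n‖ < 3 / 4) (hm : m ≠ n) : ‖greenK h E (latticePt m) x‖ ≤
      2 * kG E * Real.exp (√E / 2) * Real.exp (-(√E / 2 * ‖latticePt (m - n)‖)) := by
  obtain ⟨h1, h2⟩ := quarter_lt_norm_sub hx hm
  rw [norm_greenK hh]
  refine (gF_le_exp hh hE h2.le).trans ?_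
  have := kG_nonneg E
  rw [mul_assoc (2 * kG E), ← Real.exp_add]
  refine mul_le_mul_of_nonneg_left (Real.exp_le_exp.2 ?_) (by positivity)
  rw [← latticePt_sub]
  have := Real.sqrt_nonneg E
  nlinarith

/-- The sum of the regular terms near the lattice point `n`. -/
def greenReg (h E : ℝ) (c : ℤ × ℤ → ℂ) (n m : ℤ × ℤ) (x : Plane) : ℂ :=
  if m = n then 0 else c m * greenK h E (latticePt m) x

theorem norm_greenReg_le {h E : ℝ} (hh : 0 < h) (hE : 0 < E) (c : L2Lat) {x : Plane}
    {n : ℤ × ℤ} (hx : ‖x - latticePt n‖ < 3 / 4) (m : ℤ × ℤ) : ‖greenReg h E c n m x‖ ≤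
      ‖c‖ * (2 * kG E * Real.exp (√E / 2)) * Real.exp (-(√E / 2 * ‖latticePt (m - n)‖)) := by
  have := kG_nonneg E
  rw [greenReg]
  split_ifs with hm
  · rw [norm_zero]; positivity
  · rw [norm_mul, mul_assoc]
    exact mul_le_mul (lp.norm_apply_le_norm (by norm_num) c m) (norm_greenK_le_exp hh hE hx hm)
      (norm_nonneg _) (norm_nonneg _)

theorem summable_greenReg_bound {E : ℝ} (hE : 0 < E) (C : ℝ) (n : ℤ × ℤ) :
    Summable fun m : ℤ × ℤ => C * Real.exp (-(√E / 2 * ‖latticePt (m - n)‖)) :=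
  (((Equiv.subRight n).summable_iff (f := fun k => Real.exp (-(√E / 2 * ‖latticePt k‖)))).2
    (summable_exp_neg_norm (by positivity))).mul_left C

theorem summable_greenReg {h E : ℝ} (hh : 0 < h) (hE : 0 < E) (c : L2Lat) {x : Plane}
    {n : ℤ × ℤ} (hx : ‖x - latticePt n‖ < 3 / 4) : Summable fun m => greenReg h E c n m x :=
  Summable.of_norm_bounded (summable_greenReg_bound hE _ n) (norm_greenReg_le hh hE c hx)

theorem continuousAt_tsum_greenReg {h E : ℝ} (hh : 0 < h) (hE : 0 < E) (c : L2Lat) (n : ℤ × ℤ) :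
    ContinuousAt (fun x => ∑' m, greenReg h E c n m x) (latticePt n) := by
  have h1 : ContinuousOn (fun x => ∑' m, greenReg h E c n m x)
      (Metric.ball (latticePt n) (3 / 4)) := by
    refine continuousOn_tsum (fun m => ?_) (summable_greenReg_bound hE _ n) fun m x hx =>
      norm_greenReg_le hh hE c (by simpa [dist_eq_norm] using hx) m
    unfold greenReg
    split_ifs with hm
    · exact continuousOn_const
    · intro x hx
      have hx' : ‖x - latticePt n‖ < 3 / 4 := by simpa [dist_eq_norm] using hx
      have hne : x ≠ latticePt m := by
        rintro rfl
        have := (quarter_lt_norm_sub hx' hm).2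
        simp at this
        linarith
      exact (continuousAt_const.mul (continuousAt_greenK hh hE hne)).continuousWithinAt
  exact h1.continuousAt (Metric.ball_mem_nhds _ (by norm_num))

theorem greenK_term_eq (h E : ℝ) (c : ℤ × ℤ → ℂ) (n m : ℤ × ℤ) (x : Plane) :
    c m * greenK h E (latticePt m) x = greenReg h E c n m x +
      if m = n then c n * greenK h E (latticePt n) x else 0 := by
  rw [greenReg]
  split_ifs with hm
  · rw [hm, zero_add]
  · rw [add_zero]

theorem hasSum_greenK {h E : ℝ} (hh : 0 < h) (hE : 0 < E) (c : L2Lat) {x : Plane}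
    {n : ℤ × ℤ} (hx : ‖x - latticePt n‖ < 3 / 4) :
    HasSum (fun m => c m * greenK h E (latticePt m) x)
      ((∑' m, greenReg h E c n m x) + c n * greenK h E (latticePt n) x) := by
  have h1 : HasSum (fun m => if m = n then c n * greenK h E (latticePt n) x else 0)
      (c n * greenK h E (latticePt n) x) := by
    simpa using hasSum_ite_eq n (c n * greenK h E (latticePt n) x)
  exact ((summable_greenReg hh hE c hx).hasSum.add h1).congr_fun fun m =>
    greenK_term_eq h E c n m x

/-- The boundary behaviour of sums of Green functions. -/
theorem tendsto_tsum_greenK {h E : ℝ} (hh : 0 < h) (hE : 0 < E) (c : L2Lat) (n : ℤ × ℤ) {q : ℝ}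
    (hq : qVal h ((-E : ℝ) : ℂ) = q) :
    Tendsto (fun x : Plane => (∑' m, c m * greenK h E (latticePt m) x) -
        c n / (2 * (Real.pi : ℂ)) * ((Real.log (1 / ‖x - latticePt n‖) : ℝ) : ℂ))
      (𝓝[≠] (latticePt n)) (𝓝 (latOp h E q c n)) := by
  -- All poles but `n` give a continuous sum with an off-diagonal matrix row as its value. The pole
  -- at `n`, freed of its logarithm, contributes `q cₙ`, the diagonal entry.
  have h1 := ((continuousAt_tsum_greenReg hh hE c n).tendsto.mono_left
    (nhdsWithin_le_nhds (s := {latticePt n}ᶜ))).add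
    ((tendsto_greenK_sub_log hh hE (latticePt n)).const_mul (c n))
  have h2 : (∑' m, greenReg h E c n m (latticePt n)) = latOp h E q c n - q * c n :=
    (hasSum_latOp_apply' hh hE q c n).tsum_eq
  rw [h2, hq, mul_comm (c n) (q : ℂ), sub_add_cancel] at h1
  refine h1.congr' ?_
  filter_upwards [nhdsWithin_le_nhds (Metric.ball_mem_nhds (latticePt n)
    (show (0 : ℝ) < 3 / 4 by norm_num))] with x hx
  rw [(hasSum_greenK hh hE c (by simpa [dist_eq_norm] using hx)).tsum_eq]
  ring

/-- The operator `c ↦ ∑ cₘ G(·,m)`. -/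
theorem exists_greenSynth {h E : ℝ} (hh : 0 < h) (hE : 0 < E) :
    ∃ T : L2Lat →L[ℂ] L2Plane, (∀ c, HasSum (fun m => c m • greenL h E m) (T c)) ∧
      (∀ f m, (ContinuousLinearMap.adjoint T f) m =
        ∫ x, conj (greenK h E (latticePt m) x) * f x) ∧
      ∀ c, (fun x => ∑' m, c m * greenK h E (latticePt m) x) =ᵐ[volume] T c := by
  obtain ⟨T, hT1, hT2⟩ := exists_synthesis (X := L2Plane) (e := greenL h E)
    (K := fun k => gramK E * Real.exp (-(√E / 4 * ‖latticePt k‖)))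
    ((summable_exp_neg_norm (by positivity)).mul_left _)
    (fun k => mul_nonneg (gramK_nonneg E) (Real.exp_pos _).le) (fun m n => by
      rw [greenL_eq hh hE, greenL_eq hh hE, inner_toLp_toLp]
      refine (norm_integral_greenK_le hh hE _ _).trans (le_of_eq ?_)
      rw [latticePt_sub])
  refine ⟨T, hT1, fun f m => ?_, fun c => ?_⟩
  · rw [hT2, greenL_eq hh hE, inner_toLp_left]
  · refine ae_eq_of_hasSum (e := fun m => c m • greenL h E m)
      (u := fun m x => c m * greenK h E (latticePt m) x) (fun m => ?_) (hT1 c) ?_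
    · filter_upwards [Lp.coeFn_smul (c m) (greenL h E m), greenL_ae hh hE m] with x h1 h2
      rw [h1, Pi.smul_apply, h2, smul_eq_mul]
    · refine Eventually.of_forall fun x => ?_
      obtain ⟨n, hn⟩ := exists_norm_sub_latticePt_lt x
      exact (hasSum_greenK hh hE c hn).summable.hasSum

/-! ### Bump functions at the lattice points -/

/-- Disjoint supports make the Gram matrix diagonal, and the common profile `p₀` makes its diagonal
constant. Pointwise, at most one term of the sum is nonzero. -/
theorem exists_synthesis_of_disjoint {p : ℤ × ℤ → Plane → ℂ} {p₀ : Plane → ℂ}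
    (hp : ∀ n, MemLp (p n) 2 volume) (hpn : ∀ n x, ‖p n x‖ = ‖p₀ (x - latticePt n)‖)
    (hz : ∀ x, 1 / 4 < ‖x‖ → p₀ x = 0) :
    ∃ T : L2Lat →L[ℂ] L2Plane, (∀ c, HasSum (fun m => c m • (hp m).toLp (p m)) (T c)) ∧
      (∀ f m, (ContinuousLinearMap.adjoint T f) m = ∫ x, conj (p m x) * f x) ∧
      (∀ (c : L2Lat) {n : ℤ × ℤ} {x : Plane}, ‖x - latticePt n‖ < 3 / 4 →
        ∑' m, c m * p m x = c n * p n x) ∧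
      ∀ c : L2Lat, (fun x => ∑' m, c m * p m x) =ᵐ[volume] T c := by
  have hzero : ∀ {n m : ℤ × ℤ} {x : Plane}, ‖x - latticePt n‖ < 3 / 4 → m ≠ n → p m x = 0 := by
    intro n m x hx hm
    rw [← norm_eq_zero, hpn, hz _ (quarter_lt_norm_sub hx hm).2, norm_zero]
  have hsum : ∀ (c : L2Lat) {n : ℤ × ℤ} {x : Plane}, ‖x - latticePt n‖ < 3 / 4 →
      HasSum (fun m => c m * p m x) (c n * p n x) := fun c n x hx =>
    hasSum_single n fun m hm => by rw [hzero hx hm, mul_zero]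
  have hK : Summable fun k : ℤ × ℤ => if k = 0 then ∫ x, ‖p₀ x‖ ^ 2 else 0 :=
    summable_of_hasFiniteSupport ((Set.finite_singleton 0).subset fun k hk => by
      by_contra h0
      simp only [Function.mem_support, mem_singleton_iff] at hk h0
      rw [if_neg h0] at hk
      exact hk rfl)
  obtain ⟨T, hT1, hT2⟩ := exists_synthesis (X := L2Plane) (e := fun m => (hp m).toLp (p m)) hK
    (fun k => by
      split_ifs
      · exact integral_nonneg fun _ => sq_nonneg _
      · exact le_rfl) (fun m n => by
      rw [inner_toLp_toLp]
      split_ifs with hmn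
      · obtain rfl := sub_eq_zero.1 hmn
        refine (norm_integral_le_integral_norm _).trans (le_of_eq ?_)
        rw [← integral_sub_right_eq_self (fun x => ‖p₀ x‖ ^ 2) (latticePt m)]
        refine integral_congr_ae (Eventually.of_forall fun x => ?_)
        simp only
        rw [norm_mul, RCLike.norm_conj, hpn]
        ring
      · rw [integral_eq_zero_of_ae, norm_zero]
        refine Eventually.of_forall fun x => ?_
        simp only [Pi.zero_apply]
        by_cases hx : ‖x - latticePt n‖ < 3 / 4
        · rw [hzero hx (sub_ne_zero.1 hmn), map_zero, zero_mul]
        · have : p n x = 0 := by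
            rw [← norm_eq_zero, hpn, hz _ (by linarith), norm_zero]
          rw [this, mul_zero])
  refine ⟨T, hT1, fun f m => ?_, fun c n x hx => (hsum c hx).tsum_eq, fun c => ?_⟩
  · rw [hT2, inner_toLp_left]
  · refine ae_eq_of_hasSum (u := fun m x => c m * p m x) (fun m => ?_) (hT1 c) ?_
    · filter_upwards [Lp.coeFn_smul (c m) ((hp m).toLp (p m)), (hp m).coeFn_toLp] with x h1 h2
      rw [h1, Pi.smul_apply, h2, smul_eq_mul]
    · refine Eventually.of_forall fun x => ?_
      obtain ⟨n, hn⟩ := exists_norm_sub_latticePt_lt x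
      exact (hsum c hn).summable.hasSum

/-- The bumps are magnetic translates of a single one, so that both `β n` and `(H_h + E) β n` have
translation invariant moduli and `exists_synthesis_of_disjoint` applies to each family. The phase `w
n` restores the value `1` at the lattice point. -/
theorem exists_bump (h E : ℝ) : ∃ (β : ℤ × ℤ → Plane → ℂ) (β₀ β₁ : Plane → ℂ),
    (∀ n, ContDiff ℝ ∞ (β n)) ∧ (∀ n, HasCompactSupport (β n)) ∧
    (∀ n, tsupport (β n) ⊆ Metric.closedBall (latticePt n) (1 / 4)) ∧
    (∀ n, β n (latticePt n) = 1) ∧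
    (∀ n x, ‖β n x‖ = ‖β₀ (x - latticePt n)‖) ∧ (∀ x, 1 / 4 < ‖x‖ → β₀ x = 0) ∧
    (∀ n x, ‖opHE h E (β n) x‖ = ‖β₁ (x - latticePt n)‖) ∧ (∀ x, 1 / 4 < ‖x‖ → β₁ x = 0) := by
  obtain ⟨χ, hχ, hχs, hχ1, hχ2⟩ := exists_cutoff
  set β₀ : Plane → ℂ := fun x => χ ((8 : ℝ) • (x - 0)) * 1 with hβ₀
  have hc : ContDiff ℝ ∞ β₀ := (contDiff_comp_affine hχ 8 0).mul contDiff_const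
  have hev : ∀ x : Plane, 1 / 4 < ‖x‖ → β₀ =ᶠ[𝓝 x] 0 := fun x hx =>
    cutoff_eventuallyEq_zero hχ2 (by norm_num) 0 (by
      rw [Metric.mem_closedBall, dist_zero_right]; norm_num; linarith)
  have hs : HasCompactSupport β₀ := by
    refine HasCompactSupport.of_support_subset_isCompact (isCompact_closedBall 0 (1 / 4))
      fun x hx => ?_
    by_contra hxb
    rw [Metric.mem_closedBall, dist_zero_right, not_le] at hxb
    exact hx (hev x hxb).eq_of_nhds
  have h0 : β₀ 0 = 1 := by simp [hβ₀, hχ1]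
  set w : ℤ × ℤ → ℂ := fun n =>
    Complex.exp (Complex.I * h * latticePt n 1 * latticePt n 0) with hw
  have hwn : ∀ n, ‖w n‖ = 1 := by
    intro n
    rw [hw]
    simp only
    rw [show Complex.I * h * latticePt n 1 * latticePt n 0 =
      ((h * latticePt n 1 * latticePt n 0 : ℝ) : ℂ) * Complex.I by push_cast; ring,
      Complex.norm_exp_ofReal_mul_I]
  set β : ℤ × ℤ → Plane → ℂ := fun n x => w n * magTranslate h (latticePt n) β₀ x with hβ
  have hn : ∀ n x, ‖β n x‖ = ‖β₀ (x - latticePt n)‖ := fun n x => by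
    rw [hβ]; simp only; rw [norm_mul, hwn, one_mul, norm_magTranslate]
  refine ⟨β, β₀, opHE h E β₀, fun n => contDiff_const.mul (contDiff_magTranslate hc h _),
    fun n => (hasCompactSupport_magTranslate hs h _).mul_left, fun n => ?_, fun n => ?_, hn,
    fun x hx => (hev x hx).eq_of_nhds, fun n x => ?_, fun x hx => opHE_eq_zero (hev x hx) h E⟩
  · refine closure_minimal (fun x hx => ?_) Metric.isClosed_closedBall
    by_contra hxb
    rw [Metric.mem_closedBall, dist_eq_norm, not_le] at hxb
    refine hx ?_
    rw [← norm_eq_zero, hn, (hev _ hxb).eq_of_nhds]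
    simp
  · simp only [hβ, hw, magTranslate, sub_self, h0, mul_one]
    rw [← Complex.exp_add]
    simp
  · rw [hβ]
    simp only
    rw [opHE_const_mul (contDiff_magTranslate hc h _), norm_mul, hwn, one_mul, opHE,
      landau_magTranslate hc, ← norm_magTranslate h (latticePt n) (opHE h E β₀) x]
    congr 1
    simp only [magTranslate, opHE]
    ring

/-! ### Krein's formula -/

theorem hasSum_integral_conj {e : ℤ × ℤ → L2Plane} {F : L2Plane} (he : HasSum e F)
    {ψ : Plane → ℂ} (hψ : MemLp ψ 2 volume) :
    HasSum (fun m => ∫ x, conj (ψ x) * e m x) (∫ x, conj (ψ x) * F x) := by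
  have := he.mapL (innerSL ℂ (hψ.toLp ψ))
  simpa only [innerSL_apply_apply, inner_toLp_left] using this

theorem memLp_opHE {φ : Plane → ℂ} (hφ : ContDiff ℝ ∞ φ) (hs : HasCompactSupport φ) (h E : ℝ) :
    MemLp (opHE h E φ) 2 volume :=
  memLp_of_contDiff (contDiff_opHE hφ h E) (hasCompactSupport_opHE hs h E)

theorem hasSum_integral_opHE_green {h E : ℝ} (hh : 0 < h) (hE : 0 < E) {c : L2Lat} {F : L2Plane}
    (hF : HasSum (fun m => c m • greenL h E m) F) {φ : Plane → ℂ} (hφ : ContDiff ℝ ∞ φ)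
    (hs : HasCompactSupport φ) :
    HasSum (fun m => c m * conj (φ (latticePt m))) (∫ x, conj (opHE h E φ x) * F x) := by
  have := hasSum_integral_conj hF (memLp_opHE hφ hs h E)
  simpa only [pairing_smul, integral_conj_opHE_greenL hφ hs hh hE] using this

theorem integral_opHE_green_test {h E : ℝ} (hh : 0 < h) (hE : 0 < E) {c : L2Lat} {F : L2Plane}
    (hF : HasSum (fun m => c m • greenL h E m) F) {φ : Plane → ℂ} (hφ : IsTest φ) :
    ∫ x, conj (opHE h E φ x) * F x = 0 := by
  refine (hasSum_integral_opHE_green hh hE hF hφ.1 hφ.2.1).unique ?_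
  refine hasSum_zero.congr_fun fun m => ?_
  have : latticePt m ∉ tsupport φ := fun hm => hφ.2.2 hm ⟨m, rfl⟩
  rw [image_eq_zero_of_notMem_tsupport this, map_zero, mul_zero]

theorem integral_opHE_green_local {h E : ℝ} (hh : 0 < h) (hE : 0 < E) {c : L2Lat} {F : L2Plane}
    (hF : HasSum (fun m => c m • greenL h E m) F) {φ : Plane → ℂ} (hφ : ContDiff ℝ ∞ φ)
    (hs : HasCompactSupport φ) {n : ℤ × ℤ}
    (hsub : tsupport φ ⊆ Metric.closedBall (latticePt n) (1 / 4)) :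
    ∫ x, conj (opHE h E φ x) * F x = c n * conj (φ (latticePt n)) := by
  refine (hasSum_integral_opHE_green hh hE hF hφ hs).unique (hasSum_single n fun m hm => ?_)
  have : latticePt m ∉ tsupport φ := fun h' => by
    have h1 := one_le_norm_latticePt_sub hm
    have h2 := hsub h'
    rw [Metric.mem_closedBall, dist_eq_norm] at h2
    linarith
  rw [image_eq_zero_of_notMem_tsupport this, map_zero, mul_zero]

theorem ham_weak {h α : ℝ} (f : (ham h α).domain) : WeakLandau h (f : L2Plane) (ham h α f) :=
  f.2.1.choose_spec

theorem ham_weakHE {h α E : ℝ} (f : (ham h α).domain) :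
    WeakHE h E (f : L2Plane) (ham h α f - ((-E : ℝ) : ℂ) • (f : L2Plane)) := by
  have := (weakHE_iff (E := E)).2 (ham_weak f)
  convert this using 1
  push_cast
  rw [neg_smul, sub_neg_eq_add]

theorem ham_sub_eq {h α E : ℝ} {f G : L2Plane} (hw : WeakHE h E f G) (hb : PointBC α f) :
    ∃ f' : (ham h α).domain, (f' : L2Plane) = f ∧
      ham h α f' - ((-E : ℝ) : ℂ) • (f' : L2Plane) = G := by
  have e : G = (G - (E : ℂ) • f) + (E : ℂ) • f := by simp
  have hw' : WeakLandau h f (G - (E : ℂ) • f) := by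
    rw [e] at hw
    exact weakHE_iff.1 hw
  refine ⟨⟨f, ⟨_, hw'⟩, hb⟩, rfl, ?_⟩
  have : ham h α ⟨f, ⟨_, hw'⟩, hb⟩ = G - (E : ℂ) • f := (ham_weak _).unique hw'
  rw [this]
  push_cast
  simp

theorem qVal_im {h E : ℝ} (hE : 0 < E) :
    qVal h ((-E : ℝ) : ℂ) = (((qVal h ((-E : ℝ) : ℂ)).re : ℝ) : ℂ) := by
  have h1 : rhoFun h ((-E : ℝ) : ℂ) =
      ((∫ s in Ioi (0 : ℝ), Real.exp (-E * s) * (hS h s - 1 / s) : ℝ) : ℂ) := by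
    rw [rhoFun, ← integral_complex_ofReal]
    refine integral_congr_ae (Eventually.of_forall fun s => ?_)
    simp
  have h2 : qVal h ((-E : ℝ) : ℂ) = ((1 / (4 * Real.pi) * (frullaniConst - Real.log E +
      ∫ s in Ioi (0 : ℝ), Real.exp (-E * s) * (hS h s - 1 / s)) : ℝ) : ℂ) := by
    rw [qVal, h1, ← Complex.ofReal_neg, neg_neg, ← Complex.ofReal_log hE.le]
    push_cast
    ring
  rw [h2, Complex.ofReal_re]

/-- Limits at a point of functions that agree almost everywhere coincide. -/
theorem tendsto_unique_of_ae {u v : Plane → ℂ} (huv : u =ᵐ[volume] v) {y : Plane} {b b' : ℂ}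
    (hu : Tendsto u (𝓝[≠] y) (𝓝 b)) (hv : Tendsto v (𝓝[≠] y) (𝓝 b')) : b = b' := by
  have h1 : Tendsto (fun x => u x - v x) (𝓝[≠] y) (𝓝 (b - b')) := hu.sub hv
  refine sub_eq_zero.1 ?_
  by_contra hne
  have hev := h1.eventually_ne hne
  rw [eventually_nhdsWithin_iff] at hev
  obtain ⟨s, hs, hso, hys⟩ := eventually_nhds_iff.1 hev
  have hpos : 0 < volume s := hso.measure_pos volume ⟨y, hys⟩
  have hall : ∀ᵐ x, x ∉ s := by
    filter_upwards [huv, ae_ne y] with x hx hxy hxs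
    exact hs x hxs hxy (sub_eq_zero.2 hx)
  rw [ae_iff] at hall
  simp only [not_not, ofPred_mem_eq] at hall
  exact hpos.ne' hall

theorem tendsto_log_unique_of_ae {u v : Plane → ℂ} (huv : u =ᵐ[volume] v) {y : Plane} {a b b' : ℂ}
    (hu : Tendsto (fun x => u x - a / (2 * (Real.pi : ℂ)) *
      ((Real.log (1 / ‖x - y‖) : ℝ) : ℂ)) (𝓝[≠] y) (𝓝 b))
    (hv : Tendsto (fun x => v x - a / (2 * (Real.pi : ℂ)) *
      ((Real.log (1 / ‖x - y‖) : ℝ) : ℂ)) (𝓝[≠] y) (𝓝 b')) : b = b' := by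
  refine tendsto_unique_of_ae ?_ hu hv
  filter_upwards [huv] with x hx
  rw [hx]

/-- `-E` is in the resolvent set of `H_{h,α}` if and only if the lattice operator is bounded from
below. -/
theorem mem_resolventSetP_ham_iff {h E α q : ℝ} (hh : 0 < h) (hE : 0 < E) (hα : α ≠ 0)
    (hq : qVal h ((-E : ℝ) : ℂ) = q) :
    ((-E : ℝ) : ℂ) ∈ resolventSetP (ham h α) ↔
      ∃ κ > 0, ∀ c, κ * ‖c‖ ≤ ‖latOp h E (q + α⁻¹) c‖ := by
  obtain ⟨T, hT, hTa, hTv⟩ := exists_greenSynth hh hE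
  obtain ⟨β, β₀, β₁, hβc, hβs, hβt, hβ1, hβ₀, hβ₀z, hβ₁, hβ₁z⟩ := exists_bump h E
  -- `S` interpolates prescribed values at the lattice points by smooth bumps, `S'` is its image
  -- under `H_h + E`, and the adjoint of `S'` will read off logarithmic coefficients.
  obtain ⟨S, hS1, hSa, hSl, hSv⟩ := exists_synthesis_of_disjoint
    (fun n => memLp_of_contDiff (hβc n) (hβs n)) hβ₀ hβ₀z
  obtain ⟨S', hS'1, hS'a, -, -⟩ := exists_synthesis_of_disjoint
    (fun n => memLp_opHE (hβc n) (hβs n) h E) hβ₁ hβ₁z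
  have hαc : (α : ℂ) ≠ 0 := by exact_mod_cast hα
  set A := latOp h E (q + α⁻¹) with hA
  have hAq : ∀ c n, A c n = latOp h E q c n + (α : ℂ)⁻¹ * c n := by
    intro c n
    rw [hA, latOp_add hh hE]
    push_cast
    rfl
  constructor
  · rintro ⟨R, hR1, hR2⟩
    set P := ‖ContinuousLinearMap.adjoint S'‖ * (‖R‖ * ‖S'‖ + ‖S‖) + 1 with hP
    have hP0 : 0 < P := by positivity
    refine ⟨P⁻¹, inv_pos.2 hP0, fun c => ?_⟩
    -- Pairing `(H_h + E) β n` with `∑ cₘ G(·,m)` evaluates `β n` at the poles and returns `cₙ`. So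
    -- `T` has a bounded left inverse.
    have hc : ContinuousLinearMap.adjoint S' (T c) = c := by
      ext n
      rw [hS'a, integral_opHE_green_local hh hE (hT c) (hβc n) (hβs n) (hβt n), hβ1]
      simp
    have hSw : WeakHE h E (S (A c)) (S' (A c)) := by
      intro φ hφ
      refine (hasSum_integral_conj (hS1 (A c)) (memLp_opHE hφ.1 hφ.2.1 h E)).unique ?_
      refine (hasSum_integral_conj (hS'1 (A c)) (memLp_of_contDiff hφ.1 hφ.2.1)).congr_fun
        fun m => ?_
      rw [pairing_smul, pairing_smul]
      congr 1
      have e1 := integral_conj_opHE_comm hφ.1 hφ.2.1 (hβc m) h E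
      rw [integral_congr_ae (g := fun x => conj (opHE h E φ x) * β m x) ?_, e1]
      · refine integral_congr_ae ?_
        filter_upwards [(memLp_opHE (hβc m) (hβs m) h E).coeFn_toLp] with x hx
        rw [hx]
      · filter_upwards [(memLp_of_contDiff (hβc m) (hβs m)).coeFn_toLp] with x hx
        rw [hx]
    have hTw : WeakHE h E (T c) 0 := by
      intro φ hφ
      rw [integral_opHE_green_test hh hE (hT c) hφ]
      have := pairing_smul φ 0 0
      rw [zero_smul, zero_mul] at this
      exact this.symm
    -- Correcting `T c` by `S (A c)` changes its regular values from `(latOp h E q) c` to `-α⁻¹ c`,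
    -- so the result lies in the domain. Its image under `H + E` has norm controlled by `A c`, and
    -- the resolvent then bounds `T c`, hence `c`, by `A c`.
    have hw : WeakHE h E (T c + (-1 : ℂ) • S (A c)) (0 + (-1 : ℂ) • S' (A c)) := by
      intro φ hφ
      rw [pairing_add (continuous_opHE hφ.1 h E) (hasCompactSupport_opHE hφ.2.1 h E),
        pairing_add hφ.1.continuous hφ.2.1, pairing_smul, pairing_smul, hTw φ hφ, hSw φ hφ]
    have hb : PointBC α (T c + (-1 : ℂ) • S (A c)) := by
      refine ⟨fun x => (∑' m, c m * greenK h E (latticePt m) x) + -1 * ∑' m, A c m * β m x,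
        c, fun n => latOp h E q c n - A c n, ?_, fun n => ⟨?_, ?_⟩⟩
      · filter_upwards [hTv c, hSv (A c), Lp.coeFn_add (T c) ((-1 : ℂ) • S (A c)),
          Lp.coeFn_smul (-1 : ℂ) (S (A c))] with x h1 h2 h3 h4
        rw [h3, Pi.add_apply, h4, Pi.smul_apply, ← h1, ← h2, smul_eq_mul]
      · have h2 : Tendsto (fun x => ∑' m, A c m * β m x) (𝓝[≠] (latticePt n)) (𝓝 (A c n)) := by
          have h3 : Tendsto (fun x => A c n * β n x) (𝓝[≠] (latticePt n)) (𝓝 (A c n)) := by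
            have := ((continuous_const.mul (hβc n).continuous).tendsto
              (latticePt n)).mono_left (nhdsWithin_le_nhds (s := {latticePt n}ᶜ))
              (f := fun x => A c n * β n x)
            simpa [hβ1] using this
          refine h3.congr' ?_
          filter_upwards [nhdsWithin_le_nhds (Metric.ball_mem_nhds (latticePt n)
            (show (0 : ℝ) < 3 / 4 by norm_num))] with x hx
          exact (hSl (A c) (by simpa [dist_eq_norm] using hx)).symm
        refine ((tendsto_tsum_greenK hh hE c n hq).sub h2).congr fun x => ?_
        ring
      · simp only [hAq]
        field_simp
        ring
    obtain ⟨f, hf1, hf2⟩ := ham_sub_eq hw hb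
    have hRf := hR2 f
    rw [hf2, hf1, zero_add] at hRf
    have n1 : ‖T c‖ ≤ (‖R‖ * ‖S'‖ + ‖S‖) * ‖A c‖ := by
      have e : T c = R ((-1 : ℂ) • S' (A c)) + S (A c) := by
        rw [hRf]; simp
      rw [e]
      refine (norm_add_le _ _).trans ?_
      have b1 := R.le_opNorm ((-1 : ℂ) • S' (A c))
      have b2 := S'.le_opNorm (A c)
      have b3 := S.le_opNorm (A c)
      rw [norm_smul, norm_neg, norm_one, one_mul] at b1
      have b4 := mul_le_mul_of_nonneg_left b2 (norm_nonneg R)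
      nlinarith
    have n2 : ‖c‖ ≤ P * ‖A c‖ := by
      have b1 := (ContinuousLinearMap.adjoint S').le_opNorm (T c)
      rw [hc] at b1
      have b2 := mul_le_mul_of_nonneg_left n1 (norm_nonneg (ContinuousLinearMap.adjoint S'))
      have := norm_nonneg (A c)
      rw [hP]
      nlinarith
    rw [inv_mul_eq_div, div_le_iff₀ hP0]
    linarith
  · rintro ⟨κ, hκ, hb⟩
    have hU := isUnit_of_isSelfAdjoint_of_bounded_below
      (isSelfAdjoint_latOp h E (q + α⁻¹)) hκ hb
    obtain ⟨U, hU⟩ := hU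
    set B : L2Lat →L[ℂ] L2Lat := ↑U⁻¹ with hB
    have hAB : ∀ c, A (B c) = c := by
      intro c
      rw [hA, ← hU, ← mul_apply_eq_comp, hB, Units.mul_inv]
      rfl
    refine mem_resolventSetP_of_bijective
      (C := ‖T‖ * ‖B‖ * ‖ContinuousLinearMap.adjoint T‖ + E⁻¹) (fun g => ?_) fun f hf => ?_
    · obtain ⟨f₀, u, hf₀, huc, hu, hug, hw₀⟩ := exists_weak_solution hh hE g
      -- Krein's formula: the resolvent applied to `g` is `f₀ - T A⁻¹ T* g`, with `f₀` the solution
      -- on the plane. Indeed `T* g` is the sequence of values of `f₀` on the lattice, so `A c`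
      -- equals these values, which is the boundary condition.
      set c := B (ContinuousLinearMap.adjoint T g) with hc
      have hAc : ∀ n, A c n = u (latticePt n) := by
        intro n
        rw [hc, hAB, hTa, hug]
      have hw : WeakHE h E ((-1 : ℂ) • T c + f₀) g := by
        intro φ hφ
        rw [pairing_add (continuous_opHE hφ.1 h E) (hasCompactSupport_opHE hφ.2.1 h E),
          pairing_smul, integral_opHE_green_test hh hE (hT c) hφ, mul_zero, zero_add,
          hw₀ φ hφ.1 hφ.2.1]
      have hbc : PointBC α ((-1 : ℂ) • T c + f₀) := by
        refine ⟨fun x => -1 * (∑' m, c m * greenK h E (latticePt m) x) + u x,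
          fun n => -c n, fun n => -latOp h E q c n + u (latticePt n), ?_, fun n => ⟨?_, ?_⟩⟩
        · filter_upwards [hTv c, hu, Lp.coeFn_add ((-1 : ℂ) • T c) f₀,
            Lp.coeFn_smul (-1 : ℂ) (T c)] with x h1 h2 h3 h4
          rw [h3, Pi.add_apply, h4, Pi.smul_apply, ← h1, h2, smul_eq_mul]
        · have h2 := (huc.tendsto (latticePt n)).mono_left
            (nhdsWithin_le_nhds (s := {latticePt n}ᶜ))
          refine ((tendsto_tsum_greenK hh hE c n hq).neg.add h2).congr fun x => ?_
          ring
        · simp only [← hAc, hAq]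
          field_simp
          ring
      obtain ⟨f, hf1, hf2⟩ := ham_sub_eq hw hbc
      refine ⟨f, hf2, ?_⟩
      rw [hf1]
      refine (norm_add_le _ _).trans ?_
      rw [norm_smul, norm_neg, norm_one, one_mul]
      have b1 := T.le_opNorm c
      have b2 := B.le_opNorm (ContinuousLinearMap.adjoint T g)
      have b3 := (ContinuousLinearMap.adjoint T).le_opNorm g
      have b4 := mul_le_mul_of_nonneg_left b2 (norm_nonneg T)
      have b5 := mul_le_mul_of_nonneg_left b3 (mul_nonneg (norm_nonneg T) (norm_nonneg B))
      rw [← hc] at b4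
      nlinarith
    · have hwf := ham_weakHE (E := E) f
      rw [hf] at hwf
      obtain ⟨u, a, b, huf, hab⟩ := f.2.2
      have hzero : ∀ φ : Plane → ℂ, ∫ x, conj (φ x) * (0 : L2Plane) x = 0 := by
        intro φ
        have := pairing_smul φ 0 0
        rwa [zero_smul, zero_mul] at this
      have hloc : ∀ (n : ℤ × ℤ) (φ : Plane → ℂ), ContDiff ℝ ∞ φ → HasCompactSupport φ →
          tsupport φ ⊆ Metric.closedBall (latticePt n) (1 / 4) →
          ∫ x, conj (opHE h E φ x) * (f : L2Plane) x = a n * conj (φ (latticePt n)) := by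
        intro n φ hφ hs hsub
        rw [integral_conj_opHE_local hh hE hwf huf (hab n).1 hφ hs hsub, hzero, zero_add]
      -- The logarithmic coefficients of `f` are given only as numbers. Reading them off by a
      -- bounded operator shows that they form a square summable sequence.
      set c := ContinuousLinearMap.adjoint S' (f : L2Plane) with hc
      have hca : ∀ n, c n = a n := by
        intro n
        rw [hc, hS'a, hloc n _ (hβc n) (hβs n) (hβt n), hβ1]
        simp
      have hfT : (f : L2Plane) = T c := by
        have h0 := ae_eq_zero_of_orthogonal (f := ((f : L2Plane) + (-1 : ℂ) • T c : L2Plane))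
          (Lp.memLp _) hh hE fun φ hφ hs => by
            refine integral_conj_opHE_eq_zero_of_local (fun φ hφ => ?_) (fun n φ hφ hs hsub => ?_)
              hφ hs
            · rw [pairing_add (continuous_opHE hφ.1 h E) (hasCompactSupport_opHE hφ.2.1 h E),
                pairing_smul, integral_opHE_green_test hh hE (hT c) hφ, hwf φ hφ, hzero]
              ring
            · rw [pairing_add (continuous_opHE hφ h E) (hasCompactSupport_opHE hs h E),
                pairing_smul, integral_opHE_green_local hh hE (hT c) hφ hs hsub,
                hloc n φ hφ hs hsub, hca]
              ring
        have h1 : (f : L2Plane) + (-1 : ℂ) • T c = 0 :=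
          Lp.ext (h0.trans (Lp.coeFn_zero ℂ 2 volume).symm)
        rw [neg_smul, one_smul, ← sub_eq_add_neg, sub_eq_zero] at h1
        exact h1
      -- Since `f = T c`, the regular values of `f` are those computed by the lattice operator, and
      -- the boundary condition says that `A c` vanishes.
      have hAc : A c = 0 := by
        ext n
        have h1 := tendsto_tsum_greenK hh hE c n hq
        have h2 := (hab n).1
        rw [← hca] at h2
        have hb : b n = latOp h E q c n := tendsto_log_unique_of_ae (by
          filter_upwards [huf, hTv c] with x hx1 hx2
          rw [hx1, hx2, hfT]) h2 h1
        have h3 := (hab n).2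
        rw [hAq, ← hb, hca]
        simp only [lp.coeFn_zero, Pi.zero_apply]
        field_simp
        linear_combination h3
      have hc0 : c = 0 := by
        have := hb c
        rw [hAc, norm_zero] at this
        have := norm_nonneg c
        rw [← norm_eq_zero]
        nlinarith
      rw [hc0, map_zero] at hfT
      exact Subtype.ext hfT

/-! ### Weyl operators -/

/-- `f ↦ e^{i k₁ x + i k₁ k₂ h / 2} f (x + k₂ h)` on functions. -/
def weylFun (h : ℝ) (k : ℤ × ℤ) (f : ℝ → ℂ) (x : ℝ) : ℂ :=
  Complex.exp (Complex.I * ((k.1 * x + k.1 * k.2 * h / 2 : ℝ) : ℂ)) * f (x + k.2 * h)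

theorem norm_weylFun (h : ℝ) (k : ℤ × ℤ) (f : ℝ → ℂ) (x : ℝ) :
    ‖weylFun h k f x‖ = ‖f (x + k.2 * h)‖ := by
  rw [weylFun, norm_mul, mul_comm Complex.I, Complex.norm_exp_ofReal_mul_I, one_mul]

theorem aestronglyMeasurable_weylFun {f : ℝ → ℂ} (hf : AEStronglyMeasurable f volume) (h : ℝ)
    (k : ℤ × ℤ) : AEStronglyMeasurable (weylFun h k f) volume :=
  (Continuous.aestronglyMeasurable (by fun_prop)).mul
    (hf.comp_measurePreserving (measurePreserving_add_right volume ((k.2 : ℝ) * h)))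

theorem eLpNorm_weylFun {f : ℝ → ℂ} (hf : AEStronglyMeasurable f volume) (h : ℝ) (k : ℤ × ℤ) :
    eLpNorm (weylFun h k f) 2 volume = eLpNorm f 2 volume := by
  rw [← eLpNorm_comp_measurePreserving hf (measurePreserving_add_right volume ((k.2 : ℝ) * h))]
  exact eLpNorm_congr_norm_ae (Eventually.of_forall fun x => norm_weylFun h k f x)

theorem memLp_weylFun {f : ℝ → ℂ} (hf : MemLp f 2 volume) (h : ℝ) (k : ℤ × ℤ) :
    MemLp (weylFun h k f) 2 volume :=
  ⟨aestronglyMeasurable_weylFun hf.1 h k, by rw [eLpNorm_weylFun hf.1]; exact hf.2⟩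

theorem weylFun_congr_ae {f g : ℝ → ℂ} (hfg : f =ᵐ[volume] g) (h : ℝ) (k : ℤ × ℤ) :
    weylFun h k f =ᵐ[volume] weylFun h k g := by
  filter_upwards [(measurePreserving_add_right volume
    ((k.2 : ℝ) * h)).quasiMeasurePreserving.ae hfg] with x hx
  rw [weylFun, weylFun, hx]

/-- The Weyl operator, the quantization of `e^{i(k₁ x + k₂ p)}`. -/
def weylOp (h : ℝ) (k : ℤ × ℤ) : L2Line →ₗᵢ[ℂ] L2Line where
  toFun f := (memLp_weylFun (Lp.memLp f) h k).toLp _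
  map_add' f g := by
    rw [← MemLp.toLp_add]
    refine MemLp.toLp_congr _ _ ((weylFun_congr_ae (Lp.coeFn_add f g) h k).trans
      (Eventually.of_forall fun x => ?_))
    simp only [weylFun, Pi.add_apply, mul_add]
  map_smul' c f := by
    rw [RingHom.id_apply, ← MemLp.toLp_const_smul]
    refine MemLp.toLp_congr _ _ ((weylFun_congr_ae (Lp.coeFn_smul c f) h k).trans
      (Eventually.of_forall fun x => ?_))
    simp only [weylFun, Pi.smul_apply, smul_eq_mul]
    ring
  norm_map' f := by
    simp only [LinearMap.coe_mk, AddHom.coe_mk]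
    rw [Lp.norm_toLp, eLpNorm_weylFun (Lp.aestronglyMeasurable f), Lp.norm_def]

theorem weylOp_ae (h : ℝ) (k : ℤ × ℤ) (f : L2Line) :
    weylOp h k f =ᵐ[volume] weylFun h k f :=
  (memLp_weylFun (Lp.memLp f) h k).coeFn_toLp

/-- The cocycle here is the symplectic one, `e^{-ih(j₁k₂ - j₂k₁)/2}`. It differs from that of the
lattice translations, written in the Landau gauge, only by the coboundary of `halfGauge`. -/
theorem weylOp_weylOp (h : ℝ) (j k : ℤ × ℤ) (f : L2Line) : weylOp h j (weylOp h k f) =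
    Complex.exp (-(Complex.I * ((h * (j.1 * k.2 - j.2 * k.1) / 2 : ℝ) : ℂ))) •
      weylOp h (j + k) f := by
  refine Lp.ext ?_
  refine (weylOp_ae h j _).trans ((weylFun_congr_ae (weylOp_ae h k f) h j).trans ?_)
  refine EventuallyEq.trans ?_ (Lp.coeFn_smul _ _).symm
  filter_upwards [weylOp_ae h (j + k) f] with x hx
  rw [Pi.smul_apply, hx, smul_eq_mul]
  simp only [weylFun]
  rw [← mul_assoc, ← mul_assoc, ← Complex.exp_add, ← Complex.exp_add]
  congr 2
  · push_cast [Prod.fst_add, Prod.snd_add]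
    ring
  · push_cast [Prod.snd_add]
    ring

theorem weylOp_zero (h : ℝ) (f : L2Line) : weylOp h 0 f = f := by
  refine Lp.ext ?_
  filter_upwards [weylOp_ae h 0 f] with x hx
  rw [hx]
  simp [weylFun]

theorem star_weylOp (h : ℝ) (k : ℤ × ℤ) :
    star (weylOp h k).toContinuousLinearMap = (weylOp h (-k)).toContinuousLinearMap := by
  rw [ContinuousLinearMap.star_eq_adjoint]
  symm
  rw [ContinuousLinearMap.eq_adjoint_iff]
  intro f g
  have h1 : weylOp h k (weylOp h (-k) f) = f := by
    rw [weylOp_weylOp, add_neg_cancel, weylOp_zero]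
    have : (k.1 * ((-k).2 : ℤ) - k.2 * ((-k).1 : ℤ) : ℝ) = 0 := by simp; ring
    rw [this]
    simp
  conv_rhs => rw [← h1]
  exact ((weylOp h k).inner_map_map _ _).symm

theorem norm_weylOp_le (h : ℝ) (k : ℤ × ℤ) : ‖(weylOp h k).toContinuousLinearMap‖ ≤ 1 :=
  (weylOp h k).norm_toContinuousLinearMap_le

/-- The half gauge `e^{i h m₁ m₂ / 2}`. -/
def halfGauge (h : ℝ) (m : ℤ × ℤ) : ℂ :=
  Complex.exp (Complex.I * ((h * (m.1 * m.2) / 2 : ℝ) : ℂ))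

theorem norm_halfGauge (h : ℝ) (m : ℤ × ℤ) : ‖halfGauge h m‖ = 1 := by
  rw [halfGauge, mul_comm, Complex.norm_exp_ofReal_mul_I]

/-- After multiplication by the half gauge, the Weyl operators move the orbit of any vector exactly
as `latShift` moves the standard basis of `ℓ²(ℤ²)`. -/
theorem weylOp_halfGauge_smul (h : ℝ) (k m : ℤ × ℤ) (v : L2Line) :
    weylOp h k (halfGauge h m • weylOp h m v) =
      gaugePhase h (latticePt (m + k)) (latticePt m) •
        (halfGauge h (m + k) • weylOp h (m + k) v) := by
  rw [map_smul, weylOp_weylOp, add_comm k m, smul_smul, smul_smul, halfGauge, halfGauge,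
    gaugePhase, ← Complex.exp_add, ← Complex.exp_add]
  congr 2
  simp only [latticePt, Prod.fst_add, Prod.snd_add, Matrix.cons_val_zero, Matrix.cons_val_one,
    Int.cast_add]
  push_cast
  ring

/-- The dual intertwining: the sequence `n ↦ conj (halfGauge n) • weylOp (-n) v`, as a vector-valued
function on the lattice, turns a Weyl operator acting on `v` into a lattice translation acting on
the sequence. -/
theorem conj_halfGauge_smul_weylOp (h : ℝ) (n k : ℤ × ℤ) (v : L2Line) :
    conj (halfGauge h n) • weylOp h (-n) (weylOp h k v) =
      gaugePhase h (latticePt n) (latticePt (n - k)) •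
        (conj (halfGauge h (n - k)) • weylOp h (-(n - k)) v) := by
  rw [weylOp_weylOp, smul_smul, smul_smul, halfGauge, halfGauge, ← Complex.exp_conj,
    ← Complex.exp_conj, gaugePhase, ← Complex.exp_add, ← Complex.exp_add]
  have e : -n + k = -(n - k) := by abel
  rw [e]
  congr 2
  simp only [latticePt, Prod.fst_sub, Prod.snd_sub, Matrix.cons_val_zero, Matrix.cons_val_one,
    Int.cast_sub, Prod.fst_neg, Prod.snd_neg, Int.cast_neg, map_mul, Complex.conj_I,
    Complex.conj_ofReal]
  push_cast
  ring

/-! ### Chirps -/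

/-- The normalized chirp on `[0, R]`. -/
def chirp (t R : ℝ) (x : ℝ) : ℂ :=
  (Icc 0 R).indicator (fun x => ((√R)⁻¹ : ℂ) * Complex.exp (Complex.I * ((t * x ^ 2 / 2 : ℝ) : ℂ))) x

theorem memLp_chirp (t R : ℝ) : MemLp (chirp t R) 2 volume := by
  have hc : Continuous fun x : ℝ => ((√R)⁻¹ : ℂ) * Complex.exp (Complex.I * ((t * x ^ 2 / 2 : ℝ) : ℂ)) := by
    fun_prop
  refine (memLp_indicator_iff_restrict measurableSet_Icc).2 ?_
  obtain ⟨B, hB⟩ := isCompact_Icc.exists_bound_of_continuousOn (hc.continuousOn (s := Icc 0 R))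
  exact MemLp.of_bound hc.aestronglyMeasurable B
    ((ae_restrict_mem measurableSet_Icc).mono fun x hx => hB x hx)

theorem inner_toLp_line {f g : ℝ → ℂ} (hf : MemLp f 2 volume) (hg : MemLp g 2 volume) :
    inner ℂ (hf.toLp f) (hg.toLp g) = ∫ x, conj (f x) * g x := by
  rw [L2.inner_def]
  refine integral_congr_ae ?_
  filter_upwards [hf.coeFn_toLp, hg.coeFn_toLp] with x h1 h2
  rw [h1, h2, RCLike.inner_apply, mul_comm]

theorem norm_integral_exp_le {θ : ℝ} (hθ : θ ≠ 0) (a b : ℝ) :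
    ‖∫ x in Icc a b, Complex.exp (Complex.I * θ * x)‖ ≤ 2 / |θ| := by
  rcases lt_or_ge b a with hab | hab
  · rw [Icc_eq_empty (not_le.2 hab), setIntegral_empty, norm_zero]
    positivity
  have hc : Complex.I * (θ : ℂ) ≠ 0 := mul_ne_zero Complex.I_ne_zero (by exact_mod_cast hθ)
  rw [integral_Icc_eq_integral_Ioc, ← intervalIntegral.integral_of_le hab,
    integral_exp_mul_complex hc, norm_div, norm_mul, Complex.norm_I, one_mul, Complex.norm_real,
    Real.norm_eq_abs]
  have hn : ∀ x : ℝ, ‖Complex.exp (Complex.I * θ * x)‖ = 1 := by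
    intro x
    rw [show Complex.I * θ * x = ((θ * x : ℝ) : ℂ) * Complex.I by push_cast; ring,
      Complex.norm_exp_ofReal_mul_I]
  gcongr
  refine (norm_sub_le _ _).trans ?_
  rw [hn, hn]
  norm_num

/-- On the overlap of the two intervals the quadratic phases cancel, leaving a pure oscillation of
frequency `θ = k₁ + t k₂ h`. Its integral is at most `2/|θ|`, and the normalization contributes
`R⁻¹`. -/
theorem norm_inner_chirp_le (h t : ℝ) {R : ℝ} (hR : 0 < R) (k : ℤ × ℤ)
    (hθ : (k.1 + t * (k.2 * h) : ℝ) ≠ 0) :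
    ‖inner ℂ ((memLp_chirp t R).toLp _) (weylOp h k ((memLp_chirp t R).toLp _))‖ ≤
      2 / |(k.1 + t * (k.2 * h) : ℝ)| * R⁻¹ := by
  have e0 : weylOp h k ((memLp_chirp t R).toLp _) =
      (memLp_weylFun (memLp_chirp t R) h k).toLp _ :=
    MemLp.toLp_congr (memLp_weylFun (Lp.memLp _) h k) _
      (weylFun_congr_ae (memLp_chirp t R).coeFn_toLp h k)
  rw [e0, inner_toLp_line]
  set s : ℝ := k.2 * h with hs
  set C : ℂ := ((R : ℂ)⁻¹) * Complex.exp (Complex.I * ((k.1 * k.2 * h / 2 + t * s ^ 2 / 2 : ℝ) : ℂ))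
    with hC
  have e1 : ∀ x, conj (chirp t R x) * weylFun h k (chirp t R) x =
      (Icc (max 0 (-s)) (min R (R - s))).indicator
        (fun x : ℝ => C * Complex.exp (Complex.I * ((k.1 + t * s : ℝ) : ℂ) * x)) x := by
    intro x
    by_cases hx : x ∈ Icc (max 0 (-s)) (min R (R - s))
    · have hx1 : x ∈ Icc 0 R := ⟨(le_max_left _ _).trans hx.1, hx.2.trans (min_le_left _ _)⟩
      have hx2 : x + s ∈ Icc 0 R := by
        have h1 := (le_max_right _ _).trans hx.1
        have h2 := hx.2.trans (min_le_right _ _)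
        constructor <;> linarith
      rw [indicator_of_mem hx, weylFun, chirp, chirp, indicator_of_mem hx1, ← hs,
        indicator_of_mem hx2]
      have hsq : ((√R : ℝ) : ℂ)⁻¹ * ((√R : ℝ) : ℂ)⁻¹ = (R : ℂ)⁻¹ := by
        rw [← mul_inv, ← Complex.ofReal_mul, Real.mul_self_sqrt hR.le]
      rw [hC, ← hsq, map_mul, map_inv₀, Complex.conj_ofReal, ← Complex.exp_conj, map_mul,
        Complex.conj_I, Complex.conj_ofReal]
      have : ∀ a b c d u : ℂ, u * Complex.exp a * (Complex.exp b * (u * Complex.exp c)) =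
          u * u * Complex.exp (a + b + c) := by
        intro a b c d u; rw [Complex.exp_add, Complex.exp_add]; ring
      rw [this _ _ _ 0, mul_assoc (_ * _), ← Complex.exp_add]
      congr 2
      push_cast
      ring
    · rw [indicator_of_notMem hx]
      by_cases hx1 : x ∈ Icc 0 R
      · have hx2 : x + s ∉ Icc 0 R := fun h2 => hx ⟨max_le hx1.1 (by linarith [h2.1]),
          le_min hx1.2 (by linarith [h2.2])⟩
        rw [weylFun, ← hs]
        simp only [chirp]
        rw [indicator_of_notMem hx2, mul_zero, mul_zero]
      · rw [chirp, indicator_of_notMem hx1, map_zero, zero_mul]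
  simp only [e1]
  rw [integral_indicator measurableSet_Icc, integral_const_mul, norm_mul, hC, norm_mul,
    norm_inv, Complex.norm_real, Real.norm_of_nonneg hR.le, mul_comm Complex.I,
    Complex.norm_exp_ofReal_mul_I, mul_one, mul_comm]
  gcongr
  exact norm_integral_exp_le hθ _ _

theorem norm_toLp_chirp (t : ℝ) {R : ℝ} (hR : 0 < R) : inner ℂ ((memLp_chirp t R).toLp _)
    ((memLp_chirp t R).toLp _) = (1 : ℂ) := by
  rw [inner_toLp_line]
  have e1 : ∀ x, conj (chirp t R x) * chirp t R x =
      (Icc 0 R).indicator (fun _ : ℝ => (R : ℂ)⁻¹) x := by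
    intro x
    by_cases hx : x ∈ Icc 0 R
    · rw [chirp, indicator_of_mem hx, indicator_of_mem hx]
      have hsq : ((√R : ℝ) : ℂ)⁻¹ * ((√R : ℝ) : ℂ)⁻¹ = (R : ℂ)⁻¹ := by
        rw [← mul_inv, ← Complex.ofReal_mul, Real.mul_self_sqrt hR.le]
      rw [map_mul, map_inv₀, Complex.conj_ofReal, ← Complex.exp_conj, map_mul,
        Complex.conj_I, Complex.conj_ofReal, mul_mul_mul_comm, ← Complex.exp_add, hsq]
      simp
    · rw [chirp, indicator_of_notMem hx, indicator_of_notMem hx, mul_zero]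
  simp only [e1]
  rw [integral_indicator measurableSet_Icc, setIntegral_const]
  have : (R : ℂ) ≠ 0 := by exact_mod_cast hR.ne'
  simp [Measure.real, Real.volume_Icc, hR.le, this]

/-- The correlations of the translates of a chirp tend to those of an orthonormal family. -/
theorem tendsto_inner_chirp {h : ℝ} (hh : 0 < h) (m n : ℤ × ℤ) :
    Tendsto (fun R : ℝ => inner ℂ
      (halfGauge h m • weylOp h m ((memLp_chirp (√2 / h) R).toLp _))
      (halfGauge h n • weylOp h n ((memLp_chirp (√2 / h) R).toLp _))) atTop
      (𝓝 (inner ℂ (lp.single 2 m (1 : ℂ) : L2Lat) (lp.single 2 n (1 : ℂ)))) := by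
  have hsingle : (inner ℂ (lp.single 2 m (1 : ℂ) : L2Lat) (lp.single 2 n (1 : ℂ)) : ℂ) =
      if m = n then 1 else 0 := by
    rw [lp.inner_single_left]
    split_ifs with hmn
    · subst hmn; simp
    · rw [lp.single_apply_ne _ _ _ hmn]; simp
  rw [hsingle]
  split_ifs with hmn
  · subst hmn
    refine tendsto_const_nhds.congr' ?_
    filter_upwards [eventually_gt_atTop 0] with R hR
    rw [inner_smul_left, inner_smul_right, (weylOp h m).inner_map_map, norm_toLp_chirp _ hR,
      mul_one, Complex.conj_mul', norm_halfGauge]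
    simp
  · have hk : n - m ≠ 0 := sub_ne_zero.2 (Ne.symm hmn)
    have hθ : (((n - m).1 : ℝ) + √2 / h * ((n - m).2 * h) : ℝ) ≠ 0 := by
      intro h0
      have e : (((n - m).1 : ℝ) + √2 * (n - m).2 : ℝ) = 0 := by
        rw [← h0]; field_simp
      rcases eq_or_ne (n - m).2 0 with h2 | h2
      · rw [h2] at e
        simp only [Int.cast_zero, mul_zero, add_zero, Int.cast_eq_zero] at e
        exact hk (Prod.ext e h2)
      · refine irrational_sqrt_two ⟨-((n - m).1 : ℚ) / (n - m).2, ?_⟩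
        have : ((n - m).2 : ℝ) ≠ 0 := by exact_mod_cast h2
        push_cast
        field_simp
        linarith
    refine squeeze_zero_norm' (a := fun R : ℝ => 2 / |((n - m).1 + √2 / h * ((n - m).2 * h) : ℝ)| * R⁻¹)
      ?_ ?_
    · filter_upwards [eventually_gt_atTop 0] with R hR
      rw [inner_smul_left, inner_smul_right, norm_mul, norm_mul, RCLike.norm_conj, norm_halfGauge,
        norm_halfGauge, one_mul, one_mul]
      refine le_trans (le_of_eq ?_) (norm_inner_chirp_le h (√2 / h) hR (n - m) hθ)
      have e1 := weylOp_weylOp h m (n - m) ((memLp_chirp (√2 / h) R).toLp _)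
      rw [add_sub_cancel] at e1
      have e2 := (weylOp h m).inner_map_map ((memLp_chirp (√2 / h) R).toLp _)
        (weylOp h (n - m) ((memLp_chirp (√2 / h) R).toLp _))
      rw [← e2, e1, inner_smul_right, norm_mul, Complex.norm_exp]
      simp
    · simpa using tendsto_inv_atTop_zero.const_mul
        (2 / |((n - m).1 + √2 / h * ((n - m).2 * h) : ℝ)|)

/-! ### Comparison of the lattice operator with the Weyl operator -/

section Abstract

variable {X Y : Type*} [NormedAddCommGroup X] [InnerProductSpace ℂ X]
  [NormedAddCommGroup Y] [InnerProductSpace ℂ Y]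

theorem norm_sq_linearCombination (e : ℤ × ℤ → X) (d : ℤ × ℤ →₀ ℂ) :
    ‖Finsupp.linearCombination ℂ e d‖ ^ 2 =
      (∑ m ∈ d.support, ∑ n ∈ d.support, conj (d m) * (d n * inner ℂ (e m) (e n))).re := by
  rw [← inner_self_eq_norm_sq (𝕜 := ℂ), Finsupp.linearCombination_apply, Finsupp.sum, sum_inner]
  simp_rw [inner_sum, inner_smul_left, inner_smul_right]
  rfl

theorem tendsto_norm_linearCombination {e : ℝ → ℤ × ℤ → X} {e₀ : ℤ × ℤ → Y}
    (he : ∀ m n, Tendsto (fun R => inner ℂ (e R m) (e R n)) atTop (𝓝 (inner ℂ (e₀ m) (e₀ n))))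
    (d : ℤ × ℤ →₀ ℂ) : Tendsto (fun R => ‖Finsupp.linearCombination ℂ (e R) d‖) atTop
      (𝓝 ‖Finsupp.linearCombination ℂ e₀ d‖) := by
  have h1 : Tendsto (fun R => ‖Finsupp.linearCombination ℂ (e R) d‖ ^ 2) atTop
      (𝓝 (‖Finsupp.linearCombination ℂ e₀ d‖ ^ 2)) := by
    simp only [norm_sq_linearCombination]
    refine (Complex.continuous_re.tendsto _).comp ?_
    exact tendsto_finsetSum _ fun m _ => tendsto_finsetSum _ fun n _ =>
      ((he m n).const_mul _).const_mul _
  have h2 := (Real.continuous_sqrt.tendsto _).comp h1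
  simpa [Function.comp_def, Real.sqrt_sq (norm_nonneg _)] using h2

/-- A lower bound for scalar sequences extends to sequences with values in a Hilbert space: it is
applied to the coordinates with respect to a Hilbert basis and summed with Parseval's identity. The
limit is taken over finite sets of coordinates, after Bessel's inequality. -/
theorem sum_norm_sq_le_of_bounded_below [CompleteSpace X] {A : L2Lat →L[ℂ] L2Lat} {κ : ℝ}
    (hκ : 0 ≤ κ) (hA : ∀ c, κ * ‖c‖ ≤ ‖A c‖) {U Z : ℤ × ℤ → X}
    (hU : Summable fun m => ‖U m‖ ^ 2) (hZ : Summable fun m => ‖Z m‖ ^ 2)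
    (hUZ : ∀ (b : X) (c : L2Lat), (∀ m, c m = inner ℂ b (U m)) → ∀ n, A c n = inner ℂ b (Z n))
    (M : Finset (ℤ × ℤ)) : κ ^ 2 * ∑ m ∈ M, ‖U m‖ ^ 2 ≤ ∑' n, ‖Z n‖ ^ 2 := by
  obtain ⟨w, b, -⟩ := exists_hilbertBasis ℂ X
  have hsum : ∀ j, Summable fun m => ‖(inner ℂ (b j) (U m) : ℂ)‖ ^ 2 := fun j =>
    Summable.of_nonneg_of_le (fun _ => sq_nonneg _) (fun m => by
      have := norm_inner_le_norm (𝕜 := ℂ) (b j) (U m)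
      rw [b.orthonormal.1 j, one_mul] at this
      gcongr) hU
  have hsumZ : ∀ j, Summable fun m => ‖(inner ℂ (b j) (Z m) : ℂ)‖ ^ 2 := fun j =>
    Summable.of_nonneg_of_le (fun _ => sq_nonneg _) (fun m => by
      have := norm_inner_le_norm (𝕜 := ℂ) (b j) (Z m)
      rw [b.orthonormal.1 j, one_mul] at this
      gcongr) hZ
  have hj : ∀ j, κ ^ 2 * ∑ m ∈ M, ‖(inner ℂ (b j) (U m) : ℂ)‖ ^ 2 ≤
      ∑' n, ‖(inner ℂ (b j) (Z n) : ℂ)‖ ^ 2 := by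
    intro j
    set c : L2Lat := ⟨fun m => inner ℂ (b j) (U m), memℓp_of_summable (hsum j)⟩ with hc
    have h1 := hA c
    have h2 : ‖A c‖ ^ 2 = ∑' n, ‖(inner ℂ (b j) (Z n) : ℂ)‖ ^ 2 := by
      rw [norm_sq_eq_tsum]
      refine tsum_congr fun n => ?_
      rw [hUZ (b j) c (fun _ => rfl)]
    have h3 : ∑ m ∈ M, ‖(inner ℂ (b j) (U m) : ℂ)‖ ^ 2 ≤ ‖c‖ ^ 2 := by
      rw [norm_sq_eq_tsum]
      exact (hsum j).sum_le_tsum M fun _ _ => sq_nonneg _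
    rw [← h2]
    have h4 := pow_le_pow_left₀ (by positivity) h1 2
    rw [mul_pow] at h4
    refine le_trans ?_ h4
    gcongr
  have hJ : ∀ J : Finset w, κ ^ 2 * ∑ m ∈ M, ∑ j ∈ J, ‖(inner ℂ (b j) (U m) : ℂ)‖ ^ 2 ≤
      ∑' n, ‖Z n‖ ^ 2 := by
    intro J
    calc κ ^ 2 * ∑ m ∈ M, ∑ j ∈ J, ‖(inner ℂ (b j) (U m) : ℂ)‖ ^ 2
        = ∑ j ∈ J, κ ^ 2 * ∑ m ∈ M, ‖(inner ℂ (b j) (U m) : ℂ)‖ ^ 2 := by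
          rw [Finset.sum_comm, Finset.mul_sum]
      _ ≤ ∑ j ∈ J, ∑' n, ‖(inner ℂ (b j) (Z n) : ℂ)‖ ^ 2 := Finset.sum_le_sum fun j _ => hj j
      _ = ∑' n, ∑ j ∈ J, ‖(inner ℂ (b j) (Z n) : ℂ)‖ ^ 2 :=
          (Summable.tsum_finsetSum fun j _ => hsumZ j).symm
      _ ≤ ∑' n, ‖Z n‖ ^ 2 :=
          Summable.tsum_le_tsum (fun n => b.orthonormal.sum_inner_products_le (Z n))
            (summable_sum fun j _ => hsumZ j) hZ
  have hpars : ∀ x : X, HasSum (fun j => ‖(inner ℂ (b j) x : ℂ)‖ ^ 2) (‖x‖ ^ 2) := by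
    intro x
    have h1 := (b.hasSum_inner_mul_inner x x).mapL Complex.reCLM
    simp only [Complex.reCLM_apply] at h1
    have e2 : (inner ℂ x x : ℂ).re = ‖x‖ ^ 2 := inner_self_eq_norm_sq (𝕜 := ℂ) x
    rw [e2] at h1
    refine h1.congr_fun fun j => ?_
    rw [← inner_conj_symm x (b j), Complex.conj_mul']
    norm_cast
  refine le_of_tendsto ((tendsto_finsetSum M fun m _ => hpars (U m)).const_mul (κ ^ 2))
    (Eventually.of_forall hJ)

theorem exists_sum_close [CompleteSpace X] {V : ℤ × ℤ → X →L[ℂ] X} {A : X →L[ℂ] X}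
    {f : ℤ × ℤ → ℝ} (hA : HasSum (fun k => (f k : ℂ) • V k) A) {ε : ℝ} (hε : 0 < ε) :
    ∀ᶠ F : Finset (ℤ × ℤ) in atTop, ∀ x, ‖A x - (∑ k ∈ F, (f k : ℂ) • V k) x‖ ≤ ε * ‖x‖ := by
  have := (Metric.tendsto_nhds.1 hA) ε hε
  filter_upwards [this] with F hF x
  rw [dist_comm, dist_eq_norm] at hF
  rw [← sub_apply]
  exact (ContinuousLinearMap.le_opNorm _ x).trans
    (mul_le_mul_of_nonneg_right hF.le (norm_nonneg x))

end Abstract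

/-- The twisted translation on finitely supported sequences. -/
def finShift (h : ℝ) (k : ℤ × ℤ) : (ℤ × ℤ →₀ ℂ) →ₗ[ℂ] (ℤ × ℤ →₀ ℂ) :=
  Finsupp.linearCombination ℂ fun m =>
    Finsupp.single (m + k) (gaugePhase h (latticePt (m + k)) (latticePt m))

theorem weylOp_linearCombination (h : ℝ) (k : ℤ × ℤ) (v : L2Line) (d : ℤ × ℤ →₀ ℂ) :
    weylOp h k (Finsupp.linearCombination ℂ (fun m => halfGauge h m • weylOp h m v) d) =
      Finsupp.linearCombination ℂ (fun m => halfGauge h m • weylOp h m v) (finShift h k d) := by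
  have : (weylOp h k).toLinearMap ∘ₗ
      Finsupp.linearCombination ℂ (fun m => halfGauge h m • weylOp h m v) =
      Finsupp.linearCombination ℂ (fun m => halfGauge h m • weylOp h m v) ∘ₗ finShift h k := by
    refine Finsupp.lhom_ext' fun m => LinearMap.ext_ring ?_
    simp only [LinearMap.comp_apply, Finsupp.lsingle_apply, finShift,
      Finsupp.linearCombination_single, one_smul, LinearIsometry.coe_toLinearMap]
    exact weylOp_halfGauge_smul h k m v
  exact LinearMap.congr_fun this d

theorem latShift_linearCombination (h : ℝ) (k : ℤ × ℤ) (d : ℤ × ℤ →₀ ℂ) :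
    latShift h k (Finsupp.linearCombination ℂ (fun m => (lp.single 2 m 1 : L2Lat)) d) =
      Finsupp.linearCombination ℂ (fun m => (lp.single 2 m 1 : L2Lat)) (finShift h k d) := by
  have : (latShift h k).toLinearMap ∘ₗ
      Finsupp.linearCombination ℂ (fun m => (lp.single 2 m 1 : L2Lat)) =
      Finsupp.linearCombination ℂ (fun m => (lp.single 2 m 1 : L2Lat)) ∘ₗ finShift h k := by
    refine Finsupp.lhom_ext' fun m => LinearMap.ext_ring ?_
    simp only [LinearMap.comp_apply, Finsupp.lsingle_apply, finShift,
      Finsupp.linearCombination_single, one_smul, ContinuousLinearMap.coe_coe]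
    ext n
    rw [latShift_apply, lp.coeFn_smul, Pi.smul_apply, smul_eq_mul]
    by_cases hn : n = m + k
    · subst hn
      rw [add_sub_cancel_right, lp.single_apply_self, lp.single_apply_self]
    · have hn' : n - k ≠ m := fun e => hn (by rw [← e]; abel)
      rw [lp.single_apply_ne _ _ _ hn, lp.single_apply_ne _ _ _ hn', mul_zero, mul_zero]
  exact LinearMap.congr_fun this d

/-- A finitely supported sequence is realized on the line by the corresponding combination of chirp
translates. As `R → ∞` norms converge to those in `ℓ²(ℤ²)`, and translations correspond exactly, so
the lower bound passes to the limit; density does the rest. -/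
theorem latShift_sum_bounded_below {h : ℝ} (hh : 0 < h) (F : Finset (ℤ × ℤ)) (f : ℤ × ℤ → ℝ)
    {κ : ℝ} (hB : ∀ v : L2Line,
      κ * ‖v‖ ≤ ‖(∑ k ∈ F, (f k : ℂ) • (weylOp h k).toContinuousLinearMap) v‖) (c : L2Lat) :
    κ * ‖c‖ ≤ ‖(∑ k ∈ F, (f k : ℂ) • latShift h k) c‖ := by
  set Φ := Finsupp.linearCombination ℂ (fun m => (lp.single 2 m 1 : L2Lat)) with hΦ
  have hfin : ∀ d, κ * ‖Φ d‖ ≤ ‖(∑ k ∈ F, (f k : ℂ) • latShift h k) (Φ d)‖ := by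
    intro d
    set d' := ∑ k ∈ F, (f k : ℂ) • finShift h k d with hd'
    have e1 : (∑ k ∈ F, (f k : ℂ) • latShift h k) (Φ d) = Φ d' := by
      simp only [sum_apply, smul_apply, hd', map_sum,
        map_smul]
      exact Finset.sum_congr rfl fun k _ => by rw [hΦ, latShift_linearCombination]
    rw [e1]
    have l1 := tendsto_norm_linearCombination (tendsto_inner_chirp hh) d
    have l2 := tendsto_norm_linearCombination (tendsto_inner_chirp hh) d'
    refine le_of_tendsto_of_tendsto' (l1.const_mul κ) l2 fun R => ?_
    refine (hB _).trans (le_of_eq ?_)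
    congr 1
    simp only [sum_apply, smul_apply, hd', map_sum,
      map_smul]
    exact Finset.sum_congr rfl fun k _ => by
      rw [← weylOp_linearCombination]
      rfl
  have hs : HasSum (fun m => (lp.single 2 m (c m) : L2Lat)) c := lp.hasSum_single (by norm_num) c
  refine le_of_tendsto_of_tendsto' (hs.norm.const_mul κ)
    (((ContinuousLinearMap.continuous _).tendsto c).comp hs).norm fun S => ?_
  have e : ∑ m ∈ S, (lp.single 2 m (c m) : L2Lat) = Φ (∑ m ∈ S, Finsupp.single m (c m)) := by
    rw [map_sum]
    refine Finset.sum_congr rfl fun m _ => ?_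
    rw [hΦ, Finsupp.linearCombination_single, ← lp.single_smul, smul_eq_mul, mul_one]
  simp only [Function.comp, e]
  exact hfin _

/-- The `ℓ¹` length of a lattice vector. -/
def latLen (m : ℤ × ℤ) : ℝ := |(m.1 : ℝ)| + |(m.2 : ℝ)|

theorem latLen_sub_le (n k : ℤ × ℤ) :
    latLen (n - k) ≤ latLen n + latLen k ∧ latLen n ≤ latLen (n - k) + latLen k := by
  simp only [latLen, Prod.fst_sub, Prod.snd_sub, Int.cast_sub]
  have h1 := abs_sub (n.1 : ℝ) k.1
  have h2 := abs_sub (n.2 : ℝ) k.2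
  have h3 := abs_sub_abs_le_abs_sub (n.1 : ℝ) k.1
  have h4 := abs_sub_abs_le_abs_sub (n.2 : ℝ) k.2
  constructor <;> linarith

theorem abs_exp_latLen_sub_le {δ : ℝ} (hδ : 0 < δ) (n k : ℤ × ℤ) :
    |Real.exp (-(δ * latLen (n - k))) - Real.exp (-(δ * latLen n))| ≤
      Real.exp (-(δ * latLen n)) * (Real.exp (δ * latLen k) - 1) := by
  obtain ⟨h1, h2⟩ := latLen_sub_le n k
  set a := Real.exp (δ * latLen k) with ha
  have ha1 : 1 ≤ a := Real.one_le_exp (mul_nonneg hδ.le (by rw [latLen]; positivity))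
  have e1 : Real.exp (-(δ * latLen (n - k))) ≤ Real.exp (-(δ * latLen n)) * a := by
    rw [ha, ← Real.exp_add]
    apply Real.exp_le_exp.2
    nlinarith
  have e2 : Real.exp (-(δ * latLen n)) ≤ Real.exp (-(δ * latLen (n - k))) * a := by
    rw [ha, ← Real.exp_add]
    apply Real.exp_le_exp.2
    nlinarith
  have p1 := Real.exp_pos (-(δ * latLen n))
  have p2 := Real.exp_pos (-(δ * latLen (n - k)))
  rw [abs_le]
  constructor
  · rcases le_total (Real.exp (-(δ * latLen (n - k)))) (Real.exp (-(δ * latLen n))) with h | h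
    · nlinarith
    · nlinarith
  · linarith

/-- Along the orbit of `v`, the lattice polynomial acts as `B` acts on `v`, and all entries have the
norm of `v` or of `B v`. The orbit is not square summable, so it is damped by `e^{-δ|m|}`; the
damping nearly commutes with finitely many translations, at a cost that vanishes with `δ`. Comparing
both sides of the vector-valued lower bound, the common factor `∑ χ²` cancels. -/
theorem weylOp_sum_bounded_below {h : ℝ} (F : Finset (ℤ × ℤ)) (f : ℤ × ℤ → ℝ)
    {κ : ℝ} (hκ : 0 ≤ κ) (hA : ∀ c, κ * ‖c‖ ≤ ‖(∑ k ∈ F, (f k : ℂ) • latShift h k) c‖)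
    (v : L2Line) :
    κ * ‖v‖ ≤ ‖(∑ k ∈ F, (f k : ℂ) • (weylOp h k).toContinuousLinearMap) v‖ := by
  set B := ∑ k ∈ F, (f k : ℂ) • (weylOp h k).toContinuousLinearMap with hBdef
  have main : ∀ δ > 0, κ * ‖v‖ ≤ ‖B v‖ + (∑ k ∈ F, |f k| * (Real.exp (δ * latLen k) - 1)) * ‖v‖ := by
    intro δ hδ
    set χ : ℤ × ℤ → ℝ := fun m => Real.exp (-(δ * latLen m)) with hχ
    have hχ0 : ∀ m, 0 < χ m := fun m => Real.exp_pos _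
    have hχs : Summable fun m => χ m ^ 2 := by
      refine (summable_exp_neg_abs_add (c := 2 * δ) (by positivity)).congr fun m => ?_
      rw [hχ, ← Real.exp_nat_mul]
      congr 1
      simp only [latLen]
      push_cast
      ring
    set D := ∑ k ∈ F, |f k| * (Real.exp (δ * latLen k) - 1) with hD
    set W : ℤ × ℤ → L2Line := fun m => conj (halfGauge h m) • weylOp h (-m) v with hW
    have hWn : ∀ m, ‖W m‖ = ‖v‖ := fun m => by
      rw [hW]; simp only
      rw [norm_smul, RCLike.norm_conj, norm_halfGauge, one_mul, LinearIsometry.norm_map]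
    set U : ℤ × ℤ → L2Line := fun m => (χ m : ℂ) • W m with hU
    have hUn : ∀ m, ‖U m‖ = χ m * ‖v‖ := fun m => by
      rw [hU]; simp only
      rw [norm_smul, hWn, Complex.norm_real, Real.norm_of_nonneg (hχ0 m).le]
    set g : ℤ × ℤ → ℤ × ℤ → ℂ := fun n k => gaugePhase h (latticePt n) (latticePt (n - k)) with hg
    set Z : ℤ × ℤ → L2Line := fun n => ∑ k ∈ F, ((f k : ℂ) * g n k) • U (n - k) with hZ
    have hBv : ∀ n, conj (halfGauge h n) • weylOp h (-n) (B v) =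
        ∑ k ∈ F, ((f k : ℂ) * g n k) • W (n - k) := by
      intro n
      simp only [hBdef, sum_apply, smul_apply, map_sum,
        map_smul, Finset.smul_sum, LinearIsometry.coe_toContinuousLinearMap]
      refine Finset.sum_congr rfl fun k _ => ?_
      rw [smul_comm, conj_halfGauge_smul_weylOp, mul_smul]
    have hZn : ∀ n, ‖Z n‖ ≤ χ n * (‖B v‖ + D * ‖v‖) := by
      intro n
      -- The damped orbit of `B v`, plus the commutator of the translations with the damping.
      have e : Z n = (χ n : ℂ) • (conj (halfGauge h n) • weylOp h (-n) (B v)) +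
          ∑ k ∈ F, (((f k : ℂ) * g n k) * ((χ (n - k) - χ n : ℝ) : ℂ)) • W (n - k) := by
        rw [hBv, Finset.smul_sum, ← Finset.sum_add_distrib]
        refine Finset.sum_congr rfl fun k _ => ?_
        have hUW : U (n - k) = (χ (n - k) : ℂ) • W (n - k) := rfl
        rw [hUW]
        generalize W (n - k) = w
        rw [smul_smul, smul_smul, ← add_smul]
        congr 1
        push_cast
        ring
      have b1 : ‖(χ n : ℂ) • (conj (halfGauge h n) • weylOp h (-n) (B v))‖ = χ n * ‖B v‖ := by
        rw [norm_smul, norm_smul, RCLike.norm_conj, norm_halfGauge, one_mul,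
          LinearIsometry.norm_map, Complex.norm_real, Real.norm_of_nonneg (hχ0 n).le]
      have b2 : ‖∑ k ∈ F, (((f k : ℂ) * g n k) * ((χ (n - k) - χ n : ℝ) : ℂ)) • W (n - k)‖ ≤
          χ n * (D * ‖v‖) := by
        refine (norm_sum_le _ _).trans ?_
        rw [hD, Finset.sum_mul, Finset.mul_sum]
        refine Finset.sum_le_sum fun k _ => ?_
        rw [norm_smul, norm_mul, norm_mul, hWn, Complex.norm_real, Complex.norm_real, hg]
        simp only
        rw [norm_gaugePhase, mul_one, Real.norm_eq_abs, Real.norm_eq_abs]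
        have := mul_le_mul_of_nonneg_left (abs_exp_latLen_sub_le hδ n k) (abs_nonneg (f k))
        have := mul_le_mul_of_nonneg_right this (norm_nonneg v)
        refine this.trans (le_of_eq ?_)
        ring
      rw [e]
      refine (norm_add_le _ _).trans ?_
      rw [b1]
      linarith
    have hD0 : 0 ≤ D := Finset.sum_nonneg fun k _ => mul_nonneg (abs_nonneg _) (by
      have : 1 ≤ Real.exp (δ * latLen k) :=
        Real.one_le_exp (mul_nonneg hδ.le (by rw [latLen]; positivity))
      linarith)
    have hUs : Summable fun m => ‖U m‖ ^ 2 := by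
      simp only [hUn, mul_pow]
      exact hχs.mul_right _
    have hZb : ∀ n, ‖Z n‖ ^ 2 ≤ χ n ^ 2 * (‖B v‖ + D * ‖v‖) ^ 2 := fun n => by
      rw [← mul_pow]; exact pow_le_pow_left₀ (norm_nonneg _) (hZn n) 2
    have hZs : Summable fun m => ‖Z m‖ ^ 2 :=
      Summable.of_nonneg_of_le (fun _ => sq_nonneg _) hZb (hχs.mul_right _)
    have key := sum_norm_sq_le_of_bounded_below hκ hA hUs hZs (fun b c hc n => by
      rw [sum_apply, hZ, inner_sum, lp.coeFn_sum, Finset.sum_apply]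
      refine Finset.sum_congr rfl fun k _ => ?_
      rw [smul_apply, lp.coeFn_smul, Pi.smul_apply, latShift_apply, hc]
      generalize U (n - k) = w
      rw [inner_smul_right, smul_eq_mul, mul_assoc])
    have hlim : κ ^ 2 * ((∑' m, χ m ^ 2) * ‖v‖ ^ 2) ≤
        (∑' m, χ m ^ 2) * (‖B v‖ + D * ‖v‖) ^ 2 := by
      have h1 : ∑' n, ‖Z n‖ ^ 2 ≤ (∑' m, χ m ^ 2) * (‖B v‖ + D * ‖v‖) ^ 2 := by
        rw [← tsum_mul_right]
        exact Summable.tsum_le_tsum hZb hZs (hχs.mul_right _)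
      refine le_of_tendsto ((hχs.hasSum.mul_right (‖v‖ ^ 2)).const_mul (κ ^ 2))
        (Eventually.of_forall fun M => ?_)
      refine le_trans (le_of_eq ?_) ((key M).trans h1)
      simp only [hUn, mul_pow]
    have hpos : 0 < ∑' m, χ m ^ 2 :=
      hχs.tsum_pos (fun _ => sq_nonneg _) 0 (pow_pos (hχ0 0) 2)
    have h2 : (κ * ‖v‖) ^ 2 ≤ (‖B v‖ + D * ‖v‖) ^ 2 := by
      rw [mul_pow]
      refine le_of_mul_le_mul_left ?_ hpos
      linarith
    exact le_of_sq_le_sq h2 (by positivity)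
  have hlim : Tendsto (fun δ : ℝ => ‖B v‖ + (∑ k ∈ F, |f k| * (Real.exp (δ * latLen k) - 1)) * ‖v‖)
      (𝓝[>] 0) (𝓝 (‖B v‖ + (∑ k ∈ F, |f k| * (Real.exp (0 * latLen k) - 1)) * ‖v‖)) := by
    have : Continuous fun δ : ℝ =>
        ‖B v‖ + (∑ k ∈ F, |f k| * (Real.exp (δ * latLen k) - 1)) * ‖v‖ := by fun_prop
    exact (this.tendsto 0).mono_left nhdsWithin_le_nhds
  simp only [zero_mul, Real.exp_zero, sub_self, mul_zero, Finset.sum_const_zero, add_zero] at hlim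
  exact ge_of_tendsto hlim (by filter_upwards [self_mem_nhdsWithin] with δ hδ using main δ hδ)

/-- The Weyl operator with the Fourier coefficients `f`. -/
def weylSum (h : ℝ) (f : ℤ × ℤ → ℝ) : L2Line →L[ℂ] L2Line :=
  ∑' k, (f k : ℂ) • (weylOp h k).toContinuousLinearMap

theorem hasSum_weylSum (h : ℝ) {f : ℤ × ℤ → ℝ} (hf : Summable fun k => |f k|) :
    HasSum (fun k => (f k : ℂ) • (weylOp h k).toContinuousLinearMap) (weylSum h f) :=
  hasSum_smul_of_norm_le_one (norm_weylOp_le h) hf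

theorem isSelfAdjoint_weylSum (h : ℝ) {f : ℤ × ℤ → ℝ} (hf : ∀ k, f (-k) = f k) :
    IsSelfAdjoint (weylSum h f) := isSelfAdjoint_tsum (star_weylOp h) hf

/-- The lattice operator is bounded from below if and only if the Weyl operator is invertible. -/
theorem latOp_bounded_below_iff {h E : ℝ} (hh : 0 < h) (hE : 0 < E) (d : ℝ) :
    (∃ κ > 0, ∀ c, κ * ‖c‖ ≤ ‖latOp h E d c‖) ↔ IsUnit (weylSum h (latCoef h E d)) := by
  have hsA := hasSum_latOp hh hE d
  have hsB := hasSum_weylSum h (summable_latCoef hh hE d)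
  constructor
  · rintro ⟨κ, hκ, hb⟩
    -- The transport of lower bounds works for finite sums, so both series are truncated on the same
    -- set; each truncation error costs `κ/4`, leaving `κ/2`.
    obtain ⟨F, hF1, hF2⟩ := ((exists_sum_close hsA (ε := κ / 4) (by positivity)).and
      (exists_sum_close hsB (ε := κ / 4) (by positivity))).exists
    refine isUnit_of_isSelfAdjoint_of_bounded_below
      (isSelfAdjoint_weylSum h (latCoef_neg h E d)) (κ := κ / 2) (by positivity) fun v => ?_
    have h1 := weylOp_sum_bounded_below (h := h) F (latCoef h E d) (κ := 3 * κ / 4) (by positivity)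
      (fun c => by
        have := hb c
        have := hF1 c
        have := norm_sub_norm_le (latOp h E d c) ((∑ k ∈ F, (latCoef h E d k : ℂ) • latShift h k) c)
        linarith) v
    have h2 := hF2 v
    have h3 := norm_sub_norm_le ((∑ k ∈ F, (latCoef h E d k : ℂ) •
      (weylOp h k).toContinuousLinearMap) v) (weylSum h (latCoef h E d) v)
    rw [norm_sub_rev] at h3
    linarith
  · intro hu
    obtain ⟨κ, hκ, hb⟩ := exists_bounded_below_of_isUnit hu
    obtain ⟨F, hF1, hF2⟩ := ((exists_sum_close hsA (ε := κ / 4) (by positivity)).and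
      (exists_sum_close hsB (ε := κ / 4) (by positivity))).exists
    refine ⟨κ / 2, by positivity, fun c => ?_⟩
    have h1 := latShift_sum_bounded_below hh F (latCoef h E d) (κ := 3 * κ / 4)
      (fun v => by
        have := hb v
        have := hF2 v
        have := norm_sub_norm_le (weylSum h (latCoef h E d) v) ((∑ k ∈ F, (latCoef h E d k : ℂ) •
          (weylOp h k).toContinuousLinearMap) v)
        linarith) c
    have h2 := hF1 c
    have h3 := norm_sub_norm_le ((∑ k ∈ F, (latCoef h E d k : ℂ) • latShift h k) c)
      (latOp h E d c)
    rw [norm_sub_rev] at h3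
    linarith

/-! ### The Weyl quantization of a trigonometric series -/

theorem integrable_of_hasSum {ι : Type*} [Countable ι] {F : ι → ℝ → ℂ} {g : ℝ → ℂ}
    (hF : ∀ i, Integrable (F i)) (hs : Summable fun i => ∫ x, ‖F i x‖)
    (hg : ∀ x, HasSum (fun i => F i x) (g x)) :
    Integrable g ∧ HasSum (fun i => ∫ x, F i x) (∫ x, g x) := by
  have hg' : g = fun x => ∑' i, F i x := funext fun x => (hg x).tsum_eq.symm
  refine ⟨⟨?_, ?_⟩, ?_⟩
  · have := Classical.decEq ι
    refine aestronglyMeasurable_of_tendsto_ae (atTop : Filter (Finset ι))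
      (f := fun s x => ∑ i ∈ s, F i x)
      (fun s => (integrable_finsetSum s fun i _ => hF i).aestronglyMeasurable)
      (Eventually.of_forall hg)
  · have h1 : ∑' i, ∫⁻ x, ‖F i x‖ₑ < ⊤ := by
      have e : ∀ i, ∫⁻ x, ‖F i x‖ₑ = ENNReal.ofReal (∫ x, ‖F i x‖) := fun i =>
        (ofReal_integral_norm_eq_lintegral_enorm (hF i)).symm
      simp_rw [e]
      rw [← ENNReal.ofReal_tsum_of_nonneg (fun i => integral_nonneg fun x => norm_nonneg _) hs]
      exact ENNReal.ofReal_lt_top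
    rw [← lintegral_tsum fun i => (hF i).aestronglyMeasurable.enorm] at h1
    refine lt_of_le_of_lt (lintegral_mono fun x => ?_) h1
    rw [← (hg x).tsum_eq]
    exact enorm_tsum_le_tsum_enorm
  · rw [hg']
    exact hasSum_integral_of_summable_integral_norm hF hs

theorem norm_cexp_I_mul_ofReal (t : ℝ) : ‖Complex.exp (Complex.I * (t : ℂ))‖ = 1 := by
  rw [mul_comm, Complex.norm_exp_ofReal_mul_I]

/-- For a single exponential the `y`-integral is a Fourier transform. The midpoint `(x + y)/2`
shifts the frequency `p/(2πh)` by `k₁/(4π)`; this shift is the source of the symmetric phase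
`k₁k₂h/2`. -/
theorem weyl_inner_integral {h : ℝ} (hh : 0 < h) (k : ℤ × ℤ) (φ : SchwartzMap ℝ ℂ) (c : ℂ)
    (x p : ℝ) :
    (Integrable fun y : ℝ => Complex.exp (Complex.I * p * (x - y) / h) *
        (c * Complex.exp (Complex.I * (k.1 * (((x + y) / 2 : ℝ) : ℂ) + k.2 * p))) * φ y) ∧
      (∀ y : ℝ, ‖Complex.exp (Complex.I * p * (x - y) / h) *
        (c * Complex.exp (Complex.I * (k.1 * (((x + y) / 2 : ℝ) : ℂ) + k.2 * p))) * φ y‖ =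
          ‖c‖ * ‖φ y‖) ∧
      ∫ y : ℝ, Complex.exp (Complex.I * p * (x - y) / h) *
        (c * Complex.exp (Complex.I * (k.1 * (((x + y) / 2 : ℝ) : ℂ) + k.2 * p))) * φ y =
        c * Complex.exp (Complex.I * ((k.1 * x + k.1 * k.2 * h / 2 : ℝ) : ℂ)) *
          (Complex.exp (((2 * Real.pi * ((p / (2 * Real.pi * h) - k.1 / (4 * Real.pi)) *
              (x + k.2 * h)) : ℝ) : ℂ) * Complex.I) *
            FourierTransform.fourier (φ : ℝ → ℂ)
              (p / (2 * Real.pi * h) - k.1 / (4 * Real.pi))) := by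
  have hpi := Real.pi_pos.ne'
  have hn : ∀ y : ℝ, ‖Complex.exp (Complex.I * p * (x - y) / h) *
        (c * Complex.exp (Complex.I * (k.1 * (((x + y) / 2 : ℝ) : ℂ) + k.2 * p))) * φ y‖ =
          ‖c‖ * ‖φ y‖ := by
    intro y
    have e1 : Complex.I * p * (x - y) / h = Complex.I * ((p * (x - y) / h : ℝ) : ℂ) := by
      push_cast; ring
    have e2 : Complex.I * (k.1 * (((x + y) / 2 : ℝ) : ℂ) + k.2 * p) =
        Complex.I * ((k.1 * ((x + y) / 2) + k.2 * p : ℝ) : ℂ) := by push_cast; ring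
    rw [e1, e2, norm_mul, norm_mul, norm_mul, norm_cexp_I_mul_ofReal, norm_cexp_I_mul_ofReal,
      one_mul, mul_one]
  refine ⟨?_, hn, ?_⟩
  · refine ((φ.integrable (μ := volume)).norm.const_mul ‖c‖).mono' ?_
      (Eventually.of_forall fun y => (hn y).le)
    exact Continuous.aestronglyMeasurable (by fun_prop)
  · rw [Real.fourier_real_eq_integral_exp_smul, ← mul_assoc, ← integral_const_mul]
    refine integral_congr_ae (Eventually.of_forall fun y => ?_)
    simp only [smul_eq_mul]
    rw [← mul_assoc _ _ (φ y)]
    congr 1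
    have key : ∀ A B C D F : ℂ, A + B = C + D + F → Complex.exp A * (c * Complex.exp B) =
        c * Complex.exp C * Complex.exp D * Complex.exp F := by
      intro A B C D F hAB
      rw [mul_left_comm, ← Complex.exp_add, hAB, Complex.exp_add, Complex.exp_add]
      ring
    refine key _ _ _ _ _ ?_
    have hhc : (h : ℂ) ≠ 0 := by exact_mod_cast hh.ne'
    have hpc : (Real.pi : ℂ) ≠ 0 := by exact_mod_cast hpi
    push_cast
    field_simp
    ring

/-- Fourier inversion at the point `x + k₂h`. The factor `2πh` is the Jacobian of `p ↦ p/(2πh)` and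
cancels the prefactor of the quantization. -/
theorem weyl_outer_integral {h : ℝ} (hh : 0 < h) (k : ℤ × ℤ) (φ : SchwartzMap ℝ ℂ) (c : ℂ)
    (x : ℝ) :
    (Integrable fun p : ℝ => c * Complex.exp (Complex.I * ((k.1 * x + k.1 * k.2 * h / 2 : ℝ) : ℂ)) *
          (Complex.exp (((2 * Real.pi * ((p / (2 * Real.pi * h) - k.1 / (4 * Real.pi)) *
              (x + k.2 * h)) : ℝ) : ℂ) * Complex.I) *
            FourierTransform.fourier (φ : ℝ → ℂ)
              (p / (2 * Real.pi * h) - k.1 / (4 * Real.pi)))) ∧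
      (∫ p : ℝ, ‖c * Complex.exp (Complex.I * ((k.1 * x + k.1 * k.2 * h / 2 : ℝ) : ℂ)) *
          (Complex.exp (((2 * Real.pi * ((p / (2 * Real.pi * h) - k.1 / (4 * Real.pi)) *
              (x + k.2 * h)) : ℝ) : ℂ) * Complex.I) *
            FourierTransform.fourier (φ : ℝ → ℂ)
              (p / (2 * Real.pi * h) - k.1 / (4 * Real.pi)))‖) =
        ‖c‖ * (2 * Real.pi * h * ∫ v, ‖FourierTransform.fourier (φ : ℝ → ℂ) v‖) ∧
      ∫ p : ℝ, c * Complex.exp (Complex.I * ((k.1 * x + k.1 * k.2 * h / 2 : ℝ) : ℂ)) *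
          (Complex.exp (((2 * Real.pi * ((p / (2 * Real.pi * h) - k.1 / (4 * Real.pi)) *
              (x + k.2 * h)) : ℝ) : ℂ) * Complex.I) *
            FourierTransform.fourier (φ : ℝ → ℂ)
              (p / (2 * Real.pi * h) - k.1 / (4 * Real.pi))) =
        2 * Real.pi * h * (c * weylFun h k φ x) := by
  have hP : 0 < 2 * Real.pi * h := by positivity
  have hF : Integrable (FourierTransform.fourier (φ : ℝ → ℂ)) := by
    rw [← SchwartzMap.fourier_coe]; exact SchwartzMap.integrable _
  set G : ℝ → ℂ := fun v => Complex.exp (((2 * Real.pi * (v * (x + k.2 * h)) : ℝ) : ℂ) *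
    Complex.I) * FourierTransform.fourier (φ : ℝ → ℂ) v with hG
  have hn : ∀ v, ‖G v‖ = ‖FourierTransform.fourier (φ : ℝ → ℂ) v‖ := fun v => by
    rw [hG]; simp only [norm_mul]; rw [Complex.norm_exp_ofReal_mul_I, one_mul]
  have hGi : Integrable G := by
    refine hF.norm.mono' ?_ (Eventually.of_forall fun v => (hn v).le)
    exact (Continuous.aestronglyMeasurable (by fun_prop)).mul hF.aestronglyMeasurable
  have hsub : ∀ {X : Type} [NormedAddCommGroup X] [NormedSpace ℝ X] (g : ℝ → X),
      ∫ p : ℝ, g (p / (2 * Real.pi * h) - k.1 / (4 * Real.pi)) = (2 * Real.pi * h) • ∫ v, g v := by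
    intro X _ _ g
    rw [Measure.integral_comp_div (fun q => g (q - k.1 / (4 * Real.pi))), abs_of_pos hP,
      integral_sub_right_eq_self]
  have hval : ∫ v, G v = φ (x + k.2 * h) := by
    have h1 := congrFun (Continuous.fourierInv_fourier_eq φ.continuous φ.integrable hF)
      (x + k.2 * h)
    rw [Real.fourierInv_eq'] at h1
    rw [← h1]
    refine integral_congr_ae (Eventually.of_forall fun v => ?_)
    simp only [hG, smul_eq_mul]
    congr 5
    simp [mul_comm]
  refine ⟨?_, ?_, ?_⟩
  · exact (((hGi.comp_sub_right (k.1 / (4 * Real.pi))).comp_div hP.ne').const_mul _)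
  · have e := hsub (fun v => ‖c‖ * ‖G v‖)
    rw [smul_eq_mul, integral_const_mul (μ := volume) ‖c‖ fun v => ‖G v‖] at e
    simp only [hn] at e
    rw [mul_left_comm, ← e]
    refine integral_congr_ae (Eventually.of_forall fun p => ?_)
    simp only [norm_mul]
    rw [norm_cexp_I_mul_ofReal, Complex.norm_exp_ofReal_mul_I]
    ring
  · rw [integral_const_mul]
    have e := hsub G
    rw [hval] at e
    refine (congrArg _ e).trans ?_
    rw [Complex.real_smul, weylFun]
    push_cast
    ring

/-- The integrals of the absolute values of the `k`-th term are `|f k|` times constants independent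
of `k`, so summability of `f` permits termwise integration in both variables. -/
theorem isWeylQuantization_weylSum {h : ℝ} (hh : 0 < h) {f : ℤ × ℤ → ℝ}
    (hf : Summable fun k => |f k|) {L : ℝ → ℝ → ℂ}
    (hL : ∀ x p : ℝ, HasSum (fun k : ℤ × ℤ => (f k : ℂ) *
      Complex.exp (Complex.I * (k.1 * x + k.2 * p))) (L x p)) :
    IsWeylQuantization h L (weylSum h f) := by
  intro φ
  have hin : ∀ x p : ℝ, _ := fun x p => integrable_of_hasSum
    (fun k => (weyl_inner_integral hh k φ (f k) x p).1)
    (g := fun y : ℝ => Complex.exp (Complex.I * p * (x - y) / h) * L ((x + y) / 2) p * φ y) (by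
      simp_rw [fun k y => (weyl_inner_integral hh k φ (f k) x p).2.1 y, integral_const_mul]
      refine Summable.mul_right _ ?_
      simpa using hf) (fun y => ((hL _ _).mul_left _).mul_right _)
  have hout : ∀ x : ℝ, _ := fun x => integrable_of_hasSum
    (fun k => (weyl_outer_integral hh k φ (f k) x).1)
    (g := fun p : ℝ => ∫ y : ℝ,
      Complex.exp (Complex.I * p * (x - y) / h) * L ((x + y) / 2) p * φ y) (by
      simp_rw [fun k => (weyl_outer_integral hh k φ (f k) x).2.1]
      refine Summable.mul_right _ ?_
      simpa using hf) (fun p => by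
      have := (hin x p).2
      simp_rw [fun k => (weyl_inner_integral hh k φ (f k) x p).2.2] at this
      exact this)
  refine ⟨fun x p => (hin x p).1, fun x => (hout x).1, ?_⟩
  have hs := (hasSum_weylSum h hf).mapL (ContinuousLinearMap.apply ℂ L2Line (φ.toLp 2 volume))
  refine (ae_eq_of_hasSum (u := fun k => fun x => (f k : ℂ) * weylFun h k φ x)
    (fun k => ?_) hs (Eventually.of_forall fun x => ?_)).symm
  · have h1 := (weylOp_ae h k (φ.toLp 2 volume)).trans
      (weylFun_congr_ae (SchwartzMap.coeFn_toLp φ 2 volume) h k)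
    refine (Lp.coeFn_smul (f k : ℂ) (weylOp h k (φ.toLp 2 volume))).trans ?_
    filter_upwards [h1] with x hx
    rw [Pi.smul_apply, hx, smul_eq_mul]
  · have := (hout x).2
    simp_rw [fun k => (weyl_outer_integral hh k φ (f k) x).2.2] at this
    have hpc : 2 * (Real.pi : ℂ) * h ≠ 0 := by
      exact_mod_cast (by positivity : 2 * Real.pi * h ≠ 0)
    have h2 := this.mul_left (1 / (2 * (Real.pi : ℂ) * h))
    have e : ∀ w : ℂ, 1 / (2 * (Real.pi : ℂ) * h) * (2 * Real.pi * h * w) = w := fun w => by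
      rw [← mul_assoc, one_div_mul_cancel hpc, one_mul]
    simp only [e] at h2
    exact h2

/-! ### Bounds for the Green profile at complex energies -/

theorem mul_exp_neg_le_one (x : ℝ) : x * Real.exp (-x) ≤ 1 := by
  simpa using mul_exp_neg_le_inv one_pos x

theorem pow_mul_exp_neg_le {x : ℝ} (hx : 0 ≤ x) (n : ℕ) : x ^ n * Real.exp (-x) ≤ n.factorial := by
  have h1 := Real.pow_div_factorial_le_exp x hx n
  rw [div_le_iff₀ (by positivity)] at h1
  rw [Real.exp_neg, ← div_eq_mul_inv, div_le_iff₀ (Real.exp_pos x)]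
  linarith

theorem heatProfile_le_inv_pi {h s r : ℝ} (hh : 0 < h) (hs : 0 < s) (hr : 1 ≤ r) :
    heatProfile h r s ≤ 1 / Real.pi := by
  refine (heatProfile_le hh hs r).trans ?_
  have h1 := exp_inv_div_le hs
  have h2 : Real.exp (-(r ^ 2 / (4 * s))) ≤ Real.exp (-(1 / (4 * s))) := by
    gcongr; nlinarith
  have h3 : 1 / s * Real.exp (-(r ^ 2 / (4 * s))) ≤ 4 := by
    rw [one_div, inv_mul_eq_div]
    exact (div_le_div_of_nonneg_right h2 hs.le).trans h1
  calc 1 / (4 * Real.pi) * (1 / s * Real.exp (-(r ^ 2 / (4 * s))))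
      ≤ 1 / (4 * Real.pi) * 4 := by gcongr
    _ = 1 / Real.pi := by field_simp

/-- By the square `(r - 2s√E)² ≥ 0` the full exponent is at least `r√E`. One tenth of it is kept to
absorb `1/s` and to make the bound integrable. The remaining rate `9/10` must stay close to `1`,
because the bound is later divided by `a(z,h)`, for which only the lower bound of order `e^{-√E}/E`
is available. -/
theorem heatProfile_mul_exp_le_exp {h s r E : ℝ} (hh : 0 < h) (hs : 0 < s) (hr : 1 ≤ r)
    (hE : 0 < E) :
    heatProfile h r s * Real.exp (-(E * s)) ≤
      10 / Real.pi * Real.exp (-(9 / 10 * r * √E)) * Real.exp (-(E / 10 * s)) := by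
  have h1 : 1 / s * Real.exp (-(1 / (40 * s))) ≤ 40 := by
    have := mul_exp_neg_le_one (1 / (40 * s))
    have e : 1 / s = 40 * (1 / (40 * s)) := by field_simp
    rw [e]; nlinarith
  have h2 : r * √E ≤ r ^ 2 / (4 * s) + E * s := by
    have e : r ^ 2 / (4 * s) + E * s - r * √E = (r - 2 * s * √E) ^ 2 / (4 * s) := by
      field_simp
      nlinarith [Real.sq_sqrt hE.le]
    have : 0 ≤ (r - 2 * s * √E) ^ 2 / (4 * s) := by positivity
    linarith
  have h3 : 1 / (40 * s) ≤ r ^ 2 / (40 * s) := by gcongr; nlinarith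
  have e4 : r ^ 2 / (4 * s) = 10 * (r ^ 2 / (40 * s)) := by field_simp; norm_num
  calc heatProfile h r s * Real.exp (-(E * s))
      ≤ 1 / (4 * Real.pi) * (1 / s * Real.exp (-(r ^ 2 / (4 * s)))) * Real.exp (-(E * s)) := by
        gcongr; exact heatProfile_le hh hs r
    _ = 1 / (4 * Real.pi) * (1 / s) * Real.exp (-(r ^ 2 / (4 * s)) - E * s) := by
        rw [sub_eq_add_neg, Real.exp_add]; ring
    _ ≤ 1 / (4 * Real.pi) * (1 / s) *
          Real.exp (-(1 / (40 * s)) + (-(9 / 10 * r * √E) + -(E / 10 * s))) := by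
        gcongr; nlinarith
    _ = 1 / (4 * Real.pi) * (1 / s * Real.exp (-(1 / (40 * s)))) *
          (Real.exp (-(9 / 10 * r * √E)) * Real.exp (-(E / 10 * s))) := by
        rw [Real.exp_add, Real.exp_add]; ring
    _ ≤ 1 / (4 * Real.pi) * 40 *
          (Real.exp (-(9 / 10 * r * √E)) * Real.exp (-(E / 10 * s))) := by gcongr
    _ = _ := by field_simp; ring

theorem norm_cexp_mul_heatProfile_le {h s r E : ℝ} (hh : 0 < h) (hs : 0 < s) {z : ℂ}
    (hz : z.re ≤ -E) : ‖Complex.exp (z * s) * (heatProfile h r s : ℂ)‖ ≤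
      heatProfile h r s * Real.exp (-(E * s)) := by
  rw [norm_mul, norm_cexp_mul, Complex.norm_real, Real.norm_of_nonneg (heatProfile_pos hh hs r).le,
    mul_comm]
  have := (heatProfile_pos hh hs r).le
  gcongr
  nlinarith

theorem norm_greenProfile_le {h r E : ℝ} (hh : 0 < h) (hr : 1 ≤ r) (hE : 0 < E) {z : ℂ}
    (hz : z.re ≤ -E) :
    ‖greenProfile h r z‖ ≤ 100 / (Real.pi * E) * Real.exp (-(9 / 10 * r * √E)) := by
  have hi : IntegrableOn (fun s : ℝ => 10 / Real.pi * Real.exp (-(9 / 10 * r * √E)) *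
      Real.exp (-(E / 10 * s))) (Ioi 0) := (integrableOn_exp_neg (by positivity)).const_mul _
  refine (norm_integral_le_of_norm_le hi ?_).trans_eq ?_
  · refine (ae_restrict_iff' measurableSet_Ioi).2 (Eventually.of_forall fun s hs => ?_)
    exact (norm_cexp_mul_heatProfile_le hh hs hz).trans (heatProfile_mul_exp_le_exp hh hs hr hE)
  · rw [integral_const_mul, integral_exp_neg (by positivity)]
    field_simp
    norm_num

theorem integrableOn_exp_mul_norm_heatProfile {h r : ℝ} (hh : 0 < h) (hr : 0 < r) :
    ∀ κ > 0, IntegrableOn (fun s => Real.exp (-(κ * s)) * ‖(heatProfile h r s : ℂ)‖) (Ioi 0) := by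
  intro κ hκ
  refine (integrableOn_heatProfile_mul_exp hh hκ hr).congr_fun (fun s hs => ?_) measurableSet_Ioi
  simp only [Complex.norm_real, Real.norm_of_nonneg (heatProfile_pos hh hs r).le]
  ring

theorem hasDerivAt_greenProfile {h r : ℝ} (hh : 0 < h) (hr : 0 < r) {z : ℂ} (hz : z.re < 0) :
    HasDerivAt (greenProfile h r)
      (∫ s in Ioi (0 : ℝ), Complex.exp (z * s) * (s * (heatProfile h r s : ℂ))) z :=
  hasDerivAt_laplace (φ := fun s => (heatProfile h r s : ℂ))
    (Complex.measurable_ofReal.comp (measurable_heatProfile h r))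
    (integrableOn_exp_mul_norm_heatProfile hh hr) hz

theorem exists_hasDerivAt_greenProfile {h r E : ℝ} (hh : 0 < h) (hr : 1 ≤ r) (hE : 0 < E) {z : ℂ}
    (hz : z.re ≤ -E) :
    ∃ f' : ℂ, HasDerivAt (greenProfile h r) f' z ∧ ‖f'‖ ≤ 1 / (Real.pi * E ^ 2) := by
  refine ⟨_, hasDerivAt_greenProfile hh (by linarith) (by linarith), ?_⟩
  have hi : IntegrableOn (fun s : ℝ => 1 / Real.pi * (s ^ 1 * Real.exp (-(E * s)))) (Ioi 0) :=
    (integrableOn_pow_mul_exp_neg 1 hE).const_mul _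
  refine (norm_integral_le_of_norm_le hi ?_).trans_eq ?_
  · refine (ae_restrict_iff' measurableSet_Ioi).2 (Eventually.of_forall fun s hs => ?_)
    have hs' : (0 : ℝ) < s := hs
    have h1 := norm_cexp_mul_heatProfile_le (r := r) hh hs hz
    have h2 := heatProfile_le_inv_pi hh hs hr
    calc ‖Complex.exp (z * s) * (s * (heatProfile h r s : ℂ))‖
        = s * ‖Complex.exp (z * s) * (heatProfile h r s : ℂ)‖ := by
          rw [norm_mul, norm_mul, norm_mul, Complex.norm_real, Real.norm_of_nonneg hs'.le]; ring
      _ ≤ s * (heatProfile h r s * Real.exp (-(E * s))) := by gcongr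
      _ ≤ s * (1 / Real.pi * Real.exp (-(E * s))) := by gcongr
      _ = _ := by ring
  · rw [integral_const_mul, integral_pow_mul_exp_neg 1 hE]
    simp
    field_simp

/-! ### Upper and lower bounds at distance one, for the denominator `a(z,h)` -/

theorem hasDerivAt_heatProfile_one {h s : ℝ} (hh : 0 < h) (hs : 0 < s) :
    HasDerivAt (heatProfile h 1) (heatProfile h 1 s * (hS h s ^ 2 / 4 - hC h s)) s := by
  have h1 := ((hasDerivAt_hS hh hs).div_const (4 * Real.pi)).mul
    ((((hasDerivAt_hC hh hs).mul_const ((1 : ℝ) ^ 2)).div_const 4).neg.exp)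
  refine h1.congr_deriv ?_
  simp only [heatProfile, Pi.neg_apply]
  ring

theorem abs_deriv_heatProfile_one_le {h s : ℝ} (hh : 0 < h) (hh1 : h ≤ 1) (hs : 0 < s) :
    |heatProfile h 1 s * (hS h s ^ 2 / 4 - hC h s)| ≤ 11 := by
  set x := 1 / (4 * s) with hx
  have hx0 : 0 < x := by positivity
  have hsx : 1 / s = 4 * x := by rw [hx]; field_simp
  have h1 := hS_le hh hs
  have h2 := hC_le hh hs
  have h3 := hS_pos hh hs
  have h4 := hC_pos hh hs
  have h5 := heatProfile_le hh hs 1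
  rw [one_pow, ← hx, hsx] at h5
  rw [hsx] at h1 h2
  have h6 : |hS h s ^ 2 / 4 - hC h s| ≤ 4 * x ^ 2 + 4 * x + 1 := by
    rw [abs_le]; constructor <;> nlinarith
  have e1 := pow_mul_exp_neg_le hx0.le 1
  have e2 := pow_mul_exp_neg_le hx0.le 2
  have e3 := pow_mul_exp_neg_le hx0.le 3
  simp [Nat.factorial] at e1 e2 e3
  rw [abs_mul, abs_of_pos (heatProfile_pos hh hs 1)]
  calc heatProfile h 1 s * |hS h s ^ 2 / 4 - hC h s|
      ≤ 1 / (4 * Real.pi) * (4 * x * Real.exp (-x)) * (4 * x ^ 2 + 4 * x + 1) := by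
        gcongr
    _ = 1 / Real.pi * (4 * (x ^ 3 * Real.exp (-x)) + 4 * (x ^ 2 * Real.exp (-x)) +
          x * Real.exp (-x)) := by field_simp
    _ ≤ 1 / Real.pi * 33 := by gcongr; linarith
    _ ≤ 1 / 3 * 33 := by gcongr; exact Real.pi_gt_three.le
    _ = 11 := by norm_num

/-- Decay of the profile in all directions of a half plane, by integration by parts. -/
theorem norm_greenProfile_one_le {h E : ℝ} (hh : 0 < h) (hh1 : h ≤ 1) (hE : 0 < E) {z : ℂ}
    (hz : z.re ≤ -E) : ‖greenProfile h 1 z‖ ≤ 11 / (E * ‖z‖) := by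
  have hz0 : z ≠ 0 := by rintro rfl; simp at hz; linarith
  have hzn : 0 < ‖z‖ := norm_pos_iff.2 hz0
  set w' : ℝ → ℝ := fun s => heatProfile h 1 s * (hS h s ^ 2 / 4 - hC h s) with hw'
  have hmw : Measurable w' := (measurable_heatProfile h 1).mul
    ((((measurable_hS h).pow_const 2).div_const 4).sub (measurable_hC h))
  have hi2 : IntegrableOn (fun s : ℝ => Complex.exp (z * s) * (w' s : ℂ)) (Ioi 0) := by
    refine integrableOn_cexp_mul (Complex.measurable_ofReal.comp hmw) (fun κ hκ => ?_) (by linarith)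
    refine ((integrableOn_exp_neg hκ).mul_const 11).mono' ?_ ?_
    · exact (Measurable.aestronglyMeasurable (by fun_prop)).mul
        (Complex.measurable_ofReal.comp hmw).norm.aestronglyMeasurable
    · refine (ae_restrict_iff' measurableSet_Ioi).2 (Eventually.of_forall fun s hs => ?_)
      rw [norm_mul, Real.norm_of_nonneg (Real.exp_pos _).le, norm_norm]
      gcongr
      rw [Function.comp_apply, Complex.norm_real]
      exact abs_deriv_heatProfile_one_le hh hh1 hs
  have hi1 := (integrableOn_cexp_heatProfile hh (by linarith : z.re < 0) one_pos).const_mul z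
  -- The value produced by division by zero is also the limit at `0`, so the integration by parts
  -- has no boundary terms. It gains the factor `1/‖z‖`, which controls the equation for `ζ` also
  -- far from the real axis.
  have h0 : heatProfile h 1 0 = 0 := by simp [heatProfile, hS]
  have key := integral_Ioi_of_hasDerivAt_of_tendsto
    (f := fun s : ℝ => Complex.exp (z * s) * (heatProfile h 1 s : ℂ))
    (f' := fun s : ℝ => z * (Complex.exp (z * s) * (heatProfile h 1 s : ℂ)) +
      Complex.exp (z * s) * (w' s : ℂ)) (a := 0) (m := 0) ?_ ?_ (hi1.add hi2) ?_
  · rw [integral_add hi1 hi2, integral_const_mul] at key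
    simp only [h0, Complex.ofReal_zero, mul_zero, sub_zero] at key
    have e : greenProfile h 1 z * z = -∫ s in Ioi (0 : ℝ), Complex.exp (z * s) * (w' s : ℂ) := by
      rw [greenProfile]; linear_combination key
    have hb : ‖∫ s in Ioi (0 : ℝ), Complex.exp (z * s) * (w' s : ℂ)‖ ≤ 11 / E := by
      refine (norm_integral_le_of_norm_le ((integrableOn_exp_neg hE).mul_const 11) ?_).trans_eq ?_
      · refine (ae_restrict_iff' measurableSet_Ioi).2 (Eventually.of_forall fun s hs => ?_)
        have hs' : (0 : ℝ) < s := hs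
        rw [norm_mul, norm_cexp_mul, Complex.norm_real]
        have := abs_deriv_heatProfile_one_le hh hh1 hs'
        refine mul_le_mul (Real.exp_le_exp.2 (by nlinarith)) this (norm_nonneg _)
          (Real.exp_pos _).le
      · rw [integral_mul_const, integral_exp_neg hE]; ring
    rw [← norm_neg, ← e, norm_mul] at hb
    rw [← div_div]
    exact (le_div_iff₀ hzn).2 hb
  · have hlim : Tendsto (fun s : ℝ => 8 / Real.pi * s) (𝓝[Ici 0] 0) (𝓝 0) := by
      have : Tendsto (fun s : ℝ => 8 / Real.pi * s) (𝓝 0) (𝓝 (8 / Real.pi * 0)) :=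
        (continuous_const.mul continuous_id).tendsto 0
      rw [mul_zero] at this
      exact this.mono_left nhdsWithin_le_nhds
    rw [ContinuousWithinAt]
    simp only [h0, Complex.ofReal_zero, mul_zero]
    refine squeeze_zero_norm' ?_ hlim
    filter_upwards [self_mem_nhdsWithin] with s hs
    rcases eq_or_lt_of_le (show (0 : ℝ) ≤ s from hs) with rfl | hs'
    · simp [h0]
    · refine (norm_cexp_mul_heatProfile_le hh hs' hz).trans ?_
      have hp := heatProfile_le hh hs' 1
      have hx0 : 0 < 1 / (4 * s) := by positivity
      have e2 := pow_mul_exp_neg_le hx0.le 2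
      simp only [Nat.factorial] at e2
      rw [one_pow] at hp
      have e3 : Real.exp (-(E * s)) ≤ 1 := Real.exp_le_one_iff.2 (by nlinarith)
      calc heatProfile h 1 s * Real.exp (-(E * s)) ≤ heatProfile h 1 s * 1 := by
            have := (heatProfile_pos hh hs' 1).le
            gcongr
        _ ≤ 1 / (4 * Real.pi) * (1 / s * Real.exp (-(1 / (4 * s)))) := by rw [mul_one]; exact hp
        _ = 4 / Real.pi * s * ((1 / (4 * s)) ^ 2 * Real.exp (-(1 / (4 * s)))) := by
            field_simp
        _ ≤ 4 / Real.pi * s * 2 := by gcongr; simpa using e2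
        _ = 8 / Real.pi * s := by ring
  · intro s hs
    have h1 : HasDerivAt (fun s : ℝ => Complex.exp (z * s)) (Complex.exp (z * s) * (z * 1)) s :=
      ((Complex.ofRealCLM.hasDerivAt (x := s)).const_mul z).cexp
    refine (h1.mul (hasDerivAt_heatProfile_one hh hs).ofReal_comp).congr_deriv ?_
    simp only [hw']
    ring
  · refine squeeze_zero_norm' (a := fun s : ℝ => 1 / Real.pi * Real.exp (-(E * s))) ?_ ?_
    · filter_upwards [eventually_gt_atTop 0] with s hs
      refine (norm_cexp_mul_heatProfile_le hh hs hz).trans ?_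
      gcongr
      exact heatProfile_le_inv_pi hh hs le_rfl
    · have : Tendsto (fun s : ℝ => Real.exp (-(E * s))) atTop (𝓝 0) :=
        Real.tendsto_exp_neg_atTop_nhds_zero.comp (tendsto_id.const_mul_atTop hE)
      simpa using this.const_mul (1 / Real.pi)

theorem le_heatProfile_one {h s : ℝ} (hh : 0 < h) (hh1 : h ≤ 1) (hs : 0 < s) (hs1 : s ≤ 1) :
    1 / (8 * Real.pi) * Real.exp (-(1 / (4 * s)) - 1 / 4) ≤ heatProfile h 1 s := by
  have h1 := le_hS hh hs
  have h2 := hC_le hh hs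
  have h3 : h ^ 2 * s / 2 ≤ 1 / 2 := by nlinarith [mul_le_mul hh1 hh1 hh.le zero_le_one, sq h]
  have h4 : 1 ≤ 1 / s := by rw [le_div_iff₀ hs]; linarith
  have h5 : (1 : ℝ) / 2 ≤ hS h s := by linarith
  have e : 1 / (4 * s) = 1 / s / 4 := by field_simp
  rw [heatProfile]
  calc 1 / (8 * Real.pi) * Real.exp (-(1 / (4 * s)) - 1 / 4)
      = (1 / 2) / (4 * Real.pi) * Real.exp (-(1 / (4 * s)) - 1 / 4) := by ring
    _ ≤ _ := by
      gcongr
      rw [e, one_pow]; linarith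

/-- The real part of the profile is positive near the negative real axis, far from the origin. -/
theorem le_re_greenProfile_one {h E : ℝ} (hh : 0 < h) (hh1 : h ≤ 1) (hE : 25 ≤ E) {z : ℂ}
    (hz : z.re = -E) (hi : |z.im| ≤ 1) :
    1 / (128 * Real.pi) * (Real.exp (-√E) / E) ≤ (greenProfile h 1 z).re := by
  have hE0 : 0 < E := by linarith
  have hsq : 5 ≤ √E := Real.le_sqrt_of_sq_le (by norm_num; linarith)
  have hss : √E ^ 2 = E := Real.sq_sqrt hE0.le
  set w := fun s : ℝ => heatProfile h 1 s * Real.exp (-(E * s)) with hw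
  have hwi : IntegrableOn w (Ioi 0) := integrableOn_heatProfile_mul_exp hh hE0 one_pos
  have hwp : ∀ s : ℝ, 0 < s → 0 < w s := fun s hs =>
    mul_pos (heatProfile_pos hh hs 1) (Real.exp_pos _)
  have hintg := integrableOn_cexp_heatProfile hh (by linarith : z.re < 0) one_pos
  have hre : (greenProfile h 1 z).re = ∫ s in Ioi (0 : ℝ), w s * Real.cos (z.im * s) := by
    have e1 : (∫ s in Ioi (0 : ℝ), (Complex.exp (z * s) * (heatProfile h 1 s : ℂ)).re) =
        (greenProfile h 1 z).re := integral_re hintg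
    rw [← e1]
    refine setIntegral_congr_fun measurableSet_Ioi fun s _ => ?_
    simp only [hw]
    rw [Complex.re_mul_ofReal, Complex.exp_re]
    simp only [Complex.mul_re, Complex.mul_im, Complex.ofReal_re, Complex.ofReal_im, mul_zero,
      sub_zero, zero_add, hz]
    rw [neg_mul]; ring
  -- The minimum of `1/(4s) + Es` is `√E`, attained at this point. On a window of length `1/E` to
  -- its right the exponent grows by at most `1`, which gives a contribution of order `e^{-√E}/E`.
  set t := 1 / (2 * √E) with ht
  have ht0 : 0 < t := by positivity
  have ht1 : t + 1 / E ≤ 1 := by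
    have a1 : t ≤ 1 / 6 := by rw [ht]; gcongr; linarith
    have a2 : 1 / E ≤ 1 / 9 := by gcongr; linarith
    linarith
  have hJ : Icc t (t + 1 / E) ⊆ Ioi 0 := fun s hs => lt_of_lt_of_le ht0 hs.1
  have hcont : IntegrableOn (fun s => w s * Real.cos (z.im * s)) (Ioi 0) := by
    refine hwi.mono' (hwi.aestronglyMeasurable.mul
      (Continuous.aestronglyMeasurable (by fun_prop))) ?_
    refine (ae_restrict_iff' measurableSet_Ioi).2 (Eventually.of_forall fun s hs => ?_)
    rw [norm_mul, Real.norm_of_nonneg (hwp s hs).le]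
    exact mul_le_of_le_one_right (hwp s hs).le (Real.abs_cos_le_one _)
  -- For `s ≤ 1` the cosine is at least `1/2`, since `|Im z| ≤ 1`. Only times `s > 1` can contribute
  -- negatively, and there the weight is at most of order `e^{-(E-1)} e^{-s}`.
  have hlow : ∀ s ∈ Ioi (0 : ℝ), (Icc t (t + 1 / E)).indicator (fun _ =>
      1 / (64 * Real.pi) * Real.exp (-√E)) s -
        Real.exp (-(E - 1)) / Real.pi * Real.exp (-(1 * s)) ≤ w s * Real.cos (z.im * s) := by
    intro s hs
    have hs' : (0 : ℝ) < s := hs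
    have habs : |z.im * s| ≤ s := by
      rw [abs_mul, abs_of_pos hs']; exact mul_le_of_le_one_left hs'.le hi
    have hneg : 0 ≤ Real.exp (-(E - 1)) / Real.pi * Real.exp (-(1 * s)) := by positivity
    rcases le_or_gt s 1 with hs1 | hs1
    · have hc : 1 / 2 ≤ Real.cos (z.im * s) := by
        have := Real.one_sub_sq_div_two_le_cos (x := z.im * s)
        nlinarith [sq_abs (z.im * s), abs_nonneg (z.im * s)]
      by_cases hsJ : s ∈ Icc t (t + 1 / E)
      · rw [indicator_of_mem hsJ]
        have a1 := le_heatProfile_one hh hh1 hs' hs1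
        have a2 : 1 / (4 * s) ≤ √E / 2 := by
          calc 1 / (4 * s) ≤ 1 / (4 * t) := by gcongr; exact hsJ.1
            _ = √E / 2 := by rw [ht]; field_simp; norm_num
        have a3 : E * s ≤ √E / 2 + 1 := by
          calc E * s ≤ E * (t + 1 / E) := by gcongr; exact hsJ.2
            _ = √E / 2 + 1 := by rw [ht]; field_simp; nlinarith
        have a4 : (1 : ℝ) / 4 ≤ Real.exp (-(5 / 4)) := by
          rw [Real.exp_neg, one_div]
          gcongr
          have : Real.exp (5 / 4) = Real.exp 1 * Real.exp (1 / 4) := by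
            rw [← Real.exp_add]; norm_num
          have b1 := Real.exp_one_lt_d9
          have b2 : Real.exp (1 / 4) ≤ 4 / 3 := by
            have := Real.exp_bound_div_one_sub_of_interval (x := 1 / 4) (by norm_num) (by norm_num)
            norm_num at this ⊢; linarith
          nlinarith [Real.exp_pos (1 / 4 : ℝ), Real.exp_pos (1 : ℝ)]
        have a5 : 1 / (32 * Real.pi) * Real.exp (-√E) ≤ w s := by
          calc 1 / (32 * Real.pi) * Real.exp (-√E)
              = 1 / (8 * Real.pi) * (1 / 4 * Real.exp (-√E)) := by ring
            _ ≤ 1 / (8 * Real.pi) * (Real.exp (-(5 / 4)) * Real.exp (-√E)) := by gcongr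
            _ ≤ 1 / (8 * Real.pi) * (Real.exp (-(1 / (4 * s)) - 1 / 4) * Real.exp (-(E * s))) := by
                rw [← Real.exp_add, ← Real.exp_add]
                gcongr ?_ * Real.exp ?_
                linarith
            _ = 1 / (8 * Real.pi) * Real.exp (-(1 / (4 * s)) - 1 / 4) * Real.exp (-(E * s)) := by
                ring
            _ ≤ heatProfile h 1 s * Real.exp (-(E * s)) := by gcongr
        have a6 : 1 / (64 * Real.pi) * Real.exp (-√E) =
          1 / (32 * Real.pi) * Real.exp (-√E) * (1 / 2) := by ring
        have a7 : 1 / (32 * Real.pi) * Real.exp (-√E) * (1 / 2) ≤ w s * Real.cos (z.im * s) := by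
          gcongr; exact (hwp s hs').le
        linarith
      · rw [indicator_of_notMem hsJ]
        have := mul_nonneg (hwp s hs').le (by linarith : 0 ≤ Real.cos (z.im * s))
        linarith
    · have hsJ : s ∉ Icc t (t + 1 / E) := fun hc => by linarith [hc.2]
      rw [indicator_of_notMem hsJ, zero_sub, neg_le]
      have b1 : -(w s * Real.cos (z.im * s)) ≤ w s := by
        nlinarith [hwp s hs', Real.neg_one_le_cos (z.im * s)]
      refine b1.trans ?_
      have b2 := heatProfile_le_inv_pi hh hs' le_rfl
      calc w s = heatProfile h 1 s * Real.exp (-(E * s)) := rfl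
        _ ≤ 1 / Real.pi * Real.exp (-(E * s)) := by gcongr
        _ ≤ 1 / Real.pi * Real.exp (-(E - 1) + -(1 * s)) := by gcongr; nlinarith
        _ = _ := by rw [Real.exp_add]; ring
  have hJi : IntegrableOn ((Icc t (t + 1 / E)).indicator (fun _ : ℝ =>
      1 / (64 * Real.pi) * Real.exp (-√E))) (Ioi 0) := by
    refine Integrable.integrableOn ((integrable_indicator_iff measurableSet_Icc).2 ?_)
    exact integrableOn_const (by simp)
  have hei := (integrableOn_exp_neg one_pos).const_mul (Real.exp (-(E - 1)) / Real.pi)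
  have hfin := setIntegral_mono_on (hJi.sub hei) hcont measurableSet_Ioi hlow
  rw [← hre] at hfin
  refine le_trans ?_ hfin
  have hs1 : ∫ s in Ioi (0 : ℝ), (Icc t (t + 1 / E)).indicator (fun _ : ℝ =>
      1 / (64 * Real.pi) * Real.exp (-√E)) s = 1 / (64 * Real.pi) * (Real.exp (-√E) / E) := by
    rw [setIntegral_indicator measurableSet_Icc, inter_eq_self_of_subset_right hJ,
      setIntegral_const, smul_eq_mul, Real.volume_real_Icc_of_le (by
        have : 0 < 1 / E := by positivity
        linarith)]
    ring
  have hsub := integral_sub hJi hei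
  rw [hs1, integral_const_mul, integral_exp_neg one_pos] at hsub
  refine le_trans ?_ hsub.ge
  -- The negative tail takes away at most half of the main contribution. This is where `E ≥ 25` is
  -- needed, through `5√E ≤ E`.
  have hbig : 128 * E * Real.exp (-(E - 1)) ≤ Real.exp (-√E) := by
    have c1 : 5 * √E ≤ E := by nlinarith
    have c2 := Real.pow_div_factorial_le_exp (19 / 25 * E) (by positivity) 4
    have c3 : Real.exp (19 / 25 * E) ≤ Real.exp (E - 1 - √E) := by gcongr; linarith
    have c4 : 128 * E ≤ Real.exp (E - 1 - √E) := by
      refine le_trans ?_ (c2.trans c3)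
      have : (25 : ℝ) ^ 3 ≤ E ^ 3 := by gcongr
      simp only [Nat.factorial]
      push_cast
      rw [le_div_iff₀ (by norm_num)]
      nlinarith
    calc 128 * E * Real.exp (-(E - 1)) ≤ Real.exp (E - 1 - √E) * Real.exp (-(E - 1)) := by gcongr
      _ = Real.exp (-√E) := by rw [← Real.exp_add]; congr 1; ring
  have : 1 / (64 * Real.pi) * (Real.exp (-√E) / E) =
    1 / (128 * Real.pi) * (Real.exp (-√E) / E) + 1 / (128 * Real.pi) * (Real.exp (-√E) / E) := by
      ring
  rw [this]
  have : Real.exp (-(E - 1)) / Real.pi * (1 / 1) ≤ 1 / (128 * Real.pi) * (Real.exp (-√E) / E) := by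
    calc Real.exp (-(E - 1)) / Real.pi * (1 / 1)
        = 1 / (128 * Real.pi) * (128 * E * Real.exp (-(E - 1)) / E) := by field_simp
      _ ≤ _ := by gcongr
  linarith

theorem greenProfile_conj (h r : ℝ) (z : ℂ) :
    greenProfile h r (conj z) = conj (greenProfile h r z) := by
  rw [greenProfile, greenProfile, ← integral_conj]
  refine integral_congr_ae (Eventually.of_forall fun s => ?_)
  simp [← Complex.exp_conj]

theorem qVal_conj {h : ℝ} {z : ℂ} (hz : z.re < 0) : qVal h (conj z) = conj (qVal h z) := by
  have h1 : rhoFun h (conj z) = conj (rhoFun h z) := by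
    rw [rhoFun, rhoFun, ← integral_conj]
    refine integral_congr_ae (Eventually.of_forall fun s => ?_)
    simp only [map_mul, ← Complex.exp_conj, Complex.conj_ofReal]
  have h2 : Complex.log (-conj z) = conj (Complex.log (-z)) := by
    rw [← map_neg, Complex.log_conj]
    intro hc
    have := Complex.arg_eq_pi_iff.1 hc
    simp at this
    linarith
  have h4 : conj (4 : ℂ) = 4 := Complex.conj_ofNat 4
  simp [qVal, h1, h2, h4]

/-! ### The energy as a function of the parameter `μ` -/

theorem lam_eq {h : ℝ} (hh : 0 < h) {z : ℂ} (hz : z.re < 0) (m n : ℤ) :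
    lam m n z h = greenProfile h ‖latticePt (m, n)‖ z := by
  rw [lam, greenF_eq hh (by linarith), zero_sub, norm_neg]

theorem norm_latticePt_one_zero : ‖latticePt (1, 0)‖ = 1 := by
  have := norm_latticePt_sq (1, 0)
  simp at this
  rcases this with h | h
  · exact h
  · linarith [norm_nonneg (latticePt (1, 0))]

theorem aFun_eq {h : ℝ} (hh : 0 < h) {z : ℂ} (hz : z.re < 0) :
    aFun z h = 2 * greenProfile h 1 z := by
  rw [aFun, lam_eq hh hz, norm_latticePt_one_zero]

/-- The right-hand side of the equation `log (-z) = …` equivalent to `m_α(z,h) = μ`. -/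
def logRHS (h c : ℝ) (μ z : ℂ) : ℂ :=
  c + rhoFun h z - 4 * Real.pi * μ * (2 * greenProfile h 1 z)

/-- Multiplication by `4πa` isolates the only term of `q` that is not small or constant, namely
`-log(-z)`. -/
theorem mFun_eq_iff {α h : ℝ} (hh : 0 < h) {z : ℂ} (hz : z.re < 0) (ha : aFun z h ≠ 0) (μ : ℂ) :
    mFun α z h = μ ↔
      Complex.log (-z) = logRHS h (4 * Real.pi / α + frullaniConst) μ z := by
  have hp : (Real.pi : ℂ) ≠ 0 := by exact_mod_cast Real.pi_ne_zero
  rw [mFun, div_eq_iff ha, qFun_eq_qVal hh hz, aFun_eq hh hz, qVal, logRHS]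
  push_cast
  constructor
  · intro e
    have e2 := congrArg (fun v => 4 * (Real.pi : ℂ) * v) e
    simp only [mul_add, ← mul_assoc] at e2
    rw [mul_one_div_cancel (by simp)] at e2
    linear_combination -e2
  · intro e
    rw [e]
    field_simp
    ring

theorem norm_four_pi_mul_le {h E : ℝ} (hh : 0 < h) (hh1 : h ≤ 1) (hE : 0 < E) {z μ : ℂ}
    (hz : z.re ≤ -E) :
    ‖4 * Real.pi * μ * (2 * greenProfile h 1 z)‖ ≤ 280 * ‖μ‖ / (E * ‖z‖) := by
  have h1 := norm_greenProfile_one_le hh hh1 hE hz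
  have hz0 : 0 < ‖z‖ := by
    have := Complex.abs_re_le_norm z
    rw [abs_of_neg (by linarith)] at this
    linarith
  simp only [norm_mul, Complex.norm_real, RCLike.norm_ofNat, Real.norm_of_nonneg Real.pi_pos.le]
  have hp := Real.pi_lt_d2
  calc 4 * Real.pi * ‖μ‖ * (2 * ‖greenProfile h 1 z‖)
      ≤ 4 * 3.15 * ‖μ‖ * (2 * (11 / (E * ‖z‖))) := by gcongr
    _ = 277.2 * ‖μ‖ / (E * ‖z‖) := by ring
    _ ≤ _ := by gcongr; norm_num

theorem norm_logRHS_sub_le {h E : ℝ} (hh : 0 < h) (hh1 : h ≤ 1) (hE : 0 < E) {z μ : ℂ}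
    (hz : z.re ≤ -E) (hμ : ‖μ‖ < 5) (c : ℝ) :
    ‖logRHS h c μ z - c‖ ≤ h ^ 2 / (2 * E ^ 2) + 1400 / (E * ‖z‖) := by
  have e : logRHS h c μ z - c = rhoFun h z - 4 * Real.pi * μ * (2 * greenProfile h 1 z) := by
    rw [logRHS]; ring
  rw [e]
  refine (norm_sub_le _ _).trans (add_le_add ((norm_rhoFun_le hh (by linarith)).trans ?_)
    ((norm_four_pi_mul_le hh hh1 hE hz).trans ?_))
  · have : E ^ 2 ≤ z.re ^ 2 := by nlinarith
    gcongr
  · gcongr; linarith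

/-- The logarithms of the energies that are large and close to the negative half axis. -/
def logStrip (R : ℝ) : Set ℂ := {w | Real.log R ≤ w.re ∧ |w.im| ≤ 1 / 4}

theorem convex_logStrip (R : ℝ) : Convex ℝ (logStrip R) := by
  have h1 : Convex ℝ {w : ℂ | Real.log R ≤ w.re} := convex_halfSpace_re_ge _
  have h2 : Convex ℝ {w : ℂ | w.im ≤ 1 / 4} := convex_halfSpace_im_le _
  have h3 : Convex ℝ {w : ℂ | -(1 / 4) ≤ w.im} := convex_halfSpace_im_ge _
  convert h1.inter (h3.inter h2) using 1
  ext w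
  simp [logStrip, abs_le]

theorem isClosed_logStrip (R : ℝ) : IsClosed (logStrip R) :=
  (isClosed_le continuous_const Complex.continuous_re).inter
    (isClosed_le Complex.continuous_im.abs continuous_const)

theorem logStrip_exp {R : ℝ} (hR : 0 < R) {w : ℂ} (hw : w ∈ logStrip R) :
    R ≤ ‖-Complex.exp w‖ ∧ (-Complex.exp w).re ≤ -(‖-Complex.exp w‖ / 2) ∧
      Complex.log (-(-Complex.exp w)) = w ∧ |(-Complex.exp w).im| ≤ ‖-Complex.exp w‖ * |w.im| := by
  obtain ⟨h1, h2⟩ := hw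
  have hn : ‖-Complex.exp w‖ = Real.exp w.re := by rw [norm_neg, Complex.norm_exp]
  have h3 := abs_le.1 h2
  have hp := Real.pi_gt_three
  refine ⟨?_, ?_, ?_, ?_⟩
  · rw [hn]; exact (Real.log_le_iff_le_exp hR).1 h1
  · rw [hn, Complex.neg_re, Complex.exp_re]
    have : 1 / 2 ≤ Real.cos w.im := by
      have := Real.one_sub_sq_div_two_le_cos (x := w.im)
      nlinarith [sq_abs w.im, abs_nonneg w.im]
    nlinarith [Real.exp_pos w.re]
  · rw [neg_neg, Complex.log_exp (by linarith) (by linarith)]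
  · rw [hn, Complex.neg_im, Complex.exp_im, abs_neg, abs_mul, abs_of_pos (Real.exp_pos _)]
    exact mul_le_mul_of_nonneg_left Real.abs_sin_le_abs (Real.exp_pos _).le

/-- In the variable `w = log(-z)` the derivative of `logRHS` is `z` times the `z`-derivative, here
bounded by `8/‖z‖² + 160/‖z‖`. From `‖z‖ ≥ 1000` on this is a contraction with constant `1/2`. -/
theorem exists_hasDerivAt_bound {h : ℝ} (hh : 0 < h) (hh1 : h ≤ 1) {z μ : ℂ} (hR : 1000 ≤ ‖z‖)
    (hz : z.re ≤ -(‖z‖ / 2)) (hμ : ‖μ‖ < 5) :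
    ∃ ρ' f' : ℂ, HasDerivAt (rhoFun h) ρ' z ∧ HasDerivAt (greenProfile h 1) f' z ∧
      ‖z * (ρ' - 4 * Real.pi * μ * (2 * f'))‖ ≤ 1 / 2 := by
  have hE : 0 < ‖z‖ / 2 := by linarith
  obtain ⟨ρ', h1, h2⟩ := hasDerivAt_rhoFun hh (z := z) (by linarith)
  obtain ⟨f', h3, h4⟩ := exists_hasDerivAt_greenProfile hh le_rfl hE hz
  refine ⟨ρ', f', h1, h3, ?_⟩
  have h5 : ‖ρ'‖ ≤ 8 / ‖z‖ ^ 3 := by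
    refine h2.trans ?_
    calc h ^ 2 / (-z.re) ^ 3 ≤ 1 / (‖z‖ / 2) ^ 3 := by
          gcongr
          · nlinarith
          · linarith
      _ = 8 / ‖z‖ ^ 3 := by field_simp; norm_num
  have h6 : ‖4 * (Real.pi : ℂ) * μ * (2 * f')‖ ≤ 160 / ‖z‖ ^ 2 := by
    simp only [norm_mul, Complex.norm_real, RCLike.norm_ofNat, Real.norm_of_nonneg Real.pi_pos.le]
    calc 4 * Real.pi * ‖μ‖ * (2 * ‖f'‖)
        ≤ 4 * Real.pi * 5 * (2 * (1 / (Real.pi * (‖z‖ / 2) ^ 2))) := by gcongr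
      _ = 160 / ‖z‖ ^ 2 := by field_simp; norm_num
  rw [norm_mul]
  calc ‖z‖ * ‖ρ' - 4 * Real.pi * μ * (2 * f')‖ ≤ ‖z‖ * (8 / ‖z‖ ^ 3 + 160 / ‖z‖ ^ 2) := by
        gcongr; exact (norm_sub_le _ _).trans (add_le_add h5 h6)
    _ = 8 / ‖z‖ ^ 2 + 160 / ‖z‖ := by field_simp
    _ ≤ 8 / 1000 ^ 2 + 160 / 1000 := by gcongr
    _ ≤ 1 / 2 := by norm_num

theorem norm_logRHS_exp_sub_le {h : ℝ} (hh : 0 < h) (hh1 : h ≤ 1) {R c : ℝ} (hR : 1000 ≤ R) {μ : ℂ}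
    (hμ : ‖μ‖ < 5) {w w' : ℂ} (hw : w ∈ logStrip R) (hw' : w' ∈ logStrip R) :
    ‖logRHS h c μ (-Complex.exp w') - logRHS h c μ (-Complex.exp w)‖ ≤ 1 / 2 * ‖w' - w‖ := by
  have hd : ∀ v ∈ logStrip R, ∃ d : ℂ,
      HasDerivAt (fun w => logRHS h c μ (-Complex.exp w)) d v ∧ ‖d‖ ≤ 1 / 2 := by
    intro v hv
    obtain ⟨g1, g2, -, -⟩ := logStrip_exp (by linarith) hv
    obtain ⟨ρ', f', h1, h2, h3⟩ := exists_hasDerivAt_bound hh hh1 (hR.trans g1) g2 hμ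
    have he : HasDerivAt (fun w : ℂ => -Complex.exp w) (-Complex.exp v) v :=
      (Complex.hasDerivAt_exp v).neg
    refine ⟨_, ((h1.comp v he).const_add (c : ℂ)).sub
      (((h2.comp v he).const_mul 2).const_mul (4 * Real.pi * μ)), ?_⟩
    refine le_trans (le_of_eq ?_) h3
    congr 1
    ring
  choose! d hd1 hd2 using hd
  exact Convex.norm_image_sub_le_of_norm_hasDerivWithin_le
    (fun v hv => (hd1 v hv).hasDerivWithinAt) hd2 (convex_logStrip R) hw hw'

theorem norm_logRHS_exp_sub_const_le {h : ℝ} (hh : 0 < h) (hh1 : h ≤ 1) {R : ℝ} (hR : 1000 ≤ R)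
    (c : ℝ) {μ : ℂ} (hμ : ‖μ‖ < 5) {w : ℂ} (hw : w ∈ logStrip R) :
    ‖logRHS h c μ (-Complex.exp w) - c‖ ≤ 3000 / ‖-Complex.exp w‖ ^ 2 := by
  obtain ⟨g1, g2, -, -⟩ := logStrip_exp (by linarith) hw
  have hE : 0 < ‖-Complex.exp w‖ / 2 := by linarith
  refine (norm_logRHS_sub_le hh hh1 hE g2 hμ c).trans ?_
  generalize ‖-Complex.exp w‖ = x at *
  have hx : 0 < x := by linarith
  calc h ^ 2 / (2 * (x / 2) ^ 2) + 1400 / (x / 2 * x)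
      ≤ 1 / (2 * (x / 2) ^ 2) + 1400 / (x / 2 * x) := by gcongr; nlinarith
    _ = 2802 / x ^ 2 := by field_simp; norm_num
    _ ≤ _ := by gcongr; norm_num

theorem mem_logStrip_of_norm_sub_le {R c : ℝ} (hc : Real.log R + 1 / 4 ≤ c) {v : ℂ}
    (hv : ‖v - c‖ ≤ 1 / 4) : v ∈ logStrip R := by
  have h1 := (Complex.abs_re_le_norm (v - c)).trans hv
  have h2 := (Complex.abs_im_le_norm (v - c)).trans hv
  simp only [Complex.sub_re, Complex.ofReal_re, Complex.sub_im, Complex.ofReal_im, sub_zero] at h1 h2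
  exact ⟨by linarith [(abs_le.1 h1).1], h2⟩

theorem exists_fixedPoint_logStrip {h : ℝ} (hh : 0 < h) (hh1 : h ≤ 1) {R c : ℝ} (hR : 1000 ≤ R)
    (hc : Real.log R + 1 / 4 ≤ c) {μ : ℂ} (hμ : ‖μ‖ < 5) :
    ∃ w ∈ logStrip R, logRHS h c μ (-Complex.exp w) = w := by
  have hmaps : MapsTo (fun w => logRHS h c μ (-Complex.exp w)) (logStrip R) (logStrip R) := by
    intro w hw
    refine mem_logStrip_of_norm_sub_le hc ?_
    obtain ⟨g1, -, -, -⟩ := logStrip_exp (by linarith) hw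
    refine (norm_logRHS_exp_sub_const_le hh hh1 hR c hμ hw).trans ?_
    calc 3000 / ‖-Complex.exp w‖ ^ 2 ≤ 3000 / 1000 ^ 2 := by
          have := hR.trans g1
          gcongr
      _ ≤ 1 / 4 := by norm_num
  have hK : ContractingWith (1 / 2 : NNReal) (hmaps.restrict _ _ _) := by
    refine ⟨by norm_num, LipschitzWith.of_dist_le_mul fun x y => ?_⟩
    rw [Subtype.dist_eq, Subtype.dist_eq, dist_eq_norm, dist_eq_norm]
    have := norm_logRHS_exp_sub_le (c := c) hh hh1 hR hμ y.2 x.2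
    simpa using this
  have hc' : (c : ℂ) ∈ logStrip R := ⟨by simp; linarith, by simp⟩
  obtain ⟨w, hw, hfix, -⟩ := hK.exists_fixedPoint' (isClosed_logStrip R).isComplete hmaps hc'
    (edist_ne_top _ _)
  exact ⟨w, hw, hfix⟩

/-- A bootstrap. The crude bound on `logRHS - c` over the half plane makes the real part of
`log(-z)` at least `log R`, so `‖z‖ ≥ R`. With this size of `z`, the term `1400/(E₀‖z‖)` drops below
`1/8`, which confines the imaginary part to `1/4`. -/
theorem log_neg_mem_logStrip {E₀ h : ℝ} (hE₀ : 0 < E₀) (hh : 0 < h) (hh1 : h ≤ 1)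
    (hh2 : h ≤ E₀ / 2) {R c : ℝ} (hR : 1000 ≤ R) (hR2 : 12000 / E₀ ≤ R)
    (hc : Real.log R + 1 / 8 + 1400 / E₀ ^ 2 ≤ c) {z μ : ℂ} (hz : z.re < -E₀) (hμ : ‖μ‖ < 5)
    (hs : Complex.log (-z) = logRHS h c μ z) : Complex.log (-z) ∈ logStrip R := by
  have h1 := norm_logRHS_sub_le hh hh1 hE₀ hz.le hμ c
  rw [← hs] at h1
  have hzE : E₀ ≤ ‖z‖ := by
    have := Complex.abs_re_le_norm z
    rw [abs_of_neg (by linarith)] at this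
    linarith
  have hρ : h ^ 2 / (2 * E₀ ^ 2) ≤ 1 / 8 := by
    rw [div_le_iff₀ (by positivity)]; nlinarith
  have h2 := (Complex.abs_re_le_norm _).trans h1
  have h3 := (Complex.abs_im_le_norm _).trans h1
  simp only [Complex.sub_re, Complex.ofReal_re, Complex.sub_im, Complex.ofReal_im, sub_zero] at h2 h3
  have h4 : 1400 / (E₀ * ‖z‖) ≤ 1400 / E₀ ^ 2 := by
    rw [sq]; gcongr
  have h5 : Real.log R ≤ (Complex.log (-z)).re := by linarith [(abs_le.1 h2).1]
  refine ⟨h5, ?_⟩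
  have h6 : R ≤ ‖z‖ := by
    rw [Complex.log_re, norm_neg] at h5
    exact (Real.log_le_log_iff (by linarith) (by linarith)).1 h5
  have h7 : 1400 / (E₀ * ‖z‖) ≤ 1 / 8 := by
    rw [div_le_iff₀ (mul_pos hE₀ (by linarith))]
    rw [div_le_iff₀ hE₀] at hR2
    nlinarith
  linarith

/-- The threshold for `|z|` in the construction of `ζ`. -/
def zetaR (E₀ : ℝ) : ℝ := max 3000 (max (2 * (E₀ + 1)) (12000 / E₀))

/-- The logarithm of `-ζ`, a fixed point in the strip. -/
def zetaLog (E₀ α h : ℝ) (μ : ℂ) : ℂ :=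
  Classical.epsilon fun w => w ∈ logStrip (zetaR E₀) ∧
    logRHS h (4 * Real.pi / α + frullaniConst) μ (-Complex.exp w) = w

/-- The solution `z = ζ` of `m_α(z,h) = μ` in the half plane `Re z < -E₀`. -/
def zetaVal (E₀ α h : ℝ) (μ : ℂ) : ℂ := -Complex.exp (zetaLog E₀ α h μ)

/-- Smallness of the coupling constant, for solutions of size at least `R`. -/
def SmallCoupling (E₀ R α : ℝ) : Prop :=
  0 < α ∧ Real.log R + 1 + 1400 / E₀ ^ 2 ≤ 4 * Real.pi / α + frullaniConst

theorem exists_smallCoupling (E₀ R : ℝ) : ∃ α₁ > 0, ∀ α ∈ Ioo 0 α₁, SmallCoupling E₀ R α := by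
  set K := max 1 (Real.log R + 1 + 1400 / E₀ ^ 2 - frullaniConst) with hK
  have hK1 : 1 ≤ K := le_max_left _ _
  refine ⟨4 * Real.pi / K, by positivity, fun α hα => ⟨hα.1, ?_⟩⟩
  have h1 : K ≤ 4 * Real.pi / α := by
    rw [le_div_iff₀ hα.1, mul_comm]
    exact ((lt_div_iff₀ (by linarith)).1 hα.2).le
  have := le_max_right 1 (Real.log R + 1 + 1400 / E₀ ^ 2 - frullaniConst)
  linarith

/-- The three thresholds: `3000` puts `ζ` at distance at most `1` from the real axis, `2(E₀ + 1)`
gives `Re ζ < -E₀` from `Re ζ ≤ -‖ζ‖/2`, and `12000/E₀` makes the bootstrap in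
`log_neg_mem_logStrip` work. -/
theorem le_zetaR {E₀ : ℝ} :
    3000 ≤ zetaR E₀ ∧ 2 * (E₀ + 1) ≤ zetaR E₀ ∧ 12000 / E₀ ≤ zetaR E₀ :=
  ⟨le_max_left _ _, (le_max_left _ _).trans (le_max_right _ _),
    (le_max_right _ _).trans (le_max_right _ _)⟩

theorem zetaLog_spec {E₀ α h : ℝ} (hα : SmallCoupling E₀ (zetaR E₀) α)
    (hh : 0 < h) (hh1 : h ≤ 1) {μ : ℂ} (hμ : ‖μ‖ < 5) :
    zetaLog E₀ α h μ ∈ logStrip (zetaR E₀) ∧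
      logRHS h (4 * Real.pi / α + frullaniConst) μ (zetaVal E₀ α h μ) = zetaLog E₀ α h μ := by
  have hp : 0 ≤ 1400 / E₀ ^ 2 := by positivity
  obtain ⟨w, hw⟩ := exists_fixedPoint_logStrip hh hh1 (R := zetaR E₀)
    (c := 4 * Real.pi / α + frullaniConst) (by linarith [(le_zetaR (E₀ := E₀)).1])
    (by linarith [hα.2]) hμ
  exact Classical.epsilon_spec (p := fun w => w ∈ logStrip (zetaR E₀) ∧
    logRHS h (4 * Real.pi / α + frullaniConst) μ (-Complex.exp w) = w) ⟨w, hw⟩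

/-- Since `c` is real, the imaginary part of the fixed point `w` is at most `3000/‖ζ‖²`. Multiplying
by `‖ζ‖` gives `|Im ζ| ≤ 3000/‖ζ‖ ≤ 1`, the strip in which `a(ζ,h)` is known not to vanish. -/
theorem zetaVal_bounds {E₀ α h : ℝ} (hα : SmallCoupling E₀ (zetaR E₀) α)
    (hh : 0 < h) (hh1 : h ≤ 1) {μ : ℂ} (hμ : ‖μ‖ < 5) :
    zetaR E₀ ≤ ‖zetaVal E₀ α h μ‖ ∧ (zetaVal E₀ α h μ).re ≤ -(‖zetaVal E₀ α h μ‖ / 2) ∧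
      Complex.log (-zetaVal E₀ α h μ) = zetaLog E₀ α h μ ∧ |(zetaVal E₀ α h μ).im| ≤ 1 := by
  obtain ⟨h1, h2⟩ := zetaLog_spec hα hh hh1 hμ
  have hR := (le_zetaR (E₀ := E₀)).1
  obtain ⟨g1, g2, g3, g4⟩ := logStrip_exp (by linarith) h1
  refine ⟨g1, g2, g3, g4.trans ?_⟩
  have b := norm_logRHS_exp_sub_const_le hh hh1 (by linarith)
    (4 * Real.pi / α + frullaniConst) hμ h1
  rw [show -Complex.exp (zetaLog E₀ α h μ) = zetaVal E₀ α h μ from rfl, h2] at b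
  have b2 := (Complex.abs_im_le_norm _).trans b
  simp only [Complex.sub_im, Complex.ofReal_im, sub_zero] at b2
  rw [show -Complex.exp (zetaLog E₀ α h μ) = zetaVal E₀ α h μ from rfl] at g1 ⊢
  have hx : 0 < ‖zetaVal E₀ α h μ‖ := by linarith
  calc ‖zetaVal E₀ α h μ‖ * |(zetaLog E₀ α h μ).im|
      ≤ ‖zetaVal E₀ α h μ‖ * (3000 / ‖zetaVal E₀ α h μ‖ ^ 2) := by gcongr
    _ = 3000 / ‖zetaVal E₀ α h μ‖ := by field_simp
    _ ≤ 1 := by rw [div_le_one hx]; linarith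

theorem greenProfile_one_ne_zero {h : ℝ} (hh : 0 < h) (hh1 : h ≤ 1) {z : ℂ} (hz : z.re ≤ -25)
    (hi : |z.im| ≤ 1) : greenProfile h 1 z ≠ 0 := by
  intro h0
  have := le_re_greenProfile_one hh hh1 (E := -z.re) (by linarith) (by ring) hi
  rw [h0, Complex.zero_re] at this
  have h2 : 0 < 1 / (128 * Real.pi) * (Real.exp (-√(-z.re)) / -z.re) := by
    have : 0 < -z.re := by linarith
    positivity
  linarith

/-- A solution in the half plane lies in the strip by the a priori estimate; two fixed points of a
contraction with constant `1/2` coincide. -/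
theorem eq_zetaVal_iff {E₀ α h : ℝ} (hE₀ : 0 < E₀) (hα : SmallCoupling E₀ (zetaR E₀) α)
    (hh : 0 < h) (hh1 : h ≤ 1) (hh2 : h ≤ E₀ / 2) {μ : ℂ} (hμ : ‖μ‖ < 5) (z : ℂ) :
    (z.re < -E₀ ∧ aFun z h ≠ 0 ∧ mFun α z h = μ) ↔ z = zetaVal E₀ α h μ := by
  obtain ⟨h1, h2⟩ := zetaLog_spec hα hh hh1 hμ
  obtain ⟨r1, r2, r3⟩ := le_zetaR (E₀ := E₀)
  obtain ⟨g1, g2, g3, g4⟩ := zetaVal_bounds hα hh hh1 hμ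
  constructor
  · rintro ⟨hz, ha, hm⟩
    rw [mFun_eq_iff hh (by linarith) ha] at hm
    have hmem := log_neg_mem_logStrip hE₀ hh hh1 hh2 (by linarith) r3
      (by linarith [hα.2]) hz hμ hm
    have hze : -Complex.exp (Complex.log (-z)) = z := by
      rw [Complex.exp_log (by intro h0; rw [neg_eq_zero] at h0; simp [h0] at hz; linarith), neg_neg]
    have hk := norm_logRHS_exp_sub_le (c := 4 * Real.pi / α + frullaniConst) hh hh1
      (by linarith) hμ h1 hmem
    rw [hze, ← hm, show -Complex.exp (zetaLog E₀ α h μ) = zetaVal E₀ α h μ from rfl, h2] at hk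
    have : ‖Complex.log (-z) - zetaLog E₀ α h μ‖ = 0 := by
      linarith [norm_nonneg (Complex.log (-z) - zetaLog E₀ α h μ)]
    rw [norm_eq_zero, sub_eq_zero] at this
    rw [← hze, this, zetaVal]
  · rintro rfl
    have hlt : (zetaVal E₀ α h μ).re < -E₀ := by linarith
    have ha : aFun (zetaVal E₀ α h μ) h ≠ 0 := by
      rw [aFun_eq hh (by linarith)]
      exact mul_ne_zero two_ne_zero (greenProfile_one_ne_zero hh hh1 (by linarith) g4)
    exact ⟨hlt, ha, (mFun_eq_iff hh (by linarith) ha μ).2 (g3.trans h2.symm)⟩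

/-- The solution is as large as we like when the coupling constant is small. -/
theorem zetaVal_re_le {E₀ α h : ℝ} (hE₀ : 0 < E₀) (hα : SmallCoupling E₀ (zetaR E₀) α)
    (hh : 0 < h) (hh1 : h ≤ 1) (hh2 : h ≤ E₀ / 2) {R : ℝ} (hR : zetaR E₀ ≤ 2 * R)
    (hαR : SmallCoupling E₀ (2 * R) α) {μ : ℂ} (hμ : ‖μ‖ < 5) : (zetaVal E₀ α h μ).re ≤ -R := by
  obtain ⟨h1, h2⟩ := zetaLog_spec hα hh hh1 hμ
  obtain ⟨r1, r2, r3⟩ := le_zetaR (E₀ := E₀)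
  obtain ⟨g1, g2, g3, g4⟩ := zetaVal_bounds hα hh hh1 hμ
  have hmem := log_neg_mem_logStrip hE₀ hh hh1 hh2 (R := 2 * R) (by linarith) (by linarith)
    (by linarith [hαR.2]) (z := zetaVal E₀ α h μ) (by linarith) hμ (g3.trans h2.symm)
  rw [g3] at hmem
  obtain ⟨k1, -⟩ := logStrip_exp (by linarith) hmem
  rw [show -Complex.exp (zetaLog E₀ α h μ) = zetaVal E₀ α h μ from rfl] at k1
  linarith

/-- For real `μ` the conjugate of `ζ` solves the same equation in the same half plane, so uniqueness
makes `ζ` real. -/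
theorem zetaVal_real {E₀ α h : ℝ} (hE₀ : 0 < E₀) (hα : SmallCoupling E₀ (zetaR E₀) α)
    (hh : 0 < h) (hh1 : h ≤ 1) (hh2 : h ≤ E₀ / 2) {μ : ℝ} (hμ : |μ| < 5) :
    zetaVal E₀ α h μ = ((zetaVal E₀ α h μ).re : ℂ) := by
  have hμ' : ‖(μ : ℂ)‖ < 5 := by rwa [Complex.norm_real]
  obtain ⟨h1, h2, h3⟩ := (eq_zetaVal_iff hE₀ hα hh hh1 hh2 hμ' _).2 rfl
  generalize hz : zetaVal E₀ α h μ = z at h1 h2 h3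
  have hneg : z.re < 0 := by linarith
  have hneg' : (conj z).re < 0 := by simpa using hneg
  have ha : aFun (conj z) h = conj (aFun z h) := by
    rw [aFun_eq hh hneg, aFun_eq hh hneg', greenProfile_conj, map_mul, Complex.conj_ofNat]
  have hm : mFun α (conj z) h = conj (mFun α z h) := by
    rw [mFun, mFun, ha, qFun_eq_qVal hh hneg, qFun_eq_qVal hh hneg', qVal_conj hneg]
    simp
  have := (eq_zetaVal_iff hE₀ hα hh hh1 hh2 hμ' (conj z)).1
    ⟨by simpa using h1, by rw [ha]; simpa using h2, by rw [hm, h3, Complex.conj_ofReal]⟩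
  rw [hz] at this
  exact (Complex.conj_eq_iff_re.1 this).symm

theorem norm_zetaLog_sub_le {E₀ α h : ℝ} (hα : SmallCoupling E₀ (zetaR E₀) α)
    (hh : 0 < h) (hh1 : h ≤ 1) {μ ν : ℂ} (hμ : ‖μ‖ < 5) (hν : ‖ν‖ < 5) :
    ‖zetaLog E₀ α h ν - zetaLog E₀ α h μ‖ ≤ 2 * ‖ν - μ‖ := by
  obtain ⟨h1, h2⟩ := zetaLog_spec hα hh hh1 hμ
  obtain ⟨k1, k2⟩ := zetaLog_spec hα hh hh1 hν
  obtain ⟨r1, r2, r3⟩ := le_zetaR (E₀ := E₀)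
  obtain ⟨g1, g2, g3, g4⟩ := zetaVal_bounds hα hh hh1 hν
  set c := 4 * Real.pi / α + frullaniConst
  have b1 := norm_logRHS_exp_sub_le (c := c) hh hh1 (by linarith) hμ h1 k1
  rw [show -Complex.exp (zetaLog E₀ α h μ) = zetaVal E₀ α h μ from rfl,
    show -Complex.exp (zetaLog E₀ α h ν) = zetaVal E₀ α h ν from rfl] at b1
  have e : logRHS h c ν (zetaVal E₀ α h ν) - logRHS h c μ (zetaVal E₀ α h ν) =
      -(4 * Real.pi * (ν - μ) * (2 * greenProfile h 1 (zetaVal E₀ α h ν))) := by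
    simp only [logRHS]; ring
  have b2 := norm_four_pi_mul_le hh hh1 (μ := ν - μ)
    (by linarith : 0 < ‖zetaVal E₀ α h ν‖ / 2) g2
  rw [← norm_neg, ← e] at b2
  have b3 : 280 * ‖ν - μ‖ / (‖zetaVal E₀ α h ν‖ / 2 * ‖zetaVal E₀ α h ν‖) ≤ ‖ν - μ‖ := by
    have : 3000 ≤ ‖zetaVal E₀ α h ν‖ := by linarith
    rw [div_le_iff₀ (by positivity)]
    have hq : 280 ≤ ‖zetaVal E₀ α h ν‖ / 2 * ‖zetaVal E₀ α h ν‖ := by nlinarith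
    nlinarith [norm_nonneg (ν - μ)]
  have b4 : zetaLog E₀ α h ν - zetaLog E₀ α h μ =
      (logRHS h c ν (zetaVal E₀ α h ν) - logRHS h c μ (zetaVal E₀ α h ν)) +
        (logRHS h c μ (zetaVal E₀ α h ν) - logRHS h c μ (zetaVal E₀ α h μ)) := by
    rw [h2, k2]; ring
  have b5 := norm_add_le (logRHS h c ν (zetaVal E₀ α h ν) - logRHS h c μ (zetaVal E₀ α h ν))
        (logRHS h c μ (zetaVal E₀ α h ν) - logRHS h c μ (zetaVal E₀ α h μ))
  rw [← b4] at b5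
  linarith

/-- `ζ` is a continuous local inverse of `z ↦ m_α(z,h)`. Continuity is the Lipschitz dependence of
the fixed point on `μ`, and the derivative of `m_α` does not vanish at `ζ`. -/
theorem differentiableOn_zetaVal {E₀ α h : ℝ} (hE₀ : 0 < E₀)
    (hα : SmallCoupling E₀ (zetaR E₀) α) (hh : 0 < h) (hh1 : h ≤ 1) (hh2 : h ≤ E₀ / 2) :
    DifferentiableOn ℂ (zetaVal E₀ α h) (Metric.ball 0 5) := by
  intro μ hμ
  have hμ' : ‖μ‖ < 5 := by simpa using hμ
  have hnear : ∀ᶠ ν in 𝓝 μ, ‖ν‖ < 5 := (continuous_norm.tendsto μ).eventually_lt_const hμ'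
  have hcont : ContinuousAt (zetaVal E₀ α h) μ := by
    have : ContinuousAt (zetaLog E₀ α h) μ := by
      rw [ContinuousAt, tendsto_iff_norm_sub_tendsto_zero]
      have hl : Tendsto (fun ν : ℂ => 2 * ‖ν - μ‖) (𝓝 μ) (𝓝 0) := by
        have : Continuous fun ν : ℂ => 2 * ‖ν - μ‖ := by fun_prop
        simpa using this.tendsto μ
      refine squeeze_zero' (Eventually.of_forall fun _ => norm_nonneg _) ?_ hl
      filter_upwards [hnear] with ν hν
      exact norm_zetaLog_sub_le hα hh hh1 hμ' hν
    exact (Complex.continuous_exp.continuousAt.comp this).neg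
  obtain ⟨h1, h2, h3⟩ := (eq_zetaVal_iff hE₀ hα hh hh1 hh2 hμ' _).2 rfl
  obtain ⟨r1, r2, r3⟩ := le_zetaR (E₀ := E₀)
  obtain ⟨g1, g2, g3, g4⟩ := zetaVal_bounds hα hh hh1 hμ'
  obtain ⟨ρ', f', d1, d2, d3⟩ := exists_hasDerivAt_bound hh hh1 (by linarith) g2 hμ'
  set z := zetaVal E₀ α h μ with hz
  have hz0 : z ≠ 0 := by intro h0; rw [h0] at g1; simp at g1; linarith
  have hp : (Real.pi : ℂ) ≠ 0 := by exact_mod_cast Real.pi_ne_zero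
  have hlog : HasDerivAt (fun z : ℂ => Complex.log (-z)) (z⁻¹) z := by
    have := ((hasDerivAt_id z).neg).clog (f := fun z : ℂ => -z)
      (Complex.mem_slitPlane_iff.2 (Or.inl (by simp; linarith)))
    refine this.congr_deriv ?_
    simp [neg_div_neg_eq]
  have hq : HasDerivAt (qVal h) (1 / (4 * (Real.pi : ℂ)) * (-z⁻¹ + ρ')) z := by
    refine (((hlog.const_sub (frullaniConst : ℂ)).add d1).const_mul _)
  have hab : 2 * greenProfile h 1 z ≠ 0 := by rwa [aFun_eq hh (by linarith)] at h2
  have hm : HasDerivAt (fun z => (qVal h z + (α : ℂ)⁻¹) / (2 * greenProfile h 1 z)) _ z :=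
    (hq.add_const _).div (d2.const_mul 2) hab
  have hμeq : qVal h z + (α : ℂ)⁻¹ = μ * (2 * greenProfile h 1 z) := by
    rw [mFun, div_eq_iff h2, qFun_eq_qVal hh (by linarith), aFun_eq hh (by linarith)] at h3
    exact h3
  refine (HasDerivAt.of_local_left_inverse hcont hm ?_ ?_).differentiableAt.differentiableWithinAt
  · rw [hμeq]
    intro h0
    rw [div_eq_zero_iff, or_iff_left (pow_ne_zero 2 hab)] at h0
    -- A critical point of `m_α` would make the contraction derivative equal to `1`, although its
    -- modulus is at most `1/2`.
    have e : z * (ρ' - 4 * Real.pi * μ * (2 * f')) = 1 := by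
      have e1 : (1 / (4 * (Real.pi : ℂ)) * (-z⁻¹ + ρ') - μ * (2 * f')) *
          (2 * greenProfile h 1 z) = 0 := by linear_combination h0
      rw [mul_eq_zero, or_iff_left hab] at e1
      field_simp at e1
      linear_combination e1
    rw [e, norm_one] at d3
    norm_num at d3
  · filter_upwards [hnear] with ν hν
    obtain ⟨k1, k2, k3⟩ := (eq_zetaVal_iff hE₀ hα hh hh1 hh2 hν _).2 rfl
    rwa [mFun, qFun_eq_qVal hh (by linarith), aFun_eq hh (by linarith)] at k3

/-! ### Analyticity of series of products of functions of one variable -/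

section

open scoped BoundedContinuousFunction

variable {ι : Type*} [TopologicalSpace ι] [DiscreteTopology ι]

/-- The functions are assembled into one map with values in the bounded sequences, the normally
convergent series of `u k · δ k`. Such a map from `ℂ` into a Banach space is holomorphic, hence
analytic. -/
theorem exists_analytic_sequence {u : ι → ℂ → ℂ} {U : Set ℂ} (hU : IsOpen U)
    (hu : ∀ k, DifferentiableOn ℂ (u k) U) {b : ι → ℝ} (hb : Summable b)
    (hub : ∀ k, ∀ t ∈ U, ‖u k t‖ ≤ b k) :
    ∃ V : ℂ → (ι →ᵇ ℂ), (∀ t ∈ U, AnalyticAt ℂ V t) ∧ ∀ t ∈ U, ∀ k, V t k = u k t := by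
  classical
  let δ : ι → (ι →ᵇ ℂ) := fun k => BoundedContinuousFunction.ofNormedAddCommGroupDiscrete
    (fun j => if j = k then 1 else 0) 1 (fun j => by split_ifs <;> simp)
  have hδ : ∀ k, ‖δ k‖ ≤ 1 := fun k => (BoundedContinuousFunction.norm_le zero_le_one).2 fun j => by
    simp only [δ, BoundedContinuousFunction.coe_ofNormedAddCommGroupDiscrete]
    split_ifs <;> simp
  have hn : ∀ k, ∀ t ∈ U, ‖u k t • δ k‖ ≤ b k := fun k t ht => by
    rw [norm_smul]
    exact (mul_le_of_le_one_right (norm_nonneg _) (hδ k)).trans (hub k t ht)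
  have hd := Complex.differentiableOn_tsum_of_summable_norm hb
    (F := fun k t => u k t • δ k) (fun k => (hu k).smul_const _) hU hn
  refine ⟨_, fun t ht => hd.analyticAt (hU.mem_nhds ht), fun t ht k => ?_⟩
  have hs : HasSum (fun j => u j t • δ j) (∑' j, u j t • δ j) :=
    (Summable.of_norm_bounded hb fun j => hn j t ht).hasSum
  have h1 := hs.mapL (BoundedContinuousFunction.evalCLM ℂ k)
  have h2 : HasSum (fun j => (BoundedContinuousFunction.evalCLM ℂ k) (u j t • δ j)) (u k t) := by
    have e : (fun j => (BoundedContinuousFunction.evalCLM ℂ k) (u j t • δ j)) =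
        fun j => if j = k then u k t else 0 := by
      funext j
      simp only [BoundedContinuousFunction.evalCLM_apply, BoundedContinuousFunction.coe_smul, δ,
        BoundedContinuousFunction.coe_ofNormedAddCommGroupDiscrete, smul_eq_mul]
      by_cases hjk : j = k
      · subst hjk; simp
      · simp [hjk, Ne.symm hjk]
    rw [e]
    exact hasSum_ite_eq k _
  exact h1.unique h2

/-- Joint analyticity in three variables is reduced to one variable at a time: the three sequences
are multiplied in the Banach algebra of bounded sequences, and the continuous functional `∑ b k ·
evₖ` is applied to the product. -/
theorem analyticAt_tsum_mul {u v w : ι → ℂ → ℂ} {U V W : Set ℂ} (hU : IsOpen U) (hV : IsOpen V)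
    (hW : IsOpen W) (hu : ∀ k, DifferentiableOn ℂ (u k) U) (hv : ∀ k, DifferentiableOn ℂ (v k) V)
    (hw : ∀ k, DifferentiableOn ℂ (w k) W) {b : ι → ℝ} (hb : Summable b)
    (hub : ∀ k, ∀ t ∈ U, ‖u k t‖ ≤ b k) (hvb : ∀ k, ∀ t ∈ V, ‖v k t‖ ≤ b k)
    (hwb : ∀ k, ∀ t ∈ W, ‖w k t‖ ≤ b k) (s : ℂ × ℂ × ℂ) (hs : s ∈ U ×ˢ V ×ˢ W) :
    AnalyticAt ℂ (fun t : ℂ × ℂ × ℂ => ∑' k, (b k : ℂ) * (u k t.1 * (v k t.2.1 * w k t.2.2))) s := by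
  by_cases hb0 : ∀ k, 0 ≤ b k
  swap
  · push Not at hb0
    obtain ⟨k, hk⟩ := hb0
    exact absurd ((norm_nonneg _).trans (hub k s.1 hs.1)) (not_le.2 hk)
  obtain ⟨A, hA, hA'⟩ := exists_analytic_sequence hU hu hb hub
  obtain ⟨B, hB, hB'⟩ := exists_analytic_sequence hV hv hb hvb
  obtain ⟨D, hD, hD'⟩ := exists_analytic_sequence hW hw hb hwb
  have hev : ∀ k : ι, ‖(b k : ℂ) • (BoundedContinuousFunction.evalCLM ℂ k : (ι →ᵇ ℂ) →L[ℂ] ℂ)‖ ≤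
      b k := by
    intro k
    rw [norm_smul, Complex.norm_real, Real.norm_of_nonneg (hb0 k)]
    refine mul_le_of_le_one_right (hb0 k) (ContinuousLinearMap.opNorm_le_bound _ zero_le_one
      fun g => ?_)
    rw [one_mul]
    exact g.norm_coe_le_norm k
  have hΛ : HasSum (fun k => (b k : ℂ) •
      (BoundedContinuousFunction.evalCLM ℂ k : (ι →ᵇ ℂ) →L[ℂ] ℂ)) _ :=
    (Summable.of_norm_bounded hb hev).hasSum
  set Λ := ∑' k, (b k : ℂ) • (BoundedContinuousFunction.evalCLM ℂ k : (ι →ᵇ ℂ) →L[ℂ] ℂ)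
  have hprod : AnalyticAt ℂ (fun t : ℂ × ℂ × ℂ => A t.1 * (B t.2.1 * D t.2.2)) s :=
    ((hA _ hs.1).comp_of_eq analyticAt_fst rfl).mul
      (((hB _ hs.2.1).comp_of_eq ((ContinuousLinearMap.fst ℂ ℂ ℂ).comp
          (ContinuousLinearMap.snd ℂ ℂ (ℂ × ℂ)) |>.analyticAt s) rfl).mul
        ((hD _ hs.2.2).comp_of_eq ((ContinuousLinearMap.snd ℂ ℂ ℂ).comp
          (ContinuousLinearMap.snd ℂ ℂ (ℂ × ℂ)) |>.analyticAt s) rfl))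
  have hfin := (Λ.analyticAt _).comp hprod
  refine hfin.congr ?_
  filter_upwards [(hU.prod (hV.prod hW)).mem_nhds hs] with t ht
  have h1 := hΛ.mapL (ContinuousLinearMap.apply ℂ ℂ (A t.1 * (B t.2.1 * D t.2.2)))
  refine h1.tsum_eq.symm.trans (tsum_congr fun k => ?_)
  simp only [ContinuousLinearMap.apply_apply, smul_apply,
    BoundedContinuousFunction.evalCLM_apply, BoundedContinuousFunction.coe_mul, Pi.mul_apply,
    hA' _ ht.1, hB' _ ht.2.1, hD' _ ht.2.2, smul_eq_mul]

end

/-! ### The coefficients of the symbol -/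

theorem latLen_le_norm (k : ℤ × ℤ) : 7 / 10 * latLen k ≤ ‖latticePt k‖ := by
  refine le_of_sq_le_sq ?_ (norm_nonneg _)
  rw [norm_latticePt_sq, latLen, ← sq_abs (k.1 : ℝ), ← sq_abs (k.2 : ℝ)]
  nlinarith [sq_nonneg (|(k.1 : ℝ)| - |(k.2 : ℝ)|), sq_nonneg (|(k.1 : ℝ)| + |(k.2 : ℝ)|)]

/-- The numerator decays like `e^{-(9/10)‖k‖√E}` and the denominator is at least of order
`e^{-√E}/E`. With `‖k‖ ≥ (7/10)|k|₁` and `|k|₁ ≥ 2`, one has `(9/10)‖k‖ - 1 ≥ |k|₁/10`, so a fixed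
fraction of the rate survives the division. -/
theorem norm_lam_div_aFun_le {h : ℝ} (hh : 0 < h) (hh1 : h ≤ 1) {R : ℝ} (hR : 25 ≤ R) {z : ℂ}
    (hz : z.re ≤ -R) (hi : |z.im| ≤ 1) {k : ℤ × ℤ} (hk : 2 ≤ latLen k) :
    ‖lam k.1 k.2 z h / aFun z h‖ ≤ 6400 * Real.exp (-(√R / 10 * latLen k)) := by
  have hz0 : z.re < 0 := by linarith
  set E := -z.re with hE
  have hE25 : 25 ≤ E := by linarith
  have hlow := (le_re_greenProfile_one hh hh1 hE25 (by rw [hE]; ring) hi).trans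
    (Complex.re_le_norm _)
  have hlen := latLen_le_norm k
  have hup := norm_greenProfile_le hh (r := ‖latticePt k‖) (by linarith) (by linarith : 0 < E)
    (z := z) (by rw [hE]; linarith)
  have hE0 : 0 < E := by linarith
  rw [lam_eq hh hz0, aFun_eq hh hz0, norm_div, norm_mul, RCLike.norm_ofNat]
  have hpos : 0 < 1 / (128 * Real.pi) * (Real.exp (-√E) / E) := by positivity
  calc ‖greenProfile h ‖latticePt k‖ z‖ / (2 * ‖greenProfile h 1 z‖)
      ≤ (100 / (Real.pi * E) * Real.exp (-(9 / 10 * ‖latticePt k‖ * √E))) /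
          (2 * (1 / (128 * Real.pi) * (Real.exp (-√E) / E))) := by gcongr
    _ = 6400 * (Real.exp (-(9 / 10 * ‖latticePt k‖ * √E)) / Real.exp (-√E)) := by
        field_simp; norm_num
    _ = 6400 * Real.exp (-(9 / 10 * ‖latticePt k‖ * √E) - -√E) := by rw [Real.exp_sub]
    _ ≤ _ := by
        gcongr
        have h1 : √R ≤ √E := Real.sqrt_le_sqrt (by linarith)
        have h2 : 0 ≤ √R := Real.sqrt_nonneg R
        have h3 : 0 ≤ 9 / 10 * ‖latticePt k‖ - 1 - latLen k / 10 := by linarith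
        nlinarith [mul_nonneg h3 (h2.trans h1), mul_le_mul_of_nonneg_left h1 (by linarith :
          0 ≤ latLen k / 10)]

/-- The indices of the lower order part of the symbol. -/
abbrev FarIndex : Type := {k : ℤ × ℤ // 2 ≤ |k.1| + |k.2|}

theorem FarIndex.two_le_latLen (k : FarIndex) : 2 ≤ latLen k.1 := by
  have := k.2
  rw [latLen]
  exact_mod_cast this

theorem summable_exp_neg_latLen : Summable fun k : FarIndex => Real.exp (-latLen k.1) := by
  have := (summable_exp_neg_abs_add one_pos).subtype {k : ℤ × ℤ | 2 ≤ |k.1| + |k.2|}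
  refine this.congr fun k => ?_
  simp [latLen]

theorem norm_cexp_mul_latLen_le {b : ℝ} (k : ℤ × ℤ) {x p : ℂ} (hx : |x.im| + |p.im| ≤ b) :
    ‖Complex.exp (Complex.I * (k.1 * x + k.2 * p))‖ ≤ Real.exp (b * latLen k) := by
  rw [Complex.norm_exp]
  gcongr
  have e : (Complex.I * (k.1 * x + k.2 * p)).re = -(k.1 * x.im + k.2 * p.im) := by simp
  rw [e, latLen]
  have h1 := neg_abs_le ((k.1 : ℝ) * x.im)
  have h2 := neg_abs_le ((k.2 : ℝ) * p.im)
  rw [abs_mul] at h1 h2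
  nlinarith [abs_nonneg (k.1 : ℝ), abs_nonneg (k.2 : ℝ), abs_nonneg x.im, abs_nonneg p.im]

/-- The rate `√R/10` is distributed: `b` pays for the growth of the exponential in the complex
strip, `1` for summability, and `B`, since the length is at least `2`, for the small factor
`e^{-2B}`. -/
theorem norm_symbolN_term_le {h : ℝ} (hh : 0 < h) (hh1 : h ≤ 1) {R B b : ℝ} (hR : 25 ≤ R)
    (hB : 0 ≤ B) (hb : b + 1 + B ≤ √R / 10) {z x p : ℂ} (hz : z.re ≤ -R) (hi : |z.im| ≤ 1)
    (hx : |x.im| + |p.im| ≤ b) (k : FarIndex) :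
    ‖lam k.1.1 k.1.2 z h / aFun z h * Complex.exp (Complex.I * (k.1.1 * x + k.1.2 * p))‖ ≤
      6400 * Real.exp (-(2 * B)) * Real.exp (-latLen k.1) := by
  have hk := k.two_le_latLen
  rw [norm_mul]
  calc _ ≤ 6400 * Real.exp (-(√R / 10 * latLen k.1)) * Real.exp (b * latLen k.1) := by
        gcongr
        · exact norm_lam_div_aFun_le hh hh1 hR hz hi hk
        · exact norm_cexp_mul_latLen_le k.1 hx
    _ = 6400 * Real.exp (-(√R / 10 * latLen k.1) + b * latLen k.1) := by
        rw [Real.exp_add]; ring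
    _ ≤ 6400 * Real.exp (-(2 * B) + -latLen k.1) := by
        gcongr 6400 * Real.exp ?_
        nlinarith [mul_le_mul_of_nonneg_right hb (by linarith : 0 ≤ latLen k.1),
          mul_le_mul_of_nonneg_left hk hB]
    _ = _ := by rw [Real.exp_add]; ring

theorem norm_symbolN_le {h : ℝ} (hh : 0 < h) (hh1 : h ≤ 1) {R B b : ℝ} (hR : 25 ≤ R)
    (hB : 0 ≤ B) (hb : b + 1 + B ≤ √R / 10) {z x p : ℂ} (hz : z.re ≤ -R) (hi : |z.im| ≤ 1)
    (hx : |x.im| + |p.im| ≤ b) :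
    ‖symbolN x p z h‖ ≤ 6400 * Real.exp (-(2 * B)) * ∑' k : FarIndex, Real.exp (-latLen k.1) :=
  tsum_of_norm_bounded (summable_exp_neg_latLen.hasSum.mul_left _)
    (norm_symbolN_term_le hh hh1 hR hB hb hz hi hx)

/-! ### The symbol is of strong type I -/

/-- Reindexing of the lower order part by a norm-preserving symmetry of the lattice. -/
theorem symbolN_reindex {h : ℝ} (hh : 0 < h) {z : ℂ} (hz : z.re < 0) (e : ℤ × ℤ ≃ ℤ × ℤ)
    (he : ∀ k, |(e k).1| + |(e k).2| = |k.1| + |k.2|)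
    (he' : ∀ k, ‖latticePt (e k)‖ = ‖latticePt k‖) {x p x' p' : ℂ}
    (hxp : ∀ k : ℤ × ℤ, (e k).1 * x + (e k).2 * p = k.1 * x' + k.2 * p') :
    symbolN x p z h = symbolN x' p' z h := by
  rw [symbolN, symbolN, ← (Equiv.subtypeEquiv e fun k => by
    rw [he k] : {k : ℤ × ℤ // 2 ≤ |k.1| + |k.2|} ≃ {k : ℤ × ℤ // 2 ≤ |k.1| + |k.2|}).tsum_eq]
  refine tsum_congr fun k => ?_
  simp only [Equiv.subtypeEquiv_apply]
  rw [hxp, lam_eq hh hz, lam_eq hh hz]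
  rw [show ((e k.1).1, (e k.1).2) = e k.1 from rfl, he', show (k.1.1, k.1.2) = k.1 from rfl]

theorem norm_latticePt_congr {k j : ℤ × ℤ}
    (hkj : (k.1 : ℝ) ^ 2 + (k.2 : ℝ) ^ 2 = (j.1 : ℝ) ^ 2 + (j.2 : ℝ) ^ 2) :
    ‖latticePt k‖ = ‖latticePt j‖ := by
  rw [← sq_eq_sq₀ (norm_nonneg _) (norm_nonneg _), norm_latticePt_sq, norm_latticePt_sq, hkj]

theorem symbolN_rotate {h : ℝ} (hh : 0 < h) {z : ℂ} (hz : z.re < 0) (x p : ℂ) :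
    symbolN x p z h = symbolN (-p) x z h := by
  refine symbolN_reindex hh hz ⟨fun k => (k.2, -k.1), fun k => (-k.2, k.1), fun k => by simp,
    fun k => by simp⟩ (fun k => ?_) (fun k => norm_latticePt_congr ?_) (fun k => ?_)
  · simp [add_comm]
  · simp [add_comm]
  · simp; ring

theorem symbolN_reflect {h : ℝ} (hh : 0 < h) {z : ℂ} (hz : z.re < 0) (x p : ℂ) :
    symbolN x p z h = symbolN x (-p) z h := by
  refine symbolN_reindex hh hz ⟨fun k => (k.1, -k.2), fun k => (k.1, -k.2), fun k => by simp,
    fun k => by simp⟩ (fun k => ?_) (fun k => norm_latticePt_congr ?_) (fun k => ?_)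
  · simp
  · simp
  · simp

theorem cexp_add_two_pi (m n : ℤ) (x p : ℂ) :
    Complex.exp (Complex.I * (m * (x + 2 * Real.pi) + n * p)) =
      Complex.exp (Complex.I * (m * x + n * p)) := by
  rw [show Complex.I * (m * (x + 2 * Real.pi) + n * p) =
    Complex.I * (m * x + n * p) + m * (2 * Real.pi * Complex.I) by ring,
    Complex.exp_add, Complex.exp_int_mul_two_pi_mul_I, mul_one]

theorem symbolN_periodic (x p z : ℂ) (h : ℝ) :
    symbolN x p z h = symbolN (x + 2 * Real.pi) p z h ∧
      symbolN x p z h = symbolN x (p + 2 * Real.pi) z h := by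
  refine ⟨tsum_congr fun k => ?_, tsum_congr fun k => ?_⟩
  · rw [cexp_add_two_pi]
  · rw [add_comm ((k.1.1 : ℂ) * x) (k.1.2 * (p + _)), cexp_add_two_pi, add_comm]

/-- Two quarter turns give the symmetry `(x,p) ↦ (-x,-p)`; with real coefficients this is invariance
under conjugation. -/
theorem symbolN_im {h E : ℝ} (hh : 0 < h) (hE : 0 < E) (x p : ℝ) :
    (symbolN x p ((-E : ℝ) : ℂ) h).im = 0 := by
  have hz : ((-E : ℝ) : ℂ).re < 0 := by simpa using hE
  rw [← Complex.conj_eq_iff_im]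
  have e : symbolN x p ((-E : ℝ) : ℂ) h = symbolN (-x) (-p) ((-E : ℝ) : ℂ) h := by
    rw [symbolN_rotate hh hz, symbolN_rotate hh hz]
  rw [e]
  nth_rewrite 2 [← e]
  rw [symbolN, symbolN, Complex.conj_tsum]
  refine tsum_congr fun k => ?_
  rw [lam_eq hh hz, aFun_eq hh hz, greenProfile_ofReal, greenProfile_ofReal, map_mul, map_div₀,
    map_mul, Complex.conj_ofReal, Complex.conj_ofReal, Complex.conj_ofNat, ← Complex.exp_conj]
  congr 2
  simp
  ring

theorem differentiableOn_coef {E₀ α h : ℝ} (hE₀ : 0 < E₀)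
    (hα : SmallCoupling E₀ (zetaR E₀) α) (hh : 0 < h) (hh1 : h ≤ 1) (hh2 : h ≤ E₀ / 2)
    (k : FarIndex) :
    DifferentiableOn ℂ (fun μ => lam k.1.1 k.1.2 (zetaVal E₀ α h μ) h /
      aFun (zetaVal E₀ α h μ) h) (Metric.ball 0 5) := by
  have hneg : ∀ μ ∈ Metric.ball (0 : ℂ) 5, (zetaVal E₀ α h μ).re < -E₀ ∧
      aFun (zetaVal E₀ α h μ) h ≠ 0 := fun μ hμ => by
    have := (eq_zetaVal_iff hE₀ hα hh hh1 hh2 (μ := μ) (by simpa using hμ) _).2 rfl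
    exact ⟨this.1, this.2.1⟩
  have hg : ∀ r : ℝ, 0 < r → DifferentiableOn ℂ (fun μ => greenProfile h r (zetaVal E₀ α h μ))
      (Metric.ball 0 5) := fun r hr =>
    DifferentiableOn.comp (t := {z : ℂ | z.re < 0}) (g := greenProfile h r)
      (fun z hz => (hasDerivAt_greenProfile hh hr hz).differentiableAt.differentiableWithinAt)
      (differentiableOn_zetaVal hE₀ hα hh hh1 hh2) (fun μ hμ => by
        have := (hneg μ hμ).1
        show (zetaVal E₀ α h μ).re < 0
        linarith)
  refine DifferentiableOn.div ?_ ?_ fun μ hμ => (hneg μ hμ).2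
  · refine (hg ‖latticePt k.1‖ ?_).congr fun μ hμ => lam_eq hh (by linarith [(hneg μ hμ).1]) _ _
    linarith [latLen_le_norm k.1, k.two_le_latLen]
  · exact ((hg 1 one_pos).const_mul 2).congr fun μ hμ => aFun_eq hh (by linarith [(hneg μ hμ).1])

theorem symbolP_eq {E₀ α h : ℝ} (hE₀ : 0 < E₀) (hα : SmallCoupling E₀ (zetaR E₀) α) (hh : 0 < h)
    (hh1 : h ≤ 1) (hh2 : h ≤ E₀ / 2) {μ : ℂ} (hμ : ‖μ‖ < 5) (x p : ℂ) :
    symbolP α (zetaVal E₀ α) x p μ h =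
      μ + Complex.cos x + Complex.cos p + symbolN x p (zetaVal E₀ α h μ) h := by
  rw [symbolP, symbolM, ((eq_zetaVal_iff hE₀ hα hh hh1 hh2 hμ _).2 rfl).2.2]

theorem analyticAt_symbolN {E₀ α h : ℝ} (hE₀ : 0 < E₀)
    (hα : SmallCoupling E₀ (zetaR E₀) α) (hh : 0 < h) (hh1 : h ≤ 1) (hh2 : h ≤ E₀ / 2)
    {R b : ℝ} (hR : 25 ≤ R) (hRb : 2 * b + 4 ≤ √R / 10)
    (hζ : ∀ μ : ℂ, ‖μ‖ < 5 → (zetaVal E₀ α h μ).re ≤ -R)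
    {v : ℂ × ℂ × ℂ} (hv : ‖v.1‖ < 5) (hvb : |v.2.1.im| + |v.2.2.im| < b) :
    AnalyticAt ℂ (fun v : ℂ × ℂ × ℂ => symbolN v.2.1 v.2.2 (zetaVal E₀ α h v.1) h) v := by
  have hop : IsOpen {x : ℂ | |x.im| < b} :=
    isOpen_lt Complex.continuous_im.abs continuous_const
  have hb1 : |v.2.1.im| < b := by linarith [abs_nonneg v.2.2.im]
  have hb2 : |v.2.2.im| < b := by linarith [abs_nonneg v.2.1.im]
  have hexp : ∀ (k : FarIndex) (j : ℤ), |(j : ℝ)| ≤ latLen k.1 → ∀ t ∈ {x : ℂ | |x.im| < b},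
      ‖Complex.exp (Complex.I * (j * t) - (b + 1) * latLen k.1)‖ ≤ Real.exp (-latLen k.1) := by
    intro k j hj t ht
    rw [Complex.norm_exp]
    gcongr
    have e : (Complex.I * (j * t) - (b + 1) * latLen k.1).re =
        -(j * t.im) - (b + 1) * latLen k.1 := by simp
    rw [e]
    have h1 := neg_abs_le ((j : ℝ) * t.im)
    rw [abs_mul] at h1
    have h2 : |t.im| < b := ht
    nlinarith [abs_nonneg (j : ℝ), abs_nonneg t.im]
  -- Each term is factored so that all three factors are bounded by the weight `e^{-L}`, with `L`
  -- the length of the index. The exponents balance: `(2b + 3) - 2(b + 1) - 1 = 0`, the last `1`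
  -- being the weight itself.
  have key := analyticAt_tsum_mul (ι := FarIndex) Metric.isOpen_ball hop hop
    (u := fun k μ => lam k.1.1 k.1.2 (zetaVal E₀ α h μ) h / aFun (zetaVal E₀ α h μ) h *
      (Real.exp ((2 * b + 3) * latLen k.1) / 6400 : ℝ))
    (v := fun k x => Complex.exp (Complex.I * (k.1.1 * x) - (b + 1) * latLen k.1))
    (w := fun k p => Complex.exp (Complex.I * (k.1.2 * p) - (b + 1) * latLen k.1))
    (fun k => (differentiableOn_coef hE₀ hα hh hh1 hh2 k).mul_const _)
    (fun k => Differentiable.differentiableOn (by fun_prop))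
    (fun k => Differentiable.differentiableOn (by fun_prop))
    summable_exp_neg_latLen (fun k μ hμ => ?_)
    (fun k => hexp k k.1.1 (by rw [latLen]; linarith [abs_nonneg (k.1.2 : ℝ)]))
    (fun k => hexp k k.1.2 (by rw [latLen]; linarith [abs_nonneg (k.1.1 : ℝ)]))
    v ⟨by simpa using hv, hb1, hb2⟩
  · refine ((analyticAt_const (v := (6400 : ℂ))).mul key).congr (Eventually.of_forall fun t => ?_)
    simp only [Pi.mul_apply]
    rw [symbolN, ← tsum_mul_left]
    refine tsum_congr fun k => ?_
    have e : Complex.exp (Complex.I * (k.1.1 * t.2.1 + k.1.2 * t.2.2)) =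
        Complex.exp (-latLen k.1) * (Complex.exp ((2 * b + 3) * latLen k.1) *
        (Complex.exp (Complex.I * (k.1.1 * t.2.1) - (b + 1) * latLen k.1) *
        Complex.exp (Complex.I * (k.1.2 * t.2.2) - (b + 1) * latLen k.1))) := by
      rw [← Complex.exp_add, ← Complex.exp_add, ← Complex.exp_add]
      congr 1
      ring
    rw [e]
    push_cast
    ring
  · have hμ' : ‖μ‖ < 5 := by simpa using hμ
    have h1 := norm_lam_div_aFun_le hh hh1 hR (hζ μ hμ') (zetaVal_bounds hα hh hh1 hμ').2.2.2
      k.two_le_latLen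
    rw [norm_mul, Complex.norm_real, Real.norm_of_nonneg (by positivity)]
    calc _ ≤ 6400 * Real.exp (-(√R / 10 * latLen k.1)) *
          (Real.exp ((2 * b + 3) * latLen k.1) / 6400) := by gcongr
      _ = Real.exp (-(√R / 10 * latLen k.1) + (2 * b + 3) * latLen k.1) := by
          rw [Real.exp_add]; ring
      _ ≤ _ := by
          gcongr
          nlinarith [k.two_le_latLen]

theorem analyticAt_ofReal_comp {F : ℂ × ℂ × ℂ → ℂ} {μ : ℝ} {x p : ℂ}
    (hF : AnalyticAt ℂ F ((μ : ℂ), x, p)) :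
    AnalyticAt ℝ (fun t : ℝ => F ((t : ℂ), x, p)) μ := by
  have hA := hF.restrictScalars (𝕜 := ℝ)
  have hB : AnalyticAt ℝ (fun t : ℝ => ((t : ℂ), x, p)) μ :=
    (Complex.ofRealCLM.analyticAt μ).prod analyticAt_const
  exact hA.comp_of_eq hB rfl

theorem exists_strongTypeIWith {E₀ : ℝ} (hE₀ : 0 < E₀) {ε : ℝ} (hε : 0 < ε) :
    ∃ α₁ > 0, ∀ α ∈ Ioo 0 α₁,
      StrongTypeIWith (min 1 (E₀ / 2)) ε (symbolP α (zetaVal E₀ α)) := by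
  set S := ∑' k : FarIndex, Real.exp (-latLen k.1) with hSdef
  have hS0 : 0 ≤ S := tsum_nonneg fun k => (Real.exp_pos _).le
  -- Chosen so that `B e^{-B} ≤ 1` turns the bound `6400 S e^{-2B}` for the remainder into `ε`.
  set B := 6400 * S / ε with hBdef
  have hB : 0 ≤ B := by positivity
  have hBS : 6400 * Real.exp (-(2 * B)) * S ≤ ε := by
    have h1 := mul_exp_neg_le_one B
    have h2 : Real.exp (-(2 * B)) ≤ Real.exp (-B) := by gcongr; linarith
    have e : 6400 * S = ε * B := by rw [hBdef]; field_simp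
    calc 6400 * Real.exp (-(2 * B)) * S = 6400 * S * Real.exp (-(2 * B)) := by ring
      _ ≤ 6400 * S * Real.exp (-B) := by gcongr
      _ = ε * (B * Real.exp (-B)) := by rw [e]; ring
      _ ≤ ε * 1 := by gcongr
      _ = ε := mul_one ε
  set b := 1 / ε with hb
  have hb0 : 0 < b := by positivity
  -- A single size of `‖Re ζ‖` suffices for the lower bound of `a`, for the construction of `ζ`, and
  -- for both estimates in the strip of half-width `b = 1/ε`: smallness needs `b + 1 + B`,
  -- analyticity needs `2b + 4`.
  set R := max (max 25 (zetaR E₀)) ((10 * (2 * b + 4 + B)) ^ 2) with hR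
  have hR25 : 25 ≤ R := (le_max_left _ _).trans (le_max_left _ _)
  have hRz : zetaR E₀ ≤ 2 * R := by
    have : zetaR E₀ ≤ R := (le_max_right _ _).trans (le_max_left _ _)
    linarith
  have hRs : 2 * b + 4 + B ≤ √R / 10 := by
    have : 10 * (2 * b + 4 + B) ≤ √R := Real.le_sqrt_of_sq_le (le_max_right _ _)
    linarith
  obtain ⟨α₁, h1, h1'⟩ := exists_smallCoupling E₀ (zetaR E₀)
  obtain ⟨α₂, h2, h2'⟩ := exists_smallCoupling E₀ (2 * R)
  refine ⟨min α₁ α₂, lt_min h1 h2, fun α hα => ?_⟩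
  have hα1 := h1' α ⟨hα.1, hα.2.trans_le (min_le_left _ _)⟩
  have hα2 := h2' α ⟨hα.1, hα.2.trans_le (min_le_right _ _)⟩
  have hhh : ∀ h ∈ Ioo 0 (min 1 (E₀ / 2)), 0 < h ∧ h ≤ 1 ∧ h ≤ E₀ / 2 := fun h hh =>
    ⟨hh.1, (hh.2.trans_le (min_le_left _ _)).le, (hh.2.trans_le (min_le_right _ _)).le⟩
  have hζ : ∀ h ∈ Ioo 0 (min 1 (E₀ / 2)), ∀ μ : ℂ, ‖μ‖ < 5 → (zetaVal E₀ α h μ).re ≤ -R := by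
    intro h hh μ hμ
    obtain ⟨a1, a2, a3⟩ := hhh h hh
    exact zetaVal_re_le hE₀ hα1 a1 a2 a3 hRz hα2 hμ
  have h4 : ∀ {μ : ℂ}, ‖μ‖ ≤ 4 → ‖μ‖ < 5 := fun h => by linarith
  have hhol : ∀ h ∈ Ioo 0 (min 1 (E₀ / 2)),
      AnalyticOnNhd ℂ (fun v : ℂ × ℂ × ℂ => symbolP α (zetaVal E₀ α) v.2.1 v.2.2 v.1 h)
        (tube ε) := by
    intro h hh v hv
    obtain ⟨a1, a2, a3⟩ := hhh h hh
    have hN := analyticAt_symbolN hE₀ hα1 a1 a2 a3 hR25 (b := b) (by linarith) (hζ h hh)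
      (h4 hv.1) hv.2
    have hA1 : AnalyticAt ℂ (fun v : ℂ × ℂ × ℂ => v.1) v := analyticAt_fst
    have hA2 : AnalyticAt ℂ (fun v : ℂ × ℂ × ℂ => v.2.1) v :=
      ((ContinuousLinearMap.fst ℂ ℂ ℂ).comp (ContinuousLinearMap.snd ℂ ℂ (ℂ × ℂ))).analyticAt v
    have hA3 : AnalyticAt ℂ (fun v : ℂ × ℂ × ℂ => v.2.2) v :=
      ((ContinuousLinearMap.snd ℂ ℂ ℂ).comp (ContinuousLinearMap.snd ℂ ℂ (ℂ × ℂ))).analyticAt v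
    have hcos : ∀ t : ℂ, AnalyticAt ℂ Complex.cos t := fun t => Complex.analyticAt_cos
    have hsum := ((hA1.add ((hcos _).comp_of_eq hA2 rfl)).add ((hcos _).comp_of_eq hA3 rfl)).add hN
    refine hsum.congr ?_
    have hnear : ∀ᶠ t : ℂ × ℂ × ℂ in 𝓝 v, ‖t.1‖ < 5 :=
      (continuous_fst.norm.tendsto v).eventually_lt_const (h4 hv.1)
    filter_upwards [hnear] with t ht
    rw [symbolP_eq hE₀ hα1 a1 a2 a3 ht]
    rfl
  have hmem : ∀ (x p : ℝ), ∀ μ ∈ Icc (-4 : ℝ) 4, ((μ : ℂ), (x : ℂ), (p : ℂ)) ∈ tube ε := by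
    intro x p μ hμ
    refine ⟨?_, by simpa using hε⟩
    simpa [Complex.norm_real] using abs_le.2 ⟨hμ.1, hμ.2⟩
  refine ⟨fun h hh x p μ hμ => ?_, fun h hh x p μ hμ => ?_, hhol, fun h hh μ x p hv => ?_,
    fun h hh μ x p hv => ?_, fun h hh μ x p hv => ?_⟩
  · exact analyticAt_ofReal_comp (hhol h hh _ (hmem x p μ hμ))
  · obtain ⟨a1, a2, a3⟩ := hhh h hh
    have hμ5 : |μ| < 5 := by rw [abs_lt]; constructor <;> linarith [hμ.1, hμ.2]
    have hμ5' : ‖(μ : ℂ)‖ < 5 := by rwa [Complex.norm_real]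
    have hre := zetaVal_real hE₀ hα1 a1 a2 a3 hμ5
    have hle := hζ h hh μ hμ5'
    have hN := symbolN_im a1 (E := -(zetaVal E₀ α h μ).re) (by linarith) x p
    rw [neg_neg, ← hre] at hN
    rw [symbolP_eq hE₀ hα1 a1 a2 a3 hμ5', Complex.add_im, hN, ← Complex.ofReal_cos,
      ← Complex.ofReal_cos]
    simp
  · obtain ⟨a1, a2, a3⟩ := hhh h hh
    rw [symbolP_eq hE₀ hα1 a1 a2 a3 (h4 hv.1),
      show μ + Complex.cos x + Complex.cos p + symbolN x p (zetaVal E₀ α h μ) h -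
        (Complex.cos x + Complex.cos p + μ) = symbolN x p (zetaVal E₀ α h μ) h by ring]
    exact (norm_symbolN_le a1 a2 hR25 hB (b := b) (by linarith) (hζ h hh μ (h4 hv.1))
      (zetaVal_bounds hα1 a1 a2 (h4 hv.1)).2.2.2 hv.2.le).trans hBS
  · obtain ⟨a1, a2, a3⟩ := hhh h hh
    have hneg : (zetaVal E₀ α h μ).re < 0 := by linarith [hζ h hh μ (h4 hv.1)]
    simp only [symbolP, symbolM, Complex.cos_neg]
    rw [← symbolN_rotate a1 hneg, ← symbolN_reflect a1 hneg]
    exact ⟨by ring, rfl⟩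
  · have hp := symbolN_periodic x p (zetaVal E₀ α h μ) h
    simp only [symbolP, symbolM, Complex.cos_add_two_pi]
    rw [← hp.1, ← hp.2]
    exact ⟨rfl, rfl⟩

theorem tendsto_epsOf {E₀ : ℝ} (hE₀ : 0 < E₀) :
    Tendsto (fun α => epsOf (min 1 (E₀ / 2)) (symbolP α (zetaVal E₀ α))) (𝓝[>] 0) (𝓝 0) := by
  rw [Metric.tendsto_nhds]
  intro ε hε
  obtain ⟨α₁, h1, h2⟩ := exists_strongTypeIWith hE₀ (half_pos hε)
  filter_upwards [Ioo_mem_nhdsGT h1] with α hα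
  have h3 : 0 ≤ epsOf (min 1 (E₀ / 2)) (symbolP α (zetaVal E₀ α)) :=
    Real.sInf_nonneg fun x hx => hx.1.le
  have h4 : epsOf (min 1 (E₀ / 2)) (symbolP α (zetaVal E₀ α)) ≤ ε / 2 :=
    csInf_le ⟨0, fun x hx => hx.1.le⟩ ⟨half_pos hε, h2 α hα⟩
  rw [Real.dist_eq, sub_zero, abs_of_nonneg h3]
  linarith

/-! ### The effective operator and the main theorem -/

theorem gF_pos {h E r : ℝ} (hh : 0 < h) (hE : 0 < E) (hr : 0 < r) : 0 < gF h E r := by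
  have hpos : ∀ s ∈ Ioi (0 : ℝ), 0 < heatProfile h r s * Real.exp (-(E * s)) := fun s hs =>
    mul_pos (heatProfile_pos hh hs r) (Real.exp_pos _)
  rw [gF, setIntegral_pos_iff_support_of_nonneg_ae
    ((ae_restrict_iff' measurableSet_Ioi).2 (Eventually.of_forall fun s hs => (hpos s hs).le))
    (integrableOn_heatProfile_mul_exp hh hE hr),
    inter_eq_self_of_subset_right
      (show Ioi (0 : ℝ) ⊆ Function.support _ from fun s hs => (hpos s hs).ne')]
  simp

/-- The lattice coefficients, normalized by `a(-E,h)`, are the Fourier coefficients of the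
effective symbol. -/
theorem hasSum_latCoef_cexp {h E : ℝ} (hh : 0 < h) (hE : 0 < E) (d x p : ℝ) :
    HasSum (fun k : ℤ × ℤ => ((latCoef h E d k / (2 * gF h E 1) : ℝ) : ℂ) *
      Complex.exp (Complex.I * (k.1 * x + k.2 * p)))
      (((d / (2 * gF h E 1) : ℝ) : ℂ) + Complex.cos x + Complex.cos p +
        symbolN x p ((-E : ℝ) : ℂ) h) := by
  have hz : ((-E : ℝ) : ℂ).re < 0 := by simpa using hE
  have hg := gF_pos hh hE one_pos
  set f : ℤ × ℤ → ℂ := fun k => ((latCoef h E d k / (2 * gF h E 1) : ℝ) : ℂ) *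
      Complex.exp (Complex.I * (k.1 * x + k.2 * p)) with hf
  have hfs : Summable f := by
    refine Summable.of_norm_bounded ((summable_latCoef hh hE d).div_const (2 * gF h E 1))
      fun k => ?_
    rw [hf]
    simp only [norm_mul]
    rw [show Complex.I * (k.1 * (x : ℂ) + k.2 * p) = Complex.I * ((k.1 * x + k.2 * p : ℝ) : ℂ) by
      push_cast; ring, norm_cexp_I_mul_ofReal, mul_one, Complex.norm_real, Real.norm_eq_abs,
      abs_div, abs_of_pos (by positivity : 0 < 2 * gF h E 1)]
  -- The origin gives the constant term and the four nearest neighbours, each with coefficient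
  -- `1/2`, give `cos x + cos p`; the complement indexes the series `symbolN`.
  let T : Finset (ℤ × ℤ) := {(0, 0), (1, 0), (-1, 0), (0, 1), (0, -1)}
  have hT : ∀ k : ℤ × ℤ, k ∉ T ↔ 2 ≤ |k.1| + |k.2| := by
    rintro ⟨m, n⟩
    simp only [T, Finset.mem_insert, Finset.mem_singleton, Prod.mk.injEq]
    constructor
    · intro hk
      by_contra hlt
      push Not at hlt
      rcases abs_cases m with ⟨e1, s1⟩ | ⟨e1, s1⟩ <;> rcases abs_cases n with ⟨e2, s2⟩ | ⟨e2, s2⟩ <;>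
        omega
    · intro hk
      rcases abs_cases m with ⟨e1, s1⟩ | ⟨e1, s1⟩ <;> rcases abs_cases n with ⟨e2, s2⟩ | ⟨e2, s2⟩ <;>
        omega
  have hfar : HasSum (fun k : {k // k ∉ T} => f k) (symbolN x p ((-E : ℝ) : ℂ) h) := by
    have h1 : Summable fun k : FarIndex => f k.1 := hfs.subtype _
    have h2 : symbolN x p ((-E : ℝ) : ℂ) h = ∑' k : FarIndex, f k.1 := by
      refine tsum_congr fun k => ?_
      have hk0 : k.1 ≠ 0 := by
        intro h0
        have := k.2
        rw [h0] at this
        simp at this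
      rw [lam_eq hh hz, aFun_eq hh hz, greenProfile_ofReal, greenProfile_ofReal, hf]
      simp only [latCoef, if_neg hk0]
      push_cast
      rfl
    rw [h2]
    exact ((Equiv.subtypeEquivRight hT).hasSum_iff (f := fun k : FarIndex => f k.1)).2 h1.hasSum
  have hn : ∀ k : ℤ × ℤ, (k.1 : ℝ) ^ 2 + (k.2 : ℝ) ^ 2 = 1 → latCoef h E d k = gF h E 1 := by
    intro k hk
    have hk0 : k ≠ 0 := by rintro rfl; simp at hk
    have h1 : ‖latticePt k‖ = 1 := by
      rw [← norm_latticePt_one_zero]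
      exact norm_latticePt_congr (by simpa using hk)
    rw [latCoef, if_neg hk0, h1]
  have h0 : latCoef h E d (0, 0) = d := if_pos rfl
  have hhalf : gF h E 1 / (2 * gF h E 1) = 1 / 2 := by field_simp
  suffices hv : ((d / (2 * gF h E 1) : ℝ) : ℂ) + Complex.cos x + Complex.cos p +
      symbolN x p ((-E : ℝ) : ℂ) h = symbolN x p ((-E : ℝ) : ℂ) h + ∑ k ∈ T, f k by
    rw [hv]
    exact (Finset.hasSum_compl_iff T).1 hfar
  rw [show T = {(0, 0), (1, 0), (-1, 0), (0, 1), (0, -1)} from rfl, Finset.sum_insert (by decide),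
    Finset.sum_insert (by decide), Finset.sum_insert (by decide), Finset.sum_insert (by decide),
    Finset.sum_singleton]
  simp only [hf]
  rw [h0, hn (1, 0) (by simp), hn (-1, 0) (by simp), hn (0, 1) (by simp), hn (0, -1) (by simp),
    hhalf, Complex.cos, Complex.cos]
  simp only [Int.cast_zero, Int.cast_one, Int.cast_neg, zero_mul, one_mul, add_zero, zero_add,
    mul_zero, Complex.exp_zero, mul_one, neg_mul]
  rw [mul_comm Complex.I (x : ℂ), mul_comm Complex.I (p : ℂ), mul_neg, mul_neg,
    mul_comm Complex.I (x : ℂ), mul_comm Complex.I (p : ℂ)]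
  push_cast
  ring

/-! ### Absence of spectrum for `|m_α| > 4`, and the effective operator -/

theorem norm_weylSum_le (h : ℝ) {f : ℤ × ℤ → ℝ} (hf : Summable fun k => |f k|) :
    ‖weylSum h f‖ ≤ ∑' k, |f k| := by
  refine tsum_of_norm_bounded hf.hasSum fun k => ?_
  rw [norm_smul, Complex.norm_real]
  exact mul_le_of_le_one_right (abs_nonneg _) (norm_weylOp_le h k)

theorem weylSum_div (h : ℝ) (f : ℤ × ℤ → ℝ) (a : ℝ) :
    weylSum h (fun k => f k / a) = ((a⁻¹ : ℝ) : ℂ) • weylSum h f := by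
  rw [weylSum, weylSum, ← tsum_const_smul'']
  refine tsum_congr fun k => ?_
  rw [smul_smul, div_eq_inv_mul, Complex.ofReal_mul]

theorem isUnit_weylSum_div {h a : ℝ} (ha : a ≠ 0) (f : ℤ × ℤ → ℝ) :
    IsUnit (weylSum h fun k => f k / a) ↔ IsUnit (weylSum h f) := by
  have ha' : ((a⁻¹ : ℝ) : ℂ) ≠ 0 := by exact_mod_cast inv_ne_zero ha
  rw [weylSum_div]
  exact isUnit_smul_iff (Units.mk0 _ ha') (weylSum h f)

/-- A dominating diagonal coefficient makes the operator invertible. -/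
theorem isUnit_weylSum_latCoef {h E d : ℝ} (hh : 0 < h) (hE : 0 < E)
    (hd : ∑' k, |latCoef h E 0 k| < |d|) : IsUnit (weylSum h (latCoef h E d)) := by
  have hsum := (hasSum_weylSum h (summable_latCoef hh hE 0)).add
    (hasSum_ite_eq (0 : ℤ × ℤ) ((d : ℂ) • (1 : L2Line →L[ℂ] L2Line)))
  have e : weylSum h (latCoef h E d) = weylSum h (latCoef h E 0) + (d : ℂ) • 1 := by
    refine (hasSum_weylSum h (summable_latCoef hh hE d)).unique ?_
    convert hsum using 2 with k
    by_cases hk : k = 0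
    · subst hk
      have h1 : (weylOp h 0).toContinuousLinearMap = 1 := by
        ext1 v
        exact weylOp_zero h v
      simp [latCoef, h1]
    · simp [latCoef, hk]
  refine isUnit_of_isSelfAdjoint_of_bounded_below (isSelfAdjoint_weylSum h (latCoef_neg h E d))
    (sub_pos.2 hd) fun v => ?_
  rw [e]
  have h1 := (weylSum h (latCoef h E 0)).le_of_opNorm_le
    (norm_weylSum_le h (summable_latCoef hh hE 0)) v
  have h2 : ‖((d : ℂ) • (1 : L2Line →L[ℂ] L2Line)) v‖ = |d| * ‖v‖ := by
    rw [smul_apply, one_apply_eq_self, norm_smul, Complex.norm_real, Real.norm_eq_abs]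
  have h3 := norm_sub_norm_le (((d : ℂ) • (1 : L2Line →L[ℂ] L2Line)) v)
    (-(weylSum h (latCoef h E 0) v))
  rw [norm_neg, sub_neg_eq_add, add_comm, h2] at h3
  rw [add_apply]
  linarith

/-- All coefficients are nonnegative, so their sum divided by `a` is the symbol without its constant
term at `x = p = 0`, namely `1 + 1 + N(0,0) ≤ 3`. -/
theorem tsum_latCoef_le_of_large {h E : ℝ} (hh : 0 < h) (hh1 : h ≤ 1) {R B : ℝ} (hR : 25 ≤ R)
    (hB : 0 ≤ B) (hRB : 1 + B ≤ √R / 10)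
    (hBS : 6400 * Real.exp (-(2 * B)) * ∑' k : FarIndex, Real.exp (-latLen k.1) ≤ 1)
    (hE : R ≤ E) : ∑' k, |latCoef h E 0 k| ≤ 3 * (2 * gF h E 1) := by
  have hE0 : 0 < E := by linarith
  have hg := gF_pos hh hE0 one_pos
  have habs : ∀ k, |latCoef h E 0 k| = latCoef h E 0 k := fun k => abs_of_nonneg (by
    rw [latCoef]; split_ifs; exacts [le_rfl, gF_nonneg hh E _])
  have h1 := hasSum_latCoef_cexp hh hE0 0 0 0
  simp only [Complex.ofReal_zero, mul_zero, add_zero, Complex.exp_zero, mul_one, Complex.cos_zero,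
    zero_div, zero_add] at h1
  have h2 : HasSum (fun k : ℤ × ℤ => ((latCoef h E 0 k / (2 * gF h E 1) : ℝ) : ℂ))
      (((∑' k, latCoef h E 0 k) / (2 * gF h E 1) : ℝ) : ℂ) := by
    refine Complex.hasSum_ofReal.2 (HasSum.div_const ?_ _)
    exact ((summable_latCoef hh hE0 0).congr habs).hasSum
  have h3 := norm_symbolN_le hh hh1 hR hB (b := 0) (by linarith) (z := ((-E : ℝ) : ℂ))
    (x := 0) (p := 0) (by simpa using hE) (by simp) (by simp)
  have h4 := congrArg norm (h2.unique h1)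
  have h5 : ‖(1 : ℂ) + 1 + symbolN 0 0 ((-E : ℝ) : ℂ) h‖ ≤ 3 := by
    refine (norm_add_le _ _).trans ?_
    have : ‖(1 : ℂ) + 1‖ = 2 := by norm_num
    linarith
  rw [← h4, Complex.norm_real] at h5
  have h6 := (le_abs_self _).trans h5
  rw [div_le_iff₀ (by positivity)] at h6
  simpa only [habs] using h6

theorem gF_le_exp_norm {h E E₀ r : ℝ} (hh : 0 < h) (hE₀ : 0 < E₀) (hE : E₀ ≤ E) (hr : 1 ≤ r) :
    gF h E r ≤ 100 / (Real.pi * E₀) * Real.exp (-(9 / 10 * √E₀ * r)) := by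
  have := norm_greenProfile_le hh hr hE₀ (z := ((-E : ℝ) : ℂ)) (by simpa using hE)
  rw [greenProfile_ofReal, Complex.norm_real] at this
  refine (le_abs_self _).trans (this.trans_eq ?_)
  congr 3
  ring

theorem tsum_latCoef_le {h E E₀ : ℝ} (hh : 0 < h) (hE₀ : 0 < E₀) (hE : E₀ ≤ E) :
    ∑' k, |latCoef h E 0 k| ≤ ∑' k : ℤ × ℤ,
      100 / (Real.pi * E₀) * Real.exp (-(9 / 10 * √E₀ * ‖latticePt k‖)) := by
  have hs : 0 < √E₀ := Real.sqrt_pos.2 hE₀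
  refine Summable.tsum_le_tsum (fun k => ?_) (summable_latCoef hh (by linarith) 0)
    ((summable_exp_neg_norm (by positivity)).mul_left _)
  rw [latCoef]
  split_ifs with hk
  · rw [abs_zero]; positivity
  · rw [abs_of_nonneg (gF_nonneg hh E _)]
    exact gF_le_exp_norm hh hE₀ hE (one_le_norm_latticePt hk)

/-- The diagonal dominates in two regimes. For large `E` the off-diagonal sum is at most `3a`, less
than the assumed `4a`. For `E₀ < E < R` it is bounded independently of `α`, while `q` is bounded
from below and `α⁻¹` is as large as needed. -/
theorem exists_isUnit_weylSum {E₀ : ℝ} (hE₀ : 0 < E₀) :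
    ∃ α₁ > 0, ∀ α ∈ Ioo 0 α₁, ∀ h ∈ Ioo 0 (min 1 (E₀ / 2)), ∀ E > E₀,
      4 * (2 * gF h E 1) < |(qVal h ((-E : ℝ) : ℂ)).re + α⁻¹| →
        IsUnit (weylSum h (latCoef h E ((qVal h ((-E : ℝ) : ℂ)).re + α⁻¹))) := by
  set S := ∑' k : FarIndex, Real.exp (-latLen k.1) with hSdef
  have hS0 : 0 ≤ S := tsum_nonneg fun k => (Real.exp_pos _).le
  set B := 6400 * S with hBdef
  have hB : 0 ≤ B := by positivity
  have hBS : 6400 * Real.exp (-(2 * B)) * S ≤ 1 := by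
    have h1 := mul_exp_neg_le_one B
    have h2 : Real.exp (-(2 * B)) ≤ Real.exp (-B) := by gcongr; linarith
    calc 6400 * Real.exp (-(2 * B)) * S = B * Real.exp (-(2 * B)) := by ring
      _ ≤ B * Real.exp (-B) := by gcongr
      _ ≤ 1 := h1
  set R := max 25 ((10 * (1 + B)) ^ 2) with hR
  have hR25 : 25 ≤ R := le_max_left _ _
  have hRs : 1 + B ≤ √R / 10 := by
    have : 10 * (1 + B) ≤ √R := Real.le_sqrt_of_sq_le (le_max_right _ _)
    linarith
  set T := ∑' k : ℤ × ℤ, 100 / (Real.pi * E₀) * Real.exp (-(9 / 10 * √E₀ * ‖latticePt k‖))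
  -- The subtracted quotient is a lower bound of `q` for `E < R`, so `α⁻¹ ≥ K` makes `q + α⁻¹` at
  -- least `T + 1`, above the bound `T` of the off-diagonal sum.
  set K := max 1 (T + 1 - (frullaniConst - Real.log R - 1 / 8) / (4 * Real.pi)) with hK
  have hK1 : 1 ≤ K := le_max_left _ _
  refine ⟨K⁻¹, by positivity, fun α hα h hh E hE hd => ?_⟩
  have hh1 : h ≤ 1 := (hh.2.trans_le (min_le_left _ _)).le
  have hh2 : h ≤ E₀ / 2 := (hh.2.trans_le (min_le_right _ _)).le
  have hE0 : 0 < E := by linarith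
  refine isUnit_weylSum_latCoef hh.1 hE0 ?_
  rcases le_or_gt R E with hRE | hRE
  · refine (tsum_latCoef_le_of_large hh.1 hh1 hR25 hB hRs hBS hRE).trans_lt (lt_trans ?_ hd)
    have := gF_pos hh.1 hE0 one_pos
    linarith
  · refine (tsum_latCoef_le hh.1 hE₀ hE.le).trans_lt (lt_of_lt_of_le ?_ (le_abs_self _))
    have h1 : K ≤ α⁻¹ := (le_inv_comm₀ (by linarith) hα.1).2 hα.2.le
    have h2 := (le_max_right 1 _).trans h1
    have h3 : (frullaniConst - Real.log R - 1 / 8) / (4 * Real.pi) ≤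
        (qVal h ((-E : ℝ) : ℂ)).re := by
      have hρ := norm_rhoFun_le hh.1 (z := ((-E : ℝ) : ℂ)) (by simpa using hE0)
      have hρ2 := (neg_le_of_abs_le (Complex.abs_re_le_norm (rhoFun h ((-E : ℝ) : ℂ))))
      have hρ3 : h ^ 2 / (2 * ((-E : ℝ) : ℂ).re ^ 2) ≤ 1 / 8 := by
        rw [Complex.ofReal_re, neg_sq, div_le_iff₀ (by positivity)]
        nlinarith [hh.1]
      have hl : Real.log E ≤ Real.log R := Real.log_le_log hE0 hRE.le
      have e : (qVal h ((-E : ℝ) : ℂ)).re =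
          (frullaniConst - Real.log E + (rhoFun h ((-E : ℝ) : ℂ)).re) / (4 * Real.pi) := by
        rw [qVal, show (1 : ℂ) / (4 * Real.pi) = ((1 / (4 * Real.pi) : ℝ) : ℂ) by push_cast; rfl,
          Complex.re_ofReal_mul, Complex.add_re, Complex.sub_re, Complex.ofReal_re, Complex.log_re,
          norm_neg, Complex.norm_real, norm_neg, Real.norm_of_nonneg hE0.le]
        ring
      rw [e]
      gcongr
      linarith
    linarith

/-- The Weyl quantization of the effective symbol. -/
def effOp (E₀ α h μ : ℝ) : L2Line →L[ℂ] L2Line :=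
  weylSum h fun k => latCoef h (-(zetaVal E₀ α h μ).re)
    ((qVal h (((zetaVal E₀ α h μ).re : ℝ) : ℂ)).re + α⁻¹) k /
      (2 * gF h (-(zetaVal E₀ α h μ).re) 1)

theorem aFun_mFun_ofReal {h E : ℝ} (hh : 0 < h) (hE : 0 < E) (α : ℝ) :
    aFun ((-E : ℝ) : ℂ) h ≠ 0 ∧ mFun α ((-E : ℝ) : ℂ) h =
      ((((qVal h ((-E : ℝ) : ℂ)).re + α⁻¹) / (2 * gF h E 1) : ℝ) : ℂ) := by
  have hz : ((-E : ℝ) : ℂ).re < 0 := by simpa using hE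
  have e : aFun ((-E : ℝ) : ℂ) h = ((2 * gF h E 1 : ℝ) : ℂ) := by
    rw [aFun_eq hh hz, greenProfile_ofReal]; push_cast; rfl
  constructor
  · rw [e]
    exact_mod_cast (mul_pos two_pos (gF_pos hh hE one_pos)).ne'
  · rw [mFun, e, qFun_eq_qVal hh hz, qVal_im hE]
    push_cast
    rfl

theorem mem_spectrumP_ham_iff {h E α : ℝ} (hh : 0 < h) (hE : 0 < E) (hα : α ≠ 0) :
    ((-E : ℝ) : ℂ) ∈ spectrumP (ham h α) ↔
      ¬IsUnit (weylSum h (latCoef h E ((qVal h ((-E : ℝ) : ℂ)).re + α⁻¹))) := by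
  rw [spectrumP, mem_compl_iff, mem_resolventSetP_ham_iff hh hE hα (qVal_im hE),
    latOp_bounded_below_iff hh hE]

theorem isWeylQuantization_effOp {E₀ α h : ℝ} (hE₀ : 0 < E₀)
    (hα : SmallCoupling E₀ (zetaR E₀) α) (hh : 0 < h) (hh1 : h ≤ 1) (hh2 : h ≤ E₀ / 2) {μ : ℝ}
    (hμ : μ ∈ Icc (-4 : ℝ) 4) :
    IsWeylQuantization h (fun x p => symbolP α (zetaVal E₀ α) x p μ h) (effOp E₀ α h μ) := by
  have hμ5 : |μ| < 5 := by rw [abs_lt]; constructor <;> linarith [hμ.1, hμ.2]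
  have hre := zetaVal_real hE₀ hα hh hh1 hh2 hμ5
  have hlt := ((eq_zetaVal_iff hE₀ hα hh hh1 hh2 (μ := μ) (by rwa [Complex.norm_real]) _).2 rfl).1
  obtain ⟨E, hE⟩ : ∃ E : ℝ, (zetaVal E₀ α h μ).re = -E := ⟨_, (neg_neg _).symm⟩
  rw [hE] at hre hlt
  have hE0 : 0 < E := by linarith
  have hg := gF_pos hh hE0 one_pos
  rw [effOp, hE, neg_neg]
  refine isWeylQuantization_weylSum hh ?_ fun x p => ?_
  · refine ((summable_latCoef hh hE0 ((qVal h ((-E : ℝ) : ℂ)).re + α⁻¹)).div_const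
      (2 * gF h E 1)).congr fun k => ?_
    rw [abs_div, abs_of_pos (by positivity : 0 < 2 * gF h E 1)]
  · rw [symbolP, hre, symbolM, (aFun_mFun_ofReal hh hE0 α).2]
    exact hasSum_latCoef_cexp hh hE0 _ x p

theorem spectrum_effOp_iff {E₀ α h : ℝ} (hE₀ : 0 < E₀)
    (hα : SmallCoupling E₀ (zetaR E₀) α) (hh : 0 < h) (hh1 : h ≤ 1) (hh2 : h ≤ E₀ / 2) {μ : ℝ}
    (hμ : μ ∈ Icc (-4 : ℝ) 4) {E : ℝ} (hE : E₀ < E) (hm : mFun α ((-E : ℝ) : ℂ) h = μ) :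
    (0 : ℂ) ∈ spectrum ℂ (effOp E₀ α h μ) ↔ ((-E : ℝ) : ℂ) ∈ spectrumP (ham h α) := by
  have hE0 : 0 < E := by linarith
  have hμ5 : ‖(μ : ℂ)‖ < 5 := by
    rw [Complex.norm_real, Real.norm_eq_abs, abs_lt]; constructor <;> linarith [hμ.1, hμ.2]
  have hz := (eq_zetaVal_iff hE₀ hα hh hh1 hh2 hμ5 ((-E : ℝ) : ℂ)).1
    ⟨by simpa using hE, (aFun_mFun_ofReal hh hE0 α).1, hm⟩
  have hg := gF_pos hh hE0 one_pos
  rw [spectrum.zero_mem_iff, mem_spectrumP_ham_iff hh hE0 hα.1.ne', effOp, ← hz,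
    Complex.ofReal_re, neg_neg, isUnit_weylSum_div (by positivity)]

end PointLandau

end

open PointLandau in
theorem mainTheorem1 (E₀ : ℝ) (hE₀ : 0 < E₀) :
    ∃ α₀ > (0 : ℝ), ∃ h₀ > (0 : ℝ), ∃ ζ : ℝ → ℝ → ℂ → ℂ, ∃ Phat : ℝ → ℝ → ℝ → (L2Line →L[ℂ] L2Line),
      (∀ α ∈ Ioo 0 α₀, ∀ h ∈ Ioo 0 h₀,
        (∀ μ : ℂ, ‖μ‖ < 5 → ∀ z : ℂ,
          (z.re < -E₀ ∧ aFun z h ≠ 0 ∧ mFun α z h = μ) ↔ z = ζ α h μ) ∧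
        (∀ μ ∈ Icc (-4 : ℝ) 4,
          IsWeylQuantization h (fun x p => symbolP α (ζ α) x p μ h) (Phat α h μ)) ∧
        {z : ℝ | (z : ℂ) ∈ spectrumP (ham h α) ∧ z < -E₀} =
          {z : ℝ | z < -E₀ ∧ ∃ μ ∈ muSpec (Icc (-4) 4) (Phat α h), mFun α z h = μ}) ∧
      (∀ α ∈ Ioo 0 α₀, StrongTypeI h₀ (symbolP α (ζ α))) ∧
      Tendsto (fun α => epsOf h₀ (symbolP α (ζ α))) (𝓝[>] 0) (𝓝 0) := by
  obtain ⟨α₁, p1, h1⟩ := exists_smallCoupling E₀ (zetaR E₀)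
  obtain ⟨α₂, p2, h2⟩ := exists_strongTypeIWith hE₀ one_pos
  obtain ⟨α₃, p3, h3⟩ := exists_isUnit_weylSum hE₀
  -- The bound `h < E₀/2` gives `|ρ| ≤ h²/(2E₀²) ≤ 1/8` on the whole half plane; `h < 1` makes the
  -- estimates of the Green profile uniform.
  refine ⟨min α₁ (min α₂ α₃), lt_min p1 (lt_min p2 p3), min 1 (E₀ / 2),
    lt_min one_pos (half_pos hE₀), zetaVal E₀, effOp E₀, fun α hα h hh => ?_, fun α hα => ?_,
    tendsto_epsOf hE₀⟩
  · have hα1 := h1 α ⟨hα.1, hα.2.trans_le (min_le_left _ _)⟩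
    have hα3 : α ∈ Ioo 0 α₃ :=
      ⟨hα.1, hα.2.trans_le ((min_le_right _ _).trans (min_le_right _ _))⟩
    have hh1 : h ≤ 1 := (hh.2.trans_le (min_le_left _ _)).le
    have hh2 : h ≤ E₀ / 2 := (hh.2.trans_le (min_le_right _ _)).le
    refine ⟨fun μ hμ z => eq_zetaVal_iff hE₀ hα1 hh.1 hh1 hh2 hμ z,
      fun μ hμ => isWeylQuantization_effOp hE₀ hα1 hh.1 hh1 hh2 hμ, ?_⟩
    ext z
    obtain ⟨E, rfl⟩ : ∃ E : ℝ, z = -E := ⟨-z, (neg_neg z).symm⟩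
    simp only [mem_ofPred_eq]
    constructor
    · rintro ⟨hz, hE⟩
      have hE' : E₀ < E := by linarith
      have hE0 : 0 < E := by linarith
      have hg := gF_pos hh.1 hE0 one_pos
      have hm := (aFun_mFun_ofReal hh.1 hE0 α).2
      -- Spectral points automatically have `|m_α| ≤ 4`, so the corresponding `μ` lies in the
      -- interval where the effective operator is defined by the statement.
      have hle : |(qVal h ((-E : ℝ) : ℂ)).re + α⁻¹| ≤ 4 * (2 * gF h E 1) := by
        by_contra hlt
        exact (mem_spectrumP_ham_iff hh.1 hE0 hα.1.ne').1 hz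
          (h3 α hα3 h hh E hE' (not_le.1 hlt))
      have hμ : ((qVal h ((-E : ℝ) : ℂ)).re + α⁻¹) / (2 * gF h E 1) ∈ Icc (-4 : ℝ) 4 := by
        rw [mem_Icc, ← abs_le, abs_div, abs_of_pos (by positivity : 0 < 2 * gF h E 1),
          div_le_iff₀ (by positivity)]
        exact hle
      exact ⟨hE, _, ⟨hμ, (spectrum_effOp_iff hE₀ hα1 hh.1 hh1 hh2 hμ hE' hm).2 hz⟩, hm⟩
    · rintro ⟨hE, μ, ⟨hμ, hs⟩, hm⟩
      exact ⟨(spectrum_effOp_iff hE₀ hα1 hh.1 hh1 hh2 hμ (by linarith) hm).1 hs, hE⟩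
  · exact ⟨1, one_pos, h2 α ⟨hα.1, hα.2.trans_le ((min_le_right _ _).trans (min_le_left _ _))⟩⟩
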